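/- Work on $\mathbb R^2$ with $\hat f(\xi)=\int_{\mathbb R^2}e^{-ix\cdot\xi}f(x)\,dx$, and for real $s$ let $\Lambda^s$ be the Fourier multiplier $\widehat{\Lambda^s f}(\xi)=|\xi|^s\hat f(\xi)$. For $m\ge 0$ let $A^m$ be the space of continuous functions $f$ on $\mathbb R^2$ (scalar or vector valued) that are inverse Fourier transforms of an integrable function $\hat f$ with $\int(1+|\xi|)^m|\hat f(\xi)|\,d\xi<\infty$; we say that $\Lambda^s f$ is defined if $\hat f$ and $|\xi|^s\hat f$ are both integrable. For a vector field $V$ and a scalar function $\varphi$ put $[\Lambda^{s},V\cdot\nabla]\varphi=\Lambda^{s}(V\cdot\nabla\varphi)-V\cdot\nabla\Lambda^{s}\varphi$. Norms take values in $[0,\infty]$, with $0\cdot\infty=0$. (i) Let $0\le s_1<1$, $0\le s_2-s_1\le 1$, $\frac1p=\frac1q+\frac1r$ with $2<q<\infty$ and $1<p,r<\infty$, and let $a\in[s_2-s_1,1]$. Then there is a constant $C$, depending only on $s_1,s_2,p,q,r,a$, such that for every $V\in A^{1+s_2}$ with $\nabla\cdot V=0$ and every $\varphi\in A^{1+s_2}$,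 the functions $\Lambda^{s_2}(V\cdot\nabla\varphi)$ and $\Lambda^{-s_1}[\Lambda^{s_2},V\cdot\nabla]\varphi$ are defined and $$\|\Lambda^{-s_1}[\Lambda^{s_2},V\cdot\nabla]\varphi\|_{L^p}\le C\,\|\Lambda^aV\|_{L^q}\,\|\Lambda^{s_2-s_1+1-a}\varphi\|_{L^r}.$$ (ii) Let $0<s_1<1$, $0<s_3<1$, $0<s_2<s_1+s_3$. Then there is a constant $C$, depending only on $s_1,s_2,s_3$, such that for every $V\in A^{1+s_2}$ with $\nabla\cdot V=0$ and every $\varphi\in A^{1+s_2}$ for which $\Lambda^{-s_3}V$ and $\Lambda^{s_2-s_1+1-s_3}\varphi$ are defined, the functions $\Lambda^{s_2}(\Lambda^{-s_3}V\cdot\nabla\varphi)$ and $\Lambda^{-s_1}[\Lambda^{s_2},\Lambda^{-s_3}V\cdot\nabla]\varphi$ are defined and $$\|\Lambda^{-s_1}[\Lambda^{s_2},\Lambda^{-s_3}V\cdot\nabla]\varphi\|_{L^2}\le C\,\|V\|_{L^\infty}\,\|\Lambda^{s_2-s_1+1-s_3}\varphi\|_{L^2}.$$ -/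

import Mathlib

open MeasureTheory FourierTransform
open scoped NNReal ENNReal

noncomputable section

/-- The Euclidean plane `ℝ²`. -/
abbrev Plane : Type := EuclideanSpace ℝ (Fin 2)

section FourierSide

variable {E : Type*} [NormedAddCommGroup E] [NormedSpace ℂ E]

/-- `g` is an integrable Fourier transform of `f`: `f(x) = ∫ e^{2πi x·ξ} g(ξ) dξ` for all `x`,
with `g ∈ L¹(ℝ²)`. Here `f` need not be integrable. -/
def IsFourierDataOf (g f : Plane → E) : Prop :=
  Integrable g ∧ 𝓕⁻ g = f

/-- `f` has an integrable Fourier transform. -/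
def HasIntegrableFourier (f : Plane → E) : Prop :=
  ∃ g : Plane → E, IsFourierDataOf g f

open Classical in
/-- The integrable Fourier transform of `f` (unique up to a null set, see
`IsFourierDataOf.fhat_ae_eq`), and `0` if there is none. The normalization is
`f(x) = ∫ e^{2πi x·ξ} (fhat f)(ξ) dξ`. -/
def fhat (f : Plane → E) : Plane → E :=
  if h : HasIntegrableFourier f then h.choose else 0

/-- The symbol of `Λ^s = (-Δ)^{s/2}`. With the kernel `e^{2πi x·ξ}` the frequency of the
exponential is `2πξ`, so the symbol `|frequency|^s` reads `(2π|ξ|)^s`. -/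
def lamSymbol (s : ℝ) (ξ : Plane) : ℂ :=
  (((2 * Real.pi * ‖ξ‖) ^ s : ℝ) : ℂ)

/-- `Λ^s f` is defined: both `f` and `Λ^s f` have an integrable Fourier transform. -/
def LamDefined (s : ℝ) (f : Plane → E) : Prop :=
  HasIntegrableFourier f ∧ Integrable (fun ξ => lamSymbol s ξ • fhat f ξ)

/-- `Λ^s f`, the Fourier multiplier operator with symbol `|ξ|^s`
(meaningful when `LamDefined s f`). -/
def Lam (s : ℝ) (f : Plane → E) : Plane → E :=
  𝓕⁻ (fun ξ => lamSymbol s ξ • fhat f ξ)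

/-- `f` is continuous with Fourier transform satisfying `∫ (1 + |ξ|)^m |f̂(ξ)| dξ < ∞`. -/
def FourierRegular (m : ℝ) (f : Plane → E) : Prop :=
  HasIntegrableFourier f ∧ Integrable (fun ξ => (((1 + ‖ξ‖) ^ m : ℝ) : ℂ) • fhat f ξ)

/-- An integrable function whose inverse Fourier transform vanishes is zero almost everywhere. -/
theorem ae_eq_zero_of_fourierInv_eq_zero [CompleteSpace E] {d : Plane → E} (hd : Integrable d)
    (h0 : 𝓕⁻ d = 0) : d =ᵐ[volume] 0 := by
  have hF : 𝓕 d = 0 := by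
    funext v
    have h1 := congrFun h0 (-v)
    rw [Real.fourierInv_eq_fourier_neg, neg_neg] at h1
    exact h1
  refine ae_eq_zero_of_integral_contDiff_smul_eq_zero hd.locallyIntegrable ?_
  intro ψ hψ hψc
  have hc : ContDiff ℝ (⊤ : ℕ∞) (fun x => (ψ x : ℂ)) := Complex.ofRealCLM.contDiff.comp hψ
  have hcs : HasCompactSupport (fun x => (ψ x : ℂ)) := hψc.comp_left (g := fun t : ℝ => (t : ℂ)) (by simp)
  set ψS : SchwartzMap Plane ℂ := hcs.toSchwartzMap hc with hψS
  have key := VectorFourier.integral_fourierIntegral_smul_eq_flip (L := innerₗ Plane)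
    (μ := volume) (ν := volume) (f := ((𝓕⁻ ψS : SchwartzMap Plane ℂ) : Plane → ℂ)) (g := d)
    Real.continuous_fourierChar (by exact continuous_inner)
    (𝓕⁻ ψS : SchwartzMap Plane ℂ).integrable hd
  have e1 : ∀ ξ, VectorFourier.fourierIntegral Real.fourierChar volume (innerₗ Plane)
      ((𝓕⁻ ψS : SchwartzMap Plane ℂ) : Plane → ℂ) ξ = (ψ ξ : ℂ) := by
    intro ξ
    have : (𝓕 ((𝓕⁻ ψS : SchwartzMap Plane ℂ) : Plane → ℂ)) ξ = ψS ξ := by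
      rw [← SchwartzMap.fourier_coe]; simp
    exact this
  have e2 : ∀ x, VectorFourier.fourierIntegral Real.fourierChar volume (innerₗ Plane).flip d x
      = 0 := by
    intro x
    rw [flip_innerₗ]
    exact congrFun hF x
  simp only [e1, e2, smul_zero, integral_zero] at key
  simpa using key

/-- Two integrable Fourier transforms of the same function agree almost everywhere, so `fhat` does
not depend on the choice. -/
theorem IsFourierDataOf.fhat_ae_eq [CompleteSpace E] {g f : Plane → E}
    (h : IsFourierDataOf g f) : fhat f =ᵐ[volume] g := by
  have hf : HasIntegrableFourier f := ⟨g, h⟩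
  have hfh : fhat f = hf.choose := by rw [fhat, dif_pos hf]
  have h2 : IsFourierDataOf (fhat f) f := hfh ▸ hf.choose_spec
  have := ae_eq_zero_of_fourierInv_eq_zero (h2.1.sub h.1) (by
    funext v
    have hv : (𝓕⁻ (fhat f)) v = (𝓕⁻ g) v := by rw [h2.2, h.2]
    rw [Real.fourierInv_eq, Real.fourierInv_eq] at hv
    rw [Real.fourierInv_eq]
    simp only [Pi.sub_apply, smul_sub, Pi.zero_apply]
    rw [integral_sub, hv, sub_self]
    · simpa using (Real.fourierIntegral_convergent_iff (μ := volume) (f := fhat f) (-v)).2 h2.1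
    · simpa using (Real.fourierIntegral_convergent_iff (μ := volume) (f := g) (-v)).2 h.1)
  filter_upwards [this] with x hx
  exact sub_eq_zero.1 hx

end FourierSide

/-- The `i`-th standard basis vector of `ℝ²`. -/
def planeBasis (i : Fin 2) : Plane := EuclideanSpace.single i (1 : ℝ)

/-- The divergence `∂₁V₁ + ∂₂V₂` of a (complex) vector field on the plane. -/
def planeDiv (V : Plane → EuclideanSpace ℂ (Fin 2)) (x : Plane) : ℂ :=
  ∑ i : Fin 2, fderiv ℝ V x (planeBasis i) i

/-- The advection term `(V · ∇)φ = V₁ ∂₁φ + V₂ ∂₂φ`. -/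
def advect (V : Plane → EuclideanSpace ℂ (Fin 2)) (φ : Plane → ℂ) (x : Plane) : ℂ :=
  ∑ i : Fin 2, V x i * fderiv ℝ φ x (planeBasis i)

/-- The commutator `[Λ^s, V · ∇]φ = Λ^s((V · ∇)φ) - (V · ∇)(Λ^s φ)`. -/
def lamCommutator (s : ℝ) (V : Plane → EuclideanSpace ℂ (Fin 2)) (φ : Plane → ℂ) : Plane → ℂ :=
  fun x => Lam s (advect V φ) x - advect V (Lam s φ) x

end

/-! Tested against a function `h`, the commutator becomes a trilinear form in the frequencies ζ of
`V` and η of `φ`, with symbol |ζ+η|^{-s₁} (|ζ+η|^{s₂} - |η|^{s₂}) V̂(ζ)·η and the transform of `h`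
taken at ζ+η (`lamCommutator_spec`). By duality it is enough to bound this form by a product of
three norms. The difficulty is to separate the three frequencies while exhibiting the derivative
that the commutator moves onto `V`.

Put X = π|ζ+η|², Y = π|η|², Z = π|ζ|², ν = s₂/2 and N_μ(X) = ∫ r^{μ-1} e^{-r-X/r} dr, a modified
Bessel function in disguise. The expression W(τ) = τ^{-ν} (N_{ν+1}(τX) N_ν(τY) - N_ν(τX)
N_{ν+1}(τY)) has derivative -τ^{-ν} (X-Y) N_ν(τX) N_ν(τY) and tends to Γ(ν)Γ(1-ν)(X^ν - Y^ν) as τ →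
0. Integrating the derivative of e^{-τZ} W(τ) over τ > 0 therefore writes X^ν - Y^ν as an integral
of products of one function of each of τX, τY, τZ, with prefactors X-Y and Z
(`integral_besselE_wronskian`). Both prefactors are combinations of ζ·(ζ+η) and ζ·η, so a derivative
falls on `V`; and since div V = 0 gives V̂·η = V̂·(ζ+η), every term can be arranged to carry exactly
one derivative on each of the three factors (`wronskTerm_eq_sum`).

These functions of τX, τY, τZ, with the fractional powers that turn V̂, φ̂ into |ζ|^a V̂, |η|^b φ̂,
are superpositions of Gaussians with finite total mass (`LaplaceRep`). The form is thus an average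
of integrals ∫ dτ/τ ∫ dx of three heat evolutions, at least two of which carry derivatives.
Cauchy–Schwarz over dyadic scales and Hölder in x bound it by two square functions and a maximal
function (`exists_trilinear_multiplier_le`). The square functions are bounded on L^p as for
martingales: along the times 4^k, uniform convexity makes the oscillations of the heat flow
telescope (`exists_lintegral_square_le`).

The powers can be absorbed as long as a < 1 and b < 1. If exactly one of them is 1, that factor
gives its derivative up to a Riesz transform (`exists_riesz_le`) and receives the maximal function.
If both are 1, only one factor with cancellation is left, and an integration by parts in τ produces
two new derivatives (`coreBound_one_one`). -/

/-! ### The Gaussian kernel and the heat operators -/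

/-- The Gaussian kernel of total mass one whose Fourier symbol is `exp (-π τ ‖ξ‖ ^ 2)`. -/
noncomputable def heatK (τ : ℝ) (x : Plane) : ℝ := τ⁻¹ * Real.exp (-(Real.pi * ‖x‖ ^ 2 / τ))

theorem heatK_pos {τ : ℝ} (hτ : 0 < τ) (x : Plane) : 0 < heatK τ x := by
  unfold heatK; positivity

@[fun_prop]
theorem continuous_heatK (τ : ℝ) : Continuous (heatK τ) := by
  unfold heatK; fun_prop

theorem heatK_neg (τ : ℝ) (x : Plane) : heatK τ (-x) = heatK τ x := by
  simp [heatK]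

theorem heatK_sub_comm (τ : ℝ) (x y : Plane) : heatK τ (x - y) = heatK τ (y - x) := by
  rw [← heatK_neg, neg_sub]

theorem integrable_heatK {τ : ℝ} (hτ : 0 < τ) : Integrable (heatK τ) := by
  have h := (GaussianFourier.integrable_cexp_neg_mul_sq_norm_add (V := Plane)
    (b := ((Real.pi / τ : ℝ) : ℂ)) (by
      rw [Complex.ofReal_re]; positivity) 0 0).norm.const_mul τ⁻¹
  refine h.congr (Filter.Eventually.of_forall fun x => ?_)
  simp only [heatK, zero_mul, add_zero, Complex.norm_exp]
  congr 2
  rw [← Complex.ofReal_pow, ← Complex.ofReal_neg, ← Complex.ofReal_mul, Complex.ofReal_re]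
  ring

theorem integral_heatK {τ : ℝ} (hτ : 0 < τ) : ∫ x, heatK τ x = 1 := by
  have h := GaussianFourier.integral_rexp_neg_mul_sq_norm (V := Plane) (b := Real.pi / τ)
    (by positivity)
  have hd : (Module.finrank ℝ Plane : ℝ) / 2 = 1 := by simp
  rw [hd, Real.rpow_one] at h
  have hpi : Real.pi ≠ 0 := Real.pi_ne_zero
  calc ∫ x, heatK τ x = ∫ x : Plane, τ⁻¹ * Real.exp (-(Real.pi / τ) * ‖x‖ ^ 2) := by
        refine integral_congr_ae (Filter.Eventually.of_forall fun x => ?_)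
        simp only [heatK]
        congr 2; ring
    _ = 1 := by
        rw [integral_const_mul, h]
        field_simp

theorem lintegral_heatK {τ : ℝ} (hτ : 0 < τ) : ∫⁻ x, ENNReal.ofReal (heatK τ x) = 1 := by
  rw [← ofReal_integral_eq_lintegral_ofReal (integrable_heatK hτ)
    (Filter.Eventually.of_forall fun x => (heatK_pos hτ x).le), integral_heatK hτ]
  simp

theorem lintegral_heatK_sub {τ : ℝ} (hτ : 0 < τ) (x : Plane) :
    ∫⁻ y, ENNReal.ofReal (heatK τ (x - y)) = 1 := by
  rw [lintegral_sub_left_eq_self (fun y => ENNReal.ofReal (heatK τ y)) x, lintegral_heatK hτ]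

theorem heatK_le_of_le {σ τ : ℝ} (hσ : 0 < σ) (hστ : σ ≤ τ) (x : Plane) :
    heatK σ x ≤ τ / σ * heatK τ x := by
  have hτ : 0 < τ := hσ.trans_le hστ
  unfold heatK
  have h1 : τ / σ * (τ⁻¹ * Real.exp (-(Real.pi * ‖x‖ ^ 2 / τ)))
      = σ⁻¹ * Real.exp (-(Real.pi * ‖x‖ ^ 2 / τ)) := by field_simp
  rw [h1]
  have : Real.pi * ‖x‖ ^ 2 / τ ≤ Real.pi * ‖x‖ ^ 2 / σ := by
    have := Real.pi_pos
    gcongr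
  gcongr

/-- Completing the square in `z`. The remaining Gaussian is centred at a weighted mean of `x` and
`y`; integrating it out gives the semigroup law. -/
theorem heatK_mul_heatK {σ τ : ℝ} (hσ : 0 < σ) (hτ : 0 < τ) (x y z : Plane) :
    heatK σ (x - z) * heatK τ (z - y) = heatK (σ + τ) (x - y) *
      heatK (σ * τ / (σ + τ)) (z - ((τ / (σ + τ)) • x + (σ / (σ + τ)) • y)) := by
  have hst : 0 < σ + τ := by positivity
  have key : ‖x - z‖ ^ 2 / σ + ‖z - y‖ ^ 2 / τ = ‖x - y‖ ^ 2 / (σ + τ) +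
      ‖z - ((τ / (σ + τ)) • x + (σ / (σ + τ)) • y)‖ ^ 2 / (σ * τ / (σ + τ)) := by
    simp only [EuclideanSpace.norm_sq_eq, Fin.sum_univ_two, PiLp.sub_apply, PiLp.add_apply,
      PiLp.smul_apply, smul_eq_mul, Real.norm_eq_abs, sq_abs]
    field_simp
    ring
  unfold heatK
  have e : ∀ a b c d : ℝ, a * Real.exp b * (c * Real.exp d) = a * c * Real.exp (b + d) := by
    intro a b c d; rw [Real.exp_add]; ring
  rw [e, e]
  congr 1
  · field_simp
  · congr 1
    have := congrArg (fun t => -(Real.pi * t)) key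
    simp only [mul_add, neg_add] at this
    simpa only [mul_div_assoc] using this

theorem lintegral_heatK_mul_heatK {σ τ : ℝ} (hσ : 0 < σ) (hτ : 0 < τ) (x y : Plane) :
    ∫⁻ z, ENNReal.ofReal (heatK σ (x - z)) * ENNReal.ofReal (heatK τ (z - y))
      = ENNReal.ofReal (heatK (σ + τ) (x - y)) := by
  have hst : 0 < σ * τ / (σ + τ) := by positivity
  calc _ = ∫⁻ z, ENNReal.ofReal (heatK (σ + τ) (x - y)) * ENNReal.ofReal
          (heatK (σ * τ / (σ + τ)) (z - ((τ / (σ + τ)) • x + (σ / (σ + τ)) • y))) := by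
        refine lintegral_congr fun z => ?_
        rw [← ENNReal.ofReal_mul (heatK_pos hσ _).le, heatK_mul_heatK hσ hτ,
          ENNReal.ofReal_mul (heatK_pos (by positivity) _).le]
    _ = _ := by
        rw [lintegral_const_mul _ (by fun_prop), lintegral_sub_right_eq_self
          (fun z => ENNReal.ofReal (heatK (σ * τ / (σ + τ)) z)), lintegral_heatK hst, mul_one]

/-- The heat operator on `[0, ∞]`-valued functions. -/
noncomputable def heatE (τ : ℝ) (f : Plane → ℝ≥0∞) (x : Plane) : ℝ≥0∞ :=
  ∫⁻ y, ENNReal.ofReal (heatK τ (x - y)) * f y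

@[fun_prop]
theorem measurable_heatK_sub (τ : ℝ) :
    Measurable fun z : Plane × Plane => ENNReal.ofReal (heatK τ (z.1 - z.2)) :=
  ((continuous_heatK τ).comp (continuous_fst.sub continuous_snd)).measurable.ennreal_ofReal

@[fun_prop]
theorem measurable_heatE (τ : ℝ) {f : Plane → ℝ≥0∞} (hf : Measurable f) :
    Measurable (heatE τ f) := by
  unfold heatE
  exact Measurable.lintegral_prod_right' (f := fun z : Plane × Plane =>
    ENNReal.ofReal (heatK τ (z.1 - z.2)) * f z.2) (by fun_prop)

theorem heatE_mono (τ : ℝ) {f g : Plane → ℝ≥0∞} (h : ∀ y, f y ≤ g y) (x : Plane) :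
    heatE τ f x ≤ heatE τ g x :=
  lintegral_mono fun y => mul_le_mul_right (h y) _

theorem heatE_const {τ : ℝ} (hτ : 0 < τ) (c : ℝ≥0∞) (x : Plane) :
    heatE τ (fun _ => c) x = c := by
  unfold heatE
  rw [lintegral_mul_const _ (by fun_prop), lintegral_heatK_sub hτ, one_mul]

theorem heatE_add (τ : ℝ) {f g : Plane → ℝ≥0∞} (hf : Measurable f) (x : Plane) :
    heatE τ (fun y => f y + g y) x = heatE τ f x + heatE τ g x := by
  unfold heatE
  simp only [mul_add]
  rw [lintegral_add_left (by fun_prop)]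

theorem heatE_const_mul (τ : ℝ) (c : ℝ≥0∞) {f : Plane → ℝ≥0∞} (hf : Measurable f) (x : Plane) :
    heatE τ (fun y => c * f y) x = c * heatE τ f x := by
  unfold heatE
  rw [← lintegral_const_mul _ (by fun_prop)]
  exact lintegral_congr fun y => by ring

theorem heatE_le_of_le {σ τ : ℝ} (hσ : 0 < σ) (hστ : σ ≤ τ) (f : Plane → ℝ≥0∞)
    (hf : Measurable f) (x : Plane) :
    heatE σ f x ≤ ENNReal.ofReal (τ / σ) * heatE τ f x := by
  have hτ : 0 < τ := hσ.trans_le hστ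
  unfold heatE
  rw [← lintegral_const_mul _ (by fun_prop)]
  refine lintegral_mono fun y => ?_
  rw [← mul_assoc, ← ENNReal.ofReal_mul (by positivity)]
  gcongr
  exact heatK_le_of_le hσ hστ _

theorem heatE_heatE {σ τ : ℝ} (hσ : 0 < σ) (hτ : 0 < τ) {f : Plane → ℝ≥0∞} (hf : Measurable f)
    (x : Plane) : heatE σ (heatE τ f) x = heatE (σ + τ) f x := by
  unfold heatE
  calc _ = ∫⁻ z, ∫⁻ y, ENNReal.ofReal (heatK σ (x - z)) *
        (ENNReal.ofReal (heatK τ (z - y)) * f y) := by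
        refine lintegral_congr fun z => ?_
        rw [lintegral_const_mul _ (by fun_prop)]
    _ = ∫⁻ y, ∫⁻ z, ENNReal.ofReal (heatK σ (x - z)) *
        (ENNReal.ofReal (heatK τ (z - y)) * f y) := by
        rw [lintegral_lintegral_swap]
        exact Measurable.aemeasurable (by fun_prop)
    _ = _ := by
        refine lintegral_congr fun y => ?_
        simp_rw [← mul_assoc]
        rw [lintegral_mul_const _ (by fun_prop), lintegral_heatK_mul_heatK hσ hτ]

theorem lintegral_heatE_mul (τ : ℝ) {f g : Plane → ℝ≥0∞} (hf : Measurable f) (hg : Measurable g) :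
    ∫⁻ x, heatE τ f x * g x = ∫⁻ x, f x * heatE τ g x := by
  unfold heatE
  calc _ = ∫⁻ x, ∫⁻ y, ENNReal.ofReal (heatK τ (x - y)) * f y * g x := by
        refine lintegral_congr fun z => ?_
        rw [lintegral_mul_const _ (by fun_prop)]
    _ = ∫⁻ y, ∫⁻ x, ENNReal.ofReal (heatK τ (x - y)) * f y * g x := by
        rw [lintegral_lintegral_swap]
        exact Measurable.aemeasurable (by fun_prop)
    _ = _ := by
        refine lintegral_congr fun y => ?_
        rw [← lintegral_const_mul _ (by fun_prop)]
        refine lintegral_congr fun x => ?_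
        rw [heatK_sub_comm]; ring

theorem lintegral_heatE {τ : ℝ} (hτ : 0 < τ) {f : Plane → ℝ≥0∞} (hf : Measurable f) :
    ∫⁻ x, heatE τ f x = ∫⁻ x, f x := by
  have h := lintegral_heatE_mul τ hf (g := fun _ => 1) measurable_const
  simpa [heatE_const hτ] using h

/-- The probability measure with density the Gaussian centred at `x`. -/
noncomputable def heatMeasure (τ : ℝ) (x : Plane) : Measure Plane :=
  volume.withDensity fun y => ENNReal.ofReal (heatK τ (x - y))

theorem isProbabilityMeasure_heatMeasure {τ : ℝ} (hτ : 0 < τ) (x : Plane) :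
    IsProbabilityMeasure (heatMeasure τ x) :=
  ⟨by rw [heatMeasure, withDensity_apply _ MeasurableSet.univ, setLIntegral_univ,
    lintegral_heatK_sub hτ]⟩

theorem lintegral_heatMeasure (τ : ℝ) (x : Plane) {f : Plane → ℝ≥0∞} (hf : Measurable f) :
    ∫⁻ y, f y ∂(heatMeasure τ x) = heatE τ f x := by
  rw [heatMeasure, lintegral_withDensity_eq_lintegral_mul _ (by fun_prop) hf]
  rfl

/-- Jensen's inequality, in the form that L^p norms increase with the exponent on a probability
space. -/
theorem heatE_rpow_le {τ : ℝ} (hτ : 0 < τ) {p : ℝ} (hp : 1 ≤ p) {f : Plane → ℝ≥0∞}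
    (hf : Measurable f) (x : Plane) : heatE τ f x ^ p ≤ heatE τ (fun y => f y ^ p) x := by
  have := isProbabilityMeasure_heatMeasure hτ x
  rw [← lintegral_heatMeasure τ x hf, ← lintegral_heatMeasure τ x (by fun_prop)]
  have h := eLpNorm'_le_eLpNorm'_of_exponent_le (μ := heatMeasure τ x) (f := f) one_pos hp
    hf.aestronglyMeasurable
  simp only [eLpNorm', enorm_eq_self, ENNReal.rpow_one, div_one] at h
  calc _ ≤ ((∫⁻ y, f y ^ p ∂(heatMeasure τ x)) ^ (1 / p)) ^ p := by gcongr
    _ = _ := by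
      rw [← ENNReal.rpow_mul, one_div, inv_mul_cancel₀ (by positivity), ENNReal.rpow_one]

theorem heatE_rpow_le_of_le_one {τ : ℝ} (hτ : 0 < τ) {θ : ℝ} (h0 : 0 ≤ θ) (h1 : θ ≤ 1)
    {f : Plane → ℝ≥0∞} (hf : Measurable f) (x : Plane) :
    heatE τ (fun y => f y ^ θ) x ≤ heatE τ f x ^ θ := by
  rcases h0.eq_or_lt with rfl | h0
  · simp [heatE_const hτ]
  have h := heatE_rpow_le hτ (p := 1 / θ) (by rw [le_div_iff₀ h0]; linarith)
    (f := fun y => f y ^ θ) (by fun_prop) x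
  simp only [← ENNReal.rpow_mul, mul_one_div_cancel h0.ne', ENNReal.rpow_one] at h
  calc _ = (heatE τ (fun y => f y ^ θ) x ^ (1 / θ)) ^ θ := by
        rw [← ENNReal.rpow_mul, one_div_mul_cancel h0.ne', ENNReal.rpow_one]
    _ ≤ _ := by gcongr

/-- Cauchy–Schwarz for the Gaussian averages. -/
theorem heatE_mul_sq_le (τ : ℝ) {f g : Plane → ℝ≥0∞} (hf : Measurable f) (hg : Measurable g)
    (x : Plane) : heatE τ (fun y => f y * g y) x ^ (2 : ℝ) ≤
      heatE τ (fun y => f y ^ (2 : ℝ)) x * heatE τ (fun y => g y ^ (2 : ℝ)) x := by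
  have h := ENNReal.lintegral_mul_le_Lp_mul_Lq (heatMeasure τ x) Real.HolderConjugate.two_two
    hf.aemeasurable hg.aemeasurable
  simp only [Pi.mul_apply] at h
  rw [lintegral_heatMeasure τ x (by fun_prop), lintegral_heatMeasure τ x (by fun_prop),
    lintegral_heatMeasure τ x (by fun_prop)] at h
  calc _ ≤ (heatE τ (fun y => f y ^ (2 : ℝ)) x ^ (1 / (2 : ℝ)) *
        heatE τ (fun y => g y ^ (2 : ℝ)) x ^ (1 / (2 : ℝ))) ^ (2 : ℝ) := by gcongr
    _ = _ := by
      rw [← ENNReal.mul_rpow_of_nonneg _ _ (by norm_num), ← ENNReal.rpow_mul]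
      norm_num

/-! ### The Hardy–Littlewood maximal function -/

/-- The Hardy–Littlewood maximal function on the plane (normalized by the squared radius). -/
noncomputable def maxFn (f : Plane → ℝ≥0∞) (x : Plane) : ℝ≥0∞ :=
  ⨆ (r : ℝ) (_ : 0 < r), (∫⁻ y in Metric.ball x r, f y) / ENNReal.ofReal (r ^ 2)

theorem lintegral_ball_le_maxFn (f : Plane → ℝ≥0∞) (x : Plane) {r : ℝ} (hr : 0 < r) :
    ∫⁻ y in Metric.ball x r, f y ≤ ENNReal.ofReal (r ^ 2) * maxFn f x := by
  have h : (∫⁻ y in Metric.ball x r, f y) / ENNReal.ofReal (r ^ 2) ≤ maxFn f x :=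
    le_iSup₂ (f := fun (r : ℝ) (_ : 0 < r) =>
      (∫⁻ y in Metric.ball x r, f y) / ENNReal.ofReal (r ^ 2)) r hr
  rw [ENNReal.div_le_iff_le_mul (Or.inl (by positivity)) (Or.inl ENNReal.ofReal_ne_top)] at h
  rwa [mul_comm] at h

/-- An average above `c` on an open ball stays above `c` on a slightly smaller concentric ball, and
that one is contained in the ball of the original radius about any nearby centre. This settles the
measurability of `maxFn`. -/
theorem lowerSemicontinuous_maxFn (f : Plane → ℝ≥0∞) : LowerSemicontinuous (maxFn f) := by
  intro x c hc
  obtain ⟨r, hr⟩ := lt_iSup_iff.1 hc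
  obtain ⟨hr0, hr⟩ := lt_iSup_iff.1 hr
  rw [ENNReal.lt_div_iff_mul_lt (Or.inl (by positivity)) (Or.inl ENNReal.ofReal_ne_top)] at hr
  have hU : Metric.ball x r = ⋃ n : ℕ, Metric.ball x (r - 1 / (n + 1)) := by
    ext y
    simp only [Metric.mem_ball, Set.mem_iUnion]
    constructor
    · intro h
      obtain ⟨n, hn⟩ := exists_nat_one_div_lt (sub_pos.2 h)
      exact ⟨n, by linarith⟩
    · rintro ⟨n, hn⟩
      have : (0 : ℝ) < 1 / (n + 1) := by positivity
      linarith
  have hmono : Monotone fun n : ℕ => Metric.ball x (r - 1 / ((n : ℝ) + 1)) := by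
    intro m n hmn
    apply Metric.ball_subset_ball
    have : (1 : ℝ) / (n + 1) ≤ 1 / (m + 1) := by
      apply one_div_le_one_div_of_le (by positivity)
      gcongr
    linarith
  rw [hU, setLIntegral_iUnion_of_directed _ hmono.directed_le] at hr
  obtain ⟨n, hn⟩ := lt_iSup_iff.1 hr
  have hpos : (0 : ℝ) < 1 / (n + 1) := by positivity
  filter_upwards [Metric.ball_mem_nhds x hpos] with x' hx'
  refine lt_of_lt_of_le ?_ (le_iSup₂ (f := fun (r : ℝ) (_ : 0 < r) =>
      (∫⁻ y in Metric.ball x' r, f y) / ENNReal.ofReal (r ^ 2)) r hr0)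
  rw [ENNReal.lt_div_iff_mul_lt (Or.inl (by positivity)) (Or.inl ENNReal.ofReal_ne_top)]
  refine hn.trans_le (lintegral_mono_set (Metric.ball_subset_ball' ?_))
  rw [dist_comm]
  have := Metric.mem_ball.1 hx'
  linarith

@[fun_prop]
theorem measurable_maxFn (f : Plane → ℝ≥0∞) : Measurable (maxFn f) :=
  (lowerSemicontinuous_maxFn f).measurable

/-- The 4 replaces π, because averages are divided by r² and not by πr². -/
theorem maxFn_const_le (c : ℝ≥0∞) (x : Plane) : maxFn (fun _ => c) x ≤ 4 * c := by
  refine iSup₂_le fun r hr => ?_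
  rw [setLIntegral_const, EuclideanSpace.volume_ball_fin_two, ENNReal.ofReal_pow hr.le]
  rw [ENNReal.div_le_iff_le_mul (Or.inl (by positivity)) (Or.inl (by finiteness))]
  have : ENNReal.ofReal Real.pi ≤ 4 := by
    simpa using ENNReal.ofReal_le_ofReal Real.pi_le_four
  calc c * (ENNReal.ofReal r ^ 2 * ENNReal.ofReal Real.pi) ≤ c * (ENNReal.ofReal r ^ 2 * 4) := by
        gcongr
    _ = 4 * c * ENNReal.ofReal r ^ 2 := by ring

theorem maxFn_mono {f g : Plane → ℝ≥0∞} (h : ∀ x, f x ≤ g x) (x : Plane) :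
    maxFn f x ≤ maxFn g x :=
  iSup₂_mono fun _ _ => ENNReal.div_le_div_right (lintegral_mono h) _

theorem maxFn_add_le {f g : Plane → ℝ≥0∞} (hf : Measurable f) (x : Plane) :
    maxFn (fun y => f y + g y) x ≤ maxFn f x + maxFn g x := by
  refine iSup₂_le fun r hr => ?_
  rw [lintegral_add_left hf, ENNReal.add_div]
  exact add_le_add
    (le_iSup₂ (f := fun (r : ℝ) (_ : 0 < r) =>
      (∫⁻ y in Metric.ball x r, f y) / ENNReal.ofReal (r ^ 2)) r hr)
    (le_iSup₂ (f := fun (r : ℝ) (_ : 0 < r) =>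
      (∫⁻ y in Metric.ball x r, g y) / ENNReal.ofReal (r ^ 2)) r hr)

/-- Gaussian averages are dominated by the maximal function. -/
theorem heatE_le_maxFn {τ : ℝ} (hτ : 0 < τ) {f : Plane → ℝ≥0∞} (hf : Measurable f) (x : Plane) :
    heatE τ f x ≤ maxFn f x := by
  -- Layer-cake form of the exponential: the Gaussian becomes a superposition of indicators of balls
  -- with weight e^{-r} dr.
  have hexp : ∀ s : ℝ, ENNReal.ofReal (Real.exp (-s)) =
      ∫⁻ r in Set.Ioi s, ENNReal.ofReal (Real.exp (-r)) := by
    intro s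
    rw [← ofReal_integral_eq_lintegral_ofReal, integral_exp_neg_Ioi]
    · exact (integrableOn_exp_mul_Ioi (a := -1) (by norm_num) s).congr_fun (fun r _ => by simp)
        measurableSet_Ioi
    · exact Filter.Eventually.of_forall fun r => (Real.exp_pos _).le
  have hg : ∫⁻ r in Set.Ioi (0 : ℝ), ENNReal.ofReal (Real.exp (-r)) * ENNReal.ofReal r = 1 := by
    have := Real.Gamma_eq_integral (s := 2) (by norm_num)
    rw [show (2 : ℝ) = (1 : ℕ) + 1 by norm_num, Real.Gamma_nat_eq_factorial] at this
    have h2 := Real.GammaIntegral_convergent (s := 2) (by norm_num)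
    norm_num at this h2
    calc _ = ∫⁻ r in Set.Ioi (0 : ℝ), ENNReal.ofReal (Real.exp (-r) * r) := by
          refine lintegral_congr fun r => ?_
          rw [ENNReal.ofReal_mul (Real.exp_pos _).le]
      _ = _ := by
          rw [← ofReal_integral_eq_lintegral_ofReal h2, ← this]
          · simp
          · filter_upwards [ae_restrict_mem measurableSet_Ioi] with r hr
            have : (0 : ℝ) < r := hr
            positivity
  have hπ := Real.pi_pos
  unfold heatE heatK
  calc _ = ∫⁻ y, ∫⁻ r, ENNReal.ofReal τ⁻¹ * ((Set.Ioi (Real.pi * ‖x - y‖ ^ 2 / τ)).indicator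
          (fun r => ENNReal.ofReal (Real.exp (-r))) r * f y) := by
        refine lintegral_congr fun y => ?_
        rw [ENNReal.ofReal_mul (by positivity), hexp, lintegral_const_mul, lintegral_mul_const,
          lintegral_indicator measurableSet_Ioi, mul_assoc]
        · exact Measurable.indicator (by fun_prop) measurableSet_Ioi
        · exact (Measurable.indicator (by fun_prop) measurableSet_Ioi).mul_const _
    _ = ∫⁻ r, ∫⁻ y, ENNReal.ofReal τ⁻¹ * ((Set.Ioi (Real.pi * ‖x - y‖ ^ 2 / τ)).indicator
          (fun r => ENNReal.ofReal (Real.exp (-r))) r * f y) := by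
        rw [lintegral_lintegral_swap]
        refine Measurable.aemeasurable ?_
        have h0 : Measurable (fun z : Plane × ℝ =>
            (Set.Ioi (Real.pi * ‖x - z.1‖ ^ 2 / τ)).indicator
              (fun r => ENNReal.ofReal (Real.exp (-r))) z.2) := by
          have : (fun z : Plane × ℝ => (Set.Ioi (Real.pi * ‖x - z.1‖ ^ 2 / τ)).indicator
              (fun r => ENNReal.ofReal (Real.exp (-r))) z.2) =
              {z : Plane × ℝ | Real.pi * ‖x - z.1‖ ^ 2 / τ < z.2}.indicator
                (fun z => ENNReal.ofReal (Real.exp (-z.2))) := by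
            ext z; simp [Set.indicator]
          rw [this]
          refine Measurable.indicator (by fun_prop) (measurableSet_lt (by fun_prop) (by fun_prop))
        exact (h0.mul (hf.comp measurable_fst)).const_mul _
    _ ≤ ∫⁻ r in Set.Ioi (0 : ℝ),
          ENNReal.ofReal (Real.exp (-r)) * ENNReal.ofReal r * maxFn f x := by
        rw [← lintegral_indicator measurableSet_Ioi]
        refine lintegral_mono fun r => ?_
        by_cases hr : 0 < r
        · rw [Set.indicator_of_mem (by exact hr)]
          have hb : ∀ y, (Set.Ioi (Real.pi * ‖x - y‖ ^ 2 / τ)).indicator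
              (fun r => ENNReal.ofReal (Real.exp (-r))) r * f y ≤
              ENNReal.ofReal (Real.exp (-r)) *
                (Metric.ball x (Real.sqrt (r * τ))).indicator f y := by
            -- The level set is the ball of radius √(rτ/π), enlarged to √(rτ); no constant is lost
            -- because `maxFn` omits the factor π.
            intro y
            by_cases hy : Real.pi * ‖x - y‖ ^ 2 / τ < r
            · rw [Set.indicator_of_mem (by exact hy), Set.indicator_of_mem]
              rw [Metric.mem_ball, dist_comm, dist_eq_norm]
              apply Real.lt_sqrt_of_sq_lt
              rw [div_lt_iff₀ hτ] at hy
              have := Real.pi_gt_three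
              nlinarith [sq_nonneg ‖x - y‖]
            · rw [Set.indicator_of_notMem (by exact hy)]; simp
          calc _ ≤ ∫⁻ y, ENNReal.ofReal τ⁻¹ * (ENNReal.ofReal (Real.exp (-r)) *
                (Metric.ball x (Real.sqrt (r * τ))).indicator f y) := by
                exact lintegral_mono fun y => mul_le_mul_right (hb y) _
            _ = ENNReal.ofReal τ⁻¹ * (ENNReal.ofReal (Real.exp (-r)) *
                ∫⁻ y in Metric.ball x (Real.sqrt (r * τ)), f y) := by
                rw [lintegral_const_mul _ (by
                  exact (hf.indicator measurableSet_ball).const_mul _), lintegral_const_mul _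
                  (hf.indicator measurableSet_ball), lintegral_indicator measurableSet_ball]
            _ ≤ ENNReal.ofReal τ⁻¹ * (ENNReal.ofReal (Real.exp (-r)) *
                (ENNReal.ofReal (Real.sqrt (r * τ) ^ 2) * maxFn f x)) := by
                gcongr
                exact lintegral_ball_le_maxFn f x (by positivity)
            _ = _ := by
                rw [Real.sq_sqrt (by positivity), ENNReal.ofReal_mul hr.le]
                have : ENNReal.ofReal τ⁻¹ * ENNReal.ofReal τ = 1 := by
                  rw [← ENNReal.ofReal_mul (by positivity), inv_mul_cancel₀ hτ.ne']; simp
                calc _ = (ENNReal.ofReal τ⁻¹ * ENNReal.ofReal τ) *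
                    (ENNReal.ofReal (Real.exp (-r)) * ENNReal.ofReal r * maxFn f x) := by ring
                  _ = _ := by rw [this, one_mul]
        · rw [Set.indicator_of_notMem (by exact hr)]
          have hz : ∀ y, (Set.Ioi (Real.pi * ‖x - y‖ ^ 2 / τ)).indicator
              (fun r => ENNReal.ofReal (Real.exp (-r))) r = 0 := by
            intro y
            apply Set.indicator_of_notMem
            simp only [Set.mem_Ioi, not_lt]
            have : 0 ≤ Real.pi * ‖x - y‖ ^ 2 / τ := by positivity
            linarith
          simp [hz]
    _ = maxFn f x := by
        rw [lintegral_mul_const _ (by fun_prop), hg, one_mul]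

/-- The weak-type `(1,1)` bound for the maximal function. -/
theorem volume_lt_maxFn_le (f : Plane → ℝ≥0∞) {c : ℝ} (hc : 0 < c) :
    volume {x | ENNReal.ofReal c < maxFn f x} ≤ ENNReal.ofReal (64 / c) * ∫⁻ x, f x := by
  by_cases hf : ∫⁻ x, f x = ⊤
  · rw [hf, ENNReal.mul_top (by positivity)]; exact le_top
  set t := {x | ENNReal.ofReal c < maxFn f x} with ht
  have hx : ∀ x ∈ t, ∃ r : ℝ, 0 < r ∧
      ENNReal.ofReal (c * r ^ 2) < ∫⁻ y in Metric.ball x r, f y := by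
    intro x hx
    obtain ⟨r, hr⟩ := lt_iSup_iff.1 (show ENNReal.ofReal c < maxFn f x from hx)
    obtain ⟨hr0, hr⟩ := lt_iSup_iff.1 hr
    rw [ENNReal.lt_div_iff_mul_lt (Or.inl (by positivity)) (Or.inl ENNReal.ofReal_ne_top),
      ← ENNReal.ofReal_mul hc.le] at hr
    exact ⟨r, hr0, hr⟩
  choose! r hr0 hr using hx
  -- Vitali's lemma needs bounded radii; here c r² is less than the finite total integral of `f`.
  have hR : ∀ x ∈ t, r x ≤ Real.sqrt ((∫⁻ x, f x).toReal / c) := by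
    intro x hx
    apply Real.le_sqrt_of_sq_le
    rw [le_div_iff₀ hc, mul_comm]
    have := (hr x hx).le.trans (setLIntegral_le_lintegral _ _)
    exact (ENNReal.ofReal_le_iff_le_toReal hf).1 this
  obtain ⟨u, hut, hud, hcov⟩ := Vitali.exists_disjoint_subfamily_covering_enlargement_ball t id r
    _ hR 4 (by norm_num)
  have huc : u.Countable := hud.countable_of_isOpen (fun _ _ => Metric.isOpen_ball)
    fun x hx => Metric.nonempty_ball.2 (hr0 x (hut hx))
  calc volume t ≤ volume (⋃ x ∈ u, Metric.ball x (4 * r x)) := by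
        apply measure_mono
        intro x hx
        obtain ⟨b, hb, hsub⟩ := hcov x hx
        exact Set.mem_biUnion hb (hsub (Metric.mem_ball_self (hr0 x hx)))
    _ ≤ ∑' x : u, volume (Metric.ball (x : Plane) (4 * r x)) := measure_biUnion_le _ huc _
    _ ≤ ∑' x : u, ENNReal.ofReal (64 / c) * ∫⁻ y in Metric.ball (x : Plane) (r x), f y := by
        refine ENNReal.tsum_le_tsum fun x => ?_
        have hx := hut x.2
        have h0 := hr0 x hx
        rw [EuclideanSpace.volume_ball_fin_two]
        -- The dilated ball has area 16πr² ≤ 64r², and c r² is less than the integral of `f` over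
        -- the undilated ball.
        calc _ ≤ ENNReal.ofReal (4 * r x) ^ 2 * ENNReal.ofReal 4 := by
              gcongr; exact Real.pi_le_four
          _ = ENNReal.ofReal (64 / c) * ENNReal.ofReal (c * r x ^ 2) := by
              rw [← ENNReal.ofReal_pow (by positivity), ← ENNReal.ofReal_mul (by positivity),
                ← ENNReal.ofReal_mul (by positivity)]
              congr 1; field_simp; ring
          _ ≤ _ := by gcongr; exact (hr x hx).le
    _ = ENNReal.ofReal (64 / c) * ∫⁻ y in ⋃ x ∈ u, Metric.ball x (r x), f y := by
        rw [ENNReal.tsum_mul_left, lintegral_biUnion huc (fun _ _ => measurableSet_ball)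
          (by simpa using hud)]
    _ ≤ _ := mul_le_mul_right (setLIntegral_le_lintegral _ _) _

/-- The strong-type bound for the maximal function on bounded functions. -/
theorem exists_lintegral_maxFn_rpow_le {p : ℝ} (hp : 1 < p) :
    ∃ C : ℝ≥0, ∀ f : Plane → ℝ≥0∞, Measurable f → (∃ K : ℝ≥0, ∀ x, f x ≤ K) →
      ∫⁻ x, maxFn f x ^ p ≤ C * ∫⁻ x, f x ^ p := by
  refine ⟨(p * (128 * (8 ^ (p - 1) / (p - 1)))).toNNReal, fun f hf ⟨K, hK⟩ => ?_⟩
  have hp1 : 0 < p - 1 := by linarith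
  have hp0 : 0 < p := by linarith
  have hfin : ∀ x, maxFn f x ≠ ⊤ := fun x =>
    ne_top_of_le_ne_top (by finiteness : (4 * K : ℝ≥0∞) ≠ ⊤)
      ((maxFn_mono hK x).trans (maxFn_const_le _ x))
  have hffin : ∀ x, f x ≠ ⊤ := fun x => ne_top_of_le_ne_top ENNReal.coe_ne_top (hK x)
  -- Marcinkiewicz truncation: the part of `f` below t/8 has maximal function at most 4·t/8 = t/2,
  -- so only the large part can push `maxFn f` beyond t. The weak bound at level t/2 gives 64/(t/2)
  -- = 128/t.
  have hlevel : ∀ t : ℝ, 0 < t → volume {x | t < (maxFn f x).toReal} ≤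
      ENNReal.ofReal (128 / t) * ∫⁻ x, {x | t < 8 * (f x).toReal}.indicator f x := by
    intro t ht
    set g := {x | t < 8 * (f x).toReal}.indicator f with hg
    have hgm : Measurable g := hf.indicator (measurableSet_lt (by fun_prop) (by fun_prop))
    have hfg : ∀ x, f x ≤ g x + ENNReal.ofReal (t / 8) := by
      intro x
      by_cases hx : t < 8 * (f x).toReal
      · rw [hg, Set.indicator_of_mem (by exact hx)]; exact le_self_add
      · refine le_add_left ?_
        rw [ENNReal.le_ofReal_iff_toReal_le (hffin x) (by positivity)]
        linarith
    refine le_trans (measure_mono ?_) ((volume_lt_maxFn_le g (half_pos ht)).trans_eq ?_)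
    · intro x hx
      simp only [Set.mem_ofPred_eq] at hx ⊢
      have h1 : maxFn f x ≤ maxFn g x + ENNReal.ofReal (t / 2) := by
        refine (maxFn_mono hfg x).trans ((maxFn_add_le hgm x).trans ?_)
        gcongr
        refine (maxFn_const_le _ x).trans_eq ?_
        rw [show (4 : ℝ≥0∞) = ENNReal.ofReal 4 by simp, ← ENNReal.ofReal_mul (by norm_num)]
        congr 1; ring
      by_contra hcon
      rw [not_lt] at hcon
      have h2 : maxFn f x ≤ ENNReal.ofReal t := by
        refine h1.trans ((add_le_add_left hcon _).trans_eq ?_)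
        rw [← ENNReal.ofReal_add (by positivity) (by positivity)]
        congr 1; ring
      have := ENNReal.toReal_le_of_le_ofReal ht.le h2
      linarith
    · congr 2; field_simp; norm_num
  have hinner : ∀ x, ∫⁻ t in Set.Ioi (0 : ℝ), ENNReal.ofReal (128 / t) *
      {t : ℝ | t < 8 * (f x).toReal}.indicator (fun _ => f x) t * ENNReal.ofReal (t ^ (p - 1)) =
      ENNReal.ofReal (128 * (8 ^ (p - 1) / (p - 1))) * f x ^ p := by
    intro x
    set a := (f x).toReal with ha
    have ha0 : 0 ≤ a := ENNReal.toReal_nonneg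
    have hfa : f x = ENNReal.ofReal a := (ENNReal.ofReal_toReal (hffin x)).symm
    calc _ = ∫⁻ t in Set.Ioi (0 : ℝ), (Set.Ioo 0 (8 * a)).indicator
          (fun t => ENNReal.ofReal (128 * a * t ^ (p - 2))) t := by
          refine setLIntegral_congr_fun measurableSet_Ioi fun t ht => ?_
          have ht : (0 : ℝ) < t := ht
          by_cases hta : t < 8 * a
          · rw [Set.indicator_of_mem (by exact hta), Set.indicator_of_mem (by exact ⟨ht, hta⟩),
              hfa, ← ENNReal.ofReal_mul (by positivity), ← ENNReal.ofReal_mul (by positivity)]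
            congr 1
            rw [show p - 1 = (p - 2) + 1 by ring, Real.rpow_add ht, Real.rpow_one]
            field_simp
          · rw [Set.indicator_of_notMem (by exact hta), Set.indicator_of_notMem (by
              intro h; exact hta h.2)]
            simp
      _ = ∫⁻ t in Set.Ioo 0 (8 * a), ENNReal.ofReal (128 * a * t ^ (p - 2)) := by
          rw [lintegral_indicator measurableSet_Ioo, Measure.restrict_restrict measurableSet_Ioo]
          congr 2
          ext t; simp only [Set.mem_inter_iff, Set.mem_Ioo, Set.mem_Ioi]; tauto
      _ = ENNReal.ofReal (∫ t in (0 : ℝ)..(8 * a), 128 * a * t ^ (p - 2)) := by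
          rw [intervalIntegral.integral_of_le (by positivity), integral_Ioc_eq_integral_Ioo,
            ofReal_integral_eq_lintegral_ofReal]
          · have := ((intervalIntegral.intervalIntegrable_rpow' (a := 0) (b := 8 * a)
              (r := p - 2) (by linarith)).const_mul (128 * a)).1
            exact this.mono_set Set.Ioo_subset_Ioc_self
          · filter_upwards [ae_restrict_mem measurableSet_Ioo] with t ht
            have : 0 < t := ht.1
            positivity
      _ = _ := by
          rw [intervalIntegral.integral_const_mul, integral_rpow (Or.inl (by linarith)),
            show p - 2 + 1 = p - 1 by ring, Real.zero_rpow hp1.ne', hfa,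
            ENNReal.ofReal_rpow_of_nonneg ha0 hp0.le, ← ENNReal.ofReal_mul (by positivity),
            Real.mul_rpow (by norm_num) ha0]
          congr 1
          rcases ha0.eq_or_lt with h | h
          · rw [← h, Real.zero_rpow hp0.ne', Real.zero_rpow hp1.ne']; simp
          · have : a ^ p = a ^ (p - 1) * a := by
              rw [← Real.rpow_add_one h.ne']; congr 1; ring
            rw [this]
            field_simp
            ring
  calc ∫⁻ x, maxFn f x ^ p = ∫⁻ x, ENNReal.ofReal ((maxFn f x).toReal ^ p) := by
        refine lintegral_congr fun x => ?_
        rw [← ENNReal.ofReal_rpow_of_nonneg ENNReal.toReal_nonneg hp0.le,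
          ENNReal.ofReal_toReal (hfin x)]
    _ = ENNReal.ofReal p * ∫⁻ t in Set.Ioi 0, volume {x | t < (maxFn f x).toReal} *
          ENNReal.ofReal (t ^ (p - 1)) := by
        rw [lintegral_rpow_eq_lintegral_meas_lt_mul volume
          (Filter.Eventually.of_forall fun x => ENNReal.toReal_nonneg)
          (measurable_maxFn f).ennreal_toReal.aemeasurable hp0]
    _ ≤ ENNReal.ofReal p * ∫⁻ t in Set.Ioi (0 : ℝ), ∫⁻ x, ENNReal.ofReal (128 / t) *
          {t : ℝ | t < 8 * (f x).toReal}.indicator (fun _ => f x) t *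
            ENNReal.ofReal (t ^ (p - 1)) := by
        gcongr 1
        refine setLIntegral_mono' measurableSet_Ioi fun t ht => ?_
        have hm : Measurable ({x | t < 8 * (f x).toReal}.indicator f) :=
          hf.indicator (measurableSet_lt (by fun_prop) (by fun_prop))
        rw [lintegral_mul_const _ (by exact hm.const_mul _), lintegral_const_mul _ (by exact hm)]
        gcongr
        exact hlevel t ht
    _ = ENNReal.ofReal p * ∫⁻ x, ∫⁻ t in Set.Ioi (0 : ℝ), ENNReal.ofReal (128 / t) *
          {t : ℝ | t < 8 * (f x).toReal}.indicator (fun _ => f x) t *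
            ENNReal.ofReal (t ^ (p - 1)) := by
        rw [lintegral_lintegral_swap]
        refine Measurable.aemeasurable ?_
        have : (Function.uncurry fun (t : ℝ) (x : Plane) => ENNReal.ofReal (128 / t) *
          {t : ℝ | t < 8 * (f x).toReal}.indicator (fun _ => f x) t *
            ENNReal.ofReal (t ^ (p - 1))) = fun z : ℝ × Plane => ENNReal.ofReal (128 / z.1) *
          {z : ℝ × Plane | z.1 < 8 * (f z.2).toReal}.indicator (fun z => f z.2) z *
            ENNReal.ofReal (z.1 ^ (p - 1)) := by
          ext z; simp [Function.uncurry, Set.indicator]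
        rw [this]
        have h2 : Measurable ({z : ℝ × Plane | z.1 < 8 * (f z.2).toReal}.indicator
            (fun z => f z.2)) :=
          Measurable.indicator (by fun_prop) (measurableSet_lt (by fun_prop) (by fun_prop))
        fun_prop
    _ = _ := by
        simp_rw [hinner]
        rw [lintegral_const_mul _ (by fun_prop), ← mul_assoc, ← ENNReal.ofReal_mul hp0.le]
        rfl

/-! ### Quantitative convexity of powers -/

/-- Since p ≤ 2, the second derivative p(p-1)s^{p-2} on (0, a+b) is at least its value at a+b.
Subtracting the quadratic with that curvature leaves a convex function, which lies above its tangent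
at `a`. The cases a = 0 and b = 0, where s^{p-2} may blow up, are checked by hand. -/
theorem rpow_sub_tangent_ge {p a b : ℝ} (hp1 : 1 < p) (hp2 : p ≤ 2) (ha : 0 ≤ a) (hb : 0 ≤ b) :
    a ^ p + p * a ^ (p - 1) * (b - a) + p * (p - 1) / 2 * ((b - a) ^ 2 * (a + b) ^ (p - 2))
      ≤ b ^ p := by
  have hsq : ∀ t : ℝ, 0 < t → t ^ 2 * t ^ (p - 2) = t ^ p := by
    intro t ht
    rw [← Real.rpow_two, ← Real.rpow_add ht]; congr 1; ring
  rcases ha.eq_or_lt with rfl | ha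
  · rw [Real.zero_rpow (by linarith), Real.zero_rpow (by linarith)]
    rcases hb.eq_or_lt with rfl | hb
    · simp [Real.zero_rpow (by linarith : p ≠ 0)]
    · have := hsq b hb
      simp only [sub_zero, zero_add, this, mul_zero, zero_mul]
      have hb' : 0 < b ^ p := by positivity
      have h2 : p * (p - 1) / 2 ≤ 1 := by nlinarith
      calc p * (p - 1) / 2 * b ^ p ≤ 1 * b ^ p := by gcongr
        _ = b ^ p := one_mul _
  rcases hb.eq_or_lt with rfl | hb
  · rw [Real.zero_rpow (by linarith)]
    have h1 : (0 - a) ^ 2 * (a + 0) ^ (p - 2) = a ^ p := by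
      rw [add_zero, zero_sub, neg_sq, hsq a ha]
    have h2 : a ^ (p - 1) * a = a ^ p := by
      rw [← Real.rpow_add_one ha.ne']; congr 1; ring
    have h3 : p * a ^ (p - 1) * (0 - a) = -(p * a ^ p) := by rw [← h2]; ring
    rw [h1, h3]
    have : 0 < a ^ p := by positivity
    have h4 : 1 - p + p * (p - 1) / 2 ≤ 0 := by nlinarith
    calc a ^ p + -(p * a ^ p) + p * (p - 1) / 2 * a ^ p
        = (1 - p + p * (p - 1) / 2) * a ^ p := by ring
      _ ≤ 0 := mul_nonpos_of_nonpos_of_nonneg h4 this.le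
  set L := a + b with hL
  have hL0 : 0 < L := by positivity
  set g : ℝ → ℝ := fun s => s ^ p - p * (p - 1) / 2 * L ^ (p - 2) * s ^ 2 with hg
  set g' : ℝ → ℝ := fun s => p * s ^ (p - 1) - p * (p - 1) * L ^ (p - 2) * s with hg'
  have hd : ∀ s, 0 < s → HasDerivAt g (g' s) s := by
    intro s hs
    have h1 := Real.hasDerivAt_rpow_const (x := s) (p := p) (Or.inl hs.ne')
    have h2 := (hasDerivAt_pow 2 s).const_mul (p * (p - 1) / 2 * L ^ (p - 2))
    refine (h1.sub h2).congr_deriv ?_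
    simp only [hg', Nat.cast_ofNat, Nat.add_one_sub_one, pow_one]; ring
  have hd2 : ∀ s, 0 < s → HasDerivAt g' (p * (p - 1) * (s ^ (p - 2) - L ^ (p - 2))) s := by
    intro s hs
    have h1 := (Real.hasDerivAt_rpow_const (x := s) (p := p - 1) (Or.inl hs.ne')).const_mul p
    have h2 := (hasDerivAt_id s).const_mul (p * (p - 1) * L ^ (p - 2))
    refine (h1.sub h2).congr_deriv ?_
    rw [show p - 1 - 1 = p - 2 by ring]; ring
  have hconv : ConvexOn ℝ (Set.Ioo 0 L) g := by
    have hderiv : ∀ s ∈ Set.Ioo 0 L, deriv g s = g' s := fun s hs => (hd s hs.1).deriv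
    apply MonotoneOn.convexOn_of_deriv (convex_Ioo 0 L)
    · exact fun s hs => (hd s hs.1).continuousAt.continuousWithinAt
    · rw [interior_Ioo]; exact fun s hs => (hd s hs.1).differentiableAt.differentiableWithinAt
    · rw [interior_Ioo]
      have : MonotoneOn g' (Set.Ioo 0 L) := by
        apply monotoneOn_of_deriv_nonneg (convex_Ioo 0 L)
        · exact fun s hs => (hd2 s hs.1).continuousAt.continuousWithinAt
        · rw [interior_Ioo]
          exact fun s hs => (hd2 s hs.1).differentiableAt.differentiableWithinAt
        · rw [interior_Ioo]
          intro s hs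
          rw [(hd2 s hs.1).deriv]
          have : L ^ (p - 2) ≤ s ^ (p - 2) :=
            Real.rpow_le_rpow_of_nonpos hs.1 hs.2.le (by linarith)
          have h2 : 0 ≤ p * (p - 1) := by nlinarith
          exact mul_nonneg h2 (by linarith)
      intro s hs t ht hst
      rw [hderiv s hs, hderiv t ht]
      exact this hs ht hst
  have haL : a ∈ Set.Ioo 0 L := ⟨ha, by linarith⟩
  have hbL : b ∈ Set.Ioo 0 L := ⟨hb, by linarith⟩
  have hkey : g a + g' a * (b - a) ≤ g b := by
    rcases lt_trichotomy a b with h | h | h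
    · have := hconv.le_slope_of_hasDerivAt haL hbL h (hd a ha)
      rw [slope_def_field, le_div_iff₀ (by linarith)] at this
      linarith
    · rw [← h]; simp
    · have := hconv.slope_le_of_hasDerivAt hbL haL h (hd a ha)
      rw [slope_def_field, div_le_iff₀ (by linarith)] at this
      linarith
  simp only [hg, hg'] at hkey
  linarith

/-- Quantitative convexity of `‖x‖ ^ p` for `1 < p ≤ 2`. -/
theorem norm_rpow_sub_tangent_ge {E : Type*} [NormedAddCommGroup E] [InnerProductSpace ℝ E]
    {p : ℝ} (hp1 : 1 < p) (hp2 : p ≤ 2) (c x : E) :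
    ‖c‖ ^ p + p * ‖c‖ ^ (p - 2) * inner ℝ c (x - c) +
      p * (p - 1) / 2 * (‖x - c‖ ^ 2 * (‖x‖ + ‖c‖) ^ (p - 2)) ≤ ‖x‖ ^ p := by
  have h := rpow_sub_tangent_ge hp1 hp2 (norm_nonneg c) (norm_nonneg x)
  have hin : inner ℝ c (x - c) = inner ℝ c x - ‖c‖ ^ 2 := by
    rw [inner_sub_right, real_inner_self_eq_norm_sq]
  have hns : ‖x - c‖ ^ 2 = ‖x‖ ^ 2 - 2 * inner ℝ c x + ‖c‖ ^ 2 := by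
    rw [norm_sub_sq_real, real_inner_comm]
  have hcs : inner ℝ c x ≤ ‖c‖ * ‖x‖ := real_inner_le_norm c x
  rcases (norm_nonneg c).eq_or_lt with hc | hc
  · have hc0 : c = 0 := norm_eq_zero.1 hc.symm
    subst hc0
    have h0 : (0 : ℝ) ^ (p - 1) = 0 := Real.zero_rpow (by linarith)
    simp only [norm_zero, h0, inner_zero_left, sub_zero, mul_zero, zero_mul, add_zero,
      zero_add] at h ⊢
    exact h
  have hpow : ‖c‖ ^ (p - 1) = ‖c‖ ^ (p - 2) * ‖c‖ := by
    rw [← Real.rpow_add_one hc.ne']; congr 1; ring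
  have hmon : (‖x‖ + ‖c‖) ^ (p - 2) ≤ ‖c‖ ^ (p - 2) :=
    Real.rpow_le_rpow_of_nonpos hc (by linarith [norm_nonneg x]) (by linarith)
  set A := ‖c‖ ^ (p - 2)
  set B := (‖x‖ + ‖c‖) ^ (p - 2) with hB
  have hB0 : 0 ≤ B := by positivity
  rw [add_comm ‖c‖ ‖x‖, ← hB, hpow] at h
  rw [hns, hin]
  -- `D` is the defect in Cauchy–Schwarz. Compared with the scalar inequality for the norms, the
  -- linear term loses p·A·D while the quadratic term gains p(p-1)·B·D, and the loss wins because B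
  -- ≤ A and p-1 ≤ 1.
  set D := ‖c‖ * ‖x‖ - inner ℝ c x with hD
  have hD0 : 0 ≤ D := by linarith
  have hxin : inner ℝ c x = ‖c‖ * ‖x‖ - D := by rw [hD]; ring
  rw [hxin]
  have e : p * (p - 1) * (D * B) ≤ p * (D * A) := by
    have h1 : D * B ≤ D * A := mul_le_mul_of_nonneg_left hmon hD0
    have h2 : 0 ≤ D * B := mul_nonneg hD0 hB0
    have h3 : p * (p - 1) * (D * B) ≤ p * (D * B) := by
      apply mul_le_mul_of_nonneg_right _ h2
      nlinarith
    have h4 : p * (D * B) ≤ p * (D * A) := mul_le_mul_of_nonneg_left h1 (by linarith)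
    linarith
  linarith

/-- Bernoulli's inequality for the ratio t/t₀. -/
theorem rpow_tangent_le {q t t₀ : ℝ} (hq : 1 < q) (ht : 0 ≤ t) (ht₀ : 0 ≤ t₀) :
    t₀ ^ q + q * t₀ ^ (q - 1) * (t - t₀) ≤ t ^ q := by
  rcases ht₀.eq_or_lt with rfl | h
  · rw [Real.zero_rpow (by linarith), Real.zero_rpow (by linarith)]
    simp; positivity
  · have h1 := one_add_mul_self_le_rpow_one_add (s := t / t₀ - 1)
      (by have : 0 ≤ t / t₀ := by positivity
          linarith) hq.le
    rw [show 1 + (t / t₀ - 1) = t / t₀ by ring, Real.div_rpow ht ht₀, le_div_iff₀ (by positivity)]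
      at h1
    have h2 : t₀ ^ q = t₀ ^ (q - 1) * t₀ := by
      rw [← Real.rpow_add_one h.ne']; congr 1; ring
    refine le_trans (le_of_eq ?_) h1
    rw [h2]; field_simp

/-! ### The heat operator on bounded functions -/

/-- A bounded measurable function. -/
def BddMeas {E : Type*} [NormedAddCommGroup E] [MeasurableSpace E] (f : Plane → E) : Prop :=
  Measurable f ∧ ∃ K : ℝ≥0, ∀ x, ‖f x‖ ≤ K

theorem BddMeas.enorm_le {E : Type*} [NormedAddCommGroup E] [MeasurableSpace E] {f : Plane → E}
    (hf : BddMeas f) : ∃ K : ℝ≥0, ∀ x, ‖f x‖ₑ ≤ K := by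
  obtain ⟨-, K, hK⟩ := hf
  exact ⟨K, fun x => by
    rw [enorm_eq_nnnorm]; exact_mod_cast hK x⟩

theorem BddMeas.integrable {E : Type*} [NormedAddCommGroup E] [MeasurableSpace E] [BorelSpace E]
    [SecondCountableTopology E] {f : Plane → E} (hf : BddMeas f) (μ : Measure Plane)
    [IsFiniteMeasure μ] : Integrable f μ := by
  obtain ⟨hm, K, hK⟩ := hf
  exact Integrable.of_bound hm.aestronglyMeasurable K (Filter.Eventually.of_forall hK)

/-- The heat operator on vector-valued functions. -/
noncomputable def heat {E : Type*} [NormedAddCommGroup E] [NormedSpace ℝ E] (τ : ℝ)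
    (f : Plane → E) (x : Plane) : E :=
  ∫ y, heatK τ (x - y) • f y

section Heat

variable {E : Type*} [NormedAddCommGroup E] [NormedSpace ℝ E]

theorem integral_heatMeasure {τ : ℝ} (hτ : 0 < τ) (f : Plane → E) (x : Plane) :
    ∫ y, f y ∂(heatMeasure τ x) = heat τ f x := by
  rw [heatMeasure, integral_withDensity_eq_integral_toReal_smul (by fun_prop)
    (Filter.Eventually.of_forall fun y => ENNReal.ofReal_lt_top)]
  simp only [ENNReal.toReal_ofReal (heatK_pos hτ _).le]
  rfl

theorem enorm_heat_le {τ : ℝ} (hτ : 0 < τ) (f : Plane → E) (x : Plane) :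
    ‖heat τ f x‖ₑ ≤ heatE τ (fun y => ‖f y‖ₑ) x := by
  refine (enorm_integral_le_lintegral_enorm _).trans_eq ?_
  refine lintegral_congr fun y => ?_
  rw [enorm_smul, Real.enorm_of_nonneg (heatK_pos hτ _).le]

variable [MeasurableSpace E] [BorelSpace E] [SecondCountableTopology E]

theorem BddMeas.heat {τ : ℝ} (hτ : 0 < τ) {f : Plane → E} (hf : BddMeas f) :
    BddMeas (heat τ f) := by
  refine ⟨?_, ?_⟩
  · apply StronglyMeasurable.measurable
    apply StronglyMeasurable.integral_prod_right (f := fun x y => heatK τ (x - y) • f y)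
    have h1 : Measurable fun z : Plane × Plane => heatK τ (z.1 - z.2) :=
      ((continuous_heatK τ).comp (continuous_fst.sub continuous_snd)).measurable
    exact (h1.smul (hf.1.comp measurable_snd)).stronglyMeasurable
  · obtain ⟨K, hK⟩ := hf.2
    refine ⟨K, fun x => ?_⟩
    have := isProbabilityMeasure_heatMeasure hτ x
    rw [← integral_heatMeasure hτ]
    simpa using norm_integral_le_of_norm_le_const (μ := heatMeasure τ x)
      (Filter.Eventually.of_forall hK)

theorem BddMeas.integrable_heatK_smul {τ : ℝ} (hτ : 0 < τ) {f : Plane → E} (hf : BddMeas f)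
    (x : Plane) : Integrable (fun y => heatK τ (x - y) • f y) := by
  obtain ⟨hm, K, hK⟩ := hf
  have h := ((integrable_heatK hτ).comp_sub_left x)
  exact h.smul_bdd (K : ℝ) hm.aestronglyMeasurable (Filter.Eventually.of_forall hK)

theorem heat_heat [CompleteSpace E] {σ τ : ℝ} (hσ : 0 < σ) (hτ : 0 < τ) {f : Plane → E} (hf : BddMeas f)
    (x : Plane) : heat σ (heat τ f) x = heat (σ + τ) f x := by
  have hms : 0 < σ * τ / (σ + τ) := by positivity
  unfold heat
  calc _ = ∫ z, ∫ y, heatK σ (x - z) • heatK τ (z - y) • f y := by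
        refine integral_congr_ae (Filter.Eventually.of_forall fun z => ?_)
        simp only
        rw [integral_smul]
    _ = ∫ y, ∫ z, heatK σ (x - z) • heatK τ (z - y) • f y := by
        rw [integral_integral_swap]
        obtain ⟨hm, K, hK⟩ := hf
        have hmeas : Measurable (Function.uncurry fun z y : Plane =>
            heatK σ (x - z) • heatK τ (z - y) • f y) := by
          have h1 : Measurable fun z : Plane × Plane => heatK τ (z.1 - z.2) :=
            ((continuous_heatK τ).comp (continuous_fst.sub continuous_snd)).measurable
          have h2 : Measurable fun z : Plane × Plane => heatK σ (x - z.1) :=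
            ((continuous_heatK σ).comp (continuous_const.sub continuous_fst)).measurable
          exact h2.smul (h1.smul (hm.comp measurable_snd))
        refine (integrable_prod_iff hmeas.aestronglyMeasurable).2 ⟨?_, ?_⟩
        · refine Filter.Eventually.of_forall fun z => ?_
          exact (BddMeas.integrable_heatK_smul hτ ⟨hm, K, hK⟩ z).smul (heatK σ (x - z))
        · refine (((integrable_heatK hσ).comp_sub_left x).mul_const (K : ℝ)).mono'
            (hmeas.norm.stronglyMeasurable.integral_prod_right').aestronglyMeasurable ?_
          refine Filter.Eventually.of_forall fun z => ?_
          have h0 : 0 ≤ ∫ y, ‖Function.uncurry (fun z y : Plane =>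
              heatK σ (x - z) • heatK τ (z - y) • f y) (z, y)‖ :=
            integral_nonneg fun y => norm_nonneg _
          rw [Real.norm_of_nonneg h0]
          calc _ ≤ ∫ y, heatK σ (x - z) * (heatK τ (z - y) * K) := by
                refine integral_mono_of_nonneg
                  (Filter.Eventually.of_forall fun y => norm_nonneg _)
                  ((((integrable_heatK hτ).comp_sub_left z).mul_const (K : ℝ)).const_mul _)
                  (Filter.Eventually.of_forall fun y => ?_)
                simp only [Function.uncurry, norm_smul, Real.norm_of_nonneg (heatK_pos hσ _).le,
                  Real.norm_of_nonneg (heatK_pos hτ _).le]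
                gcongr
                · exact (heatK_pos hσ _).le
                · exact (heatK_pos hτ _).le
                · exact hK y
            _ = heatK σ (x - z) * K := by
                rw [integral_const_mul, integral_mul_const,
                  integral_sub_left_eq_self (fun y => heatK τ y) volume z, integral_heatK hτ,
                  one_mul]
    _ = ∫ y, heatK (σ + τ) (x - y) • f y := by
        refine integral_congr_ae (Filter.Eventually.of_forall fun y => ?_)
        simp only
        simp_rw [smul_smul, heatK_mul_heatK hσ hτ]
        rw [integral_smul_const, integral_const_mul, integral_sub_right_eq_self
          (fun z => heatK (σ * τ / (σ + τ)) z), integral_heatK hms, mul_one]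

end Heat

/-! ### Square function estimates for families controlled by heat oscillations -/

/-- Any finite set of integers sits in a window [-m, m), over which the hypothesis telescopes to
a(-m) ≤ A. -/
theorem tsum_int_le_of_telescope {a b : ℤ → ℝ≥0∞} {A : ℝ≥0∞} (h : ∀ k, a (k + 1) + b k ≤ a k)
    (hA : ∀ k, a k ≤ A) : ∑' k, b k ≤ A := by
  have key : ∀ (k : ℤ) (n : ℕ), a (k + n) + ∑ i ∈ Finset.range n, b (k + i) ≤ a k := by
    intro k n
    induction n with
    | zero => simp
    | succ n ih =>
      rw [Finset.sum_range_succ]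
      calc a (k + (n + 1 : ℕ)) + (∑ i ∈ Finset.range n, b (k + i) + b (k + n))
          = (a (k + n + 1) + b (k + n)) + ∑ i ∈ Finset.range n, b (k + i) := by
            push_cast; rw [← add_assoc k]; ring
        _ ≤ a (k + n) + ∑ i ∈ Finset.range n, b (k + i) := by gcongr; exact h _
        _ ≤ a k := ih
  rw [ENNReal.tsum_eq_iSup_sum]
  refine iSup_le fun s => ?_
  obtain ⟨m, hm⟩ : ∃ m : ℕ, ∀ k ∈ s, -(m : ℤ) ≤ k ∧ k < m := by
    refine ⟨s.sup Int.natAbs + 1, fun k hk => ?_⟩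
    have := Finset.le_sup (f := Int.natAbs) hk
    omega
  calc ∑ k ∈ s, b k ≤ ∑ k ∈ (Finset.range (2 * m)).image (fun i : ℕ => -(m : ℤ) + i), b k := by
        apply Finset.sum_le_sum_of_subset
        intro k hk
        have := hm k hk
        rw [Finset.mem_image]
        exact ⟨(k + m).toNat, by rw [Finset.mem_range]; omega, by omega⟩
    _ = ∑ i ∈ Finset.range (2 * m), b (-(m : ℤ) + i) := by
        rw [Finset.sum_image]
        intro i _ j _ hij
        simpa using hij
    _ ≤ a (-(m : ℤ)) := le_trans (le_add_self) (key _ (2 * m))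
    _ ≤ A := hA _

/-- The family `D` is controlled by the oscillation of the heat flow of `f` at scale `τ`. -/
def OscControlled (f : Plane → ℂ) (D : ℝ → Plane → ℝ≥0∞) : Prop :=
  (∀ τ, Measurable (D τ)) ∧ ∀ τ, 0 < τ → ∀ x, ∀ c : ℂ,
    D τ x ≤ heatE τ (fun y => ‖heat τ f y - c‖ₑ) x

theorem integrable_of_measurable_of_le {μ : Measure Plane} [IsFiniteMeasure μ] {g : Plane → ℝ}
    (hg : Measurable g) {K : ℝ} (h0 : ∀ y, 0 ≤ g y) (hK : ∀ y, g y ≤ K) : Integrable g μ :=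
  Integrable.of_bound hg.aestronglyMeasurable K (Filter.Eventually.of_forall fun y => by
    rw [Real.norm_of_nonneg (h0 y)]; exact hK y)

/-! ### Square functions for 1 < p ≤ 2 -/

/-- The gain in Jensen's inequality for `‖·‖ ^ p`, `1 < p ≤ 2`. -/
theorem enorm_heat_rpow_add_le {p : ℝ} (hp1 : 1 < p) (hp2 : p ≤ 2) {σ : ℝ} (hσ : 0 < σ)
    {u : Plane → ℂ} (hu : BddMeas u) (x : Plane) :
    ‖heat σ u x‖ₑ ^ p + ENNReal.ofReal (p * (p - 1) / 2) *
      heatE σ (fun y => ‖u y - heat σ u x‖ₑ ^ (2 : ℝ) * (‖u y‖ₑ + ‖heat σ u x‖ₑ) ^ (p - 2)) x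
      ≤ heatE σ (fun y => ‖u y‖ₑ ^ p) x := by
  set c := heat σ u x with hc
  set μ := heatMeasure σ x with hμ
  have hprob : IsProbabilityMeasure μ := isProbabilityMeasure_heatMeasure hσ x
  obtain ⟨hum, K, hK⟩ := hu
  have hp0 : 0 < p := by linarith
  have hκ : 0 ≤ p * (p - 1) / 2 := by nlinarith
  set Z : Plane → ℝ := fun y => ‖u y‖ + ‖c‖ with hZ
  have hZ0 : ∀ y, 0 ≤ Z y := fun y => by positivity
  have hle : ∀ y, ‖u y - c‖ ≤ Z y := fun y => norm_sub_le _ _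
  have hI1 : Integrable (fun y => ‖u y‖ ^ p) μ :=
    integrable_of_measurable_of_le (K := (K : ℝ) ^ p) (by fun_prop) (fun y => by positivity)
      fun y => Real.rpow_le_rpow (norm_nonneg _) (hK y) hp0.le
  have hZm : Measurable Z := by fun_prop
  have hI2 : Integrable (fun y => ‖u y - c‖ ^ 2 * Z y ^ (p - 2)) μ := by
    refine integrable_of_measurable_of_le (K := ((K : ℝ) + ‖c‖) ^ p) (by fun_prop)
      (fun y => by positivity) fun y => ?_
    rcases (hZ0 y).eq_or_lt with h | h
    · have : ‖u y - c‖ = 0 := le_antisymm (by rw [h]; exact hle y) (norm_nonneg _)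
      rw [this]; simp; positivity
    · calc ‖u y - c‖ ^ 2 * Z y ^ (p - 2) ≤ Z y ^ 2 * Z y ^ (p - 2) := by
            gcongr; exact hle y
        _ = Z y ^ p := by rw [← Real.rpow_two, ← Real.rpow_add h]; congr 1; ring
        _ ≤ _ := by gcongr; exact add_le_add_left (hK y) _
  have hIu : Integrable u μ := BddMeas.integrable ⟨hum, K, hK⟩ μ
  have hIuc : Integrable (fun y => u y - c) μ := hIu.sub (integrable_const c)
  have hIin : Integrable (fun y => inner ℝ c (u y - c)) μ := hIuc.const_inner c
  -- `c` is the mean of `u`, so the linear term of the convexity inequality integrates to zero.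
  have hint0 : ∫ y, inner ℝ c (u y - c) ∂μ = 0 := by
    rw [integral_inner hIuc, integral_sub hIu (integrable_const c),
      hμ, integral_heatMeasure hσ, ← hc]
    simp
  have hreal : ‖c‖ ^ p + p * (p - 1) / 2 * ∫ y, ‖u y - c‖ ^ 2 * Z y ^ (p - 2) ∂μ ≤
      ∫ y, ‖u y‖ ^ p ∂μ := by
    have hI3 : Integrable (fun y => ‖c‖ ^ p + p * ‖c‖ ^ (p - 2) * inner ℝ c (u y - c)) μ :=
      (integrable_const _).add (hIin.const_mul _)
    have h1 : ∫ y, (‖c‖ ^ p + p * ‖c‖ ^ (p - 2) * inner ℝ c (u y - c) +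
        p * (p - 1) / 2 * (‖u y - c‖ ^ 2 * Z y ^ (p - 2))) ∂μ ≤ ∫ y, ‖u y‖ ^ p ∂μ :=
      integral_mono (hI3.add (hI2.const_mul _)) hI1
        fun y => norm_rpow_sub_tangent_ge hp1 hp2 c (u y)
    rw [integral_add hI3 (hI2.const_mul _),
      integral_add (integrable_const _) (hIin.const_mul _), integral_const_mul,
      integral_const_mul, hint0] at h1
    simpa using h1
  have e1 : heatE σ (fun y => ‖u y‖ₑ ^ p) x = ENNReal.ofReal (∫ y, ‖u y‖ ^ p ∂μ) := by
    rw [← lintegral_heatMeasure σ x (by fun_prop), ofReal_integral_eq_lintegral_ofReal hI1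
      (Filter.Eventually.of_forall fun y => by positivity)]
    refine lintegral_congr fun y => ?_
    rw [← ENNReal.ofReal_rpow_of_nonneg (norm_nonneg _) hp0.le, ofReal_norm]
  have e2 : heatE σ (fun y => ‖u y - c‖ₑ ^ (2 : ℝ) * (‖u y‖ₑ + ‖c‖ₑ) ^ (p - 2)) x =
      ENNReal.ofReal (∫ y, ‖u y - c‖ ^ 2 * Z y ^ (p - 2) ∂μ) := by
    rw [← lintegral_heatMeasure σ x (by fun_prop), ofReal_integral_eq_lintegral_ofReal hI2
      (Filter.Eventually.of_forall fun y => by positivity)]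
    refine lintegral_congr fun y => ?_
    have hZe : ‖u y‖ₑ + ‖c‖ₑ = ENNReal.ofReal (Z y) := by
      rw [hZ, ENNReal.ofReal_add (norm_nonneg _) (norm_nonneg _), ofReal_norm, ofReal_norm]
    rcases (hZ0 y).eq_or_lt with h | h
    · have : ‖u y - c‖ = 0 := le_antisymm (by rw [h]; exact hle y) (norm_nonneg _)
      rw [← ofReal_norm (u y - c), this]; simp
    · rw [hZe, ENNReal.ofReal_rpow_of_pos h, ENNReal.ofReal_mul (by positivity), ← ofReal_norm,
        ENNReal.ofReal_rpow_of_nonneg (norm_nonneg _) (by norm_num), Real.rpow_two]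
  rw [e1, e2, ← ENNReal.ofReal_mul hκ, ← ofReal_norm c,
    ENNReal.ofReal_rpow_of_nonneg (norm_nonneg _) hp0.le, ← ENNReal.ofReal_add (by positivity)]
  · exact ENNReal.ofReal_le_ofReal hreal
  · exact mul_nonneg hκ (integral_nonneg fun y => by positivity)

theorem measurable_heatE_param (σ : ℝ) {F : Plane → Plane → ℝ≥0∞}
    (hF : Measurable (Function.uncurry F)) : Measurable fun x => heatE σ (F x) x := by
  unfold heatE
  exact Measurable.lintegral_prod_right' (f := fun z : Plane × Plane =>
    ENNReal.ofReal (heatK σ (z.1 - z.2)) * F z.1 z.2) ((measurable_heatK_sub σ).mul hF)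

theorem lintegral_enorm_heat_rpow_le {E : Type*} [NormedAddCommGroup E] [NormedSpace ℝ E]
    [MeasurableSpace E] [BorelSpace E] {p : ℝ} (hp : 1 ≤ p) {τ : ℝ} (hτ : 0 < τ) {f : Plane → E}
    (hf : Measurable f) : ∫⁻ x, ‖heat τ f x‖ₑ ^ p ≤ ∫⁻ x, ‖f x‖ₑ ^ p := by
  calc _ ≤ ∫⁻ x, heatE τ (fun y => ‖f y‖ₑ ^ p) x := by
        refine lintegral_mono fun x => ?_
        exact (ENNReal.rpow_le_rpow (enorm_heat_le hτ f x) (by linarith)).trans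
          (heatE_rpow_le hτ hp (by fun_prop) x)
    _ = _ := lintegral_heatE hτ (by fun_prop)

/-- The Jensen gains Q_k telescope to a multiple of ∫ |f|^p. Cauchy–Schwarz with the weight
(|u|+|c|)^{p-2} gives D² ≤ 18 M^{2-p} Q_k, where M is the maximal function of `f`; Hölder with
exponents 2/(2-p) and 2/p then combines the bounds of M^p and of Σ Q_k. -/
theorem exists_lintegral_square_le_of_le_two {p : ℝ} (hp1 : 1 < p) (hp2 : p ≤ 2) :
    ∃ C : ℝ≥0, ∀ (f : Plane → ℂ) (D : ℝ → Plane → ℝ≥0∞), BddMeas f → OscControlled f D →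
      ∀ τ₀ : ℝ, 0 < τ₀ → ∫⁻ x, (∑' k : ℤ, D (4 ^ k * τ₀) x ^ (2 : ℝ)) ^ (p / 2)
        ≤ C * ∫⁻ x, ‖f x‖ₑ ^ p := by
  obtain ⟨CM, hCM⟩ := exists_lintegral_maxFn_rpow_le hp1
  have hp0 : 0 < p := by linarith
  set κ : ℝ := p * (p - 1) / 2 with hκ
  have hκ0 : 0 < κ := by rw [hκ]; nlinarith
  refine ⟨(18 : ℝ≥0) ^ (p / 2) * (CM ^ ((2 - p) / 2) * (κ⁻¹).toNNReal ^ (p / 2)),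
    fun f D hf ⟨hDm, hD⟩ τ₀ hτ₀ => ?_⟩
  set t : ℤ → ℝ := fun k => 4 ^ k * τ₀ with ht
  have ht0 : ∀ k, 0 < t k := fun k => by positivity
  -- The scale ratio 4 = 3 + 1 makes each term the heat flow at time 3 t_k of its predecessor, as
  -- for martingale averages.
  have htsucc : ∀ k, t (k + 1) = 3 * t k + t k := fun k => by
    simp only [ht, zpow_add_one₀ (by norm_num : (4 : ℝ) ≠ 0)]; ring
  set u : ℤ → Plane → ℂ := fun k => heat (t k) f with hu
  have hub : ∀ k, BddMeas (u k) := fun k => hf.heat (ht0 k)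
  have husucc : ∀ k x, u (k + 1) x = heat (3 * t k) (u k) x := fun k x => by
    simp only [hu]
    rw [heat_heat (by have := ht0 k; positivity) (ht0 k) hf, htsucc]
  set Q : ℤ → Plane → ℝ≥0∞ := fun k x => heatE (3 * t k) (fun y =>
    ‖u k y - u (k + 1) x‖ₑ ^ (2 : ℝ) * (‖u k y‖ₑ + ‖u (k + 1) x‖ₑ) ^ (p - 2)) x with hQ
  have hum : ∀ k, Measurable (u k) := fun k => (hub k).1
  have hQm : ∀ k, Measurable (Q k) := fun k => by
    have h1 := hum k
    have h2 := hum (k + 1)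
    exact measurable_heatE_param _ (by unfold Function.uncurry; fun_prop)
  have hM : ∫⁻ x, maxFn (fun y => ‖f y‖ₑ) x ^ p ≤ CM * ∫⁻ x, ‖f x‖ₑ ^ p :=
    hCM _ hf.1.enorm hf.enorm_le
  have htel : ∑' k, ENNReal.ofReal κ * ∫⁻ x, Q k x ≤ ∫⁻ x, ‖f x‖ₑ ^ p := by
    refine tsum_int_le_of_telescope (a := fun k => ∫⁻ x, ‖u k x‖ₑ ^ p) (fun k => ?_)
      (fun k => lintegral_enorm_heat_rpow_le hp1.le (ht0 k) hf.1)
    have h3 : 0 < 3 * t k := by have := ht0 k; positivity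
    rw [← lintegral_const_mul _ (hQm k), ← lintegral_add_left (by have := hum (k+1); fun_prop),
      ← lintegral_heatE h3 (f := fun x => ‖u k x‖ₑ ^ p) (by have := hum k; fun_prop)]
    refine lintegral_mono fun x => ?_
    simp only [hQ, husucc k x]
    exact enorm_heat_rpow_add_le hp1 hp2 h3 (hub k) x
  have hsumQ : ∫⁻ x, ∑' k, Q k x ≤ ENNReal.ofReal κ⁻¹ * ∫⁻ x, ‖f x‖ₑ ^ p := by
    rw [lintegral_tsum fun k => (hQm k).aemeasurable]
    calc ∑' k, ∫⁻ x, Q k x = ENNReal.ofReal κ⁻¹ * ∑' k, ENNReal.ofReal κ * ∫⁻ x, Q k x := by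
          rw [ENNReal.tsum_mul_left, ← mul_assoc, ← ENNReal.ofReal_mul (by positivity),
            inv_mul_cancel₀ hκ0.ne']
          simp
      _ ≤ _ := by gcongr
  have hpt : ∀ k x, D (t k) x ^ (2 : ℝ) ≤
      18 * (maxFn (fun y => ‖f y‖ₑ) x ^ (2 - p) * Q k x) := by
    intro k x
    have h3 : 0 < 3 * t k := by have := ht0 k; positivity
    set c := u (k + 1) x with hc
    have hkm := hum k
    have hfin : ∀ y, ‖u k y‖ₑ + ‖c‖ₑ ≠ ⊤ := fun y => by finiteness
    -- Passing from time t_k to 3 t_k costs the factor 3. The two opposite powers are inserted for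
    -- Cauchy–Schwarz; they cancel except where both norms vanish, and there the oscillation
    -- vanishes too.
    have h1 : D (t k) x ≤ 3 * heatE (3 * t k) (fun y =>
        (‖u k y - c‖ₑ * (‖u k y‖ₑ + ‖c‖ₑ) ^ ((p - 2) / 2)) *
          (‖u k y‖ₑ + ‖c‖ₑ) ^ ((2 - p) / 2)) x := by
      refine (hD (t k) (ht0 k) x c).trans ?_
      refine (heatE_le_of_le (ht0 k) (by linarith [ht0 k] : t k ≤ 3 * t k) _
        (hkm.sub_const c).enorm x).trans ?_
      rw [mul_div_assoc, div_self (ht0 k).ne', mul_one]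
      simp only [ENNReal.ofReal_ofNat]
      gcongr
      refine heatE_mono _ (fun y => ?_) x
      by_cases h0 : ‖u k y‖ₑ + ‖c‖ₑ = 0
      · have : ‖u k y - c‖ₑ ≤ ‖u k y‖ₑ + ‖c‖ₑ := enorm_sub_le
        change ‖u k y - c‖ₑ ≤ _
        rw [le_antisymm (this.trans h0.le) zero_le]; exact zero_le
      · rw [mul_assoc, ← ENNReal.rpow_add _ _ h0 (hfin y)]
        rw [show (p - 2) / 2 + (2 - p) / 2 = 0 by ring, ENNReal.rpow_zero, mul_one]
    have h2 : heatE (3 * t k) (fun y => ((‖u k y‖ₑ + ‖c‖ₑ) ^ ((2 - p) / 2)) ^ (2 : ℝ)) x ≤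
        2 * maxFn (fun y => ‖f y‖ₑ) x ^ (2 - p) := by
      have hM1 : heatE (3 * t k) (fun y => ‖u k y‖ₑ) x ≤ maxFn (fun y => ‖f y‖ₑ) x := by
        calc _ ≤ heatE (3 * t k) (heatE (t k) (fun y => ‖f y‖ₑ)) x :=
              heatE_mono _ (fun y => enorm_heat_le (ht0 k) f y) x
          _ = heatE (3 * t k + t k) (fun y => ‖f y‖ₑ) x := heatE_heatE h3 (ht0 k) hf.1.enorm x
          _ ≤ _ := heatE_le_maxFn (by linarith [ht0 k]) hf.1.enorm x
      have hM2 : ‖c‖ₑ ≤ maxFn (fun y => ‖f y‖ₑ) x :=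
        (enorm_heat_le (ht0 _) f x).trans (heatE_le_maxFn (ht0 _) hf.1.enorm x)
      calc _ ≤ heatE (3 * t k) (fun y => ‖u k y‖ₑ ^ (2 - p) + ‖c‖ₑ ^ (2 - p)) x := by
            refine heatE_mono _ (fun y => ?_) x
            rw [← ENNReal.rpow_mul, div_mul_cancel₀ _ (by norm_num)]
            exact ENNReal.rpow_add_le_add_rpow _ _ (by linarith) (by linarith)
        _ = heatE (3 * t k) (fun y => ‖u k y‖ₑ ^ (2 - p)) x + ‖c‖ₑ ^ (2 - p) := by
            rw [heatE_add _ (by fun_prop), heatE_const h3]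
        _ ≤ maxFn (fun y => ‖f y‖ₑ) x ^ (2 - p) + maxFn (fun y => ‖f y‖ₑ) x ^ (2 - p) := by
            gcongr
            · refine (heatE_rpow_le_of_le_one h3 (by linarith) (by linarith)
                hkm.enorm x).trans ?_
              exact ENNReal.rpow_le_rpow hM1 (by linarith)
        _ = _ := by ring
    calc D (t k) x ^ (2 : ℝ) ≤ (3 * heatE (3 * t k) (fun y =>
        (‖u k y - c‖ₑ * (‖u k y‖ₑ + ‖c‖ₑ) ^ ((p - 2) / 2)) *
          (‖u k y‖ₑ + ‖c‖ₑ) ^ ((2 - p) / 2)) x) ^ (2 : ℝ) := by gcongr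
      _ = 9 * heatE (3 * t k) (fun y =>
        (‖u k y - c‖ₑ * (‖u k y‖ₑ + ‖c‖ₑ) ^ ((p - 2) / 2)) *
          (‖u k y‖ₑ + ‖c‖ₑ) ^ ((2 - p) / 2)) x ^ (2 : ℝ) := by
          rw [ENNReal.mul_rpow_of_nonneg _ _ (by norm_num)]; norm_num
      _ ≤ 9 * (Q k x * (2 * maxFn (fun y => ‖f y‖ₑ) x ^ (2 - p))) := by
          gcongr
          refine (heatE_mul_sq_le _ (by fun_prop) (by fun_prop) x).trans ?_
          refine mul_le_mul' (le_of_eq ?_) h2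
          simp only [hQ]
          congr 1
          ext y
          rw [ENNReal.mul_rpow_of_nonneg _ _ (by norm_num), ← ENNReal.rpow_mul,
            div_mul_cancel₀ _ (by norm_num)]
      _ = _ := by ring
  calc ∫⁻ x, (∑' k : ℤ, D (4 ^ k * τ₀) x ^ (2 : ℝ)) ^ (p / 2)
      ≤ ∫⁻ x, (18 : ℝ≥0∞) ^ (p / 2) * ((maxFn (fun y => ‖f y‖ₑ) x ^ p) ^ ((2 - p) / 2) *
          (∑' k, Q k x) ^ (p / 2)) := by
        refine lintegral_mono fun x => ?_
        calc _ ≤ (18 * (maxFn (fun y => ‖f y‖ₑ) x ^ (2 - p) * ∑' k, Q k x)) ^ (p / 2) := by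
              gcongr
              rw [← ENNReal.tsum_mul_left, ← ENNReal.tsum_mul_left]
              exact ENNReal.tsum_le_tsum fun k => hpt k x
          _ = _ := by
              rw [ENNReal.mul_rpow_of_nonneg _ _ (by positivity),
                ENNReal.mul_rpow_of_nonneg _ _ (by positivity), ← ENNReal.rpow_mul,
                ← ENNReal.rpow_mul]
              rw [show (2 - p) * (p / 2) = p * ((2 - p) / 2) by ring]
    _ ≤ 18 ^ (p / 2) * ((∫⁻ x, maxFn (fun y => ‖f y‖ₑ) x ^ p) ^ ((2 - p) / 2) *
          (∫⁻ x, ∑' k, Q k x) ^ (p / 2)) := by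
        have hsm : Measurable fun x => ∑' k, Q k x := Measurable.tsum hQm
        rw [lintegral_const_mul _ (by fun_prop)]
        gcongr
        exact ENNReal.lintegral_mul_norm_pow_le (by fun_prop) hsm.aemeasurable
          (by linarith) (by linarith) (by ring)
    _ ≤ 18 ^ (p / 2) * ((CM * ∫⁻ x, ‖f x‖ₑ ^ p) ^ ((2 - p) / 2) *
          (ENNReal.ofReal κ⁻¹ * ∫⁻ x, ‖f x‖ₑ ^ p) ^ (p / 2)) := by
        have : 0 ≤ (2 - p) / 2 := by linarith
        gcongr
    _ = _ := by
        have h2p : 0 ≤ (2 - p) / 2 := by linarith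
        rw [ENNReal.mul_rpow_of_nonneg _ _ h2p, ENNReal.mul_rpow_of_nonneg _ _ (by positivity)]
        have : ∀ I : ℝ≥0∞, I ^ ((2 - p) / 2) * I ^ (p / 2) = I := by
          intro I
          rw [← ENNReal.rpow_add_of_nonneg _ _ h2p (by positivity)]
          rw [show (2 - p) / 2 + p / 2 = 1 by ring, ENNReal.rpow_one]
        calc _ = 18 ^ (p / 2) * ((CM : ℝ≥0∞) ^ ((2 - p) / 2) * ENNReal.ofReal κ⁻¹ ^ (p / 2)) *
              ((∫⁻ x, ‖f x‖ₑ ^ p) ^ ((2 - p) / 2) * (∫⁻ x, ‖f x‖ₑ ^ p) ^ (p / 2)) := by ring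
          _ = _ := by
              rw [this]
              push_cast
              rw [ENNReal.coe_rpow_of_nonneg _ (by positivity : 0 ≤ p / 2),
                ENNReal.coe_rpow_of_nonneg _ h2p,
                ENNReal.coe_rpow_of_nonneg _ (by positivity : 0 ≤ p / 2)]
              rfl

/-! ### Square functions for p > 2 -/

/-- The gain in Jensen's inequality for `(‖u‖² + v²) ^ (p / 2)`, `p > 2`. -/
theorem enorm_heat_sq_add_rpow_add_le {p : ℝ} (hp : 2 < p) {σ : ℝ} (hσ : 0 < σ)
    {u : Plane → ℂ} {v : Plane → ℝ} (hu : BddMeas u) (hv : BddMeas v) (x : Plane) :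
    (‖heat σ u x‖ₑ ^ (2 : ℝ) + ‖heat σ v x‖ₑ ^ (2 : ℝ)) ^ (p / 2) +
      ‖heat σ v x‖ₑ ^ (p - 2) * heatE σ (fun y => ‖u y - heat σ u x‖ₑ ^ (2 : ℝ)) x
      ≤ heatE σ (fun y => (‖u y‖ₑ ^ (2 : ℝ) + ‖v y‖ₑ ^ (2 : ℝ)) ^ (p / 2)) x := by
  set c := heat σ u x with hc
  set d := heat σ v x with hd
  set μ := heatMeasure σ x with hμ
  have hprob : IsProbabilityMeasure μ := isProbabilityMeasure_heatMeasure hσ x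
  have hIu : Integrable u μ := hu.integrable μ
  have hIv : Integrable v μ := hv.integrable μ
  obtain ⟨hum, K, hK⟩ := hu
  obtain ⟨hvm, L, hL⟩ := hv
  have hp0 : 0 < p := by linarith
  have hIu2 : Integrable (fun y => ‖u y‖ ^ 2) μ :=
    integrable_of_measurable_of_le (K := (K : ℝ) ^ 2) (by fun_prop) (fun y => by positivity)
      fun y => by gcongr; exact hK y
  have hIv2 : Integrable (fun y => v y ^ 2) μ :=
    integrable_of_measurable_of_le (K := (L : ℝ) ^ 2) (by fun_prop) (fun y => by positivity)
      fun y => by rw [← sq_abs]; gcongr; exact hL y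
  have hI1 : Integrable (fun y => (‖u y‖ ^ 2 + v y ^ 2) ^ (p / 2)) μ :=
    integrable_of_measurable_of_le (K := ((K : ℝ) ^ 2 + (L : ℝ) ^ 2) ^ (p / 2)) (by fun_prop)
      (fun y => by positivity) fun y => by
        rw [← sq_abs (v y)]; gcongr
        · exact hK y
        · exact hL y
  have hIuc : Integrable (fun y => u y - c) μ := hIu.sub (integrable_const c)
  have hI2 : Integrable (fun y => ‖u y - c‖ ^ 2) μ :=
    integrable_of_measurable_of_le (K := ((K : ℝ) + ‖c‖) ^ 2) (by fun_prop)
      (fun y => by positivity) fun y => by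
        gcongr; exact (norm_sub_le _ _).trans (add_le_add_left (hK y) _)
  have hIvd : Integrable (fun y => 2 * d * (v y - d)) μ :=
    (hIv.sub (integrable_const d)).const_mul _
  have hIin : Integrable (fun y => 2 * inner ℝ c (u y - c)) μ :=
    (hIuc.const_inner c).const_mul 2
  have hin0 : ∫ y, 2 * inner ℝ c (u y - c) ∂μ = 0 := by
    rw [integral_const_mul, integral_inner hIuc, integral_sub hIu (integrable_const c),
      hμ, integral_heatMeasure hσ, ← hc]
    simp
  have hvd0 : ∫ y, 2 * d * (v y - d) ∂μ = 0 := by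
    rw [integral_const_mul, integral_sub hIv (integrable_const d),
      hμ, integral_heatMeasure hσ, ← hd]
    simp
  set t₀ := ‖c‖ ^ 2 + d ^ 2 with ht₀
  have ht₀0 : 0 ≤ t₀ := by positivity
  -- The tangent slope at t₀ is (p/2) t₀^{p/2-1}; as t₀ ≥ d² and p/2 ≥ 1 it is at least |d|^{p-2},
  -- which is the weight kept in the gain.
  have hd2 : (d ^ 2) ^ (p / 2 - 1) ≤ t₀ ^ (p / 2 - 1) := by
    apply Real.rpow_le_rpow (by positivity) _ (by linarith)
    rw [ht₀]; nlinarith [sq_nonneg ‖c‖]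
  have hd3 : (d ^ 2) ^ (p / 2 - 1) = ‖d‖ ^ (p - 2) := by
    rw [← sq_abs, ← Real.rpow_two, ← Real.rpow_mul (abs_nonneg d), Real.norm_eq_abs]
    congr 1; ring
  have hpt : ∀ y, t₀ ^ (p / 2) + p / 2 * t₀ ^ (p / 2 - 1) *
      (2 * inner ℝ c (u y - c) + 2 * d * (v y - d)) + ‖d‖ ^ (p - 2) * ‖u y - c‖ ^ 2
        ≤ (‖u y‖ ^ 2 + v y ^ 2) ^ (p / 2) := by
    intro y
    have h1 := rpow_tangent_le (q := p / 2) (t := ‖u y‖ ^ 2 + v y ^ 2) (t₀ := t₀) (by linarith)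
      (by positivity) ht₀0
    have h2 : ‖u y‖ ^ 2 = ‖c‖ ^ 2 + 2 * inner ℝ c (u y - c) + ‖u y - c‖ ^ 2 := by
      rw [← norm_add_sq_real]; simp
    have h3 : ‖u y‖ ^ 2 + v y ^ 2 - t₀ ≥
        2 * inner ℝ c (u y - c) + 2 * d * (v y - d) + ‖u y - c‖ ^ 2 := by
      rw [h2, ht₀]; nlinarith [sq_nonneg (v y - d)]
    have hA : 0 ≤ t₀ ^ (p / 2 - 1) := by positivity
    have h4 : p / 2 * t₀ ^ (p / 2 - 1) *
        (2 * inner ℝ c (u y - c) + 2 * d * (v y - d) + ‖u y - c‖ ^ 2) ≤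
        p / 2 * t₀ ^ (p / 2 - 1) * (‖u y‖ ^ 2 + v y ^ 2 - t₀) :=
      mul_le_mul_of_nonneg_left h3 (by positivity)
    have h5 : ‖d‖ ^ (p - 2) * ‖u y - c‖ ^ 2 ≤ p / 2 * t₀ ^ (p / 2 - 1) * ‖u y - c‖ ^ 2 := by
      apply mul_le_mul_of_nonneg_right _ (by positivity)
      rw [← hd3]
      nlinarith
    linarith
  have hreal : t₀ ^ (p / 2) + ‖d‖ ^ (p - 2) * ∫ y, ‖u y - c‖ ^ 2 ∂μ ≤
      ∫ y, (‖u y‖ ^ 2 + v y ^ 2) ^ (p / 2) ∂μ := by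
    have hI4 : Integrable (fun y => 2 * inner ℝ c (u y - c) + 2 * d * (v y - d)) μ :=
      hIin.add hIvd
    have hI3 : Integrable (fun y => t₀ ^ (p / 2) + p / 2 * t₀ ^ (p / 2 - 1) *
        (2 * inner ℝ c (u y - c) + 2 * d * (v y - d))) μ :=
      (integrable_const _).add (hI4.const_mul _)
    have h1 := integral_mono (μ := μ) (hI3.add (hI2.const_mul (‖d‖ ^ (p - 2)))) hI1 hpt
    simp only [Pi.add_apply] at h1
    rw [integral_add hI3 (hI2.const_mul _), integral_add (integrable_const _) (hI4.const_mul _),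
      integral_const_mul, integral_const_mul, integral_add hIin hIvd, hin0, hvd0] at h1
    simpa using h1
  have conv : ∀ (a : ℂ) (b : ℝ), (‖a‖ₑ ^ (2 : ℝ) + ‖b‖ₑ ^ (2 : ℝ)) ^ (p / 2) =
      ENNReal.ofReal ((‖a‖ ^ 2 + b ^ 2) ^ (p / 2)) := by
    intro a b
    rw [← ENNReal.ofReal_rpow_of_nonneg (by positivity) (by positivity),
      ENNReal.ofReal_add (by positivity) (by positivity), ← sq_abs b, ← Real.norm_eq_abs,
      ENNReal.ofReal_pow (norm_nonneg _), ENNReal.ofReal_pow (norm_nonneg _), ofReal_norm,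
      ofReal_norm, ENNReal.rpow_two, ENNReal.rpow_two]
  have e1 : heatE σ (fun y => (‖u y‖ₑ ^ (2 : ℝ) + ‖v y‖ₑ ^ (2 : ℝ)) ^ (p / 2)) x =
      ENNReal.ofReal (∫ y, (‖u y‖ ^ 2 + v y ^ 2) ^ (p / 2) ∂μ) := by
    rw [← lintegral_heatMeasure σ x (by fun_prop), ofReal_integral_eq_lintegral_ofReal hI1
      (Filter.Eventually.of_forall fun y => by positivity)]
    exact lintegral_congr fun y => conv _ _
  have e2 : heatE σ (fun y => ‖u y - c‖ₑ ^ (2 : ℝ)) x =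
      ENNReal.ofReal (∫ y, ‖u y - c‖ ^ 2 ∂μ) := by
    rw [← lintegral_heatMeasure σ x (by fun_prop), ofReal_integral_eq_lintegral_ofReal hI2
      (Filter.Eventually.of_forall fun y => by positivity)]
    refine lintegral_congr fun y => ?_
    rw [ENNReal.ofReal_pow (norm_nonneg _), ofReal_norm, ENNReal.rpow_two]
  rw [e1, e2, conv, ← ofReal_norm d, ENNReal.ofReal_rpow_of_nonneg (norm_nonneg _) (by linarith),
    ← ENNReal.ofReal_mul (by positivity), ← ENNReal.ofReal_add (by positivity)]
  · exact ENNReal.ofReal_le_ofReal hreal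
  · exact mul_nonneg (by positivity) (integral_nonneg fun y => by positivity)

/-- A Harnack-type lower bound for the heat flow of a power of a maximal function. -/
theorem exists_heatE_le_heatE_maxFn_rpow {m : ℝ} (hm : 0 < m) :
    ∃ C : ℝ≥0, ∀ φ : Plane → ℝ≥0∞, Measurable φ → ∀ τ : ℝ, 0 < τ → ∀ z : Plane,
      heatE (3 * τ) φ z ≤ C * heatE (4 * τ) (fun y => maxFn φ y ^ (1 / m)) z ^ m := by
  set K₁ : ℝ := 2 * Real.exp (Real.pi / 3) with hK₁
  have hK₁0 : 0 < K₁ := by positivity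
  set κ : ℝ := Real.exp (-(Real.pi / 4)) / 4 with hκ
  have hκ0 : 0 < κ := by positivity
  refine ⟨(K₁ * (κ⁻¹) ^ m).toNNReal, fun φ hφ τ hτ z => ?_⟩
  set I := heatE (3 * τ) φ z with hI
  -- A Gaussian average at `z` is comparable with one of twice the time at any `y` within √τ, hence
  -- is controlled by the maximal function throughout that ball.
  have h1 : ∀ y ∈ Metric.ball z (Real.sqrt τ), I ≤ ENNReal.ofReal K₁ * maxFn φ y := by
    intro y hy
    have hyz : ‖z - y‖ ^ 2 ≤ τ := by
      rw [Metric.mem_ball, dist_comm, dist_eq_norm] at hy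
      have := Real.sq_sqrt hτ.le
      nlinarith [norm_nonneg (z - y)]
    calc I ≤ ENNReal.ofReal K₁ * heatE (6 * τ) φ y := by
          rw [hI]
          unfold heatE
          rw [← lintegral_const_mul _ (by fun_prop)]
          refine lintegral_mono fun w => ?_
          rw [← mul_assoc, ← ENNReal.ofReal_mul hK₁0.le]
          gcongr
          unfold heatK
          have hyw : ‖y - w‖ ^ 2 ≤ 2 * ‖z - w‖ ^ 2 + 2 * τ := by
            have h := norm_sub_le (z - w) (z - y)
            rw [show z - w - (z - y) = y - w by abel] at h
            nlinarith [norm_nonneg (y - w), norm_nonneg (z - w), norm_nonneg (z - y),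
              sq_nonneg (‖z - w‖ - ‖z - y‖)]
          have hexp : Real.exp (-(Real.pi * ‖z - w‖ ^ 2 / (3 * τ))) ≤
              Real.exp (Real.pi / 3) * Real.exp (-(Real.pi * ‖y - w‖ ^ 2 / (6 * τ))) := by
            rw [← Real.exp_add]
            apply Real.exp_le_exp.2
            have : Real.pi * ‖y - w‖ ^ 2 / (6 * τ) ≤
                Real.pi * (2 * ‖z - w‖ ^ 2 + 2 * τ) / (6 * τ) := by
              have := Real.pi_pos
              gcongr
            have e : Real.pi * (2 * ‖z - w‖ ^ 2 + 2 * τ) / (6 * τ) =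
                Real.pi * ‖z - w‖ ^ 2 / (3 * τ) + Real.pi / 3 := by field_simp; ring
            linarith
          calc (3 * τ)⁻¹ * Real.exp (-(Real.pi * ‖z - w‖ ^ 2 / (3 * τ)))
              ≤ (3 * τ)⁻¹ * (Real.exp (Real.pi / 3) *
                Real.exp (-(Real.pi * ‖y - w‖ ^ 2 / (6 * τ)))) := by gcongr
            _ = _ := by rw [hK₁]; field_simp; ring
      _ ≤ _ := by gcongr; exact heatE_le_maxFn (by positivity) hφ y
  have h2 : ENNReal.ofReal κ * (ENNReal.ofReal K₁⁻¹ * I) ^ (1 / m) ≤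
      heatE (4 * τ) (fun y => maxFn φ y ^ (1 / m)) z := by
    -- On this ball the Gaussian of time 4τ is at least κ/τ, and the area πτ is at least τ.
    calc ENNReal.ofReal κ * (ENNReal.ofReal K₁⁻¹ * I) ^ (1 / m)
        ≤ ∫⁻ y in Metric.ball z (Real.sqrt τ), ENNReal.ofReal (κ / τ) *
            (ENNReal.ofReal K₁⁻¹ * I) ^ (1 / m) := by
          rw [setLIntegral_const, EuclideanSpace.volume_ball_fin_two,
            ← ENNReal.ofReal_pow (Real.sqrt_nonneg _), Real.sq_sqrt hτ.le]
          calc _ = ENNReal.ofReal (κ / τ) * (ENNReal.ofReal K₁⁻¹ * I) ^ (1 / m) *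
                (ENNReal.ofReal τ * 1) := by
                rw [mul_one, mul_right_comm, ← ENNReal.ofReal_mul (by positivity)]
                congr 2; field_simp
            _ ≤ _ := by
                gcongr
                rw [ENNReal.one_le_ofReal]
                linarith [Real.pi_gt_three]
      _ ≤ ∫⁻ y in Metric.ball z (Real.sqrt τ), ENNReal.ofReal (heatK (4 * τ) (z - y)) *
            maxFn φ y ^ (1 / m) := by
          refine setLIntegral_mono' measurableSet_ball fun y hy => ?_
          gcongr
          · have hyz : ‖z - y‖ ^ 2 ≤ τ := by
              rw [Metric.mem_ball, dist_comm, dist_eq_norm] at hy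
              have := Real.sq_sqrt hτ.le
              nlinarith [norm_nonneg (z - y)]
            unfold heatK
            have : Real.exp (-(Real.pi / 4)) ≤
                Real.exp (-(Real.pi * ‖z - y‖ ^ 2 / (4 * τ))) := by
              apply Real.exp_le_exp.2
              have := Real.pi_pos
              rw [neg_le_neg_iff, div_le_div_iff₀ (by positivity) (by positivity)]
              nlinarith
            calc κ / τ = (4 * τ)⁻¹ * Real.exp (-(Real.pi / 4)) := by
                  rw [hκ]; field_simp
              _ ≤ _ := by gcongr
          · calc ENNReal.ofReal K₁⁻¹ * I ≤
                  ENNReal.ofReal K₁⁻¹ * (ENNReal.ofReal K₁ * maxFn φ y) := by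
                  gcongr; exact h1 y hy
              _ = maxFn φ y := by
                  rw [← mul_assoc, ← ENNReal.ofReal_mul (by positivity),
                    inv_mul_cancel₀ hK₁0.ne']
                  simp
      _ ≤ _ := setLIntegral_le_lintegral _ _
  calc I = ENNReal.ofReal (K₁ * κ⁻¹ ^ m) *
        (ENNReal.ofReal κ * (ENNReal.ofReal K₁⁻¹ * I) ^ (1 / m)) ^ m := by
        rw [ENNReal.mul_rpow_of_nonneg _ _ hm.le, ← ENNReal.rpow_mul,
          one_div_mul_cancel hm.ne', ENNReal.rpow_one, ← mul_assoc, ← mul_assoc,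
          ENNReal.ofReal_rpow_of_pos hκ0, ← ENNReal.ofReal_mul (by positivity),
          ← ENNReal.ofReal_mul (by positivity)]
        have : K₁ * κ⁻¹ ^ m * κ ^ m * K₁⁻¹ = 1 := by
          rw [Real.inv_rpow hκ0.le]
          have : κ ^ m ≠ 0 := by positivity
          field_simp
        rw [this]; simp
    _ ≤ _ := by
        rw [ENNReal.ofReal]
        gcongr

/-- Two Gaussians centred at `x` are dominated by a chain from `x` to `z` to `y`. Only the chain
form allows the outer average to be moved onto a weight by symmetry. -/
theorem heatK_mul_heatK_le {τ : ℝ} (hτ : 0 < τ) (x y z : Plane) :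
    heatK τ (x - z) * heatK τ (x - y) ≤ 9 * (heatK (3 * τ) (x - z) * heatK (3 * τ) (z - y)) := by
  have hyz : ‖z - y‖ ^ 2 ≤ 2 * ‖x - y‖ ^ 2 + 2 * ‖x - z‖ ^ 2 := by
    have h := norm_sub_le (x - y) (x - z)
    rw [show x - y - (x - z) = z - y by abel] at h
    nlinarith [norm_nonneg (z - y), norm_nonneg (x - y), norm_nonneg (x - z),
      sq_nonneg (‖x - y‖ - ‖x - z‖)]
  unfold heatK
  have e : ∀ a b c d : ℝ, a * Real.exp b * (c * Real.exp d) = a * c * Real.exp (b + d) := by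
    intro a b c d; rw [Real.exp_add]; ring
  rw [e, e, ← mul_assoc]
  have h9 : 9 * ((3 * τ)⁻¹ * (3 * τ)⁻¹) = τ⁻¹ * τ⁻¹ := by field_simp; norm_num
  rw [h9]
  apply mul_le_mul_of_nonneg_left _ (by positivity)
  apply Real.exp_le_exp.2
  have hπ := Real.pi_pos
  have h1 : Real.pi * ‖z - y‖ ^ 2 / (3 * τ) ≤
      Real.pi * (2 * ‖x - y‖ ^ 2 + 2 * ‖x - z‖ ^ 2) / (3 * τ) := by gcongr
  have h2 : Real.pi * ‖x - z‖ ^ 2 / τ + Real.pi * ‖x - y‖ ^ 2 / τ -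
      Real.pi * ‖x - z‖ ^ 2 / (3 * τ) -
      Real.pi * (2 * ‖x - y‖ ^ 2 + 2 * ‖x - z‖ ^ 2) / (3 * τ) =
      Real.pi * ‖x - y‖ ^ 2 / (3 * τ) := by field_simp; ring
  have h3 : 0 ≤ Real.pi * ‖x - y‖ ^ 2 / (3 * τ) := by positivity
  linarith

/-- The hypothesis holds for every constant, so the constant may be `w z` and the resulting bound
averaged over `z` around `x`. -/
theorem heat_osc_sq_le {τ : ℝ} (hτ : 0 < τ) {u w : Plane → ℂ} (hu : Measurable u)
    (hw : Measurable w) {d : ℝ≥0∞} {x : Plane}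
    (hd : ∀ c : ℂ, d ≤ heatE τ (fun y => ‖u y - c‖ₑ) x) :
    d ^ (2 : ℝ) ≤ 9 * heatE (3 * τ)
      (fun z => heatE (3 * τ) (fun y => ‖u y - w z‖ₑ ^ (2 : ℝ)) z) x := by
  have h1 : ∀ c : ℂ, d ^ (2 : ℝ) ≤ heatE τ (fun y => ‖u y - c‖ₑ ^ (2 : ℝ)) x := fun c =>
    (ENNReal.rpow_le_rpow (hd c) (by norm_num)).trans
      (heatE_rpow_le hτ (by norm_num) (by fun_prop) x)
  calc d ^ (2 : ℝ) = heatE τ (fun _ => d ^ (2 : ℝ)) x := (heatE_const hτ _ x).symm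
    _ ≤ heatE τ (fun z => heatE τ (fun y => ‖u y - w z‖ₑ ^ (2 : ℝ)) x) x :=
        heatE_mono _ (fun z => h1 (w z)) x
    _ ≤ _ := by
        unfold heatE
        rw [← lintegral_const_mul' _ _ (by norm_num)]
        refine lintegral_mono fun z => ?_
        rw [← lintegral_const_mul' _ _ (by simp), ← lintegral_const_mul' _ _ (by simp),
          ← lintegral_const_mul' _ _ (by simp)]
        refine lintegral_mono fun y => ?_
        dsimp only
        rw [← mul_assoc, ← mul_assoc, ← mul_assoc]
        refine mul_le_mul_left ?_ _
        rw [← ENNReal.ofReal_mul (heatK_pos hτ _).le, mul_assoc,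
          ← ENNReal.ofReal_mul (heatK_pos (by positivity) _).le,
          show (9 : ℝ≥0∞) = ENNReal.ofReal 9 by simp, ← ENNReal.ofReal_mul (by norm_num)]
        exact ENNReal.ofReal_le_ofReal (heatK_mul_heatK_le hτ x y z)

/-- The weight enters a convex functional: with ψ = (Mφ)^{1/(p-2)} and `u`, `v` the heat flows of
`f`, ψ, the integrals of (|u|²+v²)^{p/2} telescope with gains v^{p-2} times the variance of `u`. The
Harnack-type bound dominates the heat average of φ by v^{p-2}, so the gains control the weighted
square function. -/
theorem exists_lintegral_square_mul_le {p : ℝ} (hp : 2 < p) :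
    ∃ C : ℝ≥0, ∀ (f : Plane → ℂ) (D : ℝ → Plane → ℝ≥0∞) (φ : Plane → ℝ≥0∞), BddMeas f →
      OscControlled f D → Measurable φ → (∃ K : ℝ≥0, ∀ x, φ x ≤ K) →
      ∀ τ₀ : ℝ, 0 < τ₀ → ∫⁻ x, (∑' k : ℤ, D (4 ^ k * τ₀) x ^ (2 : ℝ)) * φ x
        ≤ C * ((∫⁻ x, ‖f x‖ₑ ^ p) + ∫⁻ x, φ x ^ (p / (p - 2))) := by
  have hp0 : 0 < p := by linarith
  have hp2 : 0 < p - 2 := by linarith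
  have hpp : 1 < p / (p - 2) := by rw [one_lt_div hp2]; linarith
  obtain ⟨CM, hCM⟩ := exists_lintegral_maxFn_rpow_le hpp
  obtain ⟨CH, hCH⟩ := exists_heatE_le_heatE_maxFn_rpow hp2
  refine ⟨9 * CH * (2 : ℝ≥0) ^ (p / 2 - 1) * (1 + CM), fun f D φ hf ⟨hDm, hD⟩ hφm hφb τ₀ hτ₀ => ?_⟩
  set t : ℤ → ℝ := fun k => 4 ^ k * τ₀ with ht
  have ht0 : ∀ k, 0 < t k := fun k => by positivity
  have htsucc : ∀ k, t (k + 1) = 4 * t k := fun k => by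
    simp only [ht, zpow_add_one₀ (by norm_num : (4 : ℝ) ≠ 0)]; ring
  obtain ⟨K, hK⟩ := hφb
  have hMb : ∀ x, maxFn φ x ≤ 4 * K := fun x =>
    (maxFn_mono hK x).trans (maxFn_const_le K x)
  have hMm := measurable_maxFn φ
  set ψ : Plane → ℝ := fun x => (maxFn φ x ^ (1 / (p - 2))).toReal with hψ
  have hMtop : ∀ x, maxFn φ x ^ (1 / (p - 2)) ≠ ⊤ := fun x =>
    ENNReal.rpow_ne_top_of_nonneg (by positivity) (ne_top_of_le_ne_top (by finiteness) (hMb x))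
  have hψe : ∀ x, ‖ψ x‖ₑ = maxFn φ x ^ (1 / (p - 2)) := fun x => by
    rw [Real.enorm_eq_ofReal ENNReal.toReal_nonneg, ENNReal.ofReal_toReal (hMtop x)]
  have hψb : BddMeas ψ := by
    refine ⟨by fun_prop, (4 * K) ^ (1 / (p - 2)), fun x => ?_⟩
    rw [Real.norm_of_nonneg ENNReal.toReal_nonneg]
    refine ENNReal.toReal_le_coe_of_le_coe ?_
    rw [ENNReal.coe_rpow_of_nonneg _ (by positivity)]
    push_cast
    exact ENNReal.rpow_le_rpow (hMb x) (by positivity)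
  set u : ℤ → Plane → ℂ := fun k => heat (t k) f with hu
  set v : ℤ → Plane → ℝ := fun k => heat (t k) ψ with hv
  have hub : ∀ k, BddMeas (u k) := fun k => hf.heat (ht0 k)
  have hvb : ∀ k, BddMeas (v k) := fun k => hψb.heat (ht0 k)
  have hum : ∀ k, Measurable (u k) := fun k => (hub k).1
  have hvm : ∀ k, Measurable (v k) := fun k => (hvb k).1
  have h3 : ∀ k, 0 < 3 * t k := fun k => by have := ht0 k; positivity
  have husucc : ∀ k x, u (k + 1) x = heat (3 * t k) (u k) x := fun k x => by
    simp only [hu]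
    rw [heat_heat (h3 k) (ht0 k) hf, htsucc]; congr 1; ring
  have hvsucc : ∀ k x, v (k + 1) x = heat (3 * t k) (v k) x := fun k x => by
    simp only [hv]
    rw [heat_heat (h3 k) (ht0 k) hψb, htsucc]; congr 1; ring
  set Q : ℤ → Plane → ℝ≥0∞ := fun k z =>
    heatE (3 * t k) (fun y => ‖u k y - u (k + 1) z‖ₑ ^ (2 : ℝ)) z with hQ
  have hQm : ∀ k, Measurable (Q k) := fun k => by
    have h1 := hum k
    have h2 := hum (k + 1)
    exact measurable_heatE_param _ (by unfold Function.uncurry; fun_prop)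
  set B := ∫⁻ x, (‖f x‖ₑ ^ (2 : ℝ) + ‖ψ x‖ₑ ^ (2 : ℝ)) ^ (p / 2) with hB
  have hfm := hf.1
  have hψm := hψb.1
  have htel : ∑' k, ∫⁻ x, ‖v (k + 1) x‖ₑ ^ (p - 2) * Q k x ≤ B := by
    refine tsum_int_le_of_telescope
      (a := fun k => ∫⁻ x, (‖u k x‖ₑ ^ (2 : ℝ) + ‖v k x‖ₑ ^ (2 : ℝ)) ^ (p / 2))
      (fun k => ?_) (fun k => ?_)
    · have a1 := hum k
      have a2 := hvm k
      have a3 := hum (k + 1)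
      have a4 := hvm (k + 1)
      rw [← lintegral_add_left (by fun_prop),
        ← lintegral_heatE (h3 k) (f := fun x => (‖u k x‖ₑ ^ (2 : ℝ) + ‖v k x‖ₑ ^ (2 : ℝ)) ^ (p / 2))
          (by fun_prop)]
      refine lintegral_mono fun x => ?_
      simp only [hQ, husucc k x, hvsucc k x]
      exact enorm_heat_sq_add_rpow_add_le hp (h3 k) (hub k) (hvb k) x
    -- The uniform bound is the same Jensen inequality, started from `f` and ψ themselves, with the
    -- gain discarded.
    · rw [hB, ← lintegral_heatE (ht0 k)
        (f := fun x => (‖f x‖ₑ ^ (2 : ℝ) + ‖ψ x‖ₑ ^ (2 : ℝ)) ^ (p / 2)) (by fun_prop)]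
      refine lintegral_mono fun x => ?_
      exact le_self_add.trans (enorm_heat_sq_add_rpow_add_le hp (ht0 k) hf hψb x)
  have hvE : ∀ k z, heatE (3 * t k) φ z ≤ CH * ‖v (k + 1) z‖ₑ ^ (p - 2) := by
    intro k z
    refine (hCH φ hφm (t k) (ht0 k) z).trans ?_
    have : heatE (4 * t k) (fun y => maxFn φ y ^ (1 / (p - 2))) z = ‖v (k + 1) z‖ₑ := by
      simp only [hv]
      rw [htsucc]
      have h4 : 0 < 4 * t k := by have := ht0 k; positivity
      have hn : 0 ≤ heat (4 * t k) ψ z := by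
        unfold heat
        exact integral_nonneg fun y => mul_nonneg (heatK_pos h4 _).le ENNReal.toReal_nonneg
      rw [Real.enorm_eq_ofReal hn]
      unfold heat heatE
      rw [ofReal_integral_eq_lintegral_ofReal (hψb.integrable_heatK_smul h4 z)
        (Filter.Eventually.of_forall fun y => mul_nonneg (heatK_pos h4 _).le
          ENNReal.toReal_nonneg)]
      refine lintegral_congr fun y => ?_
      rw [smul_eq_mul, ENNReal.ofReal_mul (heatK_pos h4 _).le, hψ,
        ENNReal.ofReal_toReal (hMtop y)]
    rw [this]
  have hk : ∀ k, ∫⁻ x, D (t k) x ^ (2 : ℝ) * φ x ≤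
      9 * CH * ∫⁻ x, ‖v (k + 1) x‖ₑ ^ (p - 2) * Q k x := by
    intro k
    have a4 := hvm (k + 1)
    have a5 := hQm k
    calc _ ≤ ∫⁻ x, 9 * (heatE (3 * t k) (Q k) x * φ x) := by
          refine lintegral_mono fun x => ?_
          rw [← mul_assoc]
          gcongr
          exact heat_osc_sq_le (ht0 k) (hum k) (hum (k + 1)) (hD (t k) (ht0 k) x)
      _ = 9 * ∫⁻ x, Q k x * heatE (3 * t k) φ x := by
          rw [lintegral_const_mul' _ _ (by norm_num), lintegral_heatE_mul _ (hQm k) hφm]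
      _ ≤ 9 * ∫⁻ x, CH * (‖v (k + 1) x‖ₑ ^ (p - 2) * Q k x) := by
          refine mul_le_mul_right (lintegral_mono fun x => ?_) _
          calc _ ≤ Q k x * (CH * ‖v (k + 1) x‖ₑ ^ (p - 2)) := by gcongr; exact hvE k x
            _ = _ := by ring
      _ = _ := by rw [lintegral_const_mul' _ _ (by simp), mul_assoc]
  have hBle : B ≤ 2 ^ (p / 2 - 1) * (1 + CM) *
      ((∫⁻ x, ‖f x‖ₑ ^ p) + ∫⁻ x, φ x ^ (p / (p - 2))) := by
    have hM := hCM φ hφm ⟨K, hK⟩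
    calc B ≤ ∫⁻ x, 2 ^ (p / 2 - 1) * (‖f x‖ₑ ^ p + maxFn φ x ^ (p / (p - 2))) := by
          refine lintegral_mono fun x => ?_
          refine (ENNReal.rpow_add_le_mul_rpow_add_rpow _ _ (by linarith)).trans (le_of_eq ?_)
          rw [hψe, ← ENNReal.rpow_mul, ← ENNReal.rpow_mul, ← ENNReal.rpow_mul]
          congr 3
          · ring_nf
          · field_simp
      _ = 2 ^ (p / 2 - 1) * ((∫⁻ x, ‖f x‖ₑ ^ p) + ∫⁻ x, maxFn φ x ^ (p / (p - 2))) := by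
          rw [lintegral_const_mul' _ _ (ENNReal.rpow_ne_top_of_nonneg (by linarith) (by norm_num)),
            lintegral_add_left (by fun_prop)]
      _ ≤ 2 ^ (p / 2 - 1) * ((1 + CM) * (∫⁻ x, ‖f x‖ₑ ^ p) +
            (1 + CM) * ∫⁻ x, φ x ^ (p / (p - 2))) := by
          gcongr
          · exact le_mul_of_one_le_left zero_le le_self_add
          · exact hM.trans (by gcongr; exact le_add_self)
      _ = _ := by ring
  calc _ = ∑' k, ∫⁻ x, D (t k) x ^ (2 : ℝ) * φ x := by
        rw [← lintegral_tsum (fun k => by have := hDm (t k); fun_prop)]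
        simp_rw [ENNReal.tsum_mul_right]
        rfl
    _ ≤ ∑' k, 9 * CH * ∫⁻ x, ‖v (k + 1) x‖ₑ ^ (p - 2) * Q k x := ENNReal.tsum_le_tsum hk
    _ ≤ 9 * CH * B := by rw [ENNReal.tsum_mul_left]; gcongr
    _ ≤ 9 * CH * (2 ^ (p / 2 - 1) * (1 + CM) *
      ((∫⁻ x, ‖f x‖ₑ ^ p) + ∫⁻ x, φ x ^ (p / (p - 2)))) := by gcongr
    _ = _ := by
        push_cast
        rw [ENNReal.coe_rpow_of_nonneg _ (by linarith)]
        push_cast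
        ring

/-- The weight is taken to be a small multiple of A^{p/2-1}, with A the squared square function. Its
power p/(p-2) is then a multiple of A^{p/2}, and this term is absorbed on the left. -/
theorem exists_lintegral_square_le_of_two_lt {p : ℝ} (hp : 2 < p) :
    ∃ C : ℝ≥0, ∀ (f : Plane → ℂ) (D : ℝ → Plane → ℝ≥0∞), BddMeas f → OscControlled f D →
      ∀ τ₀ : ℝ, 0 < τ₀ → ∫⁻ x, (∑' k : ℤ, D (4 ^ k * τ₀) x ^ (2 : ℝ)) ^ (p / 2)
        ≤ C * ∫⁻ x, ‖f x‖ₑ ^ p := by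
  have hp0 : 0 < p := by linarith
  have hp2 : 0 < p - 2 := by linarith
  obtain ⟨C, hC⟩ := exists_lintegral_square_mul_le hp
  -- Chosen so that C ε^{p/(p-2)} ≤ ε/2, which is possible because p/(p-2) = 1 + 2/(p-2) exceeds 1.
  set ε : ℝ≥0 := (1 / (2 * (1 + C))) ^ ((p - 2) / 2) with hε
  have hbase : 0 < 1 / (2 * (1 + C)) := by positivity
  have hε0 : 0 < ε := NNReal.rpow_pos hbase
  have hεle : C * ε ^ (p / (p - 2)) ≤ ε / 2 := by
    have e1 : ε ^ (p / (p - 2)) = ε * (1 / (2 * (1 + C))) := by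
      rw [show p / (p - 2) = 1 + 2 / (p - 2) by field_simp; ring, NNReal.rpow_add hε0.ne',
        NNReal.rpow_one]
      congr 1
      rw [hε, ← NNReal.rpow_mul, show (p - 2) / 2 * (2 / (p - 2)) = 1 by field_simp, NNReal.rpow_one]
    rw [e1]
    calc C * (ε * (1 / (2 * (1 + C)))) = (C / (1 + C)) * (ε / 2) := by field_simp
      _ ≤ 1 * (ε / 2) := by
          gcongr
          rw [div_le_one (by positivity)]
          exact le_add_self
      _ = _ := one_mul _
  refine ⟨2 / ε * C, fun f D hf hD τ₀ hτ₀ => ?_⟩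
  set A : Plane → ℝ≥0∞ := fun x => ∑' k : ℤ, D (4 ^ k * τ₀) x ^ (2 : ℝ) with hA
  have hAm : Measurable A := Measurable.tsum fun k => (hD.1 _).pow_const _
  set F := ∫⁻ x, ‖f x‖ₑ ^ p with hF
  -- Truncation in height and space makes the absorbed quantity finite; monotone convergence removes
  -- it at the end.
  set B : ℕ → Plane → ℝ≥0∞ := fun n =>
    (Metric.ball (0 : Plane) n).indicator fun x => min (A x) n with hB
  have hBm : ∀ n, Measurable (B n) := fun n =>
    (hAm.min measurable_const).indicator measurableSet_ball
  have hBA : ∀ n x, B n x ≤ A x := fun n x =>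
    Set.indicator_le (s := Metric.ball (0 : Plane) n) (f := fun x => min (A x) n)
      (fun x _ => min_le_left _ _) x
  have hBn : ∀ n x, B n x ≤ n := fun n x =>
    Set.indicator_le (s := Metric.ball (0 : Plane) n) (f := fun x => min (A x) n)
      (g := fun _ => (n : ℝ≥0∞)) (fun x _ => min_le_right _ _) x
  have hn : ∀ n, ∫⁻ x, B n x ^ (p / 2) ≤ ((2 / ε * C : ℝ≥0) : ℝ≥0∞) * F := by
    intro n
    set I := ∫⁻ x, B n x ^ (p / 2) with hI
    have hIfin : I ≠ ⊤ := by
      have : I ≤ ∫⁻ x in Metric.ball (0 : Plane) n, (n : ℝ≥0∞) ^ (p / 2) := by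
        rw [← lintegral_indicator measurableSet_ball]
        refine lintegral_mono fun x => ?_
        by_cases hx : x ∈ Metric.ball (0 : Plane) n
        · rw [Set.indicator_of_mem hx]
          exact ENNReal.rpow_le_rpow (hBn n x) (by positivity)
        · rw [Set.indicator_of_notMem hx]
          simp [hB, Set.indicator_of_notMem hx, hp0]
      refine ne_top_of_le_ne_top ?_ this
      rw [setLIntegral_const]
      exact ENNReal.mul_ne_top (ENNReal.rpow_ne_top_of_nonneg (by positivity) (by simp))
        measure_ball_lt_top.ne
    have hBm' := hBm n
    have h := hC f D (fun x => ε * B n x ^ (p / 2 - 1)) hf hD (by fun_prop)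
      ⟨ε * (n : ℝ≥0) ^ (p / 2 - 1), fun x => by
        rw [ENNReal.coe_mul, ENNReal.coe_rpow_of_nonneg (n : ℝ≥0) (by linarith)]
        have := hBn n x
        have h0 : 0 ≤ p / 2 - 1 := by linarith
        gcongr
        exact_mod_cast this⟩ τ₀ hτ₀
    have h1 : ε * I ≤ ∫⁻ x, A x * (ε * B n x ^ (p / 2 - 1)) := by
      rw [hI, ← lintegral_const_mul' _ _ (by simp)]
      refine lintegral_mono fun x => ?_
      calc (ε : ℝ≥0∞) * B n x ^ (p / 2) = B n x * (ε * B n x ^ (p / 2 - 1)) := by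
            rw [mul_left_comm]
            congr 1
            nth_rewrite 2 [← ENNReal.rpow_one (B n x)]
            rw [← ENNReal.rpow_add_of_nonneg _ _ (by norm_num) (by linarith)]
            congr 1; ring
        _ ≤ _ := by gcongr; exact hBA n x
    have h2 : ∫⁻ x, (ε * B n x ^ (p / 2 - 1)) ^ (p / (p - 2)) =
        (ε : ℝ≥0∞) ^ (p / (p - 2)) * I := by
      rw [hI, ← lintegral_const_mul' _ _
        (ENNReal.rpow_ne_top_of_nonneg (by positivity) (by simp))]
      refine lintegral_congr fun x => ?_
      rw [ENNReal.mul_rpow_of_nonneg _ _ (by positivity), ← ENNReal.rpow_mul]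
      congr 2
      field_simp
    have h3 : (ε : ℝ≥0∞) * I ≤ C * F + ((ε / 2 : ℝ≥0) : ℝ≥0∞) * I := by
      calc (ε : ℝ≥0∞) * I ≤ C * (F + (ε : ℝ≥0∞) ^ (p / (p - 2)) * I) := by
            rw [← h2]; exact h1.trans h
        _ = C * F + ((C * ε ^ (p / (p - 2)) : ℝ≥0) : ℝ≥0∞) * I := by
            rw [ENNReal.coe_mul, ENNReal.coe_rpow_of_nonneg ε (by positivity)]
            ring
        _ ≤ _ := by gcongr
    have h4 : ((ε / 2 : ℝ≥0) : ℝ≥0∞) * I ≤ C * F := by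
      have hne : ((ε / 2 : ℝ≥0) : ℝ≥0∞) * I ≠ ⊤ := ENNReal.mul_ne_top ENNReal.coe_ne_top hIfin
      have e : (ε : ℝ≥0∞) * I = ((ε / 2 : ℝ≥0) : ℝ≥0∞) * I + ((ε / 2 : ℝ≥0) : ℝ≥0∞) * I := by
        rw [← add_mul, ← ENNReal.coe_add, add_halves]
      rw [e] at h3
      exact (ENNReal.add_le_add_iff_right hne).1 h3
    calc I = ((2 / ε : ℝ≥0) : ℝ≥0∞) * (((ε / 2 : ℝ≥0) : ℝ≥0∞) * I) := by
          rw [← mul_assoc, ← ENNReal.coe_mul]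
          rw [show 2 / ε * (ε / 2) = 1 by field_simp]; simp
      _ ≤ ((2 / ε : ℝ≥0) : ℝ≥0∞) * (C * F) := by gcongr
      _ = _ := by push_cast; ring
  have hmono : Monotone fun n x => B n x ^ (p / 2) := by
    intro m n hmn x
    refine ENNReal.rpow_le_rpow ?_ (by positivity)
    have hmn' : (m : ℝ≥0∞) ≤ n := by exact_mod_cast hmn
    by_cases hx : x ∈ Metric.ball (0 : Plane) m
    · have hx' : x ∈ Metric.ball (0 : Plane) n :=
        Metric.ball_subset_ball (by exact_mod_cast hmn) hx
      simp only [hB, Set.indicator_of_mem hx, Set.indicator_of_mem hx']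
      exact min_le_min_left _ hmn'
    · simp [hB, Set.indicator_of_notMem hx]
  have hsup : ∀ x, A x ^ (p / 2) ≤ ⨆ n, B n x ^ (p / 2) := by
    intro x
    have hA' : A x ≤ ⨆ n, B n x := by
      refine le_of_forall_lt fun c hc => ?_
      obtain ⟨N, hN⟩ := ENNReal.exists_nat_gt hc.ne_top
      obtain ⟨N', hN'⟩ := exists_nat_gt ‖x‖
      have hx : x ∈ Metric.ball (0 : Plane) (max N N' : ℕ) := by
        rw [mem_ball_zero_iff]
        exact hN'.trans_le (by exact_mod_cast le_max_right N N')
      refine lt_of_lt_of_le ?_ (le_iSup (fun n => B n x) (max N N'))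
      simp only [hB, Set.indicator_of_mem hx]
      exact lt_min hc (hN.trans_le (by exact_mod_cast le_max_left N N'))
    calc A x ^ (p / 2) ≤ (⨆ n, B n x) ^ (p / 2) := by gcongr
      _ = _ := (ENNReal.orderIsoRpow (p / 2) (by positivity)).map_iSup _
  calc ∫⁻ x, A x ^ (p / 2) ≤ ∫⁻ x, ⨆ n, B n x ^ (p / 2) := lintegral_mono hsup
    _ = ⨆ n, ∫⁻ x, B n x ^ (p / 2) :=
        lintegral_iSup (fun n => (hBm n).pow_const _) hmono
    _ ≤ _ := iSup_le hn

/-- The square function of a family controlled by heat oscillations is bounded on `L^p`. -/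
theorem exists_lintegral_square_le {p : ℝ} (hp : 1 < p) :
    ∃ C : ℝ≥0, ∀ (f : Plane → ℂ) (D : ℝ → Plane → ℝ≥0∞), BddMeas f → OscControlled f D →
      ∀ τ₀ : ℝ, 0 < τ₀ → ∫⁻ x, (∑' k : ℤ, D (4 ^ k * τ₀) x ^ (2 : ℝ)) ^ (p / 2)
        ≤ C * ∫⁻ x, ‖f x‖ₑ ^ p := by
  rcases le_or_gt p 2 with h | h
  · exact exists_lintegral_square_le_of_le_two hp h
  · exact exists_lintegral_square_le_of_two_lt h

/-! ### Convolution operators and the Fourier transform -/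

/-- The multiplication formula for the pairing `-innerₗ`, whose Fourier integral is the inverse
transform. -/
theorem integral_fourierInv_mul {f g : Plane → ℂ} (hf : Integrable f) (hg : Integrable g) :
    ∫ x, 𝓕⁻ f x * g x = ∫ ξ, f ξ * 𝓕⁻ g ξ := by
  have h := VectorFourier.integral_fourierIntegral_smul_eq_flip (L := -innerₗ Plane)
    (μ := volume) (ν := volume) (f := f) (g := g) Real.continuous_fourierChar
    (by exact continuous_inner.neg) hf hg
  have e1 : ∀ F : Plane → ℂ, VectorFourier.fourierIntegral Real.fourierChar volume
      (-innerₗ Plane) F = 𝓕⁻ F := fun F => rfl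
  have e2 : (-innerₗ Plane).flip = -innerₗ Plane := by
    ext x y; simp [real_inner_comm]
  rw [e2] at h
  simpa [e1] using h

/-- Convolution of a function with a real kernel. -/
noncomputable def kconv (k : Plane → ℝ) (f : Plane → ℂ) (x : Plane) : ℂ :=
  ∫ y, k (x - y) • f y

theorem heat_eq_kconv (τ : ℝ) (f : Plane → ℂ) : heat τ f = kconv (heatK τ) f := rfl

theorem fourierInv_comp_sub_left {k : Plane → ℂ} (x ξ : Plane) :
    𝓕⁻ (fun y => k (x - y)) ξ = Real.fourierChar (inner ℝ x ξ) • 𝓕 k ξ := by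
  rw [Real.fourierInv_eq, Real.fourier_eq,
    ← integral_sub_left_eq_self (fun y => Real.fourierChar (inner ℝ y ξ) • k (x - y)) volume x,
    Circle.smul_def, ← integral_smul]
  congr 1
  ext y
  rw [sub_sub_cancel, inner_sub_left, sub_eq_add_neg, AddChar.map_add_eq_mul]
  simp only [Circle.smul_def, smul_eq_mul, Circle.coe_mul, mul_assoc]

theorem kconv_fourierInv {k : Plane → ℝ} (hk : Integrable k) {g : Plane → ℂ} (hg : Integrable g) :
    kconv k (𝓕⁻ g) = 𝓕⁻ (fun ξ => 𝓕 (fun x => (k x : ℂ)) ξ * g ξ) := by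
  ext x
  have hk' : Integrable fun y => ((k (x - y) : ℝ) : ℂ) := (hk.comp_sub_left x).ofReal
  have h := integral_fourierInv_mul hg hk'
  calc kconv k (𝓕⁻ g) x = ∫ y, 𝓕⁻ g y * ((k (x - y) : ℝ) : ℂ) := by
        unfold kconv
        congr 1; ext y
        rw [Complex.real_smul, mul_comm]
    _ = _ := by
        rw [h, Real.fourierInv_eq]
        congr 1; ext ξ
        rw [fourierInv_comp_sub_left (k := fun y => ((k y : ℝ) : ℂ)), real_inner_comm]
        simp only [Circle.smul_def, smul_eq_mul]
        ring

theorem kconv_eq_convolution (k : Plane → ℝ) (h : Plane → ℂ) :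
    kconv k h = convolution h (fun x => (k x : ℂ)) (ContinuousLinearMap.mul ℂ ℂ) volume := by
  ext x
  unfold kconv convolution
  congr 1; ext y
  rw [Complex.real_smul, mul_comm]
  rfl

theorem integrable_kconv {k : Plane → ℝ} (hk : Integrable k) {h : Plane → ℂ} (hh : Integrable h) :
    Integrable (kconv k h) := by
  rw [kconv_eq_convolution]
  exact hh.integrable_convolution _ hk.ofReal

theorem fourierInv_kconv {k : Plane → ℝ} (hk : Integrable k) {h : Plane → ℂ} (hh : Integrable h)
    (ξ : Plane) : 𝓕⁻ (kconv k h) ξ = 𝓕 (fun x => (k x : ℂ)) (-ξ) * 𝓕⁻ h ξ := by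
  rw [Real.fourierInv_eq_fourier_neg, kconv_eq_convolution, mul_comm,
    Real.fourierInv_eq_fourier_neg h]
  exact Real.fourier_mul_convolution_eq (R := ℂ) hh hk.ofReal (-ξ)

theorem BddMeas.kconv {k : Plane → ℝ} (hkc : Continuous k) (hk : Integrable k) {f : Plane → ℂ}
    (hf : BddMeas f) : BddMeas (kconv k f) := by
  refine ⟨?_, ?_⟩
  · apply StronglyMeasurable.measurable
    apply StronglyMeasurable.integral_prod_right (f := fun x y => k (x - y) • f y)
    have h1 : Measurable fun z : Plane × Plane => k (z.1 - z.2) :=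
      (hkc.comp (continuous_fst.sub continuous_snd)).measurable
    exact (h1.smul (hf.1.comp measurable_snd)).stronglyMeasurable
  · obtain ⟨K, hK⟩ := hf.2
    refine ⟨(∫ y, ‖k y‖).toNNReal * K, fun x => ?_⟩
    rw [NNReal.coe_mul, Real.coe_toNNReal _ (integral_nonneg fun y => norm_nonneg _),
      ← integral_sub_left_eq_self (fun y => ‖k y‖) volume x, ← integral_mul_const]
    refine (norm_integral_le_integral_norm _).trans ?_
    refine integral_mono_of_nonneg (Filter.Eventually.of_forall fun y => norm_nonneg _)
      ((hk.comp_sub_left x).norm.mul_const _) (Filter.Eventually.of_forall fun y => ?_)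
    simp only [norm_smul]
    gcongr
    exact hK y

theorem BddMeas.integrable_kernel_smul {k : Plane → ℝ} (hk : Integrable k) {f : Plane → ℂ}
    (hf : BddMeas f) (x : Plane) : Integrable (fun y => k (x - y) • f y) := by
  obtain ⟨hm, K, hK⟩ := hf
  exact (hk.comp_sub_left x).smul_bdd (K : ℝ) hm.aestronglyMeasurable
    (Filter.Eventually.of_forall hK)

/-- This cancellation is what allows operators with mean-zero kernels to be bounded by oscillations,
as `OscControlled` requires. -/
theorem kconv_sub_const {k : Plane → ℝ} (hk : Integrable k) (h0 : ∫ y, k y = 0) {f : Plane → ℂ}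
    (hf : BddMeas f) (c : ℂ) : kconv k (fun y => f y - c) = kconv k f := by
  ext x
  unfold kconv
  simp_rw [smul_sub]
  rw [integral_sub (hf.integrable_kernel_smul hk x) ((hk.comp_sub_left x).smul_const c),
    integral_smul_const, integral_sub_left_eq_self (fun y => k y) volume x, h0]
  simp

/-! ### Derivatives of the heat kernel -/

theorem fourier_heatK {τ : ℝ} (hτ : 0 < τ) (ξ : Plane) :
    𝓕 (fun x => (heatK τ x : ℂ)) ξ = (Real.exp (-(Real.pi * τ * ‖ξ‖ ^ 2)) : ℂ) := by
  have hb : 0 < ((Real.pi / τ : ℝ) : ℂ).re := by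
    rw [Complex.ofReal_re]; positivity
  have h := fourier_gaussian_innerProductSpace (V := Plane) hb ξ
  have e : (fun x => (heatK τ x : ℂ)) = fun x : Plane =>
      ((τ⁻¹ : ℝ) : ℂ) • Complex.exp (-((Real.pi / τ : ℝ) : ℂ) * ‖x‖ ^ 2) := by
    ext x
    unfold heatK
    push_cast
    rw [smul_eq_mul]
    congr 2; ring
  have hτ' : (τ : ℂ) ≠ 0 := by exact_mod_cast hτ.ne'
  have hπ' : (Real.pi : ℂ) ≠ 0 := by exact_mod_cast Real.pi_ne_zero
  have e2 : 𝓕 (fun x => (heatK τ x : ℂ)) ξ =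
      ((τ⁻¹ : ℝ) : ℂ) • 𝓕 (fun x : Plane =>
        Complex.exp (-((Real.pi / τ : ℝ) : ℂ) * ‖x‖ ^ 2)) ξ := by
    rw [e, Real.fourier_eq, Real.fourier_eq, ← integral_smul]
    congr 1; ext x
    exact smul_comm _ _ _
  rw [e2, h]
  simp only [finrank_euclideanSpace, Fintype.card_fin]
  push_cast
  rw [show ((2 : ℂ) / 2) = 1 by norm_num, Complex.cpow_one, smul_eq_mul]
  have : (Real.pi : ℂ) / (Real.pi / τ) = τ := by field_simp
  rw [this, ← mul_assoc, inv_mul_cancel₀ hτ', one_mul]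
  congr 1
  field_simp

/-- The partial derivative `∂ⱼ` of the heat kernel. -/
noncomputable def dheatK (j : Fin 2) (τ : ℝ) (x : Plane) : ℝ := -(2 * Real.pi * x j / τ) * heatK τ x

theorem continuous_dheatK (j : Fin 2) (τ : ℝ) : Continuous (dheatK j τ) := by
  have := continuous_heatK τ
  unfold dheatK
  fun_prop

theorem abs_coord_le_norm (x : Plane) (j : Fin 2) : |x j| ≤ ‖x‖ := by
  rw [← Real.norm_eq_abs]
  exact PiLp.norm_apply_le x j

/-- The linear factor |x|/√τ is absorbed by half of the Gaussian exponent, which doubles the time.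
-/
theorem abs_dheatK_le {τ : ℝ} (hτ : 0 < τ) (j : Fin 2) (x : Plane) :
    |dheatK j τ x| ≤ 4 * Real.pi / Real.sqrt τ * heatK (2 * τ) x := by
  have hs : 0 < Real.sqrt τ := Real.sqrt_pos.2 hτ
  set u := ‖x‖ / Real.sqrt τ with hu
  have hu0 : 0 ≤ u := by positivity
  have hu2 : u ^ 2 = ‖x‖ ^ 2 / τ := by rw [hu, div_pow, Real.sq_sqrt hτ.le]
  have h1 : u ≤ Real.exp (Real.pi * u ^ 2 / 2) := by
    have := Real.add_one_le_exp (Real.pi * u ^ 2 / 2)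
    nlinarith [Real.pi_gt_three, sq_nonneg (u - 1)]
  have h2 : Real.exp (-(Real.pi * ‖x‖ ^ 2 / τ)) =
      Real.exp (-(Real.pi * u ^ 2 / 2)) * Real.exp (-(Real.pi * ‖x‖ ^ 2 / (2 * τ))) := by
    rw [← Real.exp_add, hu2]; congr 1; field_simp; ring
  have h3 : u * Real.exp (-(Real.pi * u ^ 2 / 2)) ≤ 1 := by
    rw [Real.exp_neg, ← div_eq_mul_inv, div_le_one (Real.exp_pos _)]; exact h1
  have hx : ‖x‖ = u * Real.sqrt τ := by rw [hu]; field_simp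
  unfold dheatK heatK
  rw [abs_mul, abs_neg, abs_mul τ⁻¹, abs_of_pos (Real.exp_pos _), abs_of_pos (inv_pos.2 hτ), h2]
  have h4 : |2 * Real.pi * x j / τ| ≤ 2 * Real.pi * (u * Real.sqrt τ) / τ := by
    rw [abs_div, abs_mul, abs_of_pos (by positivity : 0 < 2 * Real.pi), abs_of_pos hτ, ← hx]
    gcongr
    exact abs_coord_le_norm x j
  set G := Real.exp (-(Real.pi * ‖x‖ ^ 2 / (2 * τ))) with hG
  have hG0 : 0 < G := Real.exp_pos _
  calc _ ≤ 2 * Real.pi * (u * Real.sqrt τ) / τ *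
        (τ⁻¹ * (Real.exp (-(Real.pi * u ^ 2 / 2)) * G)) := by gcongr
    _ = 2 * Real.pi * Real.sqrt τ / τ * τ⁻¹ * G * (u * Real.exp (-(Real.pi * u ^ 2 / 2))) := by ring
    _ ≤ 2 * Real.pi * Real.sqrt τ / τ * τ⁻¹ * G * 1 := by gcongr
    _ = 4 * Real.pi / Real.sqrt τ * ((2 * τ)⁻¹ * G) := by
        nth_rewrite 2 [← Real.sq_sqrt hτ.le]
        field_simp
        norm_num

theorem integrable_dheatK {τ : ℝ} (hτ : 0 < τ) (j : Fin 2) : Integrable (dheatK j τ) :=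
  ((integrable_heatK (by positivity : 0 < 2 * τ)).const_mul (4 * Real.pi / Real.sqrt τ)).mono'
    (continuous_dheatK j τ).aestronglyMeasurable
    (Filter.Eventually.of_forall fun x => abs_dheatK_le hτ j x)

theorem integral_dheatK (j : Fin 2) (τ : ℝ) : ∫ x, dheatK j τ x = 0 := by
  have h : ∀ x, dheatK j τ (-x) = -dheatK j τ x := by
    intro x
    unfold dheatK
    rw [heatK_neg]
    simp only [PiLp.neg_apply]
    ring
  have := integral_neg_eq_self (fun x => dheatK j τ x) volume
  simp_rw [h, integral_neg] at this
  linarith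

/-- Differentiating the transform of the Gaussian in direction j brings down a multiple of the
coordinate x_j, and x_j `heatK` is a multiple of `dheatK`. Thus the formula comes from the gradient
of e^{-πτ|ξ|²}. -/
theorem fourier_dheatK {τ : ℝ} (hτ : 0 < τ) (j : Fin 2) (ξ : Plane) :
    𝓕 (fun x => (dheatK j τ x : ℂ)) ξ =
      2 * Real.pi * Complex.I * (ξ j : ℂ) * (Real.exp (-(Real.pi * τ * ‖ξ‖ ^ 2)) : ℂ) := by
  have hnorm : Integrable (fun v : Plane => ‖v‖ * ‖(heatK τ v : ℂ)‖) := by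
    have h1 := (integrable_dheatK hτ 0).norm
    have h2 := (integrable_dheatK hτ 1).norm
    refine ((h1.add h2).const_mul (τ / (2 * Real.pi))).mono'
      ((continuous_norm.mul
        (Complex.continuous_ofReal.comp (continuous_heatK τ)).norm).aestronglyMeasurable)
      (Filter.Eventually.of_forall fun v => ?_)
    have hv : ‖v‖ ≤ |v 0| + |v 1| := by
      rw [EuclideanSpace.norm_eq]
      apply Real.sqrt_le_iff.2
      refine ⟨by positivity, ?_⟩
      rw [Fin.sum_univ_two]
      simp only [Real.norm_eq_abs]
      nlinarith [abs_nonneg (v 0), abs_nonneg (v 1)]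
    simp only [Complex.norm_real, norm_mul, norm_norm, Pi.add_apply, Real.norm_eq_abs]
    unfold dheatK
    simp only [abs_mul, abs_neg, abs_div, abs_of_pos hτ, abs_of_pos Real.pi_pos,
      abs_of_pos (zero_lt_two (α := ℝ))]
    have : τ / (2 * Real.pi) * (2 * Real.pi * |v 0| / τ * |heatK τ v| +
        2 * Real.pi * |v 1| / τ * |heatK τ v|) = (|v 0| + |v 1|) * |heatK τ v| := by
      field_simp
    rw [this]
    gcongr
    · rw [abs_norm]; exact hv
    · rw [abs_of_pos (heatK_pos hτ v)]
  have hintg : Integrable (fun v : Plane => (heatK τ v : ℂ)) := (integrable_heatK hτ).ofReal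
  have hd := Real.hasFDerivAt_fourier hintg hnorm ξ
  have hd2 : HasFDerivAt (𝓕 (fun v : Plane => (heatK τ v : ℂ)))
      (Complex.ofRealCLM.comp ((Real.exp (-(Real.pi * τ * ‖ξ‖ ^ 2))) •
        (-((Real.pi * τ) • (2 • innerSL ℝ ξ))))) ξ := by
    have e : 𝓕 (fun v : Plane => (heatK τ v : ℂ)) = fun ξ : Plane =>
        Complex.ofRealCLM (Real.exp (-(Real.pi * τ * ‖ξ‖ ^ 2))) := by
      ext ξ; rw [fourier_heatK hτ]; rfl
    rw [e]
    apply Complex.ofRealCLM.hasFDerivAt.comp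
    apply HasFDerivAt.exp
    exact ((hasStrictFDerivAt_norm_sq ξ).hasFDerivAt.const_mul (Real.pi * τ)).neg
  have h := congrArg (fun L => L (planeBasis j)) (hd.unique hd2)
  simp only [planeBasis] at h
  rw [Real.fourier_eq] at h
  have hI : Integrable (fun v : Plane => Real.fourierChar (-inner ℝ v ξ) •
      VectorFourier.fourierSMulRight (innerSL ℝ) (fun v : Plane => (heatK τ v : ℂ)) v) := by
    refine (Real.fourierIntegral_convergent_iff ξ).2 ?_
    refine (hnorm.const_mul (2 * Real.pi * ‖innerSL ℝ (E := Plane)‖)).mono'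
      hintg.aestronglyMeasurable.fourierSMulRight
      (Filter.Eventually.of_forall fun v => ?_)
    refine (VectorFourier.norm_fourierSMulRight_le _ _ v).trans (le_of_eq ?_)
    ring
  rw [ContinuousLinearMap.integral_apply hI] at h
  have hτ' : (τ : ℂ) ≠ 0 := by exact_mod_cast hτ.ne'
  have hin : ∀ v : Plane, innerSL ℝ v (EuclideanSpace.single j (1 : ℝ)) = v j := fun v => by
    rw [innerSL_apply_apply, EuclideanSpace.inner_single_right]; simp
  have h' : 𝓕 (fun x => (dheatK j τ x : ℂ)) ξ = (-Complex.I / τ) *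
      ∫ v : Plane, (Real.fourierChar (-inner ℝ v ξ) •
      VectorFourier.fourierSMulRight (innerSL ℝ) (fun v : Plane => (heatK τ v : ℂ)) v)
        (EuclideanSpace.single j (1 : ℝ)) := by
    rw [Real.fourier_eq, ← integral_const_mul]
    congr 1; ext v
    simp only [Circle.smul_def, ContinuousLinearMap.smul_apply,
      VectorFourier.fourierSMulRight_apply, hin,
      smul_eq_mul, dheatK]
    push_cast
    simp
    field_simp
    rw [Complex.I_sq]; ring
  rw [h', h]
  simp [hin]
  field_simp

/-! ### Iterated derivatives of the heat flow -/

/-- The operator `∂_{l₁} ⋯ ∂_{lₙ} e^{nσΔ}` (up to normalization) as a composition of convolutions. -/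
noncomputable def dheatIter (σ : ℝ) : List (Fin 2) → (Plane → ℂ) → Plane → ℂ
  | [], f => f
  | j :: l, f => kconv (dheatK j σ) (dheatIter σ l f)

/-- The symbol `∏ 2πi ξ_{l_k}` of an iterated derivative. -/
noncomputable def derivSym (l : List (Fin 2)) (ξ : Plane) : ℂ :=
  (l.map fun j => 2 * Real.pi * Complex.I * (ξ j : ℂ)).prod

theorem continuous_derivSym (l : List (Fin 2)) : Continuous (derivSym l) := by
  unfold derivSym
  apply continuous_list_prod
  intro j _
  fun_prop

theorem derivSym_nil (ξ : Plane) : derivSym [] ξ = 1 := rfl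

theorem derivSym_cons (j : Fin 2) (l : List (Fin 2)) (ξ : Plane) :
    derivSym (j :: l) ξ = 2 * Real.pi * Complex.I * (ξ j : ℂ) * derivSym l ξ := by
  simp [derivSym]

theorem norm_derivSym_le (l : List (Fin 2)) (ξ : Plane) :
    ‖derivSym l ξ‖ ≤ (2 * Real.pi * ‖ξ‖) ^ l.length := by
  induction l with
  | nil => simp [derivSym]
  | cons j l ih =>
    rw [derivSym_cons, norm_mul, List.length_cons, pow_succ']
    gcongr
    simp only [norm_mul, Complex.norm_ofNat, Complex.norm_real, Complex.norm_I, mul_one,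
      Real.norm_eq_abs, abs_of_pos Real.pi_pos]
    gcongr
    exact abs_coord_le_norm ξ j

theorem derivSym_neg (l : List (Fin 2)) (ξ : Plane) :
    derivSym l (-ξ) = (-1) ^ l.length * derivSym l ξ := by
  induction l with
  | nil => simp [derivSym]
  | cons j l ih =>
    rw [derivSym_cons, derivSym_cons, ih, List.length_cons, pow_succ]
    simp only [PiLp.neg_apply]
    push_cast
    ring

theorem BddMeas.dheatIter {σ : ℝ} (hσ : 0 < σ) {f : Plane → ℂ} (hf : BddMeas f)
    (l : List (Fin 2)) : BddMeas (dheatIter σ l f) := by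
  induction l with
  | nil => exact hf
  | cons j l ih => exact ih.kconv (continuous_dheatK j σ) (integrable_dheatK hσ j)

theorem enorm_kconv_dheatK_le {σ : ℝ} (hσ : 0 < σ) (j : Fin 2) (f : Plane → ℂ)
    (x : Plane) : ‖kconv (dheatK j σ) f x‖ₑ ≤
      ENNReal.ofReal (4 * Real.pi / Real.sqrt σ) * heatE (2 * σ) (fun y => ‖f y‖ₑ) x := by
  unfold heatE
  rw [← lintegral_const_mul' _ _ (by simp)]
  refine (enorm_integral_le_lintegral_enorm _).trans (lintegral_mono fun y => ?_)
  rw [enorm_smul, ← mul_assoc, ← ENNReal.ofReal_mul (by positivity)]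
  gcongr
  rw [← ofReal_norm, Real.norm_eq_abs]
  exact ENNReal.ofReal_le_ofReal (abs_dheatK_le hσ j _)

theorem dheatIter_sub_const {σ : ℝ} (hσ : 0 < σ) {f : Plane → ℂ} (hf : BddMeas f) (c : ℂ)
    {l : List (Fin 2)} (hl : l ≠ []) :
    dheatIter σ l (fun y => f y - c) = dheatIter σ l f := by
  induction l with
  | nil => exact absurd rfl hl
  | cons j l ih =>
    simp only [dheatIter]
    rcases eq_or_ne l [] with rfl | h
    · exact kconv_sub_const (integrable_dheatK hσ j) (integral_dheatK j σ) hf c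
    · rw [ih h]

/-- Each derivative kernel of time σ is dominated by (4π/√σ) times the Gaussian of time 2σ, and the
Gaussians compose by adding their times. -/
theorem enorm_dheatIter_heat_le {σ τ : ℝ} (hσ : 0 < σ) (hτ : 0 < τ) {f : Plane → ℂ}
    (hf : BddMeas f) (l : List (Fin 2)) (x : Plane) : ‖dheatIter σ l (heat τ f) x‖ₑ ≤
      ENNReal.ofReal (4 * Real.pi / Real.sqrt σ) ^ l.length *
        heatE (2 * l.length * σ + τ) (fun y => ‖f y‖ₑ) x := by
  induction l generalizing x with
  | nil => simpa [dheatIter] using enorm_heat_le hτ f x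
  | cons j l ih =>
    refine (enorm_kconv_dheatK_le hσ j _ x).trans ?_
    have h0 : 0 < 2 * l.length * σ + τ := by positivity
    calc _ ≤ ENNReal.ofReal (4 * Real.pi / Real.sqrt σ) * heatE (2 * σ)
          (fun y => ENNReal.ofReal (4 * Real.pi / Real.sqrt σ) ^ l.length *
            heatE (2 * l.length * σ + τ) (fun y => ‖f y‖ₑ) y) x := by
          gcongr
          exact heatE_mono _ ih x
      _ = _ := by
          rw [heatE_const_mul _ _ (measurable_heatE _ hf.1.enorm),
            heatE_heatE (by positivity) h0 hf.1.enorm, ← mul_assoc, List.length_cons, pow_succ']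
          congr 2
          push_cast; ring

theorem enorm_dheatIter_le {σ : ℝ} (hσ : 0 < σ) {f : Plane → ℂ}
    (hf : BddMeas f) {l : List (Fin 2)} (hl : l ≠ []) (x : Plane) : ‖dheatIter σ l f x‖ₑ ≤
      ENNReal.ofReal (4 * Real.pi / Real.sqrt σ) ^ l.length *
        heatE (2 * l.length * σ) (fun y => ‖f y‖ₑ) x := by
  induction l generalizing x with
  | nil => exact absurd rfl hl
  | cons j l ih =>
    refine (enorm_kconv_dheatK_le hσ j _ x).trans ?_
    rcases eq_or_ne l [] with rfl | h
    · simp [dheatIter]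
    have hlen : 0 < l.length := List.length_pos_iff.2 h
    have h0 : 0 < 2 * l.length * σ := by positivity
    calc _ ≤ ENNReal.ofReal (4 * Real.pi / Real.sqrt σ) * heatE (2 * σ)
          (fun y => ENNReal.ofReal (4 * Real.pi / Real.sqrt σ) ^ l.length *
            heatE (2 * l.length * σ) (fun y => ‖f y‖ₑ) y) x := by
          gcongr
          exact heatE_mono _ (ih h) x
      _ = _ := by
          rw [heatE_const_mul _ _ (measurable_heatE _ hf.1.enorm),
            heatE_heatE (by positivity) h0 hf.1.enorm, ← mul_assoc, List.length_cons, pow_succ']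
          congr 2
          push_cast; ring

/-! ### Scale-invariant derivatives of the heat flow -/

/-- The Gaussian symbol `e^{-π T |ξ|²}`. -/
noncomputable def gaussSym (T : ℝ) (ξ : Plane) : ℂ := (Real.exp (-(Real.pi * T * ‖ξ‖ ^ 2)) : ℂ)

theorem fourier_dheatK_eq {τ : ℝ} (hτ : 0 < τ) (j : Fin 2) (ξ : Plane) :
    𝓕 (fun x => (dheatK j τ x : ℂ)) ξ = 2 * Real.pi * Complex.I * (ξ j : ℂ) * gaussSym τ ξ :=
  fourier_dheatK hτ j ξ

theorem gaussSym_mul (S T : ℝ) (ξ : Plane) : gaussSym S ξ * gaussSym T ξ = gaussSym (S + T) ξ := by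
  unfold gaussSym
  rw [← Complex.ofReal_mul, ← Real.exp_add]
  congr 2; ring

theorem gaussSym_zero (ξ : Plane) : gaussSym 0 ξ = 1 := by simp [gaussSym]

theorem gaussSym_neg (T : ℝ) (ξ : Plane) : gaussSym T (-ξ) = gaussSym T ξ := by simp [gaussSym]

theorem norm_gaussSym (T : ℝ) (ξ : Plane) :
    ‖gaussSym T ξ‖ = Real.exp (-(Real.pi * T * ‖ξ‖ ^ 2)) := by
  unfold gaussSym
  rw [Complex.norm_real, Real.norm_of_nonneg (Real.exp_pos _).le]

theorem continuous_gaussSym : Continuous fun z : ℝ × Plane => gaussSym z.1 z.2 := by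
  unfold gaussSym; fun_prop

/-- For `l = [j₁, …, jₙ]`, the symbol `T^{n/2} ∏ (2πi ξ_{jₖ}) e^{-π T |ξ|²}`. -/
noncomputable def baseSym (l : List (Fin 2)) (T : ℝ) (ξ : Plane) : ℂ :=
  ((Real.sqrt T ^ l.length : ℝ) : ℂ) * derivSym l ξ * gaussSym T ξ

theorem continuous_baseSym (l : List (Fin 2)) :
    Continuous fun z : ℝ × Plane => baseSym l z.1 z.2 := by
  unfold baseSym
  have := continuous_derivSym l
  have := continuous_gaussSym
  fun_prop

theorem exists_norm_baseSym_le (l : List (Fin 2)) :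
    ∃ C : ℝ≥0, ∀ T : ℝ, 0 < T → ∀ ξ, ‖baseSym l T ξ‖ ≤ C := by
  refine ⟨((2 * Real.pi) ^ l.length * (l.length.factorial + 1 : ℝ)).toNNReal, fun T hT ξ => ?_⟩
  rw [Real.coe_toNNReal _ (by positivity)]
  unfold baseSym
  rw [norm_mul, norm_mul, norm_gaussSym, Complex.norm_real, Real.norm_of_nonneg (by positivity)]
  set u := Real.sqrt T * ‖ξ‖ with hu
  have hu0 : 0 ≤ u := by positivity
  have hu2 : Real.pi * T * ‖ξ‖ ^ 2 = Real.pi * u ^ 2 := by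
    rw [hu, mul_pow, Real.sq_sqrt hT.le]; ring
  -- Only u = √T|ξ| enters, so the bound is uniform in T. For u > 1 one has u ≤ πu² and uⁿ ≤ n! eᵘ;
  -- for u ≤ 1 the left side is at most 1.
  have key : u ^ l.length ≤ (l.length.factorial + 1) * Real.exp (Real.pi * u ^ 2) := by
    have hexp : Real.exp u ≤ Real.exp (Real.pi * u ^ 2) ∨ u ≤ 1 := by
      rcases le_or_gt u 1 with h | h
      · exact Or.inr h
      · left; apply Real.exp_le_exp.2; nlinarith [Real.pi_gt_three]
    rcases hexp with h | h
    · have h1 := Real.pow_div_factorial_le_exp u hu0 l.length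
      rw [div_le_iff₀ (by positivity)] at h1
      nlinarith [Real.exp_pos (Real.pi * u ^ 2), (Nat.cast_nonneg l.length.factorial : (0:ℝ) ≤ _)]
    · have h1 : u ^ l.length ≤ 1 := pow_le_one₀ hu0 h
      have h2 : 1 ≤ Real.exp (Real.pi * u ^ 2) := Real.one_le_exp (by positivity)
      nlinarith [(Nat.cast_nonneg l.length.factorial : (0:ℝ) ≤ _)]
  rw [hu2, Real.exp_neg]
  calc _ ≤ Real.sqrt T ^ l.length * (2 * Real.pi * ‖ξ‖) ^ l.length *
        (Real.exp (Real.pi * u ^ 2))⁻¹ := by gcongr; exact norm_derivSym_le l ξ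
    _ = (2 * Real.pi) ^ l.length * (u ^ l.length * (Real.exp (Real.pi * u ^ 2))⁻¹) := by
        rw [hu, mul_pow, mul_pow (Real.sqrt T)]; ring
    _ ≤ _ := by
        gcongr
        rw [← div_eq_mul_inv, div_le_iff₀ (Real.exp_pos _)]
        exact key

/-- The convolution operator with symbol `baseSym l T`. -/
noncomputable def base (l : List (Fin 2)) (T : ℝ) (f : Plane → ℂ) (x : Plane) : ℂ :=
  -- The derivatives share one third of the time and a plain heat flow takes the rest. Positive
  -- majorants double the derivative times, so both portions then have length 2T/3. For `l = []` no
  -- derivative is taken and the first argument of `dheatIter`, where the division is by zero, plays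
  -- no role.
  ((Real.sqrt T ^ l.length : ℝ) : ℂ) * dheatIter (T / (3 * l.length))
    l (heat (if l = [] then T else 2 * T / 3) f) x

theorem dheatIter_fourierInv {σ : ℝ} (hσ : 0 < σ) {g : Plane → ℂ} (hg : Integrable g)
    (l : List (Fin 2)) :
    dheatIter σ l (𝓕⁻ g) = 𝓕⁻ (fun ξ => derivSym l ξ * gaussSym (l.length * σ) ξ * g ξ) ∧
      Integrable (fun ξ => derivSym l ξ * gaussSym (l.length * σ) ξ * g ξ) := by
  induction l with
  | nil => simpa [dheatIter, derivSym_nil, gaussSym_zero] using hg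
  | cons j l ih =>
    obtain ⟨ih1, ih2⟩ := ih
    have e : (fun ξ => 𝓕 (fun x => (dheatK j σ x : ℂ)) ξ *
        (derivSym l ξ * gaussSym (l.length * σ) ξ * g ξ)) =
        fun ξ => derivSym (j :: l) ξ * gaussSym ((j :: l).length * σ) ξ * g ξ := by
      ext ξ
      have h1 : gaussSym ((j :: l).length * σ) ξ = gaussSym σ ξ * gaussSym (l.length * σ) ξ := by
        rw [gaussSym_mul]; congr 1; rw [List.length_cons]; push_cast; ring
      rw [h1, fourier_dheatK_eq hσ, derivSym_cons]
      ring
    refine ⟨?_, ?_⟩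
    · simp only [dheatIter]
      rw [ih1, kconv_fourierInv (integrable_dheatK hσ j) ih2, e]
    · rw [← e]
      refine ih2.bdd_mul (c := ∫ x, ‖(dheatK j σ x : ℂ)‖) ?_ (Filter.Eventually.of_forall fun ξ => ?_)
      · have : (𝓕 (fun x => (dheatK j σ x : ℂ))) = fun ξ : Plane =>
            2 * Real.pi * Complex.I * (ξ j : ℂ) * gaussSym σ ξ := by
          ext ξ; exact fourier_dheatK hσ j ξ
        rw [this]
        have := continuous_gaussSym
        exact Continuous.aestronglyMeasurable (by fun_prop)
      · exact VectorFourier.norm_fourierIntegral_le_integral_norm _ _ _ _ _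

theorem heat_fourierInv {τ : ℝ} (hτ : 0 < τ) {g : Plane → ℂ} (hg : Integrable g) :
    heat τ (𝓕⁻ g) = 𝓕⁻ (fun ξ => gaussSym τ ξ * g ξ) ∧
      Integrable (fun ξ => gaussSym τ ξ * g ξ) := by
  refine ⟨?_, ?_⟩
  · rw [heat_eq_kconv, kconv_fourierInv (integrable_heatK hτ) hg]
    simp_rw [fourier_heatK hτ]
    rfl
  · have := continuous_gaussSym
    refine hg.bdd_mul (c := 1) (Continuous.aestronglyMeasurable (by fun_prop))
      (Filter.Eventually.of_forall fun ξ => ?_)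
    rw [norm_gaussSym]
    exact Real.exp_le_one_iff.2 (by simp; positivity)

theorem fourierInv_const_mul (c : ℂ) (g : Plane → ℂ) (x : Plane) :
    𝓕⁻ (fun ξ => c * g ξ) x = c * 𝓕⁻ g x := by
  rw [Real.fourierInv_eq, Real.fourierInv_eq, ← integral_const_mul]
  congr 1; ext ξ
  simp only [Circle.smul_def, smul_eq_mul]; ring

theorem base_scale {T : ℝ} (hT : 0 < T) {l : List (Fin 2)} (hl : l ≠ []) :
    0 < T / (3 * l.length) ∧ (l.length : ℝ) * (T / (3 * l.length)) = T / 3 := by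
  have : 0 < (l.length : ℝ) := by exact_mod_cast List.length_pos_iff.2 hl
  exact ⟨by positivity, by field_simp⟩

theorem base_nil (T : ℝ) (f : Plane → ℂ) : base [] T f = heat T f := by
  ext x; simp [base, dheatIter]

theorem base_fourierInv (l : List (Fin 2)) {T : ℝ} (hT : 0 < T) {g : Plane → ℂ}
    (hg : Integrable g) : base l T (𝓕⁻ g) = 𝓕⁻ (fun ξ => baseSym l T ξ * g ξ) := by
  rcases eq_or_ne l [] with rfl | hl
  · rw [base_nil, (heat_fourierInv hT hg).1]
    simp [baseSym, derivSym_nil]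
  · obtain ⟨h1, h2⟩ := base_scale hT hl
    ext x
    unfold base
    rw [if_neg hl, (heat_fourierInv (by positivity) hg).1,
      (dheatIter_fourierInv h1 (heat_fourierInv (by positivity) hg).2 l).1,
      ← fourierInv_const_mul]
    refine congrArg (fun G : Plane → ℂ => 𝓕⁻ G x) (funext fun ξ => ?_)
    have hG : gaussSym T ξ = gaussSym (T / 3) ξ * gaussSym (2 * T / 3) ξ := by
      rw [gaussSym_mul]; congr 1; ring
    rw [h2, baseSym, hG]
    ring

theorem fourierInv_dheatIter {σ : ℝ} (hσ : 0 < σ) {h : Plane → ℂ} (hh : Integrable h)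
    (l : List (Fin 2)) : Integrable (dheatIter σ l h) ∧ ∀ ξ,
    𝓕⁻ (dheatIter σ l h) ξ = derivSym l (-ξ) * gaussSym (l.length * σ) ξ * 𝓕⁻ h ξ := by
  induction l with
  | nil => simpa [dheatIter, derivSym_nil, gaussSym_zero] using hh
  | cons j l ih =>
    obtain ⟨ih1, ih2⟩ := ih
    refine ⟨integrable_kconv (integrable_dheatK hσ j) ih1, fun ξ => ?_⟩
    simp only [dheatIter]
    have h1 : gaussSym ((j :: l).length * σ) ξ = gaussSym σ ξ * gaussSym (l.length * σ) ξ := by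
      rw [gaussSym_mul]; congr 1; rw [List.length_cons]; push_cast; ring
    rw [fourierInv_kconv (integrable_dheatK hσ j) ih1, ih2, fourier_dheatK_eq hσ, h1, derivSym_cons,
      gaussSym_neg]
    ring

theorem fourierInv_heat {τ : ℝ} (hτ : 0 < τ) {h : Plane → ℂ} (hh : Integrable h) :
    Integrable (heat τ h) ∧ ∀ ξ, 𝓕⁻ (heat τ h) ξ = gaussSym τ ξ * 𝓕⁻ h ξ := by
  rw [heat_eq_kconv]
  refine ⟨integrable_kconv (integrable_heatK hτ) hh, fun ξ => ?_⟩
  rw [fourierInv_kconv (integrable_heatK hτ) hh, fourier_heatK hτ, norm_neg, gaussSym]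

/-- The same operator seen from the test-function side: the inverse transform evaluates the kernel
symbol at -ξ, whence the sign. -/
theorem fourierInv_base (l : List (Fin 2)) {T : ℝ} (hT : 0 < T) {h : Plane → ℂ}
    (hh : Integrable h) : Integrable (base l T h) ∧
      ∀ ξ, 𝓕⁻ (base l T h) ξ = (-1) ^ l.length * baseSym l T ξ * 𝓕⁻ h ξ := by
  rcases eq_or_ne l [] with rfl | hl
  · rw [base_nil]
    simpa [baseSym, derivSym_nil] using fourierInv_heat hT hh
  · obtain ⟨h1, h2⟩ := base_scale hT hl
    obtain ⟨a1, a2⟩ := fourierInv_heat (by positivity : 0 < 2 * T / 3) hh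
    obtain ⟨b1, b2⟩ := fourierInv_dheatIter h1 a1 l
    have e : base l T h = fun x => ((Real.sqrt T ^ l.length : ℝ) : ℂ) *
        dheatIter (T / (3 * l.length)) l (heat (2 * T / 3) h) x := by
      ext x; rw [base, if_neg hl]
    refine ⟨by rw [e]; exact b1.const_mul _, fun ξ => ?_⟩
    have hG : gaussSym T ξ = gaussSym (T / 3) ξ * gaussSym (2 * T / 3) ξ := by
      rw [gaussSym_mul]; congr 1; ring
    rw [e, fourierInv_const_mul, b2, a2, h2, baseSym, derivSym_neg, hG]
    ring

theorem BddMeas.base (l : List (Fin 2)) {T : ℝ} (hT : 0 < T) {f : Plane → ℂ} (hf : BddMeas f) :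
    BddMeas (base l T f) := by
  rcases eq_or_ne l [] with rfl | hl
  · rw [base_nil]; exact hf.heat hT
  · obtain ⟨h1, -⟩ := base_scale hT hl
    obtain ⟨hm, K, hK⟩ := (hf.heat (by positivity : 0 < 2 * T / 3)).dheatIter h1 l
    refine ⟨?_, ‖((Real.sqrt T ^ l.length : ℝ) : ℂ)‖₊ * K, fun x => ?_⟩
    · unfold _root_.base
      rw [if_neg hl]
      exact hm.const_mul _
    · unfold _root_.base
      rw [if_neg hl, norm_mul]
      push_cast
      gcongr
      exact hK x

theorem sqrt_scale_mul {T : ℝ} (hT : 0 < T) {l : List (Fin 2)} (hl : l ≠ []) :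
    ‖((Real.sqrt T ^ l.length : ℝ) : ℂ)‖ₑ *
      ENNReal.ofReal (4 * Real.pi / Real.sqrt (T / (3 * l.length))) ^ l.length =
      ENNReal.ofReal ((4 * Real.pi * Real.sqrt (3 * l.length)) ^ l.length) := by
  have hn : 0 < (l.length : ℝ) := by exact_mod_cast List.length_pos_iff.2 hl
  rw [← ofReal_norm, Complex.norm_real, Real.norm_of_nonneg (by positivity),
    ← ENNReal.ofReal_pow (by positivity), ← ENNReal.ofReal_mul (by positivity), ← mul_pow]
  congr 2
  rw [Real.sqrt_div hT.le]
  have : Real.sqrt T ≠ 0 := (Real.sqrt_pos.2 hT).ne'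
  field_simp

theorem exists_enorm_base_le (l : List (Fin 2)) : ∃ C : ℝ≥0, ∀ T : ℝ, 0 < T →
    ∀ f : Plane → ℂ, BddMeas f → ∀ x, ∃ S : ℝ, 0 < S ∧
      ‖base l T f x‖ₑ ≤ C * heatE S (fun y => ‖f y‖ₑ) x := by
  rcases eq_or_ne l [] with rfl | hl
  · refine ⟨1, fun T hT f hf x => ⟨T, hT, ?_⟩⟩
    rw [base_nil]; simpa using enorm_heat_le hT f x
  · refine ⟨((4 * Real.pi * Real.sqrt (3 * l.length)) ^ l.length).toNNReal,
      fun T hT f hf x => ⟨2 * l.length * (T / (3 * l.length)) + 2 * T / 3, ?_, ?_⟩⟩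
    · have := (base_scale hT hl).1
      positivity
    · unfold base
      rw [if_neg hl, enorm_mul]
      change _ ≤ ENNReal.ofReal _ * _
      rw [← sqrt_scale_mul hT hl, mul_assoc]
      gcongr
      exact enorm_dheatIter_heat_le (base_scale hT hl).1 (by positivity) hf l x

/-- At T = 3τ/2 the heat portion has time 2T/3 = τ and the derivative kernels are dominated by a
Gaussian of total time 2T/3 = τ, which matches `OscControlled` exactly; constants may be subtracted
because at least one kernel has mean zero. The cutoff at τ ≤ 0 is there since measurability is
demanded for all τ. -/
theorem exists_oscControlled_base {l : List (Fin 2)} (hl : l ≠ []) : ∃ c : ℝ≥0, c ≠ 0 ∧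
    ∀ f : Plane → ℂ, BddMeas f → OscControlled f (fun τ x => (if 0 < τ then c else 0) *
      ‖base l (3 * τ / 2) f x‖ₑ) := by
  set C := (4 * Real.pi * Real.sqrt (3 * l.length)) ^ l.length with hC
  have hn : 0 < (l.length : ℝ) := by exact_mod_cast List.length_pos_iff.2 hl
  have hC0 : 0 < C := by positivity
  refine ⟨(C⁻¹).toNNReal, by simpa using hC0, fun f hf => ⟨fun τ => ?_, fun τ hτ x c => ?_⟩⟩
  · by_cases h : 0 < τ
    · simp only [h, if_true]
      exact (hf.base l (by positivity)).1.enorm.const_mul _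
    · simp [h]
  · have hT : 0 < 3 * τ / 2 := by positivity
    obtain ⟨h1, h2⟩ := base_scale hT hl
    have hb : BddMeas (fun y => heat τ f y - c) := by
      obtain ⟨hm, K, hK⟩ := hf.heat hτ
      exact ⟨hm.sub_const c, K + ‖c‖₊, fun y => (norm_sub_le _ _).trans (by push_cast; gcongr; exact hK y)⟩
    simp only [if_pos hτ]
    unfold base
    rw [if_neg hl, show 2 * (3 * τ / 2) / 3 = τ by ring, enorm_mul,
      ← dheatIter_sub_const h1 (hf.heat hτ) c hl]
    have h3 := enorm_dheatIter_le h1 hb hl x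
    rw [show 2 * (l.length : ℝ) * (3 * τ / 2 / (3 * l.length)) = τ by field_simp] at h3
    calc _ ≤ ((C⁻¹).toNNReal : ℝ≥0∞) * (‖((Real.sqrt (3 * τ / 2) ^ l.length : ℝ) : ℂ)‖ₑ *
          (ENNReal.ofReal (4 * Real.pi / Real.sqrt (3 * τ / 2 / (3 * l.length))) ^ l.length *
            heatE τ (fun y => ‖heat τ f y - c‖ₑ) x)) := by gcongr
      _ = ENNReal.ofReal C⁻¹ * ENNReal.ofReal C * heatE τ (fun y => ‖heat τ f y - c‖ₑ) x := by
          rw [← mul_assoc ‖_‖ₑ, sqrt_scale_mul hT hl, ← hC, ← mul_assoc]; rfl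
      _ = _ := by
          rw [← ENNReal.ofReal_mul (by positivity), inv_mul_cancel₀ hC0.ne']; simp

theorem exists_lintegral_base_square_le {l : List (Fin 2)} (hl : l ≠ []) {p : ℝ} (hp : 1 < p) :
    ∃ C : ℝ≥0, ∀ f : Plane → ℂ, BddMeas f → ∀ T : ℝ, 0 < T →
      ∫⁻ x, (∑' k : ℤ, ‖base l (4 ^ k * T) f x‖ₑ ^ (2 : ℝ)) ^ (p / 2) ≤ C * ∫⁻ x, ‖f x‖ₑ ^ p := by
  obtain ⟨C, hC⟩ := exists_lintegral_square_le hp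
  obtain ⟨c, hc0, hc⟩ := exists_oscControlled_base hl
  refine ⟨(c⁻¹ ^ (2 : ℝ)) ^ (p / 2) * C, fun f hf T hT => ?_⟩
  have h := hC f _ hf (hc f hf) (2 * T / 3) (by positivity)
  have e : ∀ k : ℤ, ∀ x, ‖base l (4 ^ k * T) f x‖ₑ ^ (2 : ℝ) =
      ((c⁻¹ : ℝ≥0) : ℝ≥0∞) ^ (2 : ℝ) * (((if 0 < (4 : ℝ) ^ k * (2 * T / 3) then c else 0 : ℝ≥0) : ℝ≥0∞) *
      ‖base l (3 * ((4 : ℝ) ^ k * (2 * T / 3)) / 2) f x‖ₑ) ^ (2 : ℝ) := by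
    intro k x
    rw [if_pos (by positivity), ← ENNReal.mul_rpow_of_nonneg _ _ (by norm_num), ← mul_assoc,
      ← ENNReal.coe_mul, inv_mul_cancel₀ hc0, ENNReal.coe_one, one_mul]
    rw [show 3 * ((4 : ℝ) ^ k * (2 * T / 3)) / 2 = 4 ^ k * T by ring]
  simp_rw [e, ENNReal.tsum_mul_left]
  have hp0 : 0 ≤ p / 2 := by linarith
  simp_rw [ENNReal.mul_rpow_of_nonneg _ _ hp0]
  rw [lintegral_const_mul' _ _ (by finiteness)]
  refine (mul_le_mul_right h _).trans (le_of_eq ?_)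
  rw [← mul_assoc, ENNReal.coe_mul, ENNReal.coe_rpow_of_nonneg _ hp0,
    ENNReal.coe_rpow_of_nonneg _ (by norm_num)]

/-! ### Trilinear estimates -/

/-- This direction is superadditivity of the lower integral, so no measurability is needed. -/
theorem tsum_lintegral_le_lintegral_tsum {α ι : Type*} [MeasurableSpace α] (μ : Measure α)
    (F : ι → α → ℝ≥0∞) : ∑' k, ∫⁻ x, F k x ∂μ ≤ ∫⁻ x, ∑' k, F k x ∂μ := by
  classical
  rw [ENNReal.tsum_eq_iSup_sum]
  refine iSup_le fun s => ?_
  have h : ∑ k ∈ s, ∫⁻ x, F k x ∂μ ≤ ∫⁻ x, ∑ k ∈ s, F k x ∂μ := by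
    induction s using Finset.induction_on with
    | empty => simp
    | insert a s ha ih =>
      simp_rw [Finset.sum_insert ha]
      exact (add_le_add_right ih _).trans (le_lintegral_add _ _)
  exact h.trans (lintegral_mono fun x => ENNReal.sum_le_tsum s)

theorem setLIntegral_Ioc_scale {c : ℝ} (hc : 0 < c) (F : ℝ → ℝ≥0∞) :
    ∫⁻ x in Set.Ioc c (c * 4), F x = ENNReal.ofReal c * ∫⁻ τ in Set.Ioc 1 4, F (c * τ) := by
  have h := Real.smul_map_volume_mul_left hc.ne'
  rw [← lintegral_indicator measurableSet_Ioc, ← lintegral_indicator measurableSet_Ioc]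
  nth_rewrite 1 [← h]
  rw [lintegral_smul_measure, abs_of_pos hc, smul_eq_mul]
  congr 1
  have := lintegral_map_equiv (μ := volume) (Set.indicator (Set.Ioc c (c * 4)) fun x => F x)
    (Homeomorph.mulLeft₀ c hc.ne').toMeasurableEquiv
  simp only [Homeomorph.toMeasurableEquiv_coe, Homeomorph.coe_mulLeft₀] at this
  rw [this]
  refine lintegral_congr fun x => ?_
  have hiff : c * x ∈ Set.Ioc c (c * 4) ↔ x ∈ Set.Ioc (1 : ℝ) 4 := by
    simp only [Set.mem_Ioc]
    constructor
    · rintro ⟨h1, h2⟩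
      exact ⟨by nlinarith, le_of_mul_le_mul_left h2 hc⟩
    · rintro ⟨h1, h2⟩
      exact ⟨by nlinarith, by gcongr⟩
  by_cases hx : x ∈ Set.Ioc (1 : ℝ) 4
  · rw [Set.indicator_of_mem hx, Set.indicator_of_mem (hiff.2 hx)]
  · rw [Set.indicator_of_notMem hx, Set.indicator_of_notMem (fun h => hx (hiff.1 h))]

/-- The half-line is cut into the intervals (4^k, 4^{k+1}]; rescaling each to (1, 4], of length 3,
turns dτ/τ into at most dτ. A bound for discrete scales, uniform in the starting point, thereby
gives one for continuous scales. -/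
theorem lintegral_Ioi_mul_inv_le {J : ℝ → ℝ≥0∞} {K : ℝ≥0∞}
    (h : ∀ τ : ℝ, 0 < τ → ∑' k : ℤ, J (4 ^ k * τ) ≤ K) :
    ∫⁻ τ in Set.Ioi 0, J τ * ENNReal.ofReal τ⁻¹ ≤ 3 * K := by
  have hU : Set.Ioi (0 : ℝ) ⊆ ⋃ k : ℤ, Set.Ioc ((4 : ℝ) ^ k) (4 ^ k * 4) := by
    intro x hx
    obtain ⟨n, hn⟩ := exists_mem_Ioc_zpow (Set.mem_Ioi.1 hx) (by norm_num : (1 : ℝ) < 4)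
    rw [zpow_add_one₀ (by norm_num)] at hn
    exact Set.mem_iUnion.2 ⟨n, hn⟩
  calc _ ≤ ∫⁻ τ in ⋃ k : ℤ, Set.Ioc ((4 : ℝ) ^ k) (4 ^ k * 4), J τ * ENNReal.ofReal τ⁻¹ :=
        lintegral_mono_set hU
    _ ≤ ∑' k : ℤ, ∫⁻ τ in Set.Ioc ((4 : ℝ) ^ k) (4 ^ k * 4), J τ * ENNReal.ofReal τ⁻¹ :=
        lintegral_iUnion_le _ _
    _ ≤ ∑' k : ℤ, ∫⁻ τ in Set.Ioc (1 : ℝ) 4, J (4 ^ k * τ) := by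
        refine ENNReal.tsum_le_tsum fun k => ?_
        have hk : (0 : ℝ) < 4 ^ k := by positivity
        rw [setLIntegral_Ioc_scale hk, ← lintegral_const_mul' _ _ (by simp)]
        refine setLIntegral_mono' measurableSet_Ioc fun τ hτ => ?_
        have hτ0 : 0 < τ := by linarith [hτ.1]
        rw [mul_left_comm, ← ENNReal.ofReal_mul hk.le]
        refine mul_le_of_le_one_right zero_le ?_
        rw [ENNReal.ofReal_le_one, mul_inv, ← mul_assoc, mul_inv_cancel₀ hk.ne', one_mul]
        exact inv_le_one_of_one_le₀ hτ.1.le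
    _ ≤ ∫⁻ τ in Set.Ioc (1 : ℝ) 4, ∑' k : ℤ, J (4 ^ k * τ) :=
        tsum_lintegral_le_lintegral_tsum _ _
    _ ≤ ∫⁻ _ in Set.Ioc (1 : ℝ) 4, K :=
        setLIntegral_mono' measurableSet_Ioc fun τ hτ => h τ (by linarith [hτ.1])
    _ = _ := by
        rw [setLIntegral_const, Real.volume_Ioc, mul_comm]; norm_num

theorem tsum_mul_le_sqrt {ι : Type*} (a b : ι → ℝ≥0∞) :
    ∑' k, a k * b k ≤ (∑' k, a k ^ (2 : ℝ)) ^ (1 / 2 : ℝ) * (∑' k, b k ^ (2 : ℝ)) ^ (1 / 2 : ℝ) := by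
  let _ : MeasurableSpace ι := ⊤
  have := ENNReal.lintegral_mul_le_Lp_mul_Lq (Measure.count : Measure ι)
    Real.HolderConjugate.two_two (f := a) (g := b) (Measurable.of_discrete).aemeasurable
    (Measurable.of_discrete).aemeasurable
  simpa [lintegral_count] using this

theorem tsum_lintegral_mul_mul_le {ι : Type*} [Countable ι] {E : Plane → ℝ≥0∞}
    {D₁ D₂ D₃ : ι → Plane → ℝ≥0∞} (h1 : ∀ k x, D₁ k x ≤ E x) :
    ∑' k, ∫⁻ x, D₁ k x * (D₂ k x * D₃ k x) ≤ ∫⁻ x, E x *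
      ((∑' k, D₂ k x ^ (2 : ℝ)) ^ (1 / 2 : ℝ) * (∑' k, D₃ k x ^ (2 : ℝ)) ^ (1 / 2 : ℝ)) := by
  refine (tsum_lintegral_le_lintegral_tsum _ _).trans (lintegral_mono fun x => ?_)
  calc _ ≤ ∑' k, E x * (D₂ k x * D₃ k x) := ENNReal.tsum_le_tsum fun k => by
        gcongr; exact h1 k x
    _ = E x * ∑' k, D₂ k x * D₃ k x := ENNReal.tsum_mul_left
    _ ≤ _ := by gcongr; exact tsum_mul_le_sqrt _ _

theorem lintegral_mul_mul_le {q : ℝ≥0∞} {r s : ℝ} (hr : 1 < r) (hs : 1 < s)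
    (hq : q⁻¹ + ENNReal.ofReal r⁻¹ + ENNReal.ofReal s⁻¹ = 1) {E S S' : Plane → ℝ≥0∞}
    (hE : Measurable E) (hS : Measurable S) (hS' : Measurable S') :
    ∫⁻ x, E x * (S x * S' x) ≤ eLpNorm E q volume *
      ((∫⁻ x, S x ^ r) ^ (1 / r) * (∫⁻ x, S' x ^ s) ^ (1 / s)) := by
  have hr0 : 0 < r := by linarith
  have hs0 : 0 < s := by linarith
  by_cases hqt : q = ⊤
  · subst hqt
    have hrs : r.HolderConjugate s := by
      refine Real.holderConjugate_iff.2 ⟨hr, ?_⟩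
      rw [ENNReal.inv_top, zero_add, ← ENNReal.ofReal_add (by positivity) (by positivity)] at hq
      exact (ENNReal.ofReal_eq_one).1 hq
    calc _ ≤ ∫⁻ x, eLpNorm E ⊤ volume * (S x * S' x) := by
          refine lintegral_mono_ae ?_
          filter_upwards [ae_le_eLpNormEssSup (f := E) (μ := volume)] with x hx
          rw [eLpNorm_exponent_top]
          gcongr
          simpa using hx
      _ = eLpNorm E ⊤ volume * ∫⁻ x, S x * S' x := lintegral_const_mul _ (hS.mul hS')
      _ ≤ _ := by
          gcongr
          exact ENNReal.lintegral_mul_le_Lp_mul_Lq volume hrs hS.aemeasurable hS'.aemeasurable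
  · have hq0 : q ≠ 0 := by
      rintro rfl
      simp at hq
    set t := q.toReal with ht
    have ht0 : 0 < t := ENNReal.toReal_pos hq0 hqt
    have hqt' : q = ENNReal.ofReal t := (ENNReal.ofReal_toReal hqt).symm
    have hsum : t⁻¹ + r⁻¹ + s⁻¹ = 1 := by
      rw [hqt', ← ENNReal.ofReal_inv_of_pos ht0, ← ENNReal.ofReal_add (by positivity)
        (by positivity), ← ENNReal.ofReal_add (by positivity) (by positivity)] at hq
      exact (ENNReal.ofReal_eq_one).1 hq
    have h := ENNReal.lintegral_prod_norm_pow_le (μ := (volume : Measure Plane)) Finset.univ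
      (f := ![fun x => E x ^ t, fun x => S x ^ r, fun x => S' x ^ s]) (p := ![t⁻¹, r⁻¹, s⁻¹])
      (by
        intro i _
        fin_cases i
        · exact (hE.pow_const _).aemeasurable
        · exact (hS.pow_const _).aemeasurable
        · exact (hS'.pow_const _).aemeasurable)
      (by simpa [Fin.sum_univ_three] using hsum)
      (by
        intro i _
        fin_cases i
        · exact inv_nonneg.2 ht0.le
        · exact inv_nonneg.2 hr0.le
        · exact inv_nonneg.2 hs0.le)
    simp only [Fin.prod_univ_three, Matrix.cons_val_zero, Matrix.cons_val_one,
      Matrix.cons_val] at h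
    simp_rw [ENNReal.rpow_rpow_inv ht0.ne', ENNReal.rpow_rpow_inv hr0.ne',
      ENNReal.rpow_rpow_inv hs0.ne'] at h
    rw [eLpNorm_eq_lintegral_rpow_enorm_toReal hq0 hqt, ← ht]
    simp only [enorm_eq_self, one_div]
    simpa only [mul_assoc] using h

theorem exists_eLpNorm_maxFn_le {q : ℝ≥0∞} (hq : 1 < q) : ∃ C : ℝ≥0, ∀ f : Plane → ℂ, BddMeas f →
    eLpNorm (maxFn fun y => ‖f y‖ₑ) q volume ≤ C * eLpNorm f q volume := by
  by_cases hqt : q = ⊤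
  · subst hqt
    refine ⟨4, fun f hf => ?_⟩
    rw [eLpNorm_exponent_top, eLpNorm_exponent_top]
    refine eLpNormEssSup_le_of_ae_enorm_bound (Filter.Eventually.of_forall fun x => ?_)
    rw [enorm_eq_self]
    refine le_trans ?_ (maxFn_const_le (eLpNormEssSup f volume) x)
    unfold maxFn
    refine iSup₂_mono fun r hr => ENNReal.div_le_div_right ?_ _
    exact lintegral_mono_ae (ae_restrict_of_ae (ae_le_eLpNormEssSup (f := f)))
  · have hq0 : q ≠ 0 := (zero_lt_one.trans hq).ne'
    have ht : 1 < q.toReal := by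
      rw [← ENNReal.toReal_one]
      exact (ENNReal.toReal_lt_toReal (by simp) hqt).2 hq
    obtain ⟨C, hC⟩ := exists_lintegral_maxFn_rpow_le ht
    refine ⟨C ^ (1 / q.toReal), fun f hf => ?_⟩
    rw [eLpNorm_eq_lintegral_rpow_enorm_toReal hq0 hqt,
      eLpNorm_eq_lintegral_rpow_enorm_toReal hq0 hqt]
    simp only [enorm_eq_self]
    have h0 : 0 ≤ 1 / q.toReal := by positivity
    rw [ENNReal.coe_rpow_of_nonneg _ h0, ← ENNReal.mul_rpow_of_nonneg _ _ h0]
    exact ENNReal.rpow_le_rpow (hC _ hf.1.enorm hf.enorm_le) h0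

theorem exists_square_norm_le {l : List (Fin 2)} (hl : l ≠ []) {p : ℝ} (hp : 1 < p) :
    ∃ C : ℝ≥0, ∀ f : Plane → ℂ, BddMeas f → ∀ T : ℝ, 0 < T →
      (∫⁻ x, ((∑' k : ℤ, ‖base l (4 ^ k * T) f x‖ₑ ^ (2 : ℝ)) ^ (1 / 2 : ℝ)) ^ p) ^ (1 / p)
        ≤ C * eLpNorm f (ENNReal.ofReal p) volume := by
  obtain ⟨C, hC⟩ := exists_lintegral_base_square_le hl hp
  have hp0 : 0 < p := by linarith
  have h0 : 0 ≤ 1 / p := by positivity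
  refine ⟨C ^ (1 / p), fun f hf T hT => ?_⟩
  rw [eLpNorm_eq_lintegral_rpow_enorm_toReal (by simpa using hp0) (by simp),
    ENNReal.toReal_ofReal hp0.le, ENNReal.coe_rpow_of_nonneg _ h0,
    ← ENNReal.mul_rpow_of_nonneg _ _ h0]
  refine ENNReal.rpow_le_rpow ?_ h0
  simp_rw [← ENNReal.rpow_mul, show (1 / 2 : ℝ) * p = p / 2 by ring]
  exact hC f hf T hT

/-- The first factor is dominated at all scales by a maximal function and comes out of the sum.
Cauchy–Schwarz in the scale turns the two remaining factors into square functions, and Hölder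
finishes. Cancellation is required only in `l₂` and `l₃`; the first exponent may be infinite. -/
theorem exists_tsum_lintegral_base_le (l₁ : List (Fin 2)) {l₂ l₃ : List (Fin 2)} (hl₂ : l₂ ≠ [])
    (hl₃ : l₃ ≠ []) {q : ℝ≥0∞} {r s : ℝ} (hq1 : 1 < q) (hr : 1 < r) (hs : 1 < s)
    (hq : q⁻¹ + ENNReal.ofReal r⁻¹ + ENNReal.ofReal s⁻¹ = 1) :
    ∃ C : ℝ≥0, ∀ f₁ f₂ h : Plane → ℂ, BddMeas f₁ → BddMeas f₂ → BddMeas h →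
      ∀ T₁ T₂ T₃ : ℝ, 0 < T₁ → 0 < T₂ → 0 < T₃ →
      ∑' k : ℤ, ∫⁻ x, ‖base l₁ (4 ^ k * T₁) f₁ x‖ₑ *
        (‖base l₂ (4 ^ k * T₂) f₂ x‖ₑ * ‖base l₃ (4 ^ k * T₃) h x‖ₑ) ≤
      C * (eLpNorm f₁ q volume * eLpNorm f₂ (ENNReal.ofReal r) volume *
        eLpNorm h (ENNReal.ofReal s) volume) := by
  obtain ⟨C₁, hC₁⟩ := exists_enorm_base_le l₁
  obtain ⟨CM, hCM⟩ := exists_eLpNorm_maxFn_le hq1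
  obtain ⟨C₂, hC₂⟩ := exists_square_norm_le hl₂ hr
  obtain ⟨C₃, hC₃⟩ := exists_square_norm_le hl₃ hs
  refine ⟨C₁ * CM * C₂ * C₃, fun f₁ f₂ h hf₁ hf₂ hh T₁ T₂ T₃ hT₁ hT₂ hT₃ => ?_⟩
  have hE : ∀ (k : ℤ) x, ‖base l₁ (4 ^ k * T₁) f₁ x‖ₑ ≤ C₁ * maxFn (fun y => ‖f₁ y‖ₑ) x := by
    intro k x
    obtain ⟨S, hS, hle⟩ := hC₁ (4 ^ k * T₁) (by positivity) f₁ hf₁ x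
    exact hle.trans (by gcongr; exact heatE_le_maxFn hS hf₁.1.enorm x)
  refine (tsum_lintegral_mul_mul_le hE).trans ?_
  have hm : ∀ (l : List (Fin 2)) (f : Plane → ℂ) (T : ℝ), BddMeas f → 0 < T → Measurable fun x =>
      (∑' k : ℤ, ‖base l (4 ^ k * T) f x‖ₑ ^ (2 : ℝ)) ^ (1 / 2 : ℝ) := by
    intro l f T hf hT
    refine Measurable.pow_const (Measurable.tsum fun k => ?_) _
    exact (hf.base l (by positivity)).1.enorm.pow_const _
  have hMm := measurable_maxFn fun y => ‖f₁ y‖ₑ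
  calc _ = C₁ * ∫⁻ x, maxFn (fun y => ‖f₁ y‖ₑ) x *
        ((∑' k : ℤ, ‖base l₂ (4 ^ k * T₂) f₂ x‖ₑ ^ (2 : ℝ)) ^ (1 / 2 : ℝ) *
          (∑' k : ℤ, ‖base l₃ (4 ^ k * T₃) h x‖ₑ ^ (2 : ℝ)) ^ (1 / 2 : ℝ)) := by
        rw [← lintegral_const_mul' _ _ (by simp)]
        simp_rw [mul_assoc]
    _ ≤ C₁ * ((CM * eLpNorm f₁ q volume) * ((C₂ * eLpNorm f₂ (ENNReal.ofReal r) volume) *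
          (C₃ * eLpNorm h (ENNReal.ofReal s) volume))) := by
        gcongr
        refine (lintegral_mul_mul_le hr hs hq hMm (hm l₂ f₂ T₂ hf₂ hT₂) (hm l₃ h T₃ hh hT₃)).trans ?_
        gcongr
        · exact hCM f₁ hf₁
        · exact hC₂ f₂ hf₂ T₂ hT₂
        · exact hC₃ h hh T₃ hT₃
    _ = _ := by push_cast; ring

theorem bddMeas_fourierInv {g : Plane → ℂ} (hg : Integrable g) : BddMeas (𝓕⁻ g) := by
  have hc : Continuous (𝓕⁻ g) :=
    VectorFourier.fourierIntegral_continuous Real.continuous_fourierChar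
      (by exact continuous_inner.neg) hg
  refine ⟨hc.measurable, (∫ x, ‖g x‖).toNNReal, fun x => ?_⟩
  rw [Real.coe_toNNReal _ (integral_nonneg fun y => norm_nonneg _)]
  exact VectorFourier.norm_fourierIntegral_le_integral_norm _ _ _ _ _

theorem continuous_fourierInv {g : Plane → ℂ} (hg : Integrable g) : Continuous (𝓕⁻ g) :=
  VectorFourier.fourierIntegral_continuous Real.continuous_fourierChar
      (by exact continuous_inner.neg) hg

theorem BddMeas.integrable_mul {f h : Plane → ℂ} (hf : BddMeas f) (hh : Integrable h) :
    Integrable fun x => f x * h x := by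
  obtain ⟨hm, K, hK⟩ := hf
  exact hh.bdd_mul hm.aestronglyMeasurable (Filter.Eventually.of_forall hK)

/-- Parseval's identity for products of three functions. -/
theorem integral_fourierInv_mul_mul {g₁ g₂ h : Plane → ℂ} (hg₁ : Integrable g₁)
    (hg₂ : Integrable g₂) (hh : Integrable h) :
    ∫ x, 𝓕⁻ g₁ x * (𝓕⁻ g₂ x * h x) = ∫ ζ, ∫ η, g₁ ζ * g₂ η * 𝓕⁻ h (ζ + η) := by
  rw [integral_fourierInv_mul hg₁ ((bddMeas_fourierInv hg₂).integrable_mul hh)]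
  congr 1; ext ζ
  simp_rw [mul_assoc]
  rw [integral_const_mul]
  congr 1
  have hch : Integrable fun x => Real.fourierChar (inner ℝ x ζ) • h x := by
    simpa using (Real.fourierIntegral_convergent_iff (μ := volume) (f := h) (-ζ)).2 hh
  calc 𝓕⁻ (fun x => 𝓕⁻ g₂ x * h x) ζ
      = ∫ x, 𝓕⁻ g₂ x * (Real.fourierChar (inner ℝ x ζ) • h x) := by
        rw [Real.fourierInv_eq]
        congr 1; ext x
        simp only [Circle.smul_def, smul_eq_mul]; ring
    _ = _ := by
        rw [integral_fourierInv_mul hg₂ hch]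
        congr 1; ext η
        congr 1
        rw [Real.fourierInv_eq, Real.fourierInv_eq]
        congr 1; ext x
        rw [smul_smul, ← AddChar.map_add_eq_mul, inner_add_right, add_comm]

/-- The frequency form of the preceding estimate, by Parseval at each scale; the three times may be
in any fixed ratios, with a constant independent of these. -/
theorem exists_lintegral_trilinear_le (l₁ : List (Fin 2)) {l₂ l₃ : List (Fin 2)} (hl₂ : l₂ ≠ [])
    (hl₃ : l₃ ≠ []) {q : ℝ≥0∞} {r s : ℝ} (hq1 : 1 < q) (hr : 1 < r) (hs : 1 < s)
    (hq : q⁻¹ + ENNReal.ofReal r⁻¹ + ENNReal.ofReal s⁻¹ = 1) :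
    ∃ C : ℝ≥0, ∀ g₁ g₂ h : Plane → ℂ, Integrable g₁ → Integrable g₂ → Integrable h → BddMeas h →
      ∀ a₁ a₂ a₃ : ℝ, 0 < a₁ → 0 < a₂ → 0 < a₃ →
      ∫⁻ τ in Set.Ioi 0, ‖∫ ζ, ∫ η, (baseSym l₁ (a₁ * τ) ζ * g₁ ζ) *
        (baseSym l₂ (a₂ * τ) η * g₂ η) * (baseSym l₃ (a₃ * τ) (ζ + η) * 𝓕⁻ h (ζ + η))‖ₑ *
          ENNReal.ofReal τ⁻¹ ≤
      C * (eLpNorm (𝓕⁻ g₁) q volume * eLpNorm (𝓕⁻ g₂) (ENNReal.ofReal r) volume *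
        eLpNorm h (ENNReal.ofReal s) volume) := by
  obtain ⟨C, hC⟩ := exists_tsum_lintegral_base_le l₁ hl₂ hl₃ hq1 hr hs hq
  refine ⟨3 * C, fun g₁ g₂ h hg₁ hg₂ hh hhb a₁ a₂ a₃ ha₁ ha₂ ha₃ => ?_⟩
  rw [ENNReal.coe_mul, ENNReal.coe_ofNat, mul_assoc]
  refine lintegral_Ioi_mul_inv_le fun τ hτ => ?_
  refine le_trans (ENNReal.tsum_le_tsum fun k => ?_) (hC (𝓕⁻ g₁) (𝓕⁻ g₂) h
    (bddMeas_fourierInv hg₁) (bddMeas_fourierInv hg₂) hhb (a₁ * τ) (a₂ * τ) (a₃ * τ)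
    (by positivity) (by positivity) (by positivity))
  have e : ∀ a : ℝ, a * (4 ^ k * τ) = 4 ^ k * (a * τ) := fun a => by ring
  simp_rw [e]
  have key : ∀ (l : List (Fin 2)) {T : ℝ} (_ : 0 < T) {g : Plane → ℂ} (_ : Integrable g),
      Integrable fun ξ => baseSym l T ξ * g ξ := by
    intro l T hT g hg
    obtain ⟨C, hC⟩ := exists_norm_baseSym_le l
    have := continuous_baseSym l
    exact hg.bdd_mul (c := C) (Continuous.aestronglyMeasurable (by fun_prop))
      (Filter.Eventually.of_forall fun ξ => hC T hT ξ)
  have p1 : 0 < 4 ^ k * (a₁ * τ) := by positivity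
  have p2 : 0 < 4 ^ k * (a₂ * τ) := by positivity
  have p3 : 0 < 4 ^ k * (a₃ * τ) := by positivity
  obtain ⟨hb1, hb2⟩ := fourierInv_base l₃ p3 hh
  have hpar := integral_fourierInv_mul_mul (key l₁ p1 hg₁) (key l₂ p2 hg₂) hb1
  rw [← base_fourierInv l₁ p1 hg₁, ← base_fourierInv l₂ p2 hg₂] at hpar
  simp_rw [hb2] at hpar
  -- The sign from `fourierInv_base` is inserted twice; having modulus one, it disappears from the
  -- norm.
  have hsgn : ∀ ζ η : Plane, (baseSym l₁ (4 ^ k * (a₁ * τ)) ζ * g₁ ζ) *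
        (baseSym l₂ (4 ^ k * (a₂ * τ)) η * g₂ η) *
        (baseSym l₃ (4 ^ k * (a₃ * τ)) (ζ + η) * 𝓕⁻ h (ζ + η)) =
      (-1) ^ l₃.length * ((baseSym l₁ (4 ^ k * (a₁ * τ)) ζ * g₁ ζ) *
        (baseSym l₂ (4 ^ k * (a₂ * τ)) η * g₂ η) *
        ((-1) ^ l₃.length * baseSym l₃ (4 ^ k * (a₃ * τ)) (ζ + η) * 𝓕⁻ h (ζ + η))) := by
    intro ζ η
    have : ((-1 : ℂ) ^ l₃.length) * (-1) ^ l₃.length = 1 := by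
      rw [← mul_pow]; simp
    linear_combination (-(baseSym l₁ (4 ^ k * (a₁ * τ)) ζ * g₁ ζ) *
        (baseSym l₂ (4 ^ k * (a₂ * τ)) η * g₂ η) *
        (baseSym l₃ (4 ^ k * (a₃ * τ)) (ζ + η) * 𝓕⁻ h (ζ + η))) * this
  simp_rw [hsgn, integral_const_mul]
  rw [← hpar, enorm_mul]
  have h1 : ‖((-1 : ℂ) ^ l₃.length)‖ₑ = 1 := by
    rw [← ofReal_norm]; simp
  rw [h1, one_mul]
  refine (enorm_integral_le_lintegral_enorm _).trans (le_of_eq ?_)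
  simp_rw [enorm_mul]

/-! ### Multipliers that are superpositions of Gaussian multipliers -/

/-- `F` is a superposition of the functions `X ↦ λ^{n/2} e^{-λX}`, `λ > 0`, with respect to a
finite measure. -/
def LaplaceRep (n : ℕ) (F : ℝ → ℝ) : Prop :=
  ∃ ρ : Measure ℝ, IsFiniteMeasure ρ ∧ (∀ᵐ a ∂ρ, 0 < a) ∧
    ∀ X, 0 < X → F X = ∫ a, Real.sqrt a ^ n * Real.exp (-(a * X)) ∂ρ

/-- The factor √a^n in `LaplaceRep` is the normalization that `baseSym` carries at time aτ, so a
finite measure in `a` yields the multiplier F(τ·) with n derivatives. Since `F` is represented only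
on X > 0, the point ξ = 0 is left out. -/
theorem integral_baseSym {n : ℕ} {F : ℝ → ℝ} {ρ : Measure ℝ}
    (hρ : ∀ᵐ a ∂ρ, 0 < a)
    (hF : ∀ X, 0 < X → F X = ∫ a, Real.sqrt a ^ n * Real.exp (-(a * X)) ∂ρ) (l : List (Fin 2))
    (hl : l.length = n) {τ : ℝ} (hτ : 0 < τ) {ξ : Plane} (hξ : ξ ≠ 0) :
    ∫ a, baseSym l (a * τ) ξ ∂ρ =
      ((Real.sqrt τ ^ n * F (τ * (Real.pi * ‖ξ‖ ^ 2)) : ℝ) : ℂ) * derivSym l ξ := by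
  have hX : 0 < τ * (Real.pi * ‖ξ‖ ^ 2) := by
    have := norm_pos_iff.2 hξ
    positivity
  rw [hF _ hX, Complex.ofReal_mul, mul_right_comm, ← integral_complex_ofReal, ← integral_const_mul]
  refine integral_congr_ae ?_
  filter_upwards [hρ] with a ha
  unfold baseSym gaussSym
  rw [hl, Real.sqrt_mul ha.le, mul_pow]
  push_cast
  rw [show -(Real.pi * (a * τ) * ‖ξ‖ ^ 2 : ℂ) = -(a * (τ * (Real.pi * ‖ξ‖ ^ 2)) : ℂ) by ring]
  ring

theorem ae_prod_ne_zero : ∀ᵐ z : Plane × Plane, z.1 ≠ 0 ∧ z.2 ≠ 0 ∧ z.1 + z.2 ≠ 0 := by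
  have h0 : ∀ᵐ x : Plane, x ≠ 0 := by
    simp [ae_iff]
  have h1 : ∀ᵐ z : Plane × Plane, z.1 ≠ 0 := Measure.quasiMeasurePreserving_fst.ae h0
  have h2 : ∀ᵐ z : Plane × Plane, z.2 ≠ 0 := Measure.quasiMeasurePreserving_snd.ae h0
  have h3 : ∀ᵐ z : Plane × Plane, z.1 + z.2 ≠ 0 :=
    (measurePreserving_prod_add (volume : Measure Plane) (volume : Measure Plane)
      ).quasiMeasurePreserving.ae h2
  filter_upwards [h1, h2, h3] with z a b c using ⟨a, b, c⟩

/-- Trilinear Fourier multiplier theorem for superpositions of derivatives of heat flows. -/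
theorem exists_trilinear_multiplier_le {n₁ n₂ n₃ : ℕ} (hn₂ : n₂ ≠ 0) (hn₃ : n₃ ≠ 0)
    {F₁ F₂ F₃ : ℝ → ℝ} (hF₁ : LaplaceRep n₁ F₁) (hF₂ : LaplaceRep n₂ F₂) (hF₃ : LaplaceRep n₃ F₃)
    {q : ℝ≥0∞} {r s : ℝ} (hq1 : 1 < q) (hr : 1 < r) (hs : 1 < s)
    (hq : q⁻¹ + ENNReal.ofReal r⁻¹ + ENNReal.ofReal s⁻¹ = 1)
    (l₁ l₂ l₃ : List (Fin 2)) (hl₁ : l₁.length = n₁) (hl₂ : l₂.length = n₂)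
    (hl₃ : l₃.length = n₃) :
    ∃ C : ℝ≥0, ∀ g₁ g₂ h : Plane → ℂ, Integrable g₁ → Integrable g₂ → Integrable h → BddMeas h →
      ∀ δ R : ℝ, 0 < δ →
      Integrable (fun z : Plane × Plane => ((∫ τ in Set.Ioc δ R, τ⁻¹ *
          Real.sqrt τ ^ (n₁ + n₂ + n₃) *
          (F₁ (τ * (Real.pi * ‖z.1‖ ^ 2)) * F₂ (τ * (Real.pi * ‖z.2‖ ^ 2)) *
            F₃ (τ * (Real.pi * ‖z.1 + z.2‖ ^ 2))) : ℝ) : ℂ) *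
        (derivSym l₁ z.1 * derivSym l₂ z.2 * derivSym l₃ (z.1 + z.2)) *
        (g₁ z.1 * g₂ z.2 * 𝓕⁻ h (z.1 + z.2))) ∧
      ‖∫ z : Plane × Plane, ((∫ τ in Set.Ioc δ R, τ⁻¹ * Real.sqrt τ ^ (n₁ + n₂ + n₃) *
          (F₁ (τ * (Real.pi * ‖z.1‖ ^ 2)) * F₂ (τ * (Real.pi * ‖z.2‖ ^ 2)) *
            F₃ (τ * (Real.pi * ‖z.1 + z.2‖ ^ 2))) : ℝ) : ℂ) *
        (derivSym l₁ z.1 * derivSym l₂ z.2 * derivSym l₃ (z.1 + z.2)) *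
        (g₁ z.1 * g₂ z.2 * 𝓕⁻ h (z.1 + z.2))‖ₑ ≤
      C * (eLpNorm (𝓕⁻ g₁) q volume * eLpNorm (𝓕⁻ g₂) (ENNReal.ofReal r) volume *
        eLpNorm h (ENNReal.ofReal s) volume) := by
  obtain ⟨ρ₁, hρ₁, hρ₁0, hρ₁F⟩ := hF₁
  obtain ⟨ρ₂, hρ₂, hρ₂0, hρ₂F⟩ := hF₂
  obtain ⟨ρ₃, hρ₃, hρ₃0, hρ₃F⟩ := hF₃
  obtain ⟨C, hC⟩ := exists_lintegral_trilinear_le l₁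
    (l₂ := l₂) (l₃ := l₃) (by rintro rfl; simp at hl₂; omega) (by rintro rfl; simp at hl₃; omega)
    hq1 hr hs hq
  obtain ⟨B₁, hB₁⟩ := exists_norm_baseSym_le l₁
  obtain ⟨B₂, hB₂⟩ := exists_norm_baseSym_le l₂
  obtain ⟨B₃, hB₃⟩ := exists_norm_baseSym_le l₃
  -- The trilinear constant is uniform in the times, so averaging over (a₁, a₂, a₃) costs only the
  -- total mass.
  refine ⟨C * (ρ₁.prod (ρ₂.prod ρ₃) Set.univ).toNNReal,
    fun g₁ g₂ h hg₁ hg₂ hh hhb δ R hδ => ?_⟩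
  set Q : Measure (ℝ × ℝ × ℝ) := ρ₁.prod (ρ₂.prod ρ₃) with hQ
  set μ : Measure ℝ := volume.restrict (Set.Ioc δ R) with hμ
  have hQ0 : ∀ᵐ a ∂Q, 0 < a.1 ∧ 0 < a.2.1 ∧ 0 < a.2.2 := by
    have h1 : ∀ᵐ a ∂Q, 0 < a.1 := Measure.quasiMeasurePreserving_fst.ae hρ₁0
    have h2 : ∀ᵐ b ∂(ρ₂.prod ρ₃), 0 < b.1 ∧ 0 < b.2 := by
      filter_upwards [Measure.quasiMeasurePreserving_fst.ae hρ₂0,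
        Measure.quasiMeasurePreserving_snd.ae hρ₃0] with b h1 h2 using ⟨h1, h2⟩
    filter_upwards [h1, Measure.quasiMeasurePreserving_snd.ae h2] with a h1 h2 using ⟨h1, h2⟩
  have hμ0 : ∀ᵐ τ ∂μ, δ < τ := by
    rw [hμ, ae_restrict_iff' measurableSet_Ioc]
    exact Filter.Eventually.of_forall fun τ hτ => hτ.1
  -- The restriction τ > δ bounds 1/τ and R bounds the length, so everything is absolutely
  -- integrable against `W` and Fubini applies. The final constant does not depend on δ or R.
  set W : Measure ((ℝ × ℝ × ℝ) × ℝ) := Q.prod μ with hW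
  have hW0 : ∀ᵐ w ∂W, (0 < w.1.1 ∧ 0 < w.1.2.1 ∧ 0 < w.1.2.2) ∧ δ < w.2 := by
    filter_upwards [Measure.quasiMeasurePreserving_fst.ae hQ0,
      Measure.quasiMeasurePreserving_snd.ae hμ0] with w h1 h2 using ⟨h1, h2⟩
  set k : (ℝ × ℝ × ℝ) × ℝ → Plane × Plane → ℂ := fun w z =>
    ((w.2⁻¹ : ℝ) : ℂ) * (baseSym l₁ (w.1.1 * w.2) z.1 * baseSym l₂ (w.1.2.1 * w.2) z.2 *
      baseSym l₃ (w.1.2.2 * w.2) (z.1 + z.2)) with hk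
  set G : Plane × Plane → ℂ := fun z => g₁ z.1 * g₂ z.2 * 𝓕⁻ h (z.1 + z.2) with hG
  have hchc := continuous_fourierInv hh
  have hGi : Integrable G (volume.prod volume) := by
    obtain ⟨-, K, hK⟩ := bddMeas_fourierInv hh
    refine (hg₁.mul_prod hg₂).mul_bdd (c := K) ?_
      (Filter.Eventually.of_forall fun z => hK _)
    exact (hchc.comp (continuous_fst.add continuous_snd)).aestronglyMeasurable
  have hkm : Measurable (Function.uncurry k) := by
    have c1 := (continuous_baseSym l₁).measurable
    have c2 := (continuous_baseSym l₂).measurable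
    have c3 := (continuous_baseSym l₃).measurable
    have m1 : Measurable fun p : ((ℝ × ℝ × ℝ) × ℝ) × (Plane × Plane) =>
        baseSym l₁ (p.1.1.1 * p.1.2) p.2.1 :=
      c1.comp (f := fun p : ((ℝ × ℝ × ℝ) × ℝ) × (Plane × Plane) =>
        ((p.1.1.1 * p.1.2, p.2.1) : ℝ × Plane)) (by fun_prop)
    have m2 : Measurable fun p : ((ℝ × ℝ × ℝ) × ℝ) × (Plane × Plane) =>
        baseSym l₂ (p.1.1.2.1 * p.1.2) p.2.2 :=
      c2.comp (f := fun p : ((ℝ × ℝ × ℝ) × ℝ) × (Plane × Plane) =>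
        ((p.1.1.2.1 * p.1.2, p.2.2) : ℝ × Plane)) (by fun_prop)
    have m3 : Measurable fun p : ((ℝ × ℝ × ℝ) × ℝ) × (Plane × Plane) =>
        baseSym l₃ (p.1.1.2.2 * p.1.2) (p.2.1 + p.2.2) :=
      c3.comp (f := fun p : ((ℝ × ℝ × ℝ) × ℝ) × (Plane × Plane) =>
        ((p.1.1.2.2 * p.1.2, p.2.1 + p.2.2) : ℝ × Plane)) (by fun_prop)
    have m4 : Measurable fun p : ((ℝ × ℝ × ℝ) × ℝ) × (Plane × Plane) => ((p.1.2⁻¹ : ℝ) : ℂ) := by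
      fun_prop
    exact m4.mul ((m1.mul m2).mul m3)
  have hkb : ∀ w : (ℝ × ℝ × ℝ) × ℝ, ((0 < w.1.1 ∧ 0 < w.1.2.1 ∧ 0 < w.1.2.2) ∧ δ < w.2) →
      ∀ z, ‖k w z‖ ≤ δ⁻¹ * (B₁ * B₂ * B₃) := by
    rintro w ⟨⟨h1, h2, h3⟩, h4⟩ z
    have hw : 0 < w.2 := hδ.trans h4
    simp only [hk, norm_mul, Complex.norm_real, Real.norm_of_nonneg (inv_pos.2 hw).le]
    gcongr
    · exact hB₁ _ (by positivity) _
    · exact hB₂ _ (by positivity) _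
    · exact hB₃ _ (by positivity) _
  have hkG : Integrable (Function.uncurry fun w z => k w z * G z) (W.prod (volume.prod volume)) := by
    have h1 : Integrable (fun p : ((ℝ × ℝ × ℝ) × ℝ) × (Plane × Plane) => (1 : ℂ) * G p.2)
        (W.prod (volume.prod volume)) :=
      (integrable_const (1 : ℂ)).mul_prod hGi
    simp only [one_mul] at h1
    refine h1.bdd_mul (c := δ⁻¹ * (B₁ * B₂ * B₃)) hkm.aestronglyMeasurable ?_
    filter_upwards [Measure.quasiMeasurePreserving_fst.ae hW0] with p hp
    exact hkb p.1 hp p.2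
  have hid : ∀ᵐ z : Plane × Plane, ((∫ τ in Set.Ioc δ R, τ⁻¹ * Real.sqrt τ ^ (n₁ + n₂ + n₃) *
          (F₁ (τ * (Real.pi * ‖z.1‖ ^ 2)) * F₂ (τ * (Real.pi * ‖z.2‖ ^ 2)) *
            F₃ (τ * (Real.pi * ‖z.1 + z.2‖ ^ 2))) : ℝ) : ℂ) *
        (derivSym l₁ z.1 * derivSym l₂ z.2 * derivSym l₃ (z.1 + z.2)) = ∫ w, k w z ∂W := by
    filter_upwards [ae_prod_ne_zero] with z ⟨hz1, hz2, hz3⟩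
    have hki : Integrable (fun w => k w z) W := by
      refine Integrable.of_bound (C := δ⁻¹ * (B₁ * B₂ * B₃))
        (hkm.comp (measurable_id.prodMk measurable_const)).aestronglyMeasurable ?_
      filter_upwards [hW0] with w hw using hkb w hw z
    rw [hW, integral_prod_symm _ hki, ← integral_complex_ofReal, ← integral_mul_const]
    refine setIntegral_congr_fun measurableSet_Ioc fun τ hτ => ?_
    have hτ0 : 0 < τ := hδ.trans hτ.1
    simp only [hk]
    rw [integral_const_mul, hQ]
    have e1 : ∀ a : ℝ × ℝ × ℝ, baseSym l₁ (a.1 * τ) z.1 * baseSym l₂ (a.2.1 * τ) z.2 *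
        baseSym l₃ (a.2.2 * τ) (z.1 + z.2) = baseSym l₁ (a.1 * τ) z.1 *
        (baseSym l₂ (a.2.1 * τ) z.2 * baseSym l₃ (a.2.2 * τ) (z.1 + z.2)) := fun a => mul_assoc _ _ _
    simp_rw [e1]
    rw [integral_prod_mul (fun a : ℝ => baseSym l₁ (a * τ) z.1)
      (fun b : ℝ × ℝ => baseSym l₂ (b.1 * τ) z.2 * baseSym l₃ (b.2 * τ) (z.1 + z.2)),
      integral_prod_mul (fun a : ℝ => baseSym l₂ (a * τ) z.2)
      (fun b : ℝ => baseSym l₃ (b * τ) (z.1 + z.2)),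
      integral_baseSym hρ₁0 hρ₁F l₁ hl₁ hτ0 hz1, integral_baseSym hρ₂0 hρ₂F l₂ hl₂ hτ0 hz2,
      integral_baseSym hρ₃0 hρ₃F l₃ hl₃ hτ0 hz3]
    push_cast
    ring
  have hswap : ∫ z : Plane × Plane, ((∫ τ in Set.Ioc δ R, τ⁻¹ * Real.sqrt τ ^ (n₁ + n₂ + n₃) *
          (F₁ (τ * (Real.pi * ‖z.1‖ ^ 2)) * F₂ (τ * (Real.pi * ‖z.2‖ ^ 2)) *
            F₃ (τ * (Real.pi * ‖z.1 + z.2‖ ^ 2))) : ℝ) : ℂ) *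
        (derivSym l₁ z.1 * derivSym l₂ z.2 * derivSym l₃ (z.1 + z.2)) * G z =
      ∫ w, ∫ z : Plane × Plane, k w z * G z ∂(volume.prod volume) ∂W := by
    rw [integral_integral_swap hkG]
    refine integral_congr_ae ?_
    filter_upwards [hid] with z hz
    rw [hz, integral_mul_const]
  refine ⟨?_, ?_⟩
  · refine hkG.integral_prod_right.congr ?_
    filter_upwards [hid] with z hz
    rw [hz]
    exact integral_mul_const (G z) fun w => k w z
  rw [hswap]
  have hJm : AEMeasurable (fun w => ‖∫ z : Plane × Plane, k w z * G z ∂(volume.prod volume)‖ₑ) W :=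
    (hkG.aestronglyMeasurable.integral_prod_right').enorm
  refine (enorm_integral_le_lintegral_enorm _).trans ?_
  rw [hW, lintegral_prod _ hJm]
  calc _ ≤ ∫⁻ _, (C : ℝ≥0∞) * (eLpNorm (𝓕⁻ g₁) q volume *
        eLpNorm (𝓕⁻ g₂) (ENNReal.ofReal r) volume * eLpNorm h (ENNReal.ofReal s) volume) ∂Q := by
        refine lintegral_mono_ae ?_
        filter_upwards [hQ0] with a ⟨ha1, ha2, ha3⟩
        refine le_trans ?_ (hC g₁ g₂ h hg₁ hg₂ hh hhb a.1 a.2.1 a.2.2 ha1 ha2 ha3)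
        refine le_trans ?_ (lintegral_mono_set (fun τ (hτ : τ ∈ Set.Ioc δ R) => hδ.trans hτ.1))
        refine setLIntegral_mono' measurableSet_Ioc fun τ hτ => ?_
        have hτ0 : 0 < τ := hδ.trans hτ.1
        have hintg : Integrable (fun z => k (a, τ) z * G z) (volume.prod volume) := by
          refine hGi.bdd_mul (c := δ⁻¹ * (B₁ * B₂ * B₃))
            (hkm.comp (measurable_const.prodMk measurable_id)).aestronglyMeasurable
            (Filter.Eventually.of_forall fun z => hkb (a, τ) ⟨⟨ha1, ha2, ha3⟩, hτ.1⟩ z)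
        rw [integral_prod _ hintg]
        have e2 : ∀ ζ η : Plane, k (a, τ) (ζ, η) * G (ζ, η) = ((τ⁻¹ : ℝ) : ℂ) *
            ((baseSym l₁ (a.1 * τ) ζ * g₁ ζ) * (baseSym l₂ (a.2.1 * τ) η * g₂ η) *
            (baseSym l₃ (a.2.2 * τ) (ζ + η) * 𝓕⁻ h (ζ + η))) := by
          intro ζ η; simp only [hk, hG]; ring
        simp_rw [e2, integral_const_mul]
        rw [enorm_mul, mul_comm]
        gcongr
        rw [← ofReal_norm, Complex.norm_real, Real.norm_of_nonneg (inv_pos.2 hτ0).le]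
    _ = _ := by
        rw [lintegral_const, ENNReal.coe_mul, ENNReal.coe_toNNReal (measure_ne_top _ _)]
        ring

/-! ### A Bessel-type function -/

/-- The function `N_μ(X) = ∫₀^∞ r^{μ-1} e^{-r-X/r} dr`. -/
noncomputable def besselN (μ X : ℝ) : ℝ :=
  ∫ r in Set.Ioi 0, r ^ (μ - 1) * Real.exp (-r - X / r)

theorem integrableOn_besselN_of_pos {μ : ℝ} (hμ : 0 < μ) {X : ℝ} (hX : 0 ≤ X) :
    IntegrableOn (fun r : ℝ => r ^ (μ - 1) * Real.exp (-r - X / r)) (Set.Ioi 0) := by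
  have h := Real.GammaIntegral_convergent hμ
  refine Integrable.mono' h ?_ ?_
  · exact (Measurable.aestronglyMeasurable (by fun_prop))
  · rw [ae_restrict_iff' measurableSet_Ioi]
    refine Filter.Eventually.of_forall fun r (hr : 0 < r) => ?_
    rw [Real.norm_of_nonneg (by positivity), mul_comm]
    gcongr
    have : 0 ≤ X / r := by positivity
    linarith

/-- Near r = 0 the factor e^{-X/r} is at most k!(r/X)^k; with k > -μ this reduces to a Gamma
integral. -/
theorem integrableOn_besselN (μ : ℝ) {X : ℝ} (hX : 0 < X) :
    IntegrableOn (fun r : ℝ => r ^ (μ - 1) * Real.exp (-r - X / r)) (Set.Ioi 0) := by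
  obtain ⟨k, hk⟩ := exists_nat_gt (-μ)
  have h := (Real.GammaIntegral_convergent (by linarith : 0 < μ + k)).const_mul
    (k.factorial / X ^ k)
  refine Integrable.mono' h ?_ ?_
  · exact (Measurable.aestronglyMeasurable (by fun_prop))
  · rw [ae_restrict_iff' measurableSet_Ioi]
    refine Filter.Eventually.of_forall fun r (hr : 0 < r) => ?_
    rw [Real.norm_of_nonneg (by positivity), sub_eq_add_neg (-r), Real.exp_add, Real.exp_neg (X / r)]
    have h1 := Real.pow_div_factorial_le_exp (X / r) (by positivity) k
    calc r ^ (μ - 1) * (Real.exp (-r) * (Real.exp (X / r))⁻¹)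
        ≤ r ^ (μ - 1) * (Real.exp (-r) * ((X / r) ^ k / k.factorial)⁻¹) := by gcongr
      _ = k.factorial / X ^ k * (Real.exp (-r) * (r ^ (μ - 1) * r ^ k)) := by
          rw [div_pow]; field_simp
      _ = _ := by
          rw [← Real.rpow_natCast r k, ← Real.rpow_add hr]
          congr 3; ring

theorem besselN_nonneg (μ X : ℝ) : 0 ≤ besselN μ X := by
  refine setIntegral_nonneg measurableSet_Ioi fun r (hr : 0 < r) => by positivity

theorem rpow_mul_exp_neg_le_one {t u : ℝ} (ht0 : 0 ≤ t) (ht1 : t ≤ 1) (hu : 0 ≤ u) :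
    u ^ t * Real.exp (-u) ≤ 1 := by
  have h1 : u ^ t ≤ Real.exp u := by
    calc u ^ t ≤ (1 + u) ^ t := Real.rpow_le_rpow hu (by linarith) ht0
      _ ≤ (1 + u) ^ (1 : ℝ) := Real.rpow_le_rpow_of_exponent_le (by linarith) ht1
      _ = u + 1 := by rw [Real.rpow_one, add_comm]
      _ ≤ _ := Real.add_one_le_exp u
  rw [Real.exp_neg, ← div_eq_mul_inv, div_le_one (Real.exp_pos _)]
  exact h1

/-- Inside the integral X^t e^{-X/r} ≤ r^t, which leaves the Gamma integral with exponent μ+t. -/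
theorem rpow_mul_besselN_le {μ t X : ℝ} (hμ : 0 < μ) (ht0 : 0 ≤ t) (ht1 : t ≤ 1) (hX : 0 ≤ X) :
    X ^ t * besselN μ X ≤ Real.Gamma (μ + t) := by
  unfold besselN
  rw [Real.Gamma_eq_integral (by linarith), ← integral_const_mul]
  refine setIntegral_mono_on ((integrableOn_besselN_of_pos hμ hX).const_mul _)
    (Real.GammaIntegral_convergent (by linarith)) measurableSet_Ioi fun r (hr : 0 < r) => ?_
  have h := rpow_mul_exp_neg_le_one ht0 ht1 (by positivity : 0 ≤ X / r)
  have e : X ^ t = (X / r) ^ t * r ^ t := by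
    rw [← Real.mul_rpow (by positivity) hr.le]; congr 1; field_simp
  calc X ^ t * (r ^ (μ - 1) * Real.exp (-r - X / r))
      = Real.exp (-r) * (r ^ (μ - 1) * r ^ t) * ((X / r) ^ t * Real.exp (-(X / r))) := by
        rw [e, sub_eq_add_neg (-r), Real.exp_add]; ring
    _ ≤ Real.exp (-r) * (r ^ (μ - 1) * r ^ t) * 1 := by gcongr
    _ = _ := by
        rw [mul_one, ← Real.rpow_add hr]; congr 2; ring

theorem besselN_le_Gamma {μ X : ℝ} (hμ : 0 < μ) (hX : 0 ≤ X) : besselN μ X ≤ Real.Gamma μ := by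
  simpa using rpow_mul_besselN_le hμ le_rfl zero_le_one hX

/-- Differentiation under the integral; for x > X/2 the derivative is dominated by its value at X/2.
-/
theorem hasDerivAt_besselN (μ : ℝ) {X : ℝ} (hX : 0 < X) :
    HasDerivAt (besselN μ) (-besselN (μ - 1) X) X := by
  have hb := integrableOn_besselN (μ - 1) (by positivity : 0 < X / 2)
  have h := hasDerivAt_integral_of_dominated_loc_of_deriv_le
    (μ := volume.restrict (Set.Ioi (0 : ℝ))) (x₀ := X) (s := Set.Ioi (X / 2))
    (bound := fun r => r ^ (μ - 1 - 1) * Real.exp (-r - X / 2 / r))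
    (F := fun x r => r ^ (μ - 1) * Real.exp (-r - x / r))
    (F' := fun x r => -(r ^ (μ - 1 - 1) * Real.exp (-r - x / r)))
    (Ioi_mem_nhds (by linarith))
    (Filter.Eventually.of_forall fun x => Measurable.aestronglyMeasurable (by fun_prop))
    (integrableOn_besselN μ hX) (Measurable.aestronglyMeasurable (by fun_prop))
    (by
      rw [ae_restrict_iff' measurableSet_Ioi]
      refine Filter.Eventually.of_forall fun r (hr : 0 < r) x (hx : X / 2 < x) => ?_
      rw [norm_neg, Real.norm_of_nonneg (by positivity)]
      gcongr)
    hb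
    (by
      rw [ae_restrict_iff' measurableSet_Ioi]
      refine Filter.Eventually.of_forall fun r (hr : 0 < r) x _ => ?_
      have h1 : HasDerivAt (fun x : ℝ => -r - x / r) (-(1 / r)) x :=
        ((hasDerivAt_id x).div_const r).const_sub (-r)
      convert! h1.exp.const_mul (r ^ (μ - 1)) using 1
      rw [Real.rpow_sub_one hr.ne' (μ - 1)]
      field_simp)
  have e : -besselN (μ - 1) X =
      ∫ r in Set.Ioi 0, -(r ^ (μ - 1 - 1) * Real.exp (-r - X / r)) := by
    rw [integral_neg]; rfl
  rw [e]
  exact h.2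

theorem tendsto_besselN_zero {μ : ℝ} (hμ : 0 < μ) :
    Filter.Tendsto (besselN μ) (nhdsWithin 0 (Set.Ioi 0)) (nhds (Real.Gamma μ)) := by
  rw [Real.Gamma_eq_integral hμ]
  refine tendsto_integral_filter_of_dominated_convergence
    (fun r => Real.exp (-r) * r ^ (μ - 1))
    (Filter.Eventually.of_forall fun x => Measurable.aestronglyMeasurable (by fun_prop)) ?_
    (Real.GammaIntegral_convergent hμ) ?_
  · filter_upwards [self_mem_nhdsWithin] with x (hx : 0 < x)
    rw [ae_restrict_iff' measurableSet_Ioi]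
    refine Filter.Eventually.of_forall fun r (hr : 0 < r) => ?_
    rw [Real.norm_of_nonneg (by positivity), mul_comm]
    gcongr
    have : 0 ≤ x / r := by positivity
    linarith
  · rw [ae_restrict_iff' measurableSet_Ioi]
    refine Filter.Eventually.of_forall fun r (hr : 0 < r) => ?_
    apply tendsto_nhdsWithin_of_tendsto_nhds
    have : Continuous fun x : ℝ => r ^ (μ - 1) * Real.exp (-r - x / r) := by fun_prop
    simpa [mul_comm] using this.tendsto 0

/-- Integration of the derivative of r^μ e^{-r-X/r}, which vanishes at both ends. -/
theorem besselN_add_one {μ X : ℝ} (hμ : 0 < μ) (hX : 0 < X) :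
    besselN (μ + 1) X = μ * besselN μ X + X * besselN (μ - 1) X := by
  have i1 := integrableOn_besselN (μ + 1) hX
  have i2 := integrableOn_besselN μ hX
  have i3 := integrableOn_besselN (μ - 1) hX
  have hlim0 : Filter.Tendsto (fun r : ℝ => r ^ μ * Real.exp (-r - X / r))
      (nhdsWithin 0 (Set.Ici 0)) (nhds 0) := by
    have h1 : Filter.Tendsto (fun r : ℝ => r ^ μ) (nhdsWithin 0 (Set.Ici 0)) (nhds 0) := by
      have := (Real.continuousAt_rpow_const 0 μ (Or.inr hμ.le)).tendsto
      rw [Real.zero_rpow hμ.ne'] at this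
      exact tendsto_nhdsWithin_of_tendsto_nhds this
    refine squeeze_zero' ?_ ?_ h1
    · filter_upwards [self_mem_nhdsWithin] with r (hr : 0 ≤ r)
      positivity
    · filter_upwards [self_mem_nhdsWithin] with r (hr : 0 ≤ r)
      refine mul_le_of_le_one_right (by positivity) (Real.exp_le_one_iff.2 ?_)
      have : 0 ≤ X / r := by positivity
      linarith
  have hlim : Filter.Tendsto (fun r : ℝ => r ^ μ * Real.exp (-r - X / r)) Filter.atTop (nhds 0) := by
    refine squeeze_zero' ?_ ?_ (tendsto_rpow_mul_exp_neg_mul_atTop_nhds_zero μ 1 one_pos)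
    · filter_upwards [Filter.eventually_gt_atTop 0] with r hr
      positivity
    · filter_upwards [Filter.eventually_gt_atTop 0] with r hr
      gcongr
      have : 0 ≤ X / r := by positivity
      linarith
  have hintg : IntegrableOn (fun r : ℝ => μ * (r ^ (μ - 1) * Real.exp (-r - X / r)) +
      X * (r ^ (μ - 1 - 1) * Real.exp (-r - X / r)) -
      r ^ (μ + 1 - 1) * Real.exp (-r - X / r)) (Set.Ioi 0) :=
    ((i2.const_mul μ).add (i3.const_mul X)).sub i1
  have h := integral_Ioi_of_hasDerivAt_of_tendsto (a := 0)
    (f := fun r : ℝ => r ^ μ * Real.exp (-r - X / r)) (m := 0)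
    (by
      rw [ContinuousWithinAt]
      simpa [Real.zero_rpow hμ.ne'] using hlim0)
    (fun r (hr : 0 < r) => by
      have h1 : HasDerivAt (fun r : ℝ => -r - X / r) (-1 - (-(X / r ^ 2))) r := by
        have h3 : HasDerivAt (fun r : ℝ => X / r) (-(X / r ^ 2)) r := by
          have := (hasDerivAt_inv hr.ne').const_mul X
          convert! this using 1
          field_simp
        exact (hasDerivAt_id r).neg.sub h3
      have h2 : HasDerivAt (fun r : ℝ => r ^ μ) (μ * r ^ (μ - 1)) r :=
        Real.hasDerivAt_rpow_const (Or.inl hr.ne')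
      have h4 := h2.mul h1.exp
      have e : μ * (r ^ (μ - 1) * Real.exp (-r - X / r)) +
          X * (r ^ (μ - 1 - 1) * Real.exp (-r - X / r)) -
          r ^ (μ + 1 - 1) * Real.exp (-r - X / r) = μ * r ^ (μ - 1) * Real.exp (-r - X / r) +
          r ^ μ * (Real.exp (-r - X / r) * (-1 - -(X / r ^ 2))) := by
        rw [add_sub_cancel_right, Real.rpow_sub_one hr.ne' (μ - 1), Real.rpow_sub_one hr.ne']
        field_simp
        ring
      rw [e]
      exact h4)
    hintg hlim
  have i23 : IntegrableOn (fun r : ℝ => μ * (r ^ (μ - 1) * Real.exp (-r - X / r)) +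
      X * (r ^ (μ - 1 - 1) * Real.exp (-r - X / r))) (Set.Ioi 0) :=
    (i2.const_mul μ).add (i3.const_mul X)
  rw [integral_sub i23 i1,
    integral_add (i2.const_mul μ) (i3.const_mul X), integral_const_mul, integral_const_mul] at h
  simp only [Real.zero_rpow hμ.ne', zero_mul, sub_zero] at h
  unfold besselN
  linarith

/-- The substitution r ↦ X/r exchanges the two terms of the exponent. -/
theorem besselN_neg (μ : ℝ) {X : ℝ} (hX : 0 < X) : besselN (-μ) X = X ^ (-μ) * besselN μ X := by
  unfold besselN
  set g : ℝ → ℝ := fun r => r ^ (-μ - 1) * Real.exp (-r - X / r) with hg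
  have h1 : ∫ r in Set.Ioi 0, g r = X * ∫ r in Set.Ioi 0, g (X * r) := by
    rw [integral_comp_mul_left_Ioi g 0 hX, mul_zero, smul_eq_mul, ← mul_assoc,
      mul_inv_cancel₀ hX.ne', one_mul]
  have h2 := integral_comp_rpow_Ioi (fun r => g (X * r)) (by norm_num : (-1 : ℝ) ≠ 0)
  rw [h1, ← h2, ← integral_const_mul, ← integral_const_mul]
  refine setIntegral_congr_fun measurableSet_Ioi fun r (hr : 0 < r) => ?_
  simp only [hg, smul_eq_mul, abs_neg, abs_one, one_mul, Real.rpow_neg_one]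
  have e1 : X * r⁻¹ = X / r := (div_eq_mul_inv _ _).symm
  have e2 : -(X / r) - X / (X / r) = -r - X / r := by field_simp; ring
  rw [e1, e2, Real.div_rpow hX.le hr.le]
  have e3 : X ^ (-μ - 1) = X ^ (-μ) / X := Real.rpow_sub_one hX.ne' _
  have e4 : r ^ ((-1 : ℝ) - 1) / r ^ (-μ - 1) = r ^ (μ - 1) := by
    rw [← Real.rpow_sub hr]; congr 1; ring
  rw [← e4, e3]
  field_simp

/-! ### Laplace representations -/

/-- `F` is the Laplace transform of a measure on `(0, ∞)`. -/
def IsLaplace (F : ℝ → ℝ≥0∞) : Prop :=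
  ∃ m : Measure ℝ, SFinite m ∧ (∀ᵐ a ∂m, 0 < a) ∧
    ∀ X, 0 < X → F X = ∫⁻ a, ENNReal.ofReal (Real.exp (-(a * X))) ∂m

theorem lintegral_rpow_mul_exp_neg {c X : ℝ} (hc : 0 < c) (hX : 0 < X) :
    ∫⁻ t in Set.Ioi 0, ENNReal.ofReal (t ^ (c - 1) * Real.exp (-(X * t))) =
      ENNReal.ofReal (X ^ (-c) * Real.Gamma c) := by
  have h := Real.integral_rpow_mul_exp_neg_mul_Ioi hc hX
  rw [one_div, Real.inv_rpow hX.le, ← Real.rpow_neg hX.le] at h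
  rw [← h, ofReal_integral_eq_lintegral_ofReal]
  · have hi : ∫ t in Set.Ioi 0, t ^ (c - 1) * Real.exp (-(X * t)) ≠ 0 := by
      rw [h]
      have := Real.Gamma_pos_of_pos hc
      positivity
    exact not_not.1 fun hn => hi (integral_undef hn)
  · rw [Filter.EventuallyLE, ae_restrict_iff' measurableSet_Ioi]
    exact Filter.Eventually.of_forall fun t (ht : 0 < t) => by
      simp only [Pi.zero_apply]; positivity

theorem isLaplace_exp_neg : IsLaplace fun X => ENNReal.ofReal (Real.exp (-X)) := by
  refine ⟨Measure.dirac 1, inferInstance, ?_, fun X _ => ?_⟩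
  · rw [ae_dirac_iff measurableSet_Ioi]; norm_num
  · rw [lintegral_dirac]; simp

theorem isLaplace_rpow_neg {c : ℝ} (hc : 0 < c) : IsLaplace fun X => ENNReal.ofReal (X ^ (-c)) := by
  have hG := Real.Gamma_pos_of_pos hc
  refine ⟨(volume.restrict (Set.Ioi 0)).withDensity fun t =>
    ENNReal.ofReal ((Real.Gamma c)⁻¹ * t ^ (c - 1)), inferInstance, ?_, fun X hX => ?_⟩
  · refine (withDensity_absolutelyContinuous _ _).ae_le ?_
    exact ae_restrict_mem measurableSet_Ioi
  · beta_reduce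
    rw [lintegral_withDensity_eq_lintegral_mul _ (by fun_prop) (by fun_prop)]
    have e : X ^ (-c) = (Real.Gamma c)⁻¹ * (X ^ (-c) * Real.Gamma c) := by field_simp
    rw [e, ENNReal.ofReal_mul (by positivity), ← lintegral_rpow_mul_exp_neg hc hX,
      ← lintegral_const_mul' _ _ (by simp)]
    refine setLIntegral_congr_fun measurableSet_Ioi fun t (ht : 0 < t) => ?_
    simp only [Pi.mul_apply]
    rw [← ENNReal.ofReal_mul (by positivity), ← ENNReal.ofReal_mul (by positivity), mul_comm t X]
    congr 1; ring

/-- The defining integral is already a Laplace transform in the variable a = 1/r. -/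
theorem isLaplace_besselN (μ : ℝ) : IsLaplace fun X => ENNReal.ofReal (besselN μ X) := by
  set m : Measure ℝ := (volume.restrict (Set.Ioi 0)).withDensity fun r =>
    ENNReal.ofReal (r ^ (μ - 1) * Real.exp (-r)) with hm
  have hm0 : ∀ᵐ r ∂m, 0 < r := by
    refine (withDensity_absolutelyContinuous _ _).ae_le ?_
    exact ae_restrict_mem measurableSet_Ioi
  refine ⟨m.map (fun r => r⁻¹), inferInstance, ?_, fun X hX => ?_⟩
  · rw [ae_map_iff (by fun_prop) measurableSet_Ioi]
    filter_upwards [hm0] with r hr using inv_pos.2 hr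
  · beta_reduce
    rw [lintegral_map (by fun_prop) (by fun_prop), hm,
      lintegral_withDensity_eq_lintegral_mul _ (by fun_prop) (by fun_prop)]
    unfold besselN
    rw [ofReal_integral_eq_lintegral_ofReal (integrableOn_besselN μ hX)]
    · refine setLIntegral_congr_fun measurableSet_Ioi fun r (hr : 0 < r) => ?_
      simp only [Pi.mul_apply]
      rw [← ENNReal.ofReal_mul (by positivity), mul_assoc, ← Real.exp_add]
      congr 3
      field_simp
      ring
    · rw [Filter.EventuallyLE, ae_restrict_iff' measurableSet_Ioi]
      exact Filter.Eventually.of_forall fun t (ht : 0 < t) => by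
        simp only [Pi.zero_apply]; positivity

theorem IsLaplace.mul {F G : ℝ → ℝ≥0∞} (hF : IsLaplace F) (hG : IsLaplace G) :
    IsLaplace fun X => F X * G X := by
  obtain ⟨m, hm, hm0, hmF⟩ := hF
  obtain ⟨n, hn, hn0, hnG⟩ := hG
  refine ⟨(m.prod n).map (fun a => a.1 + a.2), inferInstance, ?_, fun X hX => ?_⟩
  · rw [ae_map_iff (by fun_prop) measurableSet_Ioi]
    filter_upwards [Measure.quasiMeasurePreserving_fst.ae hm0,
      Measure.quasiMeasurePreserving_snd.ae hn0] with a h1 h2 using add_pos h1 h2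
  · simp only
    rw [lintegral_map (by fun_prop) (by fun_prop), hmF X hX, hnG X hX,
      ← lintegral_prod_mul (by fun_prop) (by fun_prop)]
    refine lintegral_congr fun a => ?_
    rw [← ENNReal.ofReal_mul (by positivity), ← Real.exp_add]
    congr 2; ring

/-- The measure must be reweighted by a^{-n/2}. Since ∫ X^{n/2-1} e^{-aX} dX = Γ(n/2) a^{-n/2},
Tonelli identifies its total mass with the integral in `hfin` divided by Γ(n/2). -/
theorem IsLaplace.laplaceRep {F : ℝ → ℝ≥0∞} (hF : IsLaplace F) {n : ℕ} (hn : n ≠ 0)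
    (hfin : ∫⁻ X in Set.Ioi 0, F X * ENNReal.ofReal (X ^ ((n : ℝ) / 2 - 1)) ≠ ⊤) :
    LaplaceRep n fun X => (F X).toReal := by
  obtain ⟨m, hm, hm0, hmF⟩ := hF
  have hn2 : 0 < (n : ℝ) / 2 := by positivity
  have hG := Real.Gamma_pos_of_pos hn2
  have hsq : ∀ a : ℝ, 0 < a → (Real.sqrt a ^ n)⁻¹ = a ^ (-((n : ℝ) / 2)) := by
    intro a ha
    rw [Real.sqrt_eq_rpow, ← Real.rpow_natCast, ← Real.rpow_mul ha.le, Real.rpow_neg ha.le]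
    congr 2; ring
  have hmass : ∫⁻ a, ENNReal.ofReal (Real.sqrt a ^ n)⁻¹ ∂m ≠ ⊤ := by
    have e1 : ∫⁻ X in Set.Ioi 0, F X * ENNReal.ofReal (X ^ ((n : ℝ) / 2 - 1)) =
        ENNReal.ofReal (Real.Gamma (n / 2)) * ∫⁻ a, ENNReal.ofReal (Real.sqrt a ^ n)⁻¹ ∂m := by
      calc _ = ∫⁻ X in Set.Ioi 0, (∫⁻ a, ENNReal.ofReal (X ^ ((n : ℝ) / 2 - 1)) *
            ENNReal.ofReal (Real.exp (-(a * X))) ∂m) := by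
            refine setLIntegral_congr_fun measurableSet_Ioi fun X (hX : 0 < X) => ?_
            beta_reduce
            rw [lintegral_const_mul' _ _ (by simp), hmF X hX, mul_comm]
        _ = ∫⁻ a, (∫⁻ X in Set.Ioi 0, ENNReal.ofReal (X ^ ((n : ℝ) / 2 - 1)) *
            ENNReal.ofReal (Real.exp (-(a * X)))) ∂m :=
            lintegral_lintegral_swap (Measurable.aemeasurable (by
              unfold Function.uncurry; fun_prop))
        _ = ∫⁻ a, ENNReal.ofReal (Real.Gamma (n / 2)) * ENNReal.ofReal (Real.sqrt a ^ n)⁻¹ ∂m := by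
            refine lintegral_congr_ae ?_
            filter_upwards [hm0] with a ha
            rw [hsq a ha, ← ENNReal.ofReal_mul hG.le, mul_comm (Real.Gamma _),
              ← lintegral_rpow_mul_exp_neg hn2 ha]
            refine setLIntegral_congr_fun measurableSet_Ioi fun X (hX : 0 < X) => ?_
            beta_reduce
            rw [ENNReal.ofReal_mul (by positivity)]
        _ = _ := lintegral_const_mul' _ _ (by simp)
    rw [e1] at hfin
    exact fun h => hfin (by rw [h, ENNReal.mul_top]; simpa using hG)
  refine ⟨m.withDensity fun a => ENNReal.ofReal (Real.sqrt a ^ n)⁻¹,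
    isFiniteMeasure_withDensity hmass, (withDensity_absolutelyContinuous _ _).ae_le hm0,
    fun X hX => ?_⟩
  beta_reduce
  rw [integral_eq_lintegral_of_nonneg_ae (Filter.Eventually.of_forall fun a => by
      simp only [Pi.zero_apply]; positivity) (Measurable.aestronglyMeasurable (by fun_prop)),
    lintegral_withDensity_eq_lintegral_mul _ (by fun_prop) (by fun_prop), hmF X hX]
  congr 1
  refine lintegral_congr_ae ?_
  filter_upwards [hm0] with a ha
  simp only [Pi.mul_apply]
  have : 0 < Real.sqrt a := Real.sqrt_pos.2 ha
  rw [← ENNReal.ofReal_mul (by positivity), ← mul_assoc, inv_mul_cancel₀ (by positivity), one_mul]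

/-- No reweighting is needed when n = 0: the total mass is the limit of F at 0, by monotone
convergence, and is at most the bound of F. -/
theorem IsLaplace.laplaceRep_zero {F : ℝ → ℝ≥0∞} (hF : IsLaplace F) {B : ℝ≥0}
    (hB : ∀ X, 0 < X → F X ≤ B) : LaplaceRep 0 fun X => (F X).toReal := by
  obtain ⟨m, hm, hm0, hmF⟩ := hF
  have hmass : m Set.univ ≤ B := by
    rw [← lintegral_one]
    calc ∫⁻ _, 1 ∂m ≤ ∫⁻ a, ⨆ k : ℕ, ENNReal.ofReal (Real.exp (-(max a 0 * (1 / (k + 1))))) ∂m := by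
          refine lintegral_mono fun a => ?_
          have ht : Filter.Tendsto (fun k : ℕ =>
              ENNReal.ofReal (Real.exp (-(max a 0 * (1 / ((k : ℝ) + 1)))))) Filter.atTop
              (nhds 1) := by
            have h1 := (tendsto_one_div_add_atTop_nhds_zero_nat (𝕜 := ℝ)).const_mul (max a 0)
            have h2 := (Real.continuous_exp.tendsto _).comp h1.neg
            have h3 := (ENNReal.continuous_ofReal.tendsto _).comp h2
            simpa [Function.comp_def] using h3
          exact le_of_tendsto' ht fun k => le_iSup (fun k : ℕ =>
            ENNReal.ofReal (Real.exp (-(max a 0 * (1 / ((k : ℝ) + 1)))))) k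
      _ = ⨆ k : ℕ, ∫⁻ a, ENNReal.ofReal (Real.exp (-(max a 0 * (1 / (k + 1))))) ∂m := by
          refine lintegral_iSup (fun k => by fun_prop) ?_
          intro j k hjk a
          apply ENNReal.ofReal_le_ofReal
          apply Real.exp_le_exp.2
          apply neg_le_neg
          have : (j : ℝ) ≤ k := by exact_mod_cast hjk
          gcongr
      _ ≤ B := by
          refine iSup_le fun k => ?_
          refine le_trans (le_of_eq ?_) (hB (1 / ((k : ℝ) + 1)) (by positivity))
          rw [hmF _ (by positivity)]
          refine lintegral_congr_ae ?_
          filter_upwards [hm0] with a ha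
          rw [max_eq_left ha.le]
  refine ⟨m, ⟨hmass.trans_lt ENNReal.coe_lt_top⟩, hm0, fun X hX => ?_⟩
  beta_reduce
  rw [integral_eq_lintegral_of_nonneg_ae (Filter.Eventually.of_forall fun a => by
      simp only [Pi.zero_apply]; positivity) (Measurable.aestronglyMeasurable (by fun_prop)),
    hmF X hX]
  simp

theorem LaplaceRep.congr {n : ℕ} {F G : ℝ → ℝ} (hF : LaplaceRep n F)
    (h : ∀ X, 0 < X → G X = F X) : LaplaceRep n G := by
  obtain ⟨ρ, h1, h2, h3⟩ := hF
  exact ⟨ρ, h1, h2, fun X hX => (h X hX).trans (h3 X hX)⟩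

theorem laplaceRep_exp_neg (n : ℕ) : LaplaceRep n fun X => Real.exp (-X) := by
  refine ⟨Measure.dirac 1, inferInstance, ?_, fun X _ => ?_⟩
  · rw [ae_dirac_iff measurableSet_Ioi]; norm_num
  · rw [integral_dirac]; simp

theorem laplaceRep_rpow_mul_exp_neg {n : ℕ} {c : ℝ} (hc : 0 ≤ c) (hn : 2 * c < n) :
    LaplaceRep n fun X => X ^ (-c) * Real.exp (-X) := by
  rcases hc.eq_or_lt with rfl | hc0
  · exact (laplaceRep_exp_neg n).congr fun X hX => by simp
  have hn0 : n ≠ 0 := by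
    rintro rfl; push_cast at hn; linarith
  refine (((isLaplace_rpow_neg hc0).mul isLaplace_exp_neg).laplaceRep hn0 ?_).congr
    fun X hX => ?_
  · have h := lintegral_rpow_mul_exp_neg (c := (n : ℝ) / 2 - c) (X := 1) (by linarith) one_pos
    refine ne_of_eq_of_ne ?_ (ne_of_eq_of_ne h ENNReal.ofReal_ne_top)
    refine setLIntegral_congr_fun measurableSet_Ioi fun X (hX : 0 < X) => ?_
    beta_reduce
    rw [← ENNReal.ofReal_mul (by positivity), ← ENNReal.ofReal_mul (by positivity),
      mul_right_comm, ← Real.rpow_add hX, one_mul]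
    congr 3; ring
  · rw [← ENNReal.ofReal_mul (by positivity), ENNReal.toReal_ofReal (by positivity)]

/-- Integrating first in X gives the Mellin transform Γ(d)Γ(μ+d). This is what limits the powers
that can be absorbed in `laplaceRep_rpow_mul_besselN`. -/
theorem lintegral_besselN_mul_rpow {μ d : ℝ} (hd : 0 < d) (hμd : 0 < μ + d) :
    ∫⁻ X in Set.Ioi 0, ENNReal.ofReal (besselN μ X * X ^ (d - 1)) ≠ ⊤ := by
  have e : ∫⁻ X in Set.Ioi 0, ENNReal.ofReal (besselN μ X * X ^ (d - 1)) =
      ∫⁻ r in Set.Ioi 0, ENNReal.ofReal (Real.Gamma d) *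
        ENNReal.ofReal (r ^ (μ + d - 1) * Real.exp (-(1 * r))) := by
    calc _ = ∫⁻ X in Set.Ioi 0, ∫⁻ r in Set.Ioi 0, ENNReal.ofReal (X ^ (d - 1)) *
          ENNReal.ofReal (r ^ (μ - 1) * Real.exp (-r - X / r)) := by
          refine setLIntegral_congr_fun measurableSet_Ioi fun X (hX : 0 < X) => ?_
          beta_reduce
          rw [lintegral_const_mul' _ _ (by simp), mul_comm, ENNReal.ofReal_mul (by positivity)]
          congr 1
          unfold besselN
          rw [ofReal_integral_eq_lintegral_ofReal (integrableOn_besselN μ hX)]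
          rw [Filter.EventuallyLE, ae_restrict_iff' measurableSet_Ioi]
          exact Filter.Eventually.of_forall fun t (ht : 0 < t) => by
            simp only [Pi.zero_apply]; positivity
      _ = ∫⁻ r in Set.Ioi 0, ∫⁻ X in Set.Ioi 0, ENNReal.ofReal (X ^ (d - 1)) *
          ENNReal.ofReal (r ^ (μ - 1) * Real.exp (-r - X / r)) :=
          lintegral_lintegral_swap (Measurable.aemeasurable (by
              unfold Function.uncurry; fun_prop))
      _ = _ := by
          refine setLIntegral_congr_fun measurableSet_Ioi fun r (hr : 0 < r) => ?_
          beta_reduce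
          have hr' : 0 < r⁻¹ := inv_pos.2 hr
          have h1 := lintegral_rpow_mul_exp_neg hd hr'
          calc _ = ∫⁻ X in Set.Ioi 0, ENNReal.ofReal (r ^ (μ - 1) * Real.exp (-r)) *
                ENNReal.ofReal (X ^ (d - 1) * Real.exp (-(r⁻¹ * X))) := by
                refine setLIntegral_congr_fun measurableSet_Ioi fun X (hX : 0 < X) => ?_
                beta_reduce
                rw [← ENNReal.ofReal_mul (by positivity), ← ENNReal.ofReal_mul (by positivity)]
                congr 1
                rw [sub_eq_add_neg (-r), Real.exp_add, show r⁻¹ * X = X / r by field_simp]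
                ring
            _ = _ := by
                rw [lintegral_const_mul' _ _ (by simp), h1,
                  ← ENNReal.ofReal_mul (by positivity),
                  ← ENNReal.ofReal_mul (Real.Gamma_pos_of_pos hd).le]
                congr 1
                rw [Real.inv_rpow hr.le, Real.rpow_neg hr.le, inv_inv, one_mul,
                  show μ + d - 1 = (μ - 1) + d by ring, Real.rpow_add hr]
                ring
  rw [e, lintegral_const_mul' _ _ (by simp), lintegral_rpow_mul_exp_neg hμd one_pos]
  exact ENNReal.mul_ne_top ENNReal.ofReal_ne_top ENNReal.ofReal_ne_top

theorem laplaceRep_rpow_mul_besselN {n : ℕ} {c μ : ℝ} (hc : 0 ≤ c) (hn : 2 * c < n)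
    (hμ : 0 < μ + (n / 2 - c)) : LaplaceRep n fun X => X ^ (-c) * besselN μ X := by
  have hn0 : n ≠ 0 := by
    rintro rfl; push_cast at hn; linarith
  have hfin := lintegral_besselN_mul_rpow (μ := μ) (d := n / 2 - c) (by linarith) hμ
  rcases hc.eq_or_lt with rfl | hc0
  · refine ((isLaplace_besselN μ).laplaceRep hn0 ?_).congr fun X hX => ?_
    · refine ne_of_eq_of_ne ?_ hfin
      refine setLIntegral_congr_fun measurableSet_Ioi fun X (hX : 0 < X) => ?_
      beta_reduce
      rw [← ENNReal.ofReal_mul (besselN_nonneg _ _), sub_zero]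
    · rw [ENNReal.toReal_ofReal (besselN_nonneg _ _)]; simp
  · refine (((isLaplace_rpow_neg hc0).mul (isLaplace_besselN μ)).laplaceRep hn0 ?_).congr
      fun X hX => ?_
    · refine ne_of_eq_of_ne ?_ hfin
      refine setLIntegral_congr_fun measurableSet_Ioi fun X (hX : 0 < X) => ?_
      beta_reduce
      have := besselN_nonneg μ X
      rw [← ENNReal.ofReal_mul (by positivity), ← ENNReal.ofReal_mul (by positivity)]
      congr 1
      rw [mul_comm (X ^ (-c)), mul_assoc, ← Real.rpow_add hX]
      congr 2; ring
    · have := besselN_nonneg μ X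
      rw [← ENNReal.ofReal_mul (by positivity), ENNReal.toReal_ofReal (by positivity)]

theorem laplaceRep_besselN_zero {μ : ℝ} (hμ : 0 < μ) : LaplaceRep 0 (besselN μ) := by
  refine ((isLaplace_besselN μ).laplaceRep_zero (B := (Real.Gamma μ).toNNReal)
    fun X hX => ENNReal.ofReal_le_ofReal (besselN_le_Gamma hμ hX.le)).congr fun X hX => ?_
  rw [ENNReal.toReal_ofReal (besselN_nonneg _ _)]

/-! ### A Wronskian identity -/

/-- The Wronskian-type expression of `N_ν(τX)` and `N_ν(τY)`. -/
noncomputable def besselW (ν X Y τ : ℝ) : ℝ :=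
  τ ^ (-ν) * (besselN (ν + 1) (τ * X) * besselN ν (τ * Y) -
    besselN ν (τ * X) * besselN (ν + 1) (τ * Y))

theorem hasDerivAt_besselN_mul (μ : ℝ) {X τ : ℝ} (hX : 0 < X) (hτ : 0 < τ) :
    HasDerivAt (fun t => besselN μ (t * X)) (-(X * besselN (μ - 1) (τ * X))) τ := by
  have h := (hasDerivAt_besselN μ (mul_pos hτ hX)).comp τ ((hasDerivAt_id τ).mul_const X)
  refine h.congr_deriv ?_
  ring

/-- With N_μ' = -N_{μ-1} and the recurrence for N_{ν+1}, all terms cancel except those with N_ν(τX)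
N_ν(τY). -/
theorem hasDerivAt_besselW {ν X Y τ : ℝ} (hν : 0 < ν) (hX : 0 < X) (hY : 0 < Y) (hτ : 0 < τ) :
    HasDerivAt (besselW ν X Y)
      (-(τ ^ (-ν) * ((X - Y) * (besselN ν (τ * X) * besselN ν (τ * Y))))) τ := by
  have h1 := hasDerivAt_besselN_mul (ν + 1) hX hτ
  have h2 := hasDerivAt_besselN_mul (ν + 1) hY hτ
  have h3 := hasDerivAt_besselN_mul ν hX hτ
  have h4 := hasDerivAt_besselN_mul ν hY hτ
  rw [add_sub_cancel_right] at h1 h2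
  have h5 := Real.hasDerivAt_rpow_const (x := τ) (p := -ν) (Or.inl hτ.ne')
  have r1 := besselN_add_one hν (mul_pos hτ hX)
  have r2 := besselN_add_one hν (mul_pos hτ hY)
  refine (h5.mul ((h1.mul h4).sub (h3.mul h2))).congr_deriv ?_
  have e : τ ^ (-ν) = τ * τ ^ (-ν - 1) := by
    rw [show -ν = 1 + (-ν - 1) by ring, Real.rpow_add hτ, Real.rpow_one,
      show 1 + (-ν - 1) - 1 = -ν - 1 by ring]
  simp only [Pi.mul_apply, Pi.sub_apply]
  rw [e, r1, r2]
  ring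

/-- The recurrence removes the terms ν N_ν N_ν, and the reflection formula trades τ^{-ν} for X^ν or
Y^ν. In this form nothing is singular at τ = 0, so both the uniform bound and the limit can be read
off. -/
theorem besselW_eq {ν X Y τ : ℝ} (hν : 0 < ν) (hX : 0 < X) (hY : 0 < Y) (hτ : 0 < τ) :
    besselW ν X Y τ = X ^ ν * besselN (1 - ν) (τ * X) * besselN ν (τ * Y) -
      Y ^ ν * besselN ν (τ * X) * besselN (1 - ν) (τ * Y) := by
  have key : ∀ {W : ℝ}, 0 < W → τ ^ (-ν) * (τ * W * besselN (ν - 1) (τ * W)) =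
      W ^ ν * besselN (1 - ν) (τ * W) := by
    intro W hW
    rw [show ν - 1 = -(1 - ν) by ring, besselN_neg _ (mul_pos hτ hW), neg_sub,
      Real.rpow_sub_one (mul_pos hτ hW).ne', Real.mul_rpow hτ.le hW.le, Real.rpow_neg hτ.le]
    field_simp
  unfold besselW
  rw [besselN_add_one hν (mul_pos hτ hX), besselN_add_one hν (mul_pos hτ hY), mul_right_comm (Y ^ ν), ← key hX,
    ← key hY]
  ring

theorem abs_besselW_le {ν X Y τ : ℝ} (hν : 0 < ν) (hν1 : ν < 1) (hX : 0 < X) (hY : 0 < Y)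
    (hτ : 0 < τ) :
    |besselW ν X Y τ| ≤ Real.Gamma ν * Real.Gamma (1 - ν) * (X ^ ν + Y ^ ν) := by
  rw [besselW_eq hν hX hY hτ]
  have n := besselN_nonneg
  have hν' : 0 < 1 - ν := by linarith
  have b1 := besselN_le_Gamma hν (mul_pos hτ hX).le
  have b2 := besselN_le_Gamma hν (mul_pos hτ hY).le
  have b3 := besselN_le_Gamma hν' (mul_pos hτ hX).le
  have b4 := besselN_le_Gamma hν' (mul_pos hτ hY).le
  have hX' := Real.rpow_nonneg hX.le ν
  have hY' := Real.rpow_nonneg hY.le ν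
  have G1 := (Real.Gamma_pos_of_pos hν).le
  have G2 := (Real.Gamma_pos_of_pos hν').le
  have c1 : X ^ ν * besselN (1 - ν) (τ * X) * besselN ν (τ * Y) ≤
      X ^ ν * Real.Gamma (1 - ν) * Real.Gamma ν :=
    mul_le_mul (mul_le_mul_of_nonneg_left b3 hX') b2 (n _ _) (mul_nonneg hX' G2)
  have c2 : Y ^ ν * besselN ν (τ * X) * besselN (1 - ν) (τ * Y) ≤
      Y ^ ν * Real.Gamma ν * Real.Gamma (1 - ν) :=
    mul_le_mul (mul_le_mul_of_nonneg_left b1 hY') b4 (n _ _) (mul_nonneg hY' G1)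
  have c3 := mul_nonneg (mul_nonneg hX' (n (1 - ν) (τ * X))) (n ν (τ * Y))
  have c4 := mul_nonneg (mul_nonneg hY' (n ν (τ * X))) (n (1 - ν) (τ * Y))
  rw [abs_le]
  constructor <;> nlinarith

theorem tendsto_besselN_mul_zero {μ X : ℝ} (hμ : 0 < μ) (hX : 0 < X) :
    Filter.Tendsto (fun τ => besselN μ (τ * X)) (nhdsWithin 0 (Set.Ioi 0))
      (nhds (Real.Gamma μ)) := by
  refine (tendsto_besselN_zero hμ).comp ?_
  refine tendsto_nhdsWithin_iff.2 ⟨?_, ?_⟩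
  · have : Filter.Tendsto (fun τ : ℝ => τ * X) (nhds 0) (nhds (0 * X)) :=
      (continuous_id.mul continuous_const).tendsto 0
    rw [zero_mul] at this
    exact this.mono_left nhdsWithin_le_nhds
  · filter_upwards [self_mem_nhdsWithin] with τ hτ using mul_pos hτ hX

theorem tendsto_besselW_zero {ν X Y : ℝ} (hν : 0 < ν) (hν1 : ν < 1) (hX : 0 < X) (hY : 0 < Y) :
    Filter.Tendsto (besselW ν X Y) (nhdsWithin 0 (Set.Ioi 0))
      (nhds (Real.Gamma ν * Real.Gamma (1 - ν) * (X ^ ν - Y ^ ν))) := by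
  have hν' : 0 < 1 - ν := by linarith
  have h := (((tendsto_besselN_mul_zero hν' hX).const_mul (X ^ ν)).mul
    (tendsto_besselN_mul_zero hν hY)).sub
    (((tendsto_besselN_mul_zero hν hX).const_mul (Y ^ ν)).mul (tendsto_besselN_mul_zero hν' hY))
  rw [show Real.Gamma ν * Real.Gamma (1 - ν) * (X ^ ν - Y ^ ν) =
    X ^ ν * Real.Gamma (1 - ν) * Real.Gamma ν - Y ^ ν * Real.Gamma ν * Real.Gamma (1 - ν) by ring]
  refine h.congr' ?_
  filter_upwards [self_mem_nhdsWithin] with τ hτ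
  rw [besselW_eq hν hX hY hτ]

/-- The kernel `e^{-τZ} N_μ(τX) N_μ'(τY)`. -/
noncomputable def besselE (μ μ' X Y Z τ : ℝ) : ℝ :=
  Real.exp (-(τ * Z)) * besselN μ' (τ * Y) * besselN μ (τ * X)

theorem besselE_nonneg (μ μ' X Y Z τ : ℝ) : 0 ≤ besselE μ μ' X Y Z τ :=
  mul_nonneg (mul_nonneg (Real.exp_pos _).le (besselN_nonneg _ _)) (besselN_nonneg _ _)

theorem continuousOn_besselE (μ μ' : ℝ) {X Y : ℝ} (Z : ℝ) (hX : 0 < X) (hY : 0 < Y) :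
    ContinuousOn (besselE μ μ' X Y Z) (Set.Ioi 0) := by
  have h : ∀ (μ : ℝ) {W : ℝ}, 0 < W → ContinuousOn (fun τ => besselN μ (τ * W)) (Set.Ioi 0) :=
    fun μ W hW τ hτ => (hasDerivAt_besselN_mul μ hW hτ).continuousAt.continuousWithinAt
  unfold besselE
  exact (((by fun_prop : Continuous fun τ : ℝ => Real.exp (-(τ * Z))).continuousOn).mul
    (h μ' hY)).mul (h μ hX)

theorem intervalIntegrable_rpow_mul_besselE (c μ μ' : ℝ) {X Y δ R : ℝ} (Z : ℝ) (hX : 0 < X)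
    (hY : 0 < Y) (hδ : 0 < δ) (hR : δ ≤ R) :
    IntervalIntegrable (fun τ => τ ^ c * besselE μ μ' X Y Z τ) volume δ R := by
  refine ContinuousOn.intervalIntegrable ?_
  rw [Set.uIcc_of_le hR]
  have hsub : Set.Icc δ R ⊆ Set.Ioi 0 := fun τ hτ => hδ.trans_le hτ.1
  refine ContinuousOn.mul (fun τ hτ => ?_) ((continuousOn_besselE μ μ' Z hX hY).mono hsub)
  exact (Real.continuousAt_rpow_const _ _ (Or.inl (hsub hτ).ne')).continuousWithinAt

/-- The fundamental theorem of calculus for e^{-τZ} W(τ). The exponential adds decay in the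
frequency of `V`; differentiating it produces the Z-terms. -/
theorem integral_besselE_wronskian {ν X Y Z δ R : ℝ} (hν : 0 < ν) (hX : 0 < X)
    (hY : 0 < Y) (hδ : 0 < δ) (hR : δ ≤ R) :
    (X - Y) * (∫ τ in Set.Ioc δ R, τ ^ (-ν) * besselE ν ν X Y Z τ) +
      Z * ((∫ τ in Set.Ioc δ R, τ ^ (-ν) * besselE (ν + 1) ν X Y Z τ) -
        ∫ τ in Set.Ioc δ R, τ ^ (-ν) * besselE ν (ν + 1) X Y Z τ) =
      Real.exp (-(δ * Z)) * besselW ν X Y δ - Real.exp (-(R * Z)) * besselW ν X Y R := by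
  have i1 := intervalIntegrable_rpow_mul_besselE (-ν) ν ν Z hX hY hδ hR
  have i2 := intervalIntegrable_rpow_mul_besselE (-ν) (ν + 1) ν Z hX hY hδ hR
  have i3 := intervalIntegrable_rpow_mul_besselE (-ν) ν (ν + 1) Z hX hY hδ hR
  have hder : ∀ τ ∈ Set.uIcc δ R, HasDerivAt (fun τ => Real.exp (-(τ * Z)) * besselW ν X Y τ)
      (-((X - Y) * (τ ^ (-ν) * besselE ν ν X Y Z τ) +
        Z * (τ ^ (-ν) * besselE (ν + 1) ν X Y Z τ - τ ^ (-ν) * besselE ν (ν + 1) X Y Z τ))) τ := by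
    intro τ hτ
    rw [Set.uIcc_of_le hR] at hτ
    have hτ0 : 0 < τ := hδ.trans_le hτ.1
    have h1 : HasDerivAt (fun τ => Real.exp (-(τ * Z))) (Real.exp (-(τ * Z)) * -(1 * Z)) τ :=
      ((hasDerivAt_id τ).mul_const Z).neg.exp
    refine (h1.mul (hasDerivAt_besselW hν hX hY hτ0)).congr_deriv ?_
    unfold besselE besselW
    ring
  have hintg := ((i1.const_mul (X - Y)).add ((i2.sub i3).const_mul Z)).neg
  have h := intervalIntegral.integral_eq_sub_of_hasDerivAt hder hintg
  rw [intervalIntegral.integral_neg, intervalIntegral.integral_add (i1.const_mul _)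
    ((i2.sub i3).const_mul Z), intervalIntegral.integral_const_mul,
    intervalIntegral.integral_const_mul, intervalIntegral.integral_sub i2 i3] at h
  simp only [← intervalIntegral.integral_of_le hR]
  linarith

/-- Integration by parts with τ^{-ν} = (τ^{1-ν})'/(1-ν). Each term on the right gains a factor X, Y
or Z, that is, two derivatives; this is needed only in the case a = b = 1. -/
theorem integral_rpow_mul_besselE {ν μ μ' X Y Z δ R : ℝ} (hν1 : ν < 1) (hX : 0 < X)
    (hY : 0 < Y) (hδ : 0 < δ) (hR : δ ≤ R) :
    (1 - ν) * (∫ τ in Set.Ioc δ R, τ ^ (-ν) * besselE μ μ' X Y Z τ) =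
      Z * (∫ τ in Set.Ioc δ R, τ ^ (1 - ν) * besselE μ μ' X Y Z τ) +
      Y * (∫ τ in Set.Ioc δ R, τ ^ (1 - ν) * besselE μ (μ' - 1) X Y Z τ) +
      X * (∫ τ in Set.Ioc δ R, τ ^ (1 - ν) * besselE (μ - 1) μ' X Y Z τ) +
      (R ^ (1 - ν) * besselE μ μ' X Y Z R - δ ^ (1 - ν) * besselE μ μ' X Y Z δ) := by
  have i0 := intervalIntegrable_rpow_mul_besselE (-ν) μ μ' Z hX hY hδ hR
  have i1 := intervalIntegrable_rpow_mul_besselE (1 - ν) μ μ' Z hX hY hδ hR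
  have i2 := intervalIntegrable_rpow_mul_besselE (1 - ν) μ (μ' - 1) Z hX hY hδ hR
  have i3 := intervalIntegrable_rpow_mul_besselE (1 - ν) (μ - 1) μ' Z hX hY hδ hR
  have hder : ∀ τ ∈ Set.uIcc δ R, HasDerivAt (fun τ => τ ^ (1 - ν) * besselE μ μ' X Y Z τ)
      ((1 - ν) * (τ ^ (-ν) * besselE μ μ' X Y Z τ) -
        (Z * (τ ^ (1 - ν) * besselE μ μ' X Y Z τ) +
          Y * (τ ^ (1 - ν) * besselE μ (μ' - 1) X Y Z τ) +
          X * (τ ^ (1 - ν) * besselE (μ - 1) μ' X Y Z τ))) τ := by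
    intro τ hτ
    rw [Set.uIcc_of_le hR] at hτ
    have hτ0 : 0 < τ := hδ.trans_le hτ.1
    have h1 : HasDerivAt (fun τ => Real.exp (-(τ * Z))) (Real.exp (-(τ * Z)) * -(1 * Z)) τ :=
      ((hasDerivAt_id τ).mul_const Z).neg.exp
    have h5 := Real.hasDerivAt_rpow_const (x := τ) (p := 1 - ν) (Or.inl hτ0.ne')
    refine (h5.mul ((h1.mul (hasDerivAt_besselN_mul μ' hY hτ0)).mul
      (hasDerivAt_besselN_mul μ hX hτ0))).congr_deriv ?_
    simp only [Pi.mul_apply]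
    unfold besselE
    rw [show 1 - ν - 1 = -ν by ring]
    ring
  have hs := ((i1.const_mul Z).add (i2.const_mul Y)).add (i3.const_mul X)
  have h := intervalIntegral.integral_eq_sub_of_hasDerivAt hder ((i0.const_mul (1 - ν)).sub hs)
  rw [intervalIntegral.integral_sub (i0.const_mul (1 - ν)) hs,
    intervalIntegral.integral_add ((i1.const_mul Z).add (i2.const_mul Y)) (i3.const_mul X),
    intervalIntegral.integral_add (i1.const_mul Z) (i2.const_mul Y)] at h
  simp only [intervalIntegral.integral_const_mul] at h
  simp only [← intervalIntegral.integral_of_le hR]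
  linarith

/-! ### Duality -/

theorem norm_mul_norm_rpow_sub_two {p : ℝ} (hp : 1 < p) (w : ℂ) :
    ‖w‖ * ‖w‖ ^ (p - 2) = ‖w‖ ^ (p - 1) := by
  rcases eq_or_ne w 0 with rfl | hw
  · rw [norm_zero, zero_mul, Real.zero_rpow (by linarith)]
  · have := norm_pos_iff.2 hw
    rw [show p - 1 = 1 + (p - 2) by ring, Real.rpow_add this, Real.rpow_one]

/-- An `L^p` bound follows by testing against bounded integrable functions. -/
theorem eLpNorm_le_of_forall_integral_mul_le {p p' : ℝ} (hpp : p.HolderConjugate p')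
    {F : Plane → ℂ} (hF : BddMeas F) {K : ℝ≥0∞}
    (h : ∀ h : Plane → ℂ, Integrable h → BddMeas h →
      ‖∫ x, F x * h x‖ₑ ≤ K * eLpNorm h (ENNReal.ofReal p') volume) :
    eLpNorm F (ENNReal.ofReal p) volume ≤ K := by
  have hp := hpp.lt
  have hp0 : 0 < p := by linarith
  have hp'0 : 0 < p' := hpp.symm.pos
  obtain ⟨hFm, B, hB⟩ := hF
  set A : ℕ → ℝ≥0∞ := fun n => ∫⁻ x in Metric.ball (0 : Plane) n, ‖F x‖ₑ ^ p with hA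
  have hAK : ∀ n, A n ^ (1 / p) ≤ K := by
    intro n
    -- The extremal test function of duality, cut off to a ball: F t = |F|^p and |t|^{p'} = |F|^p
    -- there. Boundedness of `F` makes it admissible and makes `A n` finite, so it can be divided
    -- out.
    set t : Plane → ℂ := (Metric.ball (0 : Plane) n).indicator
      fun x => (starRingEnd ℂ) (F x) * ((‖F x‖ ^ (p - 2) : ℝ) : ℂ) with ht
    have htn : ∀ x, ‖t x‖ = (Metric.ball (0 : Plane) n).indicator (fun x => ‖F x‖ ^ (p - 1)) x := by
      intro x
      rw [ht, norm_indicator_eq_indicator_norm]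
      refine congrFun (congrArg _ (funext fun y => ?_)) x
      rw [norm_mul, RCLike.norm_conj, Complex.norm_real, Real.norm_of_nonneg (by positivity),
        norm_mul_norm_rpow_sub_two hp]
    have htm : Measurable t := by
      refine Measurable.indicator ?_ Metric.isOpen_ball.measurableSet
      fun_prop
    have htb : ∀ x, ‖t x‖ ≤ (B ^ (p - 1) : ℝ) := by
      intro x
      rw [htn]
      refine Set.indicator_apply_le' (fun _ => ?_) (fun _ => by positivity)
      exact Real.rpow_le_rpow (norm_nonneg _) (hB x) (by linarith)
    have hball : volume (Metric.ball (0 : Plane) n) < ∞ := measure_ball_lt_top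
    have hti : Integrable t := by
      rw [ht, integrable_indicator_iff Metric.isOpen_ball.measurableSet]
      refine IntegrableOn.of_bound hball (Measurable.aestronglyMeasurable (by fun_prop))
        (B ^ (p - 1) : ℝ) (Filter.Eventually.of_forall fun x => ?_)
      rw [norm_mul, RCLike.norm_conj, Complex.norm_real, Real.norm_of_nonneg (by positivity),
        norm_mul_norm_rpow_sub_two hp]
      exact Real.rpow_le_rpow (norm_nonneg _) (hB x) (by linarith)
    have htB : BddMeas t := ⟨htm, B ^ (p - 1), fun x => by simpa using htb x⟩
    have h1 := h t hti htB
    have hAi : IntegrableOn (fun x => ‖F x‖ ^ p) (Metric.ball (0 : Plane) n) := by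
      refine IntegrableOn.of_bound hball (Measurable.aestronglyMeasurable (by fun_prop))
        (B ^ p : ℝ) (Filter.Eventually.of_forall fun x => ?_)
      rw [Real.norm_of_nonneg (by positivity)]
      exact Real.rpow_le_rpow (norm_nonneg _) (hB x) hp0.le
    have hAeq : A n = ENNReal.ofReal (∫ x in Metric.ball (0 : Plane) n, ‖F x‖ ^ p) := by
      rw [ofReal_integral_eq_lintegral_ofReal hAi
        (Filter.Eventually.of_forall fun x => by positivity)]
      refine lintegral_congr fun x => ?_
      rw [← ofReal_norm, ENNReal.ofReal_rpow_of_nonneg (norm_nonneg _) hp0.le]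
    have hAtop : A n ≠ ∞ := by rw [hAeq]; exact ENNReal.ofReal_ne_top
    have e1 : ‖∫ x, F x * t x‖ₑ = A n := by
      have : ∀ x, F x * t x = (Metric.ball (0 : Plane) n).indicator
          (fun x => ((‖F x‖ ^ p : ℝ) : ℂ)) x := by
        intro x
        rw [ht]
        by_cases hx : x ∈ Metric.ball (0 : Plane) n
        · rw [Set.indicator_of_mem hx, Set.indicator_of_mem hx, ← mul_assoc, Complex.mul_conj,
            Complex.normSq_eq_norm_sq, ← Complex.ofReal_mul, sq, mul_assoc,
            norm_mul_norm_rpow_sub_two hp]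
          congr 1
          rcases eq_or_ne (F x) 0 with h0 | h0
          · rw [h0, norm_zero, zero_mul, Real.zero_rpow hp0.ne']
          · have := norm_pos_iff.2 h0
            rw [← Real.rpow_one_add' this.le (by linarith)]
            congr 1; ring
        · rw [Set.indicator_of_notMem hx, Set.indicator_of_notMem hx, mul_zero]
      simp_rw [this]
      rw [integral_indicator Metric.isOpen_ball.measurableSet, integral_complex_ofReal,
        ← ofReal_norm, Complex.norm_real, hAeq, Real.norm_of_nonneg]
      exact integral_nonneg fun x => by positivity
    have e2 : eLpNorm t (ENNReal.ofReal p') volume = A n ^ (1 / p') := by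
      rw [eLpNorm_eq_lintegral_rpow_enorm_toReal (by simpa using hp'0) (by simp),
        ENNReal.toReal_ofReal hp'0.le, hA]
      congr 1
      beta_reduce
      rw [← lintegral_indicator Metric.isOpen_ball.measurableSet]
      refine lintegral_congr fun x => ?_
      rw [← ofReal_norm, htn]
      by_cases hx : x ∈ Metric.ball (0 : Plane) n
      · rw [Set.indicator_of_mem hx, Set.indicator_of_mem hx, ← ofReal_norm,
          ENNReal.ofReal_rpow_of_nonneg (norm_nonneg _) hp0.le,
          ENNReal.ofReal_rpow_of_nonneg (by positivity) hp'0.le, ← Real.rpow_mul (norm_nonneg _),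
          hpp.sub_one_mul_conj]
      · rw [Set.indicator_of_notMem hx, Set.indicator_of_notMem hx, ENNReal.ofReal_zero,
          ENNReal.zero_rpow_of_pos hp'0]
    rw [e1, e2] at h1
    rcases eq_or_ne (A n) 0 with h0 | h0
    · rw [h0, ENNReal.zero_rpow_of_pos (by positivity)]; exact zero_le
    · have h2 : A n ^ (1 / p) * A n ^ (1 / p') = A n := by
        rw [← ENNReal.rpow_add _ _ h0 hAtop]
        have := hpp.inv_add_inv_eq_one
        rw [one_div, one_div, this, ENNReal.rpow_one]
      rw [← h2] at h1
      refine (ENNReal.mul_le_mul_iff_left ?_ ?_).1 (h1.trans (by rw [h2]))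
      · exact (ENNReal.rpow_pos (pos_iff_ne_zero.2 h0) hAtop).ne'
      · exact ENNReal.rpow_ne_top_of_nonneg (by positivity) hAtop
  rw [eLpNorm_eq_lintegral_rpow_enorm_toReal (by simpa using hp0) (by simp),
    ENNReal.toReal_ofReal hp0.le]
  have hU : ⋃ n : ℕ, Metric.ball (0 : Plane) n = Set.univ := Metric.iUnion_ball_nat 0
  have hmono : Monotone fun n : ℕ => Metric.ball (0 : Plane) n :=
    fun m n hmn => Metric.ball_subset_ball (by exact_mod_cast hmn)
  have hsup : ∫⁻ x, ‖F x‖ₑ ^ p = ⨆ n, A n := by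
    rw [← setLIntegral_univ, ← hU, setLIntegral_iUnion_of_directed _ hmono.directed_le]
  rw [hsup, one_div, ENNReal.rpow_inv_le_iff hp0]
  refine iSup_le fun n => ?_
  rw [← ENNReal.rpow_inv_le_iff hp0, ← one_div]
  exact hAK n

/-! ### Riesz transforms -/

/-- The trilinear estimate with the constant 1 as its first factor, measured in L^∞ and left fixed
by the heat flow. -/
theorem exists_lintegral_bilinear_le {l₂ l₃ : List (Fin 2)} (hl₂ : l₂ ≠ [])
    (hl₃ : l₃ ≠ []) {r s : ℝ} (hrs : r.HolderConjugate s) :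
    ∃ C : ℝ≥0, ∀ g h : Plane → ℂ, Integrable g → Integrable h → BddMeas h →
      ∫⁻ τ in Set.Ioi 0, ‖∫ ξ, (baseSym l₂ τ ξ * g ξ) * (baseSym l₃ τ ξ * 𝓕⁻ h ξ)‖ₑ *
          ENNReal.ofReal τ⁻¹ ≤
      C * (eLpNorm (𝓕⁻ g) (ENNReal.ofReal r) volume * eLpNorm h (ENNReal.ofReal s) volume) := by
  obtain ⟨C, hC⟩ := exists_tsum_lintegral_base_le [] hl₂ hl₃ (q := ⊤) (r := r) (s := s)
    (by simp) hrs.lt hrs.symm.lt (by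
      rw [ENNReal.inv_top, zero_add, ← ENNReal.ofReal_add, hrs.inv_add_inv_eq_one,
        ENNReal.ofReal_one]
      · exact (inv_pos.2 hrs.pos).le
      · exact (inv_pos.2 hrs.symm.pos).le)
  refine ⟨3 * C, fun g h hg hh hhb => ?_⟩
  rw [ENNReal.coe_mul, ENNReal.coe_ofNat, mul_assoc]
  refine lintegral_Ioi_mul_inv_le fun τ hτ => ?_
  have hone : BddMeas fun _ : Plane => (1 : ℂ) := ⟨measurable_const, 1, fun x => by simp⟩
  have hle := hC (fun _ => 1) (𝓕⁻ g) h hone (bddMeas_fourierInv hg) hhb τ τ τ hτ hτ hτ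
  have hE : eLpNorm (fun _ : Plane => (1 : ℂ)) ⊤ volume ≤ 1 := by
    rw [eLpNorm_exponent_top]
    exact eLpNormEssSup_le_of_ae_enorm_bound (Filter.Eventually.of_forall fun x => by simp)
  refine le_trans (ENNReal.tsum_le_tsum fun k => ?_) (hle.trans ?_)
  · have p1 : 0 < 4 ^ k * τ := by positivity
    have hh1 : ∀ x, base [] (4 ^ k * τ) (fun _ : Plane => (1 : ℂ)) x = 1 := by
      intro x
      rw [base_nil, heat, integral_smul_const, integral_sub_left_eq_self (heatK (4 ^ k * τ)) volume x,
        integral_heatK p1, one_smul]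
    obtain ⟨hb1, hb2⟩ := fourierInv_base l₃ p1 hh
    have hi : Integrable fun ξ => baseSym l₂ (4 ^ k * τ) ξ * g ξ := by
      obtain ⟨C, hC⟩ := exists_norm_baseSym_le l₂
      have := continuous_baseSym l₂
      exact hg.bdd_mul (c := C) (Continuous.aestronglyMeasurable (by fun_prop))
        (Filter.Eventually.of_forall fun ξ => hC _ p1 ξ)
    have hpar := integral_fourierInv_mul hi hb1
    rw [← base_fourierInv l₂ p1 hg] at hpar
    simp_rw [hb2] at hpar
    have hsgn : ∀ ξ : Plane, (baseSym l₂ (4 ^ k * τ) ξ * g ξ) *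
        ((-1) ^ l₃.length * baseSym l₃ (4 ^ k * τ) ξ * 𝓕⁻ h ξ) = (-1) ^ l₃.length *
        ((baseSym l₂ (4 ^ k * τ) ξ * g ξ) * (baseSym l₃ (4 ^ k * τ) ξ * 𝓕⁻ h ξ)) := by
      intro ξ; ring
    simp_rw [hsgn, integral_const_mul] at hpar
    have h1 : ‖((-1 : ℂ) ^ l₃.length)‖ₑ = 1 := by
      rw [← ofReal_norm]; simp
    calc _ = ‖(-1 : ℂ) ^ l₃.length * ∫ ξ, (baseSym l₂ (4 ^ k * τ) ξ * g ξ) *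
            (baseSym l₃ (4 ^ k * τ) ξ * 𝓕⁻ h ξ)‖ₑ := by rw [enorm_mul, h1, one_mul]
      _ ≤ _ := by
        rw [← hpar]
        refine (enorm_integral_le_lintegral_enorm _).trans (le_of_eq ?_)
        simp_rw [hh1, enorm_mul, enorm_one, one_mul]
  · refine mul_le_mul_right ?_ _
    rw [mul_assoc]
    exact (mul_le_mul_left hE _).trans (by rw [one_mul])

/-- Writes |ξ|^{-3} as an integral of Gaussians; a Riesz symbol ξ_j/|ξ| is ξ_j|ξ|² times this. -/
theorem integral_riesz_kernel {m : ℝ} (hm : 0 < m) :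
    ∫ τ in Set.Ioi (0 : ℝ), τ ^ (1 / 2 : ℝ) * Real.exp (-(2 * Real.pi * m ^ 2 * τ)) =
      (1 / (2 * Real.pi)) ^ (3 / 2 : ℝ) * Real.Gamma (3 / 2) * (m ^ 3)⁻¹ := by
  have h := Real.integral_rpow_mul_exp_neg_mul_Ioi (a := 3 / 2) (r := 2 * Real.pi * m ^ 2)
    (by norm_num) (by positivity)
  rw [show (3 / 2 - 1 : ℝ) = 1 / 2 by norm_num] at h
  rw [h, show 1 / (2 * Real.pi * m ^ 2) = 1 / (2 * Real.pi) * (m⁻¹) ^ (2 : ℝ) by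
    rw [Real.rpow_two]; field_simp, Real.mul_rpow (by positivity) (by positivity),
    ← Real.rpow_mul (by positivity), show (2 * (3 / 2) : ℝ) = ((3 : ℕ) : ℝ) by norm_num,
    Real.rpow_natCast, inv_pow]
  ring

theorem integrableOn_riesz_kernel {m : ℝ} (hm : 0 < m) :
    IntegrableOn (fun τ : ℝ => τ ^ (1 / 2 : ℝ) * Real.exp (-(2 * Real.pi * m ^ 2 * τ)))
      (Set.Ioi 0) := by
  by_contra hcon
  have h := integral_riesz_kernel hm
  rw [integral_undef hcon] at h
  have : 0 < (1 / (2 * Real.pi)) ^ (3 / 2 : ℝ) * Real.Gamma (3 / 2) * (m ^ 3)⁻¹ := by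
    have := Real.Gamma_pos_of_pos (by norm_num : (0 : ℝ) < 3 / 2)
    positivity
  linarith

theorem sum_derivSym_pair (ξ : Plane) :
    ∑ k, derivSym [k, k] ξ = -(4 * Real.pi ^ 2 * ‖ξ‖ ^ 2 : ℝ) := by
  simp only [derivSym_cons, derivSym_nil, EuclideanSpace.real_norm_sq_eq, Fin.sum_univ_two]
  push_cast
  linear_combination (4 * Real.pi ^ 2 * ((ξ 0 : ℂ) ^ 2 + (ξ 1 : ℂ) ^ 2)) * Complex.I_sq

/-- One derivative on one side and a Laplacian on the other give √τ·τ/τ = √τ, the weight in the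
Riesz kernel, and both sides of the bilinear form have cancellation. -/
theorem sum_baseSym_pair (j : Fin 2) {τ : ℝ} (hτ : 0 < τ) (ξ : Plane) :
    ((τ⁻¹ : ℝ) : ℂ) * ∑ k, baseSym [j] τ ξ * baseSym [k, k] τ ξ =
      ((τ ^ (1 / 2 : ℝ) * Real.exp (-(2 * Real.pi * ‖ξ‖ ^ 2 * τ)) : ℝ) : ℂ) *
        (-(4 * Real.pi ^ 2 * ‖ξ‖ ^ 2 : ℝ) * derivSym [j] ξ) := by
  rw [← sum_derivSym_pair, ← Real.sqrt_eq_rpow]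
  have e : Real.exp (-(2 * Real.pi * ‖ξ‖ ^ 2 * τ)) =
      Real.exp (-(Real.pi * τ * ‖ξ‖ ^ 2)) * Real.exp (-(Real.pi * τ * ‖ξ‖ ^ 2)) := by
    rw [← Real.exp_add]; congr 1; ring
  have e2 : τ⁻¹ * (Real.sqrt τ * Real.sqrt τ ^ 2) = Real.sqrt τ := by
    rw [Real.sq_sqrt hτ.le]; field_simp
  have e3 : ((τ⁻¹ : ℝ) : ℂ) * (Real.sqrt τ * Real.sqrt τ ^ 2) = Real.sqrt τ := by
    exact_mod_cast congrArg (fun t : ℝ => (t : ℂ)) e2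
  rw [e, ← Finset.mul_sum, Finset.sum_congr rfl fun k _ => show baseSym [k, k] τ ξ =
    (Real.sqrt τ : ℂ) ^ 2 * gaussSym τ ξ * derivSym [k, k] ξ by unfold baseSym; simp; ring,
    ← Finset.mul_sum]
  unfold baseSym gaussSym
  simp only [List.length_singleton, pow_one]
  push_cast
  rw [show ((τ : ℂ))⁻¹ = ((τ⁻¹ : ℝ) : ℂ) by push_cast; rfl]
  linear_combination (Complex.exp (-(Real.pi * τ * ‖ξ‖ ^ 2)) ^ 2 * derivSym [j] ξ *
    ∑ k, derivSym [k, k] ξ) * e3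

/-- The Riesz transforms are bounded on `L^q` for `1 < q < ∞`. -/
theorem exists_riesz_le {q : ℝ} (hq : 1 < q) (j : Fin 2) : ∃ C : ℝ≥0, ∀ g : Plane → ℂ,
    Integrable g → Integrable (fun ξ => ((‖ξ‖ : ℝ) : ℂ) * g ξ) →
    eLpNorm (𝓕⁻ fun ξ => derivSym [j] ξ * g ξ) (ENNReal.ofReal q) volume ≤
      C * eLpNorm (𝓕⁻ fun ξ => ((‖ξ‖ : ℝ) : ℂ) * g ξ) (ENNReal.ofReal q) volume := by
  have hqq : q.HolderConjugate (q.conjExponent) := Real.HolderConjugate.conjExponent hq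
  choose C hC using fun k : Fin 2 => exists_lintegral_bilinear_le (l₂ := [j]) (l₃ := [k, k])
    (by simp) (by simp) hqq
  set c : ℝ := 4 * Real.pi ^ 2 * ((1 / (2 * Real.pi)) ^ (3 / 2 : ℝ) * Real.Gamma (3 / 2)) with hc
  have hc0 : 0 < c := by
    have := Real.Gamma_pos_of_pos (by norm_num : (0 : ℝ) < 3 / 2)
    positivity
  refine ⟨c.toNNReal⁻¹ * ∑ k, C k, fun g₀ hg₀ hg => ?_⟩
  set g : Plane → ℂ := fun ξ => ((‖ξ‖ : ℝ) : ℂ) * g₀ ξ with hgdef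
  have hD : ∀ ξ : Plane, ‖derivSym [j] ξ‖ ≤ 2 * Real.pi * ‖ξ‖ := fun ξ => by
    simpa using norm_derivSym_le [j] ξ
  have hDg : Integrable fun ξ => derivSym [j] ξ * g₀ ξ := by
    refine (hg.norm.const_mul (2 * Real.pi)).mono'
      ((continuous_derivSym [j]).aestronglyMeasurable.mul hg₀.1)
      (Filter.Eventually.of_forall fun ξ => ?_)
    simp only [hgdef, norm_mul, Complex.norm_real, norm_norm]
    rw [← mul_assoc]
    gcongr
    exact hD ξ
  refine eLpNorm_le_of_forall_integral_mul_le hqq (bddMeas_fourierInv hDg) fun h hh hhb => ?_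
  rw [integral_fourierInv_mul hDg hh]
  set μ : Measure ℝ := volume.restrict (Set.Ioi 0) with hμ
  set K : Plane → ℝ → ℝ := fun ξ τ =>
    τ ^ (1 / 2 : ℝ) * Real.exp (-(2 * Real.pi * ‖ξ‖ ^ 2 * τ)) with hK
  set A : Plane → ℂ := fun ξ => -(4 * Real.pi ^ 2 * ‖ξ‖ ^ 2 : ℝ) * derivSym [j] ξ *
    (g ξ * 𝓕⁻ h ξ) with hA
  have hAm : AEStronglyMeasurable A volume := by
    have h1 := continuous_derivSym [j]
    have h2 := continuous_fourierInv hh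
    exact (Continuous.aestronglyMeasurable (by fun_prop)).mul
      (hg.1.mul h2.aestronglyMeasurable)
  have hghi : Integrable fun ξ => 𝓕⁻ h ξ * g ξ := (bddMeas_fourierInv hh).integrable_mul hg
  have hne : ∀ᵐ ξ : Plane, ξ ≠ 0 := by simp [ae_iff]
  have hKA : Integrable (Function.uncurry fun ξ τ => (K ξ τ : ℂ) * A ξ) (volume.prod μ) := by
    have hm : AEStronglyMeasurable (Function.uncurry fun ξ τ => (K ξ τ : ℂ) * A ξ)
        (volume.prod μ) := by
      refine AEStronglyMeasurable.mul (Measurable.aestronglyMeasurable ?_) hAm.comp_fst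
      simp only [hK]
      fun_prop
    rw [integrable_prod_iff hm]
    refine ⟨?_, ?_⟩
    · filter_upwards [hne] with ξ hξ
      have h1 : Integrable (fun τ => (K ξ τ : ℂ)) μ :=
        (integrableOn_riesz_kernel (norm_pos_iff.2 hξ)).ofReal
      exact h1.mul_const (A ξ)
    · refine (hghi.norm.const_mul (c * (2 * Real.pi))).mono' hm.norm.integral_prod_right' ?_
      filter_upwards [hne] with ξ hξ
      have hξ0 := norm_pos_iff.2 hξ
      rw [Real.norm_of_nonneg (integral_nonneg fun τ => norm_nonneg _)]
      have e : ∀ τ ∈ Set.Ioi (0 : ℝ), ‖Function.uncurry (fun ξ τ => (K ξ τ : ℂ) * A ξ) (ξ, τ)‖ =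
          K ξ τ * ‖A ξ‖ := by
        intro τ hτ
        have hτ0 : 0 < τ := hτ
        simp only [Function.uncurry_apply_pair, norm_mul, Complex.norm_real]
        rw [Real.norm_of_nonneg (by positivity)]
      rw [hμ, setIntegral_congr_fun measurableSet_Ioi e, integral_mul_const,
        integral_riesz_kernel hξ0]
      have hAn : ‖A ξ‖ = 4 * Real.pi ^ 2 * ‖ξ‖ ^ 2 * ‖derivSym [j] ξ‖ * (‖g ξ‖ * ‖𝓕⁻ h ξ‖) := by
        rw [hA, norm_mul, norm_mul, norm_neg, Complex.norm_real, norm_mul (g ξ),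
          Real.norm_of_nonneg (by positivity)]
      rw [hAn]
      calc _ = c * (‖derivSym [j] ξ‖ * ‖ξ‖⁻¹) * (‖𝓕⁻ h ξ‖ * ‖g ξ‖) := by
            rw [hc]; field_simp
        _ ≤ c * (2 * Real.pi) * (‖𝓕⁻ h ξ‖ * ‖g ξ‖) := by
            refine mul_le_mul_of_nonneg_right (mul_le_mul_of_nonneg_left ?_ hc0.le) (by positivity)
            rw [← div_eq_mul_inv, div_le_iff₀ hξ0]
            exact hD ξ
        _ = _ := by rw [norm_mul (𝓕⁻ h ξ)]
  -- The τ-integral yields |ξ|^{-3}; the Laplacian contributes |ξ|² and `g` contributes |ξ|, so only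
  -- the derivative of g₀ remains.
  have hpt : ∀ᵐ ξ : Plane, ∫ τ, (K ξ τ : ℂ) * A ξ ∂μ = -(c : ℂ) * (derivSym [j] ξ * g₀ ξ * 𝓕⁻ h ξ) := by
    filter_upwards [hne] with ξ hξ
    have hξ0 := norm_pos_iff.2 hξ
    rw [integral_mul_const, integral_complex_ofReal, hμ, integral_riesz_kernel hξ0]
    simp only [hA, hgdef, hc]
    have : (‖ξ‖ : ℂ) ≠ 0 := by exact_mod_cast hξ0.ne'
    push_cast
    field_simp
  have hmain : (c : ℂ) * ∫ ξ, derivSym [j] ξ * g₀ ξ * 𝓕⁻ h ξ =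
      -∫ τ, (∫ ξ, (K ξ τ : ℂ) * A ξ) ∂μ := by
    rw [← integral_integral_swap hKA, integral_congr_ae hpt, integral_const_mul]
    ring
  have hsum : ∀ τ ∈ Set.Ioi (0 : ℝ), ‖∫ ξ, (K ξ τ : ℂ) * A ξ‖ₑ ≤ ∑ k : Fin 2,
      ‖∫ ξ, (baseSym [j] τ ξ * g ξ) * (baseSym [k, k] τ ξ * 𝓕⁻ h ξ)‖ₑ * ENNReal.ofReal τ⁻¹ := by
    intro τ hτ
    have hτ0 : 0 < τ := hτ
    have e : ∀ ξ, (K ξ τ : ℂ) * A ξ = ∑ k : Fin 2, ((τ⁻¹ : ℝ) : ℂ) *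
        ((baseSym [j] τ ξ * g ξ) * (baseSym [k, k] τ ξ * 𝓕⁻ h ξ)) := by
      intro ξ
      have := sum_baseSym_pair j hτ0 ξ
      simp only [hA]
      rw [← mul_assoc, ← this, Finset.mul_sum, Finset.sum_mul]
      refine Finset.sum_congr rfl fun k _ => by ring
    simp_rw [e]
    rw [integral_finsetSum]
    · refine (enorm_sum_le _ _).trans (Finset.sum_le_sum fun k _ => ?_)
      rw [integral_const_mul, enorm_mul, mul_comm]
      gcongr
      rw [← ofReal_norm, Complex.norm_real, Real.norm_of_nonneg (inv_pos.2 hτ0).le]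
    · intro k _
      obtain ⟨B₁, hB₁⟩ := exists_norm_baseSym_le [j]
      obtain ⟨B₂, hB₂⟩ := exists_norm_baseSym_le [k, k]
      have c1 := continuous_baseSym [j]
      have c2 := continuous_baseSym [k, k]
      refine Integrable.const_mul ?_ _
      have := hghi.bdd_mul (f := fun ξ => baseSym [j] τ ξ * baseSym [k, k] τ ξ) (c := B₁ * B₂)
        (Continuous.aestronglyMeasurable (by fun_prop)) (Filter.Eventually.of_forall fun ξ => by
          rw [norm_mul]
          exact mul_le_mul (hB₁ _ hτ0 ξ) (hB₂ _ hτ0 ξ) (norm_nonneg _)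
            ((norm_nonneg _).trans (hB₁ _ hτ0 ξ)))
      refine this.congr (Filter.Eventually.of_forall fun ξ => by ring)
  have hfin : ENNReal.ofReal c * ‖∫ ξ, derivSym [j] ξ * g₀ ξ * 𝓕⁻ h ξ‖ₑ ≤ (∑ k, (C k : ℝ≥0∞)) *
      (eLpNorm (𝓕⁻ g) (ENNReal.ofReal q) volume *
        eLpNorm h (ENNReal.ofReal q.conjExponent) volume) := by
    calc _ = ‖(c : ℂ) * ∫ ξ, derivSym [j] ξ * g₀ ξ * 𝓕⁻ h ξ‖ₑ := by
          rw [enorm_mul, ← ofReal_norm (c : ℂ), Complex.norm_real, Real.norm_of_nonneg hc0.le]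
      _ ≤ ∫⁻ τ, ‖∫ ξ, (K ξ τ : ℂ) * A ξ‖ₑ ∂μ := by
          rw [hmain, enorm_neg]; exact enorm_integral_le_lintegral_enorm _
      _ ≤ ∫⁻ τ, ∑ k : Fin 2, ‖∫ ξ, (baseSym [j] τ ξ * g ξ) * (baseSym [k, k] τ ξ * 𝓕⁻ h ξ)‖ₑ *
            ENNReal.ofReal τ⁻¹ ∂μ := setLIntegral_mono' measurableSet_Ioi hsum
      _ = ∑ k : Fin 2, ∫⁻ τ, ‖∫ ξ, (baseSym [j] τ ξ * g ξ) * (baseSym [k, k] τ ξ * 𝓕⁻ h ξ)‖ₑ *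
            ENNReal.ofReal τ⁻¹ ∂μ := by
          refine lintegral_finsetSum' _ fun k _ => ?_
          refine AEMeasurable.mul ?_ measurable_inv.ennreal_ofReal.aemeasurable
          have c1 := continuous_baseSym [j]
          have c2 := continuous_baseSym [k, k]
          have c3 := continuous_fourierInv hh
          have hm : AEStronglyMeasurable (fun p : ℝ × Plane => (baseSym [j] p.1 p.2 * g p.2) *
              (baseSym [k, k] p.1 p.2 * 𝓕⁻ h p.2)) (μ.prod volume) :=
            (c1.aestronglyMeasurable.mul hg.1.comp_snd).mul
              (Continuous.aestronglyMeasurable (by fun_prop))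
          exact hm.integral_prod_right'.enorm
      _ ≤ ∑ k : Fin 2, (C k : ℝ≥0∞) * (eLpNorm (𝓕⁻ g) (ENNReal.ofReal q) volume *
        eLpNorm h (ENNReal.ofReal q.conjExponent) volume) :=
          Finset.sum_le_sum fun k _ => hC k g h hg hh hhb
      _ = _ := by rw [Finset.sum_mul]
  have hcN : (c.toNNReal : ℝ≥0∞) = ENNReal.ofReal c := rfl
  have hcN0 : c.toNNReal ≠ 0 := by simpa using hc0
  rw [ENNReal.coe_mul, ENNReal.coe_inv hcN0, hcN, ENNReal.coe_finsetSum, mul_assoc, mul_assoc,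
    mul_comm, ← div_eq_mul_inv, ENNReal.le_div_iff_mul_le (by simp [hc0]) (by simp), mul_comm]
  exact hfin

/-! ### Trilinear forms with Bessel-type kernels -/

/-- `J` is integrable, with an integral bounded by `B`. -/
def IntBd (J : Plane × Plane → ℂ) (B : ℝ≥0∞) : Prop :=
  Integrable J ∧ ‖∫ z, J z‖ₑ ≤ B

theorem IntBd.mono {J : Plane × Plane → ℂ} {B B' : ℝ≥0∞} (h : IntBd J B) (hB : B ≤ B') :
    IntBd J B' := ⟨h.1, h.2.trans hB⟩

theorem IntBd.congr {J J' : Plane × Plane → ℂ} {B : ℝ≥0∞} (h : IntBd J B) (hJ : J =ᵐ[volume] J') :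
    IntBd J' B := ⟨h.1.congr hJ, by rw [← integral_congr_ae hJ]; exact h.2⟩

theorem IntBd.const_mul {J : Plane × Plane → ℂ} {B : ℝ≥0∞} (h : IntBd J B) (c : ℂ) :
    IntBd (fun z => c * J z) (‖c‖ₑ * B) :=
  ⟨h.1.const_mul c, by rw [integral_const_mul, enorm_mul]; gcongr; exact h.2⟩

theorem IntBd.add {J J' : Plane × Plane → ℂ} {B B' : ℝ≥0∞} (h : IntBd J B) (h' : IntBd J' B') :
    IntBd (fun z => J z + J' z) (B + B') :=
  ⟨h.1.add h'.1, by
    rw [integral_add h.1 h'.1]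
    exact (enorm_add_le _ _).trans (add_le_add h.2 h'.2)⟩

theorem IntBd.sum {ι : Type*} [Fintype ι] {J : ι → Plane × Plane → ℂ} {B : ι → ℝ≥0∞}
    (h : ∀ i, IntBd (J i) (B i)) : IntBd (fun z => ∑ i, J i z) (∑ i, B i) :=
  ⟨integrable_finsetSum _ fun i _ => (h i).1, by
    rw [integral_finsetSum _ fun i _ => (h i).1]
    exact (enorm_sum_le _ _).trans (Finset.sum_le_sum fun i _ => (h i).2)⟩

/-- The integrands of our trilinear forms, in frequency variables. -/
noncomputable def triTerm (c₁ c₂ c₃ e μ μ' : ℝ) (l₁ l₂ l₃ : List (Fin 2)) (g₁ g₂ h : Plane → ℂ)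
    (δ R : ℝ) (z : Plane × Plane) : ℂ :=
  (((Real.pi * ‖z.1‖ ^ 2) ^ (-c₁) * (Real.pi * ‖z.2‖ ^ 2) ^ (-c₂) *
      (Real.pi * ‖z.1 + z.2‖ ^ 2) ^ (-c₃) * ∫ τ in Set.Ioc δ R, τ ^ e * besselE μ μ'
        (Real.pi * ‖z.1 + z.2‖ ^ 2) (Real.pi * ‖z.2‖ ^ 2) (Real.pi * ‖z.1‖ ^ 2) τ : ℝ) : ℂ) *
    (derivSym l₁ z.1 * derivSym l₂ z.2 * derivSym l₃ (z.1 + z.2)) *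
    (g₁ z.1 * g₂ z.2 * 𝓕⁻ h (z.1 + z.2))

/-- Homogeneity count: one half per derivative, minus 1 for dτ/τ, minus the absorbed powers, is the
exponent of τ. -/
theorem integral_eq_rpow_mul_integral_besselE {n : ℕ} {c₁ c₂ c₃ e μ μ' X Y Z δ R : ℝ} (hX : 0 ≤ X)
    (hY : 0 ≤ Y) (hZ : 0 ≤ Z) (hδ : 0 < δ) (he : (n : ℝ) / 2 - 1 - c₁ - c₂ - c₃ = e) :
    ∫ τ in Set.Ioc δ R, τ⁻¹ * Real.sqrt τ ^ n * (((τ * Z) ^ (-c₁) * Real.exp (-(τ * Z))) *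
      ((τ * Y) ^ (-c₂) * besselN μ' (τ * Y)) * ((τ * X) ^ (-c₃) * besselN μ (τ * X))) =
    Z ^ (-c₁) * Y ^ (-c₂) * X ^ (-c₃) * ∫ τ in Set.Ioc δ R, τ ^ e * besselE μ μ' X Y Z τ := by
  rw [← integral_const_mul]
  refine setIntegral_congr_fun measurableSet_Ioc fun τ hτ => ?_
  have hτ0 : 0 < τ := hδ.trans hτ.1
  have e1 : τ ^ e = τ⁻¹ * Real.sqrt τ ^ n * (τ ^ (-c₁) * τ ^ (-c₂) * τ ^ (-c₃)) := by
    rw [Real.sqrt_eq_rpow, ← Real.rpow_natCast, ← Real.rpow_mul hτ0.le, ← Real.rpow_neg_one,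
      ← Real.rpow_add hτ0, ← Real.rpow_add hτ0, ← Real.rpow_add hτ0, ← Real.rpow_add hτ0, ← he]
    congr 1; ring
  beta_reduce
  rw [Real.mul_rpow hτ0.le hX, Real.mul_rpow hτ0.le hY, Real.mul_rpow hτ0.le hZ, e1]
  unfold besselE
  ring

/-- The trilinear estimate with the maximal function on the first factor. -/
theorem exists_triTerm_le_left {n₁ n₂ n₃ : ℕ} (hn₂ : n₂ ≠ 0) (hn₃ : n₃ ≠ 0) {c₁ c₂ c₃ μ μ' : ℝ}
    (hF₁ : LaplaceRep n₁ fun X => X ^ (-c₁) * Real.exp (-X))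
    (hF₂ : LaplaceRep n₂ fun X => X ^ (-c₂) * besselN μ' X)
    (hF₃ : LaplaceRep n₃ fun X => X ^ (-c₃) * besselN μ X)
    {q : ℝ≥0∞} {r s : ℝ} (hq1 : 1 < q) (hr : 1 < r) (hs : 1 < s)
    (hq : q⁻¹ + ENNReal.ofReal r⁻¹ + ENNReal.ofReal s⁻¹ = 1) {e : ℝ}
    (he : ((n₁ + n₂ + n₃ : ℕ) : ℝ) / 2 - 1 - c₁ - c₂ - c₃ = e)
    {l₁ l₂ l₃ : List (Fin 2)} (hl₁ : l₁.length = n₁) (hl₂ : l₂.length = n₂)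
    (hl₃ : l₃.length = n₃) :
    ∃ C : ℝ≥0, ∀ g₁ g₂ h : Plane → ℂ, Integrable g₁ → Integrable g₂ → Integrable h → BddMeas h →
      ∀ δ R : ℝ, 0 < δ → IntBd (triTerm c₁ c₂ c₃ e μ μ' l₁ l₂ l₃ g₁ g₂ h δ R)
        (C * (eLpNorm (𝓕⁻ g₁) q volume * eLpNorm (𝓕⁻ g₂) (ENNReal.ofReal r) volume *
          eLpNorm h (ENNReal.ofReal s) volume)) := by
  obtain ⟨C, hC⟩ := exists_trilinear_multiplier_le hn₂ hn₃ hF₁ hF₂ hF₃ hq1 hr hs hq l₁ l₂ l₃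
    hl₁ hl₂ hl₃
  refine ⟨C, fun g₁ g₂ h hg₁ hg₂ hh hhb δ R hδ => ?_⟩
  have h1 : IntBd _ _ := hC g₁ g₂ h hg₁ hg₂ hh hhb δ R hδ
  refine h1.congr (Filter.Eventually.of_forall fun z => ?_)
  unfold triTerm
  beta_reduce
  rw [integral_eq_rpow_mul_integral_besselE (by positivity) (by positivity) (by positivity) hδ he]

/-- The trilinear estimate with the maximal function on the second factor. -/
theorem exists_triTerm_le_right {n₁ n₂ n₃ : ℕ} (hn₁ : n₁ ≠ 0) (hn₃ : n₃ ≠ 0) {c₁ c₂ c₃ μ μ' : ℝ}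
    (hF₁ : LaplaceRep n₁ fun X => X ^ (-c₁) * Real.exp (-X))
    (hF₂ : LaplaceRep n₂ fun X => X ^ (-c₂) * besselN μ' X)
    (hF₃ : LaplaceRep n₃ fun X => X ^ (-c₃) * besselN μ X)
    {q r s : ℝ} (hq1 : 1 < q) (hr : 1 < r) (hs : 1 < s)
    (hq : q⁻¹ + r⁻¹ + s⁻¹ = 1) {e : ℝ}
    (he : ((n₁ + n₂ + n₃ : ℕ) : ℝ) / 2 - 1 - c₁ - c₂ - c₃ = e)
    {l₁ l₂ l₃ : List (Fin 2)} (hl₁ : l₁.length = n₁) (hl₂ : l₂.length = n₂)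
    (hl₃ : l₃.length = n₃) :
    ∃ C : ℝ≥0, ∀ g₁ g₂ h : Plane → ℂ, Integrable g₁ → Integrable g₂ → Integrable h → BddMeas h →
      ∀ δ R : ℝ, 0 < δ → IntBd (triTerm c₁ c₂ c₃ e μ μ' l₁ l₂ l₃ g₁ g₂ h δ R)
        (C * (eLpNorm (𝓕⁻ g₁) (ENNReal.ofReal q) volume *
          eLpNorm (𝓕⁻ g₂) (ENNReal.ofReal r) volume * eLpNorm h (ENNReal.ofReal s) volume)) := by
  have hr0 : 0 < r := by linarith
  have hq0 : 0 < q := by linarith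
  have hs0 : 0 < s := by linarith
  obtain ⟨C, hC⟩ := exists_trilinear_multiplier_le hn₁ hn₃ hF₂ hF₁ hF₃ (q := ENNReal.ofReal r)
    (by simpa using hr) hq1 hs (by
      rw [← ENNReal.ofReal_inv_of_pos hr0, ← ENNReal.ofReal_add, ← ENNReal.ofReal_add,
        ← ENNReal.ofReal_one]
      · congr 1; linarith
      all_goals positivity) l₂ l₁ l₃ hl₂ hl₁ hl₃
  refine ⟨C, fun g₁ g₂ h hg₁ hg₂ hh hhb δ R hδ => ?_⟩
  have h1 := hC g₂ g₁ h hg₂ hg₁ hh hhb δ R hδ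
  -- The left estimate is applied with ζ and η exchanged; the third factor depends only on ζ+η.
  have hmp : MeasurePreserving (Prod.swap : Plane × Plane → Plane × Plane) volume volume :=
    Measure.measurePreserving_swap
  have hJ : ∀ z : Plane × Plane, triTerm c₁ c₂ c₃ e μ μ' l₁ l₂ l₃ g₁ g₂ h δ R z =
      (fun z : Plane × Plane => ((∫ τ in Set.Ioc δ R, τ⁻¹ *
          Real.sqrt τ ^ (n₂ + n₁ + n₃) *
          (((τ * (Real.pi * ‖z.1‖ ^ 2)) ^ (-c₂) * besselN μ' (τ * (Real.pi * ‖z.1‖ ^ 2))) *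
            ((τ * (Real.pi * ‖z.2‖ ^ 2)) ^ (-c₁) * Real.exp (-(τ * (Real.pi * ‖z.2‖ ^ 2)))) *
            ((τ * (Real.pi * ‖z.1 + z.2‖ ^ 2)) ^ (-c₃) *
              besselN μ (τ * (Real.pi * ‖z.1 + z.2‖ ^ 2)))) : ℝ) : ℂ) *
        (derivSym l₂ z.1 * derivSym l₁ z.2 * derivSym l₃ (z.1 + z.2)) *
        (g₂ z.1 * g₁ z.2 * 𝓕⁻ h (z.1 + z.2))) (Prod.swap z) := by
    intro z
    unfold triTerm
    rw [← integral_eq_rpow_mul_integral_besselE (by positivity) (by positivity) (by positivity) hδ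
      he]
    simp only [Prod.fst_swap, Prod.snd_swap]
    rw [add_comm z.2 z.1, add_comm n₂ n₁]
    simp only [mul_comm ((_ : ℝ) ^ (-c₂) * besselN μ' _)]
    ring
  rw [show triTerm c₁ c₂ c₃ e μ μ' l₁ l₂ l₃ g₁ g₂ h δ R = _ from funext hJ]
  refine ⟨hmp.integrable_comp_of_integrable h1.1, ?_⟩
  rw [hmp.integral_comp MeasurableEquiv.prodComm.measurableEmbedding]
  refine h1.2.trans (le_of_eq ?_)
  ring

theorem triTerm_rpow_left {c₂ c₃ e μ μ' a : ℝ} {l₁ l₂ l₃ : List (Fin 2)} (U φ h : Plane → ℂ)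
    (δ R : ℝ) {z : Plane × Plane} (hz : z.1 ≠ 0) :
    triTerm (a / 2) c₂ c₃ e μ μ' l₁ l₂ l₃ (fun ζ => ((‖ζ‖ ^ a : ℝ) : ℂ) * U ζ) φ h δ R z =
      ((Real.pi ^ (-(a / 2)) : ℝ) : ℂ) * triTerm 0 c₂ c₃ e μ μ' l₁ l₂ l₃ U φ h δ R z := by
  have h0 := norm_pos_iff.2 hz
  have e1 : (Real.pi * ‖z.1‖ ^ 2) ^ (-(a / 2)) * ‖z.1‖ ^ a = Real.pi ^ (-(a / 2)) := by
    rw [Real.mul_rpow Real.pi_pos.le (by positivity), ← Real.rpow_two, ← Real.rpow_mul h0.le,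
      mul_assoc, ← Real.rpow_add h0]
    simp [mul_div_cancel₀]
  unfold triTerm
  rw [neg_zero, Real.rpow_zero, ← e1]
  push_cast
  ring

/-- A Laplacian in η is inserted and compensated by Y^{-1}. The absorbed power then has exponent
b/2+1, positive even for negative b > -1, and three derivatives are available against it. -/
theorem sum_triTerm_rpow_right {c₁ c₃ e μ μ' b : ℝ} {l₁ l₃ : List (Fin 2)} (m : Fin 2)
    (U φ h : Plane → ℂ) (δ R : ℝ) {z : Plane × Plane} (hz : z.2 ≠ 0) :
    ∑ k, triTerm c₁ (b / 2 + 1) c₃ e μ μ' l₁ [m, k, k] l₃ U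
        (fun η => ((‖η‖ ^ b : ℝ) : ℂ) * φ η) h δ R z =
      ((-(4 * Real.pi) * Real.pi ^ (-(b / 2)) : ℝ) : ℂ) *
        triTerm c₁ 0 c₃ e μ μ' l₁ [m] l₃ U φ h δ R z := by
  have h0 := norm_pos_iff.2 hz
  have e1 : (Real.pi * ‖z.2‖ ^ 2) ^ (-(b / 2 + 1)) * ‖z.2‖ ^ b * (4 * Real.pi ^ 2 * ‖z.2‖ ^ 2) =
      4 * Real.pi * Real.pi ^ (-(b / 2)) := by
    rw [neg_add, Real.rpow_add (by positivity), Real.rpow_neg_one,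
      Real.mul_rpow Real.pi_pos.le (by positivity), ← Real.rpow_two, ← Real.rpow_mul h0.le,
      show 2 * -(b / 2) = -b by ring]
    have : ‖z.2‖ ^ (-b) * ‖z.2‖ ^ b = 1 := by
      rw [← Real.rpow_add h0]; simp
    field_simp
    linear_combination this
  have e2 : (-(4 * Real.pi) * Real.pi ^ (-(b / 2)) : ℝ) =
    -((Real.pi * ‖z.2‖ ^ 2) ^ (-(b / 2 + 1)) * ‖z.2‖ ^ b * (4 * Real.pi ^ 2 * ‖z.2‖ ^ 2)) := by
    rw [e1]; ring
  have e3 := sum_derivSym_pair z.2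
  rw [e2]
  unfold triTerm
  simp only [neg_zero, Real.rpow_zero, derivSym_cons m [_, _], derivSym_cons m [], derivSym_nil]
  rw [← Finset.sum_mul, ← Finset.mul_sum, ← Finset.sum_mul, ← Finset.mul_sum, ← Finset.mul_sum, e3]
  push_cast
  ring

theorem integrable_mul_of_norm_le_rpow {s C : ℝ} {U m : Plane → ℂ}
    (hU : Integrable fun ζ => (((1 + ‖ζ‖) ^ s : ℝ) : ℂ) * U ζ) (hm : AEStronglyMeasurable m volume)
    (hle : ∀ ζ, ‖m ζ‖ ≤ C * (1 + ‖ζ‖) ^ s) : Integrable fun ζ => m ζ * U ζ := by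
  have hpos : ∀ ζ : Plane, 0 < (1 + ‖ζ‖) ^ s := fun ζ => by positivity
  have hc : Continuous fun ζ : Plane => (((1 + ‖ζ‖) ^ s : ℝ) : ℂ) := by
    refine Complex.continuous_ofReal.comp (Continuous.rpow_const (by fun_prop) fun ζ => Or.inl ?_)
    positivity
  have := hU.bdd_mul (f := fun ζ => m ζ * (((1 + ‖ζ‖) ^ s : ℝ) : ℂ)⁻¹) (c := C)
    (hm.mul (hc.inv₀ fun ζ => by exact_mod_cast (hpos ζ).ne').aestronglyMeasurable)
    (Filter.Eventually.of_forall fun ζ => by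
      rw [norm_mul, norm_inv, Complex.norm_real, Real.norm_of_nonneg (hpos ζ).le,
        ← div_eq_mul_inv, div_le_iff₀ (hpos ζ)]
      exact hle ζ)
  refine this.congr (Filter.Eventually.of_forall fun ζ => ?_)
  have : (((1 + ‖ζ‖) ^ s : ℝ) : ℂ) ≠ 0 := by exact_mod_cast (hpos ζ).ne'
  beta_reduce
  field_simp

theorem measurable_ofReal_norm_rpow (s : ℝ) : Measurable fun ζ : Plane => ((‖ζ‖ ^ s : ℝ) : ℂ) := by
  fun_prop

theorem rpow_norm_le_one_add_rpow {a s : ℝ} (ha : 0 ≤ a) (has : a ≤ s) (ζ : Plane) :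
    ‖ζ‖ ^ a ≤ (1 + ‖ζ‖) ^ s :=
  (Real.rpow_le_rpow (norm_nonneg _) (by linarith) ha).trans
    (Real.rpow_le_rpow_of_exponent_le (by linarith [norm_nonneg ζ]) has)

theorem integrable_rpow_norm_mul {a s : ℝ} (ha : 0 ≤ a) (has : a ≤ s) {U : Plane → ℂ}
    (hU : Integrable fun ζ => (((1 + ‖ζ‖) ^ s : ℝ) : ℂ) * U ζ) :
    Integrable fun ζ => ((‖ζ‖ ^ a : ℝ) : ℂ) * U ζ := by
  refine integrable_mul_of_norm_le_rpow (C := 1) hU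
    (measurable_ofReal_norm_rpow a).aestronglyMeasurable fun ζ => ?_
  rw [Complex.norm_real, Real.norm_of_nonneg (by positivity), one_mul]
  exact rpow_norm_le_one_add_rpow ha has ζ

theorem integrable_of_one_add_rpow {s : ℝ} (hs : 0 ≤ s) {U : Plane → ℂ}
    (hU : Integrable fun ζ => (((1 + ‖ζ‖) ^ s : ℝ) : ℂ) * U ζ) : Integrable U := by
  simpa using integrable_rpow_norm_mul le_rfl hs hU

theorem norm_derivSym_singleton_le (j : Fin 2) (ζ : Plane) :
    ‖derivSym [j] ζ‖ ≤ 2 * Real.pi * ‖ζ‖ := by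
  simpa using norm_derivSym_le [j] ζ

theorem integrable_derivSym_mul {s : ℝ} (hs : 1 ≤ s) (j : Fin 2) {U : Plane → ℂ}
    (hU : Integrable fun ζ => (((1 + ‖ζ‖) ^ s : ℝ) : ℂ) * U ζ) :
    Integrable fun ζ => derivSym [j] ζ * U ζ := by
  refine integrable_mul_of_norm_le_rpow (C := 2 * Real.pi) hU
    (continuous_derivSym [j]).aestronglyMeasurable fun ζ => ?_
  have := rpow_norm_le_one_add_rpow zero_le_one hs ζ
  rw [Real.rpow_one] at this
  exact (norm_derivSym_singleton_le j ζ).trans (by gcongr)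

/-- Riesz transform bound in terms of `|ζ|^1`. -/
theorem exists_riesz_rpow_le {q : ℝ} (hq : 1 < q) (j : Fin 2) {s : ℝ} (hs : 1 ≤ s) :
    ∃ C : ℝ≥0, ∀ g : Plane → ℂ, Integrable (fun ζ => (((1 + ‖ζ‖) ^ s : ℝ) : ℂ) * g ζ) →
    eLpNorm (𝓕⁻ fun ξ => derivSym [j] ξ * g ξ) (ENNReal.ofReal q) volume ≤
      C * eLpNorm (𝓕⁻ fun ξ => ((‖ξ‖ ^ (1 : ℝ) : ℝ) : ℂ) * g ξ) (ENNReal.ofReal q) volume := by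
  obtain ⟨C, hC⟩ := exists_riesz_le hq j
  refine ⟨C, fun g hg => ?_⟩
  have h1 := integrable_rpow_norm_mul zero_le_one hs hg
  simp only [Real.rpow_one] at h1 ⊢
  exact hC g (integrable_of_one_add_rpow (by linarith) hg) h1

/-! ### Core bounds for the truncated forms -/

/-- The basic estimate: bounds for the truncated trilinear forms, up to an error tending to `0`. -/
def CoreBound (ν σ μ μ' a b : ℝ) (q : ℝ≥0∞) (r s : ℝ) (j m n : Fin 2) : Prop :=
  ∃ C : ℝ≥0, ∀ U φ h : Plane → ℂ,
    Integrable (fun ζ => (((1 + ‖ζ‖) ^ (1 + 2 * ν) : ℝ) : ℂ) * U ζ) →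
    Integrable (fun ζ => (((1 + ‖ζ‖) ^ (1 + 2 * ν) : ℝ) : ℂ) * φ ζ) →
    Integrable (fun η => ((‖η‖ ^ b : ℝ) : ℂ) * φ η) → Integrable h → BddMeas h →
    ∃ e : ℕ → ℝ≥0∞, Filter.Tendsto e Filter.atTop (nhds 0) ∧ ∀ N : ℕ,
      IntBd (triTerm 0 0 (σ / 2) (-ν) μ μ' [j] [m] [n] U φ h ((N : ℝ) + 1)⁻¹ (N + 1))
        (C * (eLpNorm (𝓕⁻ fun ζ => ((‖ζ‖ ^ a : ℝ) : ℂ) * U ζ) q volume *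
          eLpNorm (𝓕⁻ fun η => ((‖η‖ ^ b : ℝ) : ℂ) * φ η) (ENNReal.ofReal r) volume *
          eLpNorm h (ENNReal.ofReal s) volume) + e N)

theorem LaplaceRep.rpow_zero_mul {n : ℕ} {F : ℝ → ℝ} (hF : LaplaceRep n F) :
    LaplaceRep n fun X => X ^ (-(0 : ℝ)) * F X := by
  simpa using hF

/-- `hc₁` treats two situations at once: n₁ = 1 and c₁ = a/2 when a < 1, or n₁ = c₁ = 0 when a = 1.
Only the second and third factors need cancellation, and the condition b < 1 is 2(b/2+1) < 3. -/
theorem exists_triTerm_le_low {n₁ : ℕ} {ν σ μ μ' a b c₁ : ℝ} (hσ : 0 ≤ σ) (hσ1 : σ < 1)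
    (hμ : 0 < μ) (hμ' : 0 < μ') (hb : -1 < b) (hb1 : b < 1) (hν : 2 * ν = a + b + σ - 1)
    (hc₁ : (n₁ : ℝ) / 2 - c₁ = (1 - a) / 2)
    (hF₁ : LaplaceRep n₁ fun X => X ^ (-c₁) * Real.exp (-X))
    {q : ℝ≥0∞} {r s : ℝ} (hq1 : 1 < q) (hr : 1 < r) (hs : 1 < s)
    (hq : q⁻¹ + ENNReal.ofReal r⁻¹ + ENNReal.ofReal s⁻¹ = 1) (m n : Fin 2) {l₁ : List (Fin 2)}
    (hl₁ : l₁.length = n₁) :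
    ∃ C : ℝ≥0, ∀ g₁ φ h : Plane → ℂ, Integrable g₁ →
      Integrable (fun η => ((‖η‖ ^ b : ℝ) : ℂ) * φ η) → Integrable h → BddMeas h →
      ∀ δ R : ℝ, 0 < δ → IntBd (triTerm c₁ 0 (σ / 2) (-ν) μ μ' l₁ [m] [n] g₁ φ h δ R)
        (C * (eLpNorm (𝓕⁻ g₁) q volume *
          eLpNorm (𝓕⁻ fun η => ((‖η‖ ^ b : ℝ) : ℂ) * φ η) (ENNReal.ofReal r) volume *
          eLpNorm h (ENNReal.ofReal s) volume)) := by
  have hF₂ : LaplaceRep 3 fun X => X ^ (-(b / 2 + 1)) * besselN μ' X :=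
    laplaceRep_rpow_mul_besselN (by linarith) (by push_cast; linarith) (by push_cast; linarith)
  have hF₃ : LaplaceRep 1 fun X => X ^ (-(σ / 2)) * besselN μ X :=
    laplaceRep_rpow_mul_besselN (by linarith) (by push_cast; linarith) (by push_cast; linarith)
  choose C hC using fun k : Fin 2 => exists_triTerm_le_left (e := -ν) (l₂ := [m, k, k]) (l₃ := [n])
    (by norm_num) (by norm_num) hF₁ hF₂ hF₃ hq1 hr hs hq (by push_cast; linarith) hl₁ rfl rfl
  set κ : ℝ := -(4 * Real.pi) * Real.pi ^ (-(b / 2)) with hκ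
  have hκ0 : (κ : ℂ) ≠ 0 := by
    rw [hκ]
    exact_mod_cast mul_ne_zero (neg_ne_zero.2 (by positivity)) (Real.rpow_pos_of_pos Real.pi_pos _).ne'
  refine ⟨‖(κ : ℂ)⁻¹‖₊ * ∑ k, C k, fun g₁ φ h hg₁ hφ hh hhb δ R hδ => ?_⟩
  have h1 := (IntBd.sum fun k => hC k g₁ _ h hg₁ hφ hh hhb δ R hδ).const_mul (κ : ℂ)⁻¹
  refine (h1.congr ?_).mono (le_of_eq ?_)
  · filter_upwards [ae_prod_ne_zero] with z hz
    rw [sum_triTerm_rpow_right m g₁ φ h δ R hz.2.1, inv_mul_cancel_left₀ hκ0]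
  · rw [ENNReal.coe_mul, ENNReal.coe_finsetSum, ← Finset.sum_mul, enorm_eq_nnnorm]
    ring

theorem coreBound_of_lt_lt {ν σ μ μ' a b : ℝ} (hσ : 0 ≤ σ) (hσ1 : σ < 1)
    (hμ : 0 < μ) (hμ' : 0 < μ') (ha : 0 ≤ a) (ha1 : a < 1) (hb : -1 < b) (hb1 : b < 1)
    (hν0 : 0 ≤ ν) (hν : 2 * ν = a + b + σ - 1)
    {q : ℝ≥0∞} {r s : ℝ} (hq1 : 1 < q) (hr : 1 < r) (hs : 1 < s)
    (hq : q⁻¹ + ENNReal.ofReal r⁻¹ + ENNReal.ofReal s⁻¹ = 1) (j m n : Fin 2) :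
    CoreBound ν σ μ μ' a b q r s j m n := by
  obtain ⟨C, hC⟩ := exists_triTerm_le_low (c₁ := a / 2) (n₁ := 1) (l₁ := [j]) hσ hσ1 hμ hμ' hb hb1
    hν (by push_cast; ring)
    (laplaceRep_rpow_mul_exp_neg (by linarith) (by push_cast; linarith)) hq1 hr hs hq m n rfl
  set κ : ℝ := Real.pi ^ (-(a / 2)) with hκ
  have hκ0 : (κ : ℂ) ≠ 0 := by
    rw [hκ]; exact_mod_cast (Real.rpow_pos_of_pos Real.pi_pos _).ne'
  refine ⟨‖(κ : ℂ)⁻¹‖₊ * C, fun U φ h hU hφ hφb hh hhb => ⟨0, tendsto_const_nhds, fun N => ?_⟩⟩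
  have h1 := (hC _ φ h (integrable_rpow_norm_mul ha (by linarith) hU) hφb hh hhb ((N : ℝ) + 1)⁻¹
    (N + 1) (by positivity)).const_mul (κ : ℂ)⁻¹
  refine (h1.congr ?_).mono (le_of_eq ?_)
  · filter_upwards [ae_prod_ne_zero] with z hz
    rw [triTerm_rpow_left U φ h _ _ hz.1, inv_mul_cancel_left₀ hκ0]
  · rw [ENNReal.coe_mul, Pi.zero_apply, add_zero, enorm_eq_nnnorm]
    ring

theorem triTerm_derivSym_left (c₂ c₃ e μ μ' : ℝ) (j : Fin 2) (l₂ l₃ : List (Fin 2))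
    (U φ h : Plane → ℂ) (δ R : ℝ) :
    triTerm 0 c₂ c₃ e μ μ' [] l₂ l₃ (fun ζ => derivSym [j] ζ * U ζ) φ h δ R =
      triTerm 0 c₂ c₃ e μ μ' [j] l₂ l₃ U φ h δ R := by
  funext z
  unfold triTerm
  rw [derivSym_nil]
  ring

theorem triTerm_derivSym_right (c₁ c₃ e μ μ' : ℝ) (m : Fin 2) (l₁ l₃ : List (Fin 2))
    (U φ h : Plane → ℂ) (δ R : ℝ) :
    triTerm c₁ 0 c₃ e μ μ' l₁ [] l₃ U (fun η => derivSym [m] η * φ η) h δ R =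
      triTerm c₁ 0 c₃ e μ μ' l₁ [m] l₃ U φ h δ R := by
  funext z
  unfold triTerm
  rw [derivSym_nil]
  ring

/-- For a = 1 nothing of the derivative on the first factor is left after absorbing |ζ|; the factor
takes the maximal function and ∂_j U is compared with |ζ|Û by a Riesz transform. -/
theorem coreBound_one_lt {ν σ μ μ' b : ℝ} (hσ : 0 ≤ σ) (hσ1 : σ < 1)
    (hμ : 0 < μ) (hμ' : 0 < μ') (hb : -1 < b) (hb1 : b < 1)
    (hν0 : 0 ≤ ν) (hν : 2 * ν = 1 + b + σ - 1)
    {q r s : ℝ} (hq1 : 1 < q) (hr : 1 < r) (hs : 1 < s)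
    (hq : (ENNReal.ofReal q)⁻¹ + ENNReal.ofReal r⁻¹ + ENNReal.ofReal s⁻¹ = 1) (j m n : Fin 2) :
    CoreBound ν σ μ μ' 1 b (ENNReal.ofReal q) r s j m n := by
  obtain ⟨C, hC⟩ := exists_triTerm_le_low (c₁ := 0) (n₁ := 0) (l₁ := []) hσ hσ1 hμ hμ' hb hb1
    hν (by push_cast; ring) (laplaceRep_exp_neg 0).rpow_zero_mul (by simpa using hq1) hr hs hq m n
    rfl
  obtain ⟨C₁, hC₁⟩ := exists_riesz_rpow_le hq1 j (by linarith : 1 ≤ 1 + 2 * ν)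
  refine ⟨C * C₁, fun U φ h hU hφ hφb hh hhb => ⟨0, tendsto_const_nhds, fun N => ?_⟩⟩
  have h1 := hC _ φ h (integrable_derivSym_mul (by linarith) j hU) hφb hh hhb ((N : ℝ) + 1)⁻¹
    (N + 1) (by positivity)
  rw [triTerm_derivSym_left] at h1
  refine h1.mono ?_
  rw [ENNReal.coe_mul, Pi.zero_apply, add_zero, mul_assoc (C : ℝ≥0∞)]
  refine (mul_le_mul_right (mul_le_mul_left (mul_le_mul_left (hC₁ U hU) _) _) (C : ℝ≥0∞)).trans
    (le_of_eq ?_)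
  ring

/-- The roles of the first two factors are exchanged: φ takes the maximal function after a Riesz
transform, while a < 1 preserves cancellation on the first. -/
theorem coreBound_lt_one {ν σ μ μ' a : ℝ} (hσ : 0 ≤ σ) (hσ1 : σ < 1)
    (hμ : 0 < μ) (hμ' : 0 < μ') (ha : 0 ≤ a) (ha1 : a < 1)
    (hν0 : 0 ≤ ν) (hν : 2 * ν = a + 1 + σ - 1)
    {q r s : ℝ} (hq1 : 1 < q) (hr : 1 < r) (hs : 1 < s)
    (hq : q⁻¹ + r⁻¹ + s⁻¹ = 1) (j m n : Fin 2) :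
    CoreBound ν σ μ μ' a 1 (ENNReal.ofReal q) r s j m n := by
  have hF₁ : LaplaceRep 1 fun X => X ^ (-(a / 2)) * Real.exp (-X) :=
    laplaceRep_rpow_mul_exp_neg (by linarith) (by push_cast; linarith)
  have hF₃ : LaplaceRep 1 fun X => X ^ (-(σ / 2)) * besselN μ X :=
    laplaceRep_rpow_mul_besselN (by linarith) (by push_cast; linarith) (by push_cast; linarith)
  obtain ⟨C, hC⟩ := exists_triTerm_le_right (e := -ν) (l₁ := [j]) (l₂ := []) (l₃ := [n])
    (by norm_num) (by norm_num) hF₁ (laplaceRep_besselN_zero hμ').rpow_zero_mul hF₃ hq1 hr hs hq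
    (by push_cast; linarith) rfl rfl rfl
  obtain ⟨C₁, hC₁⟩ := exists_riesz_rpow_le hr m (by linarith : 1 ≤ 1 + 2 * ν)
  set κ : ℝ := Real.pi ^ (-(a / 2)) with hκ
  have hκ0 : (κ : ℂ) ≠ 0 := by
    rw [hκ]; exact_mod_cast (Real.rpow_pos_of_pos Real.pi_pos _).ne'
  refine ⟨‖(κ : ℂ)⁻¹‖₊ * C * C₁, fun U φ h hU hφ hφb hh hhb =>
    ⟨0, tendsto_const_nhds, fun N => ?_⟩⟩
  have h1 := (hC _ _ h (integrable_rpow_norm_mul ha (by linarith) hU)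
    (integrable_derivSym_mul (by linarith) m hφ) hh hhb ((N : ℝ) + 1)⁻¹
    (N + 1) (by positivity)).const_mul (κ : ℂ)⁻¹
  rw [triTerm_derivSym_right] at h1
  refine (h1.congr ?_).mono ?_
  · filter_upwards [ae_prod_ne_zero] with z hz
    rw [triTerm_rpow_left U φ h _ _ hz.1, inv_mul_cancel_left₀ hκ0]
  · rw [ENNReal.coe_mul, ENNReal.coe_mul, Pi.zero_apply, add_zero, enorm_eq_nnnorm]
    refine (mul_le_mul_right (mul_le_mul_right (mul_le_mul_left (mul_le_mul_right (hC₁ φ hφ)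
      (eLpNorm (𝓕⁻ fun ζ => ((‖ζ‖ ^ a : ℝ) : ℂ) * U ζ) (ENNReal.ofReal q) volume))
      (eLpNorm h (ENNReal.ofReal s) volume)) (C : ℝ≥0∞)) (‖(κ : ℂ)⁻¹‖₊ : ℝ≥0∞)).trans (le_of_eq ?_)
    ring

/-! ### The endpoint a = b = 1: boundary terms and integration by parts -/

theorem measurable_besselN (μ : ℝ) : Measurable (besselN μ) := by
  have h : StronglyMeasurable (Function.uncurry fun X r : ℝ =>
      r ^ (μ - 1) * Real.exp (-r - X / r)) := by
    refine Measurable.stronglyMeasurable ?_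
    simp only [Function.uncurry_def]
    fun_prop
  exact (h.integral_prod_right (ν := volume.restrict (Set.Ioi 0))).measurable

theorem besselE_le {μ μ' X Y Z τ : ℝ} (hμ : 0 < μ) (hμ' : 0 < μ') (hX : 0 ≤ X) (hY : 0 ≤ Y)
    (hτ : 0 ≤ τ) :
    besselE μ μ' X Y Z τ ≤ Real.exp (-(τ * Z)) * (Real.Gamma μ' * Real.Gamma μ) := by
  unfold besselE
  rw [mul_assoc]
  refine mul_le_mul_of_nonneg_left ?_ (Real.exp_pos _).le
  exact mul_le_mul (besselN_le_Gamma hμ' (by positivity)) (besselN_le_Gamma hμ (by positivity))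
    (besselN_nonneg _ _) (Real.Gamma_pos_of_pos hμ').le

theorem rpow_mul_besselE_le {μ μ' t X Y Z τ : ℝ} (hμ : 0 < μ) (hμ' : 0 < μ') (ht : 0 ≤ t)
    (ht1 : t ≤ 1) (hX : 0 < X) (hY : 0 < Y) (hZ : 0 < Z) (hτ : 0 < τ) :
    τ ^ (2 * t) * besselE μ μ' X Y Z τ ≤
      Z ^ (-t) * Y ^ (-t) * (Real.Gamma (μ' + t) * Real.Gamma μ) := by
  have h1 := rpow_mul_exp_neg_le_one ht ht1 (mul_pos hτ hZ).le
  have h2 := rpow_mul_besselN_le hμ' ht ht1 (mul_pos hτ hY).le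
  have h3 := besselN_le_Gamma hμ (mul_pos hτ hX).le
  have n2 := besselN_nonneg μ' (τ * Y)
  have G2 := (Real.Gamma_pos_of_pos (by linarith : 0 < μ' + t)).le
  have e : τ ^ (2 * t) * besselE μ μ' X Y Z τ = Z ^ (-t) * Y ^ (-t) *
      (((τ * Z) ^ t * Real.exp (-(τ * Z))) * ((τ * Y) ^ t * besselN μ' (τ * Y)) *
        besselN μ (τ * X)) := by
    rw [Real.mul_rpow hτ.le hZ.le, Real.mul_rpow hτ.le hY.le, two_mul, Real.rpow_add hτ,
      Real.rpow_neg hZ.le, Real.rpow_neg hY.le]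
    unfold besselE
    field_simp
  rw [e]
  refine mul_le_mul_of_nonneg_left ?_ (by positivity)
  refine mul_le_mul ?_ h3 (besselN_nonneg _ _) G2
  calc _ ≤ 1 * Real.Gamma (μ' + t) := mul_le_mul h1 h2 (by positivity) zero_le_one
    _ = _ := one_mul _

theorem rpow_neg_mul_norm_le {c : ℝ} (hc : 0 ≤ c) (hc1 : 2 * c ≤ 1) {ζ : Plane} (hζ : ζ ≠ 0) :
    (Real.pi * ‖ζ‖ ^ 2) ^ (-c) * ‖ζ‖ ≤ (1 + ‖ζ‖) ^ (1 - 2 * c) := by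
  have h0 := norm_pos_iff.2 hζ
  have h1 : Real.pi ^ (-c) ≤ 1 :=
    Real.rpow_le_one_of_one_le_of_nonpos (by linarith [Real.pi_gt_three]) (by linarith)
  have h2 : (‖ζ‖ ^ 2) ^ (-c) * ‖ζ‖ = ‖ζ‖ ^ (1 - 2 * c) := by
    rw [← Real.rpow_two, ← Real.rpow_mul h0.le]
    nth_rw 2 [← Real.rpow_one ‖ζ‖]
    rw [← Real.rpow_add h0]
    congr 1; ring
  rw [Real.mul_rpow Real.pi_pos.le (by positivity), mul_assoc, h2]
  calc _ ≤ 1 * ‖ζ‖ ^ (1 - 2 * c) := by gcongr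
    _ ≤ _ := by
      rw [one_mul]
      exact rpow_norm_le_one_add_rpow (by linarith) le_rfl ζ

theorem one_add_norm_add_rpow_le {c : ℝ} (hc : 0 ≤ c) (ζ η : Plane) :
    (1 + ‖ζ + η‖) ^ c ≤ (1 + ‖ζ‖) ^ c * (1 + ‖η‖) ^ c := by
  rw [← Real.mul_rpow (by positivity) (by positivity)]
  refine Real.rpow_le_rpow (by positivity) ?_ hc
  nlinarith [norm_add_le ζ η, norm_nonneg ζ, norm_nonneg η, mul_nonneg (norm_nonneg ζ) (norm_nonneg η)]

/-- The boundary terms arising from integration by parts. -/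
noncomputable def bdryTerm (σ ν μ μ' : ℝ) (j m n : Fin 2) (U φ h : Plane → ℂ)
    (τ : ℝ) (z : Plane × Plane) : ℂ :=
  (((Real.pi * ‖z.1 + z.2‖ ^ 2) ^ (-(σ / 2)) * (τ ^ (1 - ν) * besselE μ μ'
        (Real.pi * ‖z.1 + z.2‖ ^ 2) (Real.pi * ‖z.2‖ ^ 2) (Real.pi * ‖z.1‖ ^ 2) τ) : ℝ) : ℂ) *
    (derivSym [j] z.1 * derivSym [m] z.2 * derivSym [n] (z.1 + z.2)) *
    (U z.1 * φ z.2 * 𝓕⁻ h (z.1 + z.2))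

/-- A dominating function uniform in τ. The power τ^{1-ν} = τ^{2t} is shared equally between e^{-τZ}
and N_{μ'}(τY); the resulting negative powers of |ζ|, |η|, |ζ+η| are compensated by the three
derivatives. -/
theorem exists_norm_bdryTerm_le {σ ν μ μ' : ℝ} (hσ : 0 ≤ σ) (hσ1 : σ < 1) (hν : 0 ≤ ν)
    (hν1 : ν < 1) (hμ : 0 < μ) (hμ' : 0 < μ') (j m n : Fin 2) {h : Plane → ℂ} (hh : Integrable h) :
    ∃ C : ℝ, ∀ U φ : Plane → ℂ, ∀ τ, 0 < τ → ∀ z : Plane × Plane,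
      z.1 ≠ 0 ∧ z.2 ≠ 0 ∧ z.1 + z.2 ≠ 0 → ‖bdryTerm σ ν μ μ' j m n U φ h τ z‖ ≤
        C * ‖((((1 + ‖z.1‖) ^ (1 + 2 * ν) : ℝ) : ℂ) * U z.1) *
          ((((1 + ‖z.2‖) ^ (1 + 2 * ν) : ℝ) : ℂ) * φ z.2)‖ := by
  obtain ⟨-, K, hK⟩ := bddMeas_fourierInv hh
  set t : ℝ := (1 - ν) / 2 with ht
  set G : ℝ := Real.Gamma (μ' + t) * Real.Gamma μ with hG
  have hG0 : 0 ≤ G := mul_nonneg (Real.Gamma_pos_of_pos (by linarith)).le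
    (Real.Gamma_pos_of_pos hμ).le
  refine ⟨(2 * Real.pi) ^ 3 * G * K, fun U φ τ hτ z hz => ?_⟩
  obtain ⟨h1, h2, h3⟩ := hz
  have p1 := norm_pos_iff.2 h1
  have p2 := norm_pos_iff.2 h2
  have p3 := norm_pos_iff.2 h3
  have hE := rpow_mul_besselE_le (t := t) hμ hμ' (by linarith) (by linarith)
    (X := Real.pi * ‖z.1 + z.2‖ ^ 2) (Y := Real.pi * ‖z.2‖ ^ 2) (Z := Real.pi * ‖z.1‖ ^ 2)
    (by positivity) (by positivity) (by positivity) hτ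
  rw [show 2 * t = 1 - ν by rw [ht]; ring] at hE
  set E := besselE μ μ' (Real.pi * ‖z.1 + z.2‖ ^ 2) (Real.pi * ‖z.2‖ ^ 2) (Real.pi * ‖z.1‖ ^ 2) τ
  have hE0 : 0 ≤ E := besselE_nonneg _ _ _ _ _ _
  have k1 := rpow_neg_mul_norm_le (c := t) (by linarith) (by linarith) h1
  have k2 := rpow_neg_mul_norm_le (c := t) (by linarith) (by linarith) h2
  have k3 := rpow_neg_mul_norm_le (c := σ / 2) (by linarith) (by linarith) h3
  have k4 := k3.trans (one_add_norm_add_rpow_le (by linarith) z.1 z.2)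
  have k5 : ∀ w : Plane, (1 + ‖w‖) ^ (1 - 2 * t) * (1 + ‖w‖) ^ (1 - 2 * (σ / 2)) ≤
      (1 + ‖w‖) ^ (1 + 2 * ν) := by
    intro w
    rw [← Real.rpow_add (by positivity)]
    exact Real.rpow_le_rpow_of_exponent_le (by linarith [norm_nonneg w]) (by rw [ht]; linarith)
  unfold bdryTerm
  rw [norm_mul, norm_mul, Complex.norm_real, Real.norm_of_nonneg (by positivity)]
  set W1 := (Real.pi * ‖z.1‖ ^ 2) ^ (-t)
  set W2 := (Real.pi * ‖z.2‖ ^ 2) ^ (-t)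
  set W3 := (Real.pi * ‖z.1 + z.2‖ ^ 2) ^ (-(σ / 2))
  have hW1 : 0 ≤ W1 := by positivity
  have hW2 : 0 ≤ W2 := by positivity
  have hW3 : 0 ≤ W3 := by positivity
  calc W3 * (τ ^ (1 - ν) * E) * ‖derivSym [j] z.1 * derivSym [m] z.2 * derivSym [n] (z.1 + z.2)‖ *
        ‖U z.1 * φ z.2 * 𝓕⁻ h (z.1 + z.2)‖
      ≤ W3 * (W1 * W2 * G) * ((2 * Real.pi * ‖z.1‖) * (2 * Real.pi * ‖z.2‖) *
          (2 * Real.pi * ‖z.1 + z.2‖)) * (‖U z.1‖ * ‖φ z.2‖ * K) := by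
        rw [norm_mul, norm_mul, norm_mul, norm_mul]
        gcongr
        · exact norm_derivSym_singleton_le j _
        · exact norm_derivSym_singleton_le m _
        · exact norm_derivSym_singleton_le n _
        · exact hK _
    _ = (2 * Real.pi) ^ 3 * G * K * (((W1 * ‖z.1‖) * (W2 * ‖z.2‖) * (W3 * ‖z.1 + z.2‖)) *
          (‖U z.1‖ * ‖φ z.2‖)) := by ring
    _ ≤ (2 * Real.pi) ^ 3 * G * K * (((1 + ‖z.1‖) ^ (1 - 2 * t) * (1 + ‖z.2‖) ^ (1 - 2 * t) *
          ((1 + ‖z.1‖) ^ (1 - 2 * (σ / 2)) * (1 + ‖z.2‖) ^ (1 - 2 * (σ / 2)))) *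
          (‖U z.1‖ * ‖φ z.2‖)) := by gcongr
    _ = (2 * Real.pi) ^ 3 * G * K * (((1 + ‖z.1‖) ^ (1 - 2 * t) * (1 + ‖z.1‖) ^ (1 - 2 * (σ / 2))) *
          ((1 + ‖z.2‖) ^ (1 - 2 * t) * (1 + ‖z.2‖) ^ (1 - 2 * (σ / 2))) *
          (‖U z.1‖ * ‖φ z.2‖)) := by ring
    _ ≤ (2 * Real.pi) ^ 3 * G * K * ((1 + ‖z.1‖) ^ (1 + 2 * ν) * (1 + ‖z.2‖) ^ (1 + 2 * ν) *
          (‖U z.1‖ * ‖φ z.2‖)) := by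
        gcongr
        · exact k5 z.1
        · exact k5 z.2
    _ = _ := by
        simp only [norm_mul, Complex.norm_real]
        rw [Real.norm_of_nonneg (by positivity : 0 ≤ (1 + ‖z.1‖) ^ (1 + 2 * ν)),
          Real.norm_of_nonneg (by positivity : 0 ≤ (1 + ‖z.2‖) ^ (1 + 2 * ν))]
        ring

theorem aestronglyMeasurable_bdryTerm (σ ν μ μ' : ℝ) (j m n : Fin 2) {U φ h : Plane → ℂ}
    (hU : AEStronglyMeasurable U volume) (hφ : AEStronglyMeasurable φ volume) (hh : Integrable h)
    (τ : ℝ) : AEStronglyMeasurable (bdryTerm σ ν μ μ' j m n U φ h τ) volume := by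
  have d1 := (continuous_derivSym [j]).measurable
  have d2 := (continuous_derivSym [m]).measurable
  have d3 := (continuous_derivSym [n]).measurable
  have hm := measurable_besselN μ
  have hm' := measurable_besselN μ'
  have hv := (continuous_fourierInv hh).measurable
  have hU' : AEStronglyMeasurable (fun z : Plane × Plane => U z.1) volume := hU.comp_fst
  have hφ' : AEStronglyMeasurable (fun z : Plane × Plane => φ z.2) volume := hφ.comp_snd
  unfold bdryTerm besselE
  refine AEStronglyMeasurable.mul (AEStronglyMeasurable.mul ?_ ?_) ((hU'.mul hφ').mul ?_)
  · exact Measurable.aestronglyMeasurable (by fun_prop)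
  · exact Measurable.aestronglyMeasurable (by fun_prop)
  · exact Measurable.aestronglyMeasurable (by fun_prop)

theorem tendsto_rpow_mul_besselE_atTop {ν μ μ' X Y Z : ℝ} (hμ : 0 < μ) (hμ' : 0 < μ')
    (hX : 0 ≤ X) (hY : 0 ≤ Y) (hZ : 0 < Z) :
    Filter.Tendsto (fun τ : ℝ => τ ^ (1 - ν) * besselE μ μ' X Y Z τ) Filter.atTop (nhds 0) := by
  have h1 := (tendsto_rpow_mul_exp_neg_mul_atTop_nhds_zero (1 - ν) Z hZ).mul_const
    (Real.Gamma μ' * Real.Gamma μ)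
  rw [zero_mul] at h1
  refine tendsto_of_tendsto_of_tendsto_of_le_of_le' tendsto_const_nhds h1 ?_ ?_
  · filter_upwards [Filter.eventually_ge_atTop 0] with τ hτ
    exact mul_nonneg (Real.rpow_nonneg hτ _) (besselE_nonneg _ _ _ _ _ _)
  · filter_upwards [Filter.eventually_ge_atTop 0] with τ hτ
    rw [mul_assoc]
    refine mul_le_mul_of_nonneg_left ?_ (Real.rpow_nonneg hτ _)
    rw [show -Z * τ = -(τ * Z) by ring]
    exact besselE_le hμ hμ' hX hY hτ

theorem tendsto_rpow_mul_besselE_zero {ν μ μ' X Y Z : ℝ} (hν1 : ν < 1) (hμ : 0 < μ) (hμ' : 0 < μ')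
    (hX : 0 ≤ X) (hY : 0 ≤ Y) (hZ : 0 < Z) :
    Filter.Tendsto (fun τ : ℝ => τ ^ (1 - ν) * besselE μ μ' X Y Z τ)
      (nhdsWithin 0 (Set.Ioi 0)) (nhds 0) := by
  have h0 : Filter.Tendsto (fun τ : ℝ => τ ^ (1 - ν)) (nhds 0) (nhds 0) := by
    have := (Real.continuousAt_rpow_const 0 (1 - ν) (Or.inr (by linarith))).tendsto
    rwa [Real.zero_rpow (by linarith)] at this
  have h1 := (h0.mono_left (nhdsWithin_le_nhds (s := Set.Ioi 0))).mul_const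
    (Real.Gamma μ' * Real.Gamma μ)
  rw [zero_mul] at h1
  refine tendsto_of_tendsto_of_tendsto_of_le_of_le' tendsto_const_nhds h1 ?_ ?_
  · filter_upwards [self_mem_nhdsWithin] with τ (hτ : 0 < τ)
    exact mul_nonneg (Real.rpow_nonneg hτ.le _) (besselE_nonneg _ _ _ _ _ _)
  · filter_upwards [self_mem_nhdsWithin] with τ (hτ : 0 < τ)
    refine mul_le_mul_of_nonneg_left ?_ (Real.rpow_nonneg hτ.le _)
    refine (besselE_le hμ hμ' hX hY hτ.le).trans ?_
    refine mul_le_of_le_one_left (mul_nonneg (Real.Gamma_pos_of_pos hμ').le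
      (Real.Gamma_pos_of_pos hμ).le) ?_
    rw [Real.exp_le_one_iff]
    nlinarith

theorem tendsto_natCast_add_one_inv :
    Filter.Tendsto (fun N : ℕ => ((N : ℝ) + 1)⁻¹) Filter.atTop (nhdsWithin 0 (Set.Ioi 0)) := by
  refine tendsto_nhdsWithin_iff.2 ⟨?_, Filter.Eventually.of_forall fun N => by
    simp only [Set.mem_Ioi]; positivity⟩
  simpa [one_div] using tendsto_one_div_add_atTop_nhds_zero_nat (𝕜 := ℝ)

theorem tendsto_natCast_add_one :
    Filter.Tendsto (fun N : ℕ => (N : ℝ) + 1) Filter.atTop Filter.atTop :=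
  Filter.tendsto_atTop_add_const_right _ _ tendsto_natCast_atTop_atTop

/-- The integrals of the boundary terms are negligible. -/
theorem tendsto_integral_bdryTerm {σ ν μ μ' : ℝ} (hσ : 0 ≤ σ) (hσ1 : σ < 1) (hν : 0 ≤ ν)
    (hν1 : ν < 1) (hμ : 0 < μ) (hμ' : 0 < μ') (j m n : Fin 2) {U φ h : Plane → ℂ}
    (hU : Integrable (fun ζ => (((1 + ‖ζ‖) ^ (1 + 2 * ν) : ℝ) : ℂ) * U ζ))
    (hφ : Integrable (fun ζ => (((1 + ‖ζ‖) ^ (1 + 2 * ν) : ℝ) : ℂ) * φ ζ)) (hh : Integrable h)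
    {τ : ℕ → ℝ} (hτ0 : ∀ N, 0 < τ N)
    (hτ : ∀ X Y Z : ℝ, 0 < X → 0 < Y → 0 < Z → Filter.Tendsto
      (fun N => τ N ^ (1 - ν) * besselE μ μ' X Y Z (τ N)) Filter.atTop (nhds 0)) :
    (∀ N, Integrable (bdryTerm σ ν μ μ' j m n U φ h (τ N))) ∧
    Filter.Tendsto (fun N => ‖∫ z, bdryTerm σ ν μ μ' j m n U φ h (τ N) z‖ₑ) Filter.atTop
      (nhds 0) := by
  obtain ⟨C, hC⟩ := exists_norm_bdryTerm_le hσ hσ1 hν hν1 hμ hμ' j m n hh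
  have hm := fun N => aestronglyMeasurable_bdryTerm σ ν μ μ' j m n
    (integrable_of_one_add_rpow (by linarith) hU).1 (integrable_of_one_add_rpow (by linarith) hφ).1
    hh (τ N)
  have hdom := ((hU.mul_prod hφ).norm.const_mul C)
  have hle : ∀ N, ∀ᵐ z : Plane × Plane, ‖bdryTerm σ ν μ μ' j m n U φ h (τ N) z‖ ≤
        C * ‖((((1 + ‖z.1‖) ^ (1 + 2 * ν) : ℝ) : ℂ) * U z.1) *
          ((((1 + ‖z.2‖) ^ (1 + 2 * ν) : ℝ) : ℂ) * φ z.2)‖ := fun N => by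
    filter_upwards [ae_prod_ne_zero] with z hz using hC U φ _ (hτ0 N) z hz
  refine ⟨fun N => hdom.mono' (hm N) (hle N), ?_⟩
  have h1 := tendsto_integral_of_dominated_convergence (f := fun _ => 0) _ hm hdom hle (by
    filter_upwards [ae_prod_ne_zero] with z ⟨h1, h2, h3⟩
    have p1 := norm_pos_iff.2 h1
    have p2 := norm_pos_iff.2 h2
    have p3 := norm_pos_iff.2 h3
    have := (hτ (Real.pi * ‖z.1 + z.2‖ ^ 2) (Real.pi * ‖z.2‖ ^ 2) (Real.pi * ‖z.1‖ ^ 2)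
      (by positivity) (by positivity) (by positivity)).const_mul
      ((Real.pi * ‖z.1 + z.2‖ ^ 2) ^ (-(σ / 2)))
    have h4 := ((Complex.continuous_ofReal.tendsto _).comp this).mul_const
      (derivSym [j] z.1 * derivSym [m] z.2 * derivSym [n] (z.1 + z.2)) |>.mul_const
      (U z.1 * φ z.2 * 𝓕⁻ h (z.1 + z.2))
    simp only [mul_zero, Complex.ofReal_zero, zero_mul] at h4
    exact h4)
  simpa using h1.enorm

theorem derivSym_singleton_add (k : Fin 2) (ζ η : Plane) :
    derivSym [k] (ζ + η) = derivSym [k] ζ + derivSym [k] η := by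
  simp only [derivSym_cons, derivSym_nil, PiLp.add_apply]
  push_cast
  ring

theorem sum_triTerm_pair_left (c₃ e μ μ' : ℝ) (j m : Fin 2) (l₃ : List (Fin 2))
    (U φ h : Plane → ℂ) (δ R : ℝ) (z : Plane × Plane) :
    ∑ k, triTerm 0 0 c₃ e μ μ' [k, k] [] l₃ (fun ζ => derivSym [j] ζ * U ζ)
        (fun η => derivSym [m] η * φ η) h δ R z =
      -((4 * Real.pi : ℝ) : ℂ) * (((Real.pi * ‖z.1‖ ^ 2 : ℝ) : ℂ) *
        triTerm 0 0 c₃ e μ μ' [j] [m] l₃ U φ h δ R z) := by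
  have e3 := sum_derivSym_pair z.1
  unfold triTerm
  rw [← Finset.sum_mul, ← Finset.mul_sum, ← Finset.sum_mul, ← Finset.sum_mul, e3, derivSym_nil]
  push_cast
  ring

theorem sum_triTerm_pair_right (c₃ e μ μ' : ℝ) (j m : Fin 2) (l₃ : List (Fin 2))
    (U φ h : Plane → ℂ) (δ R : ℝ) (z : Plane × Plane) :
    ∑ k, triTerm 0 0 c₃ e μ μ' [] [k, k] l₃ (fun ζ => derivSym [j] ζ * U ζ)
        (fun η => derivSym [m] η * φ η) h δ R z =
      -((4 * Real.pi : ℝ) : ℂ) * (((Real.pi * ‖z.2‖ ^ 2 : ℝ) : ℂ) *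
        triTerm 0 0 c₃ e μ μ' [j] [m] l₃ U φ h δ R z) := by
  have e3 := sum_derivSym_pair z.2
  unfold triTerm
  rw [← Finset.sum_mul, ← Finset.mul_sum, ← Finset.sum_mul, ← Finset.mul_sum, e3, derivSym_nil]
  push_cast
  ring

/-- Of the two derivatives contained in X, one stays on ζ+η and the other is distributed over ζ and
η, so that in each term two factors carry derivatives. -/
theorem sum_triTerm_mixed (c₃ e μ μ' : ℝ) (j m n : Fin 2)
    (U φ h : Plane → ℂ) (δ R : ℝ) (z : Plane × Plane) :
    ∑ k, (triTerm 0 0 c₃ e μ μ' [k] [] [n, k] (fun ζ => derivSym [j] ζ * U ζ)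
        (fun η => derivSym [m] η * φ η) h δ R z +
      triTerm 0 0 c₃ e μ μ' [] [k] [n, k] (fun ζ => derivSym [j] ζ * U ζ)
        (fun η => derivSym [m] η * φ η) h δ R z) =
      -((4 * Real.pi : ℝ) : ℂ) * (((Real.pi * ‖z.1 + z.2‖ ^ 2 : ℝ) : ℂ) *
        triTerm 0 0 c₃ e μ μ' [j] [m] [n] U φ h δ R z) := by
  have e3 := sum_derivSym_pair (z.1 + z.2)
  have key : ∀ k, triTerm 0 0 c₃ e μ μ' [k] [] [n, k] (fun ζ => derivSym [j] ζ * U ζ)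
        (fun η => derivSym [m] η * φ η) h δ R z +
      triTerm 0 0 c₃ e μ μ' [] [k] [n, k] (fun ζ => derivSym [j] ζ * U ζ)
        (fun η => derivSym [m] η * φ η) h δ R z =
      derivSym [k, k] (z.1 + z.2) * triTerm 0 0 c₃ e μ μ' [j] [m] [n] U φ h δ R z := by
    intro k
    have e1 : derivSym [k, k] (z.1 + z.2) = derivSym [k] (z.1 + z.2) *
      (derivSym [k] z.1 + derivSym [k] z.2) := by
      rw [← derivSym_singleton_add, derivSym_cons k [k], derivSym_cons k [], derivSym_nil, mul_one]
    have e2 : derivSym [n, k] (z.1 + z.2) = derivSym [n] (z.1 + z.2) * derivSym [k] (z.1 + z.2) := by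
      rw [derivSym_cons n [k], derivSym_cons n [], derivSym_nil, mul_one]
    rw [e1]
    unfold triTerm
    rw [e2, derivSym_nil, derivSym_nil]
    ring
  rw [Finset.sum_congr rfl fun k _ => key k, ← Finset.sum_mul, e3]
  push_cast
  ring

theorem triTerm_eq_by_parts {ν σ μ μ' δ R : ℝ} (hν1 : ν < 1) (hδ : 0 < δ) (hR : δ ≤ R)
    (j m n : Fin 2) (U φ h : Plane → ℂ) {z : Plane × Plane} (hz2 : z.2 ≠ 0) (hz3 : z.1 + z.2 ≠ 0) :
    ((1 - ν : ℝ) : ℂ) * triTerm 0 0 (σ / 2) (-ν) μ μ' [j] [m] [n] U φ h δ R z =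
      ((Real.pi * ‖z.1‖ ^ 2 : ℝ) : ℂ) *
        triTerm 0 0 (σ / 2) (1 - ν) μ μ' [j] [m] [n] U φ h δ R z +
      ((Real.pi * ‖z.2‖ ^ 2 : ℝ) : ℂ) *
        triTerm 0 0 (σ / 2) (1 - ν) μ (μ' - 1) [j] [m] [n] U φ h δ R z +
      ((Real.pi * ‖z.1 + z.2‖ ^ 2 : ℝ) : ℂ) *
        triTerm 0 0 (σ / 2) (1 - ν) (μ - 1) μ' [j] [m] [n] U φ h δ R z +
      (bdryTerm σ ν μ μ' j m n U φ h R z + -1 * bdryTerm σ ν μ μ' j m n U φ h δ z) := by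
  have p2 := norm_pos_iff.2 hz2
  have p3 := norm_pos_iff.2 hz3
  have hI := integral_rpow_mul_besselE (μ := μ) (μ' := μ') (Z := Real.pi * ‖z.1‖ ^ 2) hν1
    (by positivity : 0 < Real.pi * ‖z.1 + z.2‖ ^ 2) (by positivity : 0 < Real.pi * ‖z.2‖ ^ 2) hδ hR
  replace hI := congrArg (fun t : ℝ => (t : ℂ)) hI
  beta_reduce at hI
  simp only [Complex.ofReal_add, Complex.ofReal_sub, Complex.ofReal_mul,
    Complex.ofReal_one] at hI
  unfold triTerm bdryTerm
  simp only [neg_zero, Real.rpow_zero, Complex.ofReal_add, Complex.ofReal_sub, Complex.ofReal_mul,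
    Complex.ofReal_one]
  linear_combination (((Real.pi * ‖z.1 + z.2‖ ^ 2) ^ (-(σ / 2)) : ℝ) : ℂ) *
    (derivSym [j] z.1 * derivSym [m] z.2 * derivSym [n] (z.1 + z.2)) *
    (U z.1 * φ z.2 * 𝓕⁻ h (z.1 + z.2)) * hI

/-- The Riesz transforms use up the derivatives on `U` and φ, leaving a single one on ζ+η. After
integration by parts in τ the factors Z, Y, X supply two more, enough for cancellation in two
factors of every term. The boundary terms are the only source of the errors `e N`, and μ, μ' ≥ ν
keeps the lowered indices μ-1, μ'-1 admissible. -/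
theorem coreBound_one_one {ν σ μ μ' : ℝ} (hσ : 0 ≤ σ) (hσ1 : σ < 1)
    (hμ : ν ≤ μ) (hμ' : ν ≤ μ') (hν : 2 * ν = 1 + σ)
    {q r s : ℝ} (hq1 : 1 < q) (hr : 1 < r) (hs : 1 < s)
    (hq : q⁻¹ + r⁻¹ + s⁻¹ = 1) (j m n : Fin 2) :
    CoreBound ν σ μ μ' 1 1 (ENNReal.ofReal q) r s j m n := by
  have hν0 : 0 < ν := by linarith
  have hμ0 : 0 < μ := by linarith
  have hμ0' : 0 < μ' := by linarith
  have hq0 : 0 < q := by linarith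
  have hqE : (ENNReal.ofReal q)⁻¹ + ENNReal.ofReal r⁻¹ + ENNReal.ofReal s⁻¹ = 1 := by
    rw [← ENNReal.ofReal_inv_of_pos hq0, ← ENNReal.ofReal_add (by positivity) (by positivity),
      ← ENNReal.ofReal_add (by positivity) (by positivity), hq, ENNReal.ofReal_one]
  have hqE1 : 1 < ENNReal.ofReal q := by simpa using hq1
  have hE : ∀ n : ℕ, LaplaceRep n fun X => X ^ (-(0 : ℝ)) * Real.exp (-X) :=
    fun n => (laplaceRep_exp_neg n).rpow_zero_mul
  have hN0 : LaplaceRep 0 fun X => X ^ (-(0 : ℝ)) * besselN μ' X :=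
    (laplaceRep_besselN_zero hμ0').rpow_zero_mul
  have hN1 : LaplaceRep 1 fun X => X ^ (-(0 : ℝ)) * besselN μ' X :=
    laplaceRep_rpow_mul_besselN le_rfl (by norm_num) (by push_cast; linarith)
  have hN2 : LaplaceRep 2 fun X => X ^ (-(0 : ℝ)) * besselN (μ' - 1) X :=
    laplaceRep_rpow_mul_besselN le_rfl (by norm_num) (by push_cast; linarith)
  have hM1 : LaplaceRep 1 fun X => X ^ (-(σ / 2)) * besselN μ X :=
    laplaceRep_rpow_mul_besselN (by linarith) (by push_cast; linarith) (by push_cast; linarith)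
  have hM2 : LaplaceRep 2 fun X => X ^ (-(σ / 2)) * besselN (μ - 1) X :=
    laplaceRep_rpow_mul_besselN (by linarith) (by push_cast; linarith) (by push_cast; linarith)
  choose A hA using fun k : Fin 2 => exists_triTerm_le_right (e := 1 - ν) (l₁ := [k, k])
    (l₂ := []) (l₃ := [n]) (by norm_num) (by norm_num) (hE 2) hN0 hM1 hq1 hr hs hq
    (by push_cast; linarith) rfl rfl rfl
  choose B hB using fun k : Fin 2 => exists_triTerm_le_left (e := 1 - ν) (l₁ := [])
    (l₂ := [k, k]) (l₃ := [n]) (by norm_num) (by norm_num) (hE 0) hN2 hM1 hqE1 hr hs hqE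
    (by push_cast; linarith) rfl rfl rfl
  choose C hC using fun k : Fin 2 => exists_triTerm_le_right (e := 1 - ν) (l₁ := [k])
    (l₂ := []) (l₃ := [n, k]) (by norm_num) (by norm_num) (hE 1) hN0 hM2 hq1 hr hs hq
    (by push_cast; linarith) rfl rfl rfl
  choose D hD using fun k : Fin 2 => exists_triTerm_le_left (e := 1 - ν) (l₁ := [])
    (l₂ := [k]) (l₃ := [n, k]) (by norm_num) (by norm_num) (hE 0) hN1 hM2 hqE1 hr hs hqE
    (by push_cast; linarith) rfl rfl rfl
  obtain ⟨C₁, hC₁⟩ := exists_riesz_rpow_le hq1 j (by linarith : 1 ≤ 1 + 2 * ν)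
  obtain ⟨C₂, hC₂⟩ := exists_riesz_rpow_le hr m (by linarith : 1 ≤ 1 + 2 * ν)
  set κ : ℂ := (((1 - ν : ℝ) : ℂ))⁻¹ with hκ
  -- From Σ_k (2πiξ_k)² = -4π · π|ξ|².
  set ρ : ℂ := -(((4 * Real.pi : ℝ) : ℂ))⁻¹ with hρ
  have hν1 : ν < 1 := by linarith
  have hκ0 : ((1 - ν : ℝ) : ℂ) ≠ 0 := by exact_mod_cast (by linarith : 1 - ν ≠ 0)
  have hρ0 : ((4 * Real.pi : ℝ) : ℂ) ≠ 0 := by exact_mod_cast (by positivity : 4 * Real.pi ≠ 0)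
  refine ⟨‖κ‖₊ * (‖ρ‖₊ * ((∑ k, A k) + (∑ k, B k) + ∑ k, (C k + D k))) * C₁ * C₂,
    fun U φ h hU hφ hφb hh hhb => ?_⟩
  have hUj := integrable_derivSym_mul (by linarith) j hU
  have hφm := integrable_derivSym_mul (by linarith) m hφ
  obtain ⟨hb1, hb2⟩ := tendsto_integral_bdryTerm hσ hσ1 hν0.le hν1 hμ0 hμ0' j m n hU hφ hh
    (τ := fun N : ℕ => (N : ℝ) + 1) (fun N => by positivity) (fun X Y Z hX hY hZ =>
      (tendsto_rpow_mul_besselE_atTop hμ0 hμ0' hX.le hY.le hZ).comp tendsto_natCast_add_one)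
  obtain ⟨hb3, hb4⟩ := tendsto_integral_bdryTerm hσ hσ1 hν0.le hν1 hμ0 hμ0' j m n hU hφ hh
    (τ := fun N : ℕ => ((N : ℝ) + 1)⁻¹) (fun N => by positivity) (fun X Y Z hX hY hZ =>
      (tendsto_rpow_mul_besselE_zero hν1 hμ0 hμ0' hX.le hY.le hZ).comp tendsto_natCast_add_one_inv)
  have he := ENNReal.Tendsto.const_mul (a := ‖κ‖ₑ) (hb2.add hb4) (Or.inr enorm_ne_top)
  rw [add_zero, mul_zero] at he
  refine ⟨_, he, fun N => ?_⟩
  have hδ : 0 < ((N : ℝ) + 1)⁻¹ := by positivity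
  have hR : ((N : ℝ) + 1)⁻¹ ≤ N + 1 := by
    have h1 : (1 : ℝ) ≤ N + 1 := by linarith [Nat.cast_nonneg (α := ℝ) N]
    exact (inv_le_one_of_one_le₀ h1).trans h1
  have t1 := IntBd.sum fun k => hA k _ _ h hUj hφm hh hhb ((N : ℝ) + 1)⁻¹ (N + 1) hδ
  have t2 := IntBd.sum fun k => hB k _ _ h hUj hφm hh hhb ((N : ℝ) + 1)⁻¹ (N + 1) hδ
  have t3 := IntBd.sum fun k => (hC k _ _ h hUj hφm hh hhb ((N : ℝ) + 1)⁻¹ (N + 1) hδ).add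
    (hD k _ _ h hUj hφm hh hhb ((N : ℝ) + 1)⁻¹ (N + 1) hδ)
  have t4 : IntBd _ _ := ⟨hb1 N, le_rfl⟩
  have t5 : IntBd _ _ := ⟨hb3 N, le_rfl⟩
  have key := ((((t1.add t2).add t3).const_mul ρ).add (t4.add (t5.const_mul (-1)))).const_mul κ
  refine (key.congr ?_).mono ?_
  · filter_upwards [ae_prod_ne_zero] with z ⟨hz1, hz2, hz3⟩
    rw [sum_triTerm_pair_left, sum_triTerm_pair_right, sum_triTerm_mixed, hκ,
      inv_mul_eq_iff_eq_mul₀ hκ0, triTerm_eq_by_parts hν1 hδ hR j m n U φ h hz2 hz3, ← mul_add,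
      ← mul_add, ← mul_assoc, hρ, neg_mul_neg, inv_mul_cancel₀ hρ0, one_mul]
  · rw [enorm_neg (1 : ℂ), enorm_one, one_mul, mul_add]
    refine add_le_add_left ?_ _
    simp only [← add_mul, ← Finset.sum_mul, ENNReal.coe_mul, ENNReal.coe_add,
      ENNReal.coe_finsetSum, enorm_eq_nnnorm, mul_assoc]
    refine mul_le_mul_right (mul_le_mul_right (mul_le_mul_right ?_ _) _) _
    calc _ ≤ _ := mul_le_mul' (hC₁ U hU) (mul_le_mul_left (hC₂ φ hφ) _)
      _ = _ := by ring

/-! ### From the truncated forms to the commutator form -/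

theorem pi_mul_norm_sq_rpow {c : ℝ} {ξ : Plane} :
    (Real.pi * ‖ξ‖ ^ 2) ^ c = Real.pi ^ c * ‖ξ‖ ^ (2 * c) := by
  rw [Real.mul_rpow Real.pi_pos.le (by positivity), ← Real.rpow_two,
    ← Real.rpow_mul (norm_nonneg _)]

theorem norm_sq_sub_eq_sum_derivSym (ζ η : Plane) :
    ((Real.pi * ‖ζ + η‖ ^ 2 : ℝ) : ℂ) - ((Real.pi * ‖η‖ ^ 2 : ℝ) : ℂ) =
      -((4 * Real.pi : ℝ) : ℂ)⁻¹ * (∑ j, derivSym [j] ζ * derivSym [j] (ζ + η) +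
        ∑ j, derivSym [j] ζ * derivSym [j] η) := by
  have : ((4 * Real.pi : ℝ) : ℂ) ≠ 0 := by exact_mod_cast (by positivity : 4 * Real.pi ≠ 0)
  rw [← mul_right_inj' this, neg_mul, mul_neg, mul_inv_cancel_left₀ this]
  simp only [derivSym_cons, derivSym_nil, EuclideanSpace.real_norm_sq_eq, Fin.sum_univ_two,
    PiLp.add_apply]
  push_cast
  linear_combination (4 * (Real.pi : ℂ) ^ 2 * ((ζ 0 : ℂ) * (ζ 0 + η 0) + ζ 1 * (ζ 1 + η 1) +
    ζ 0 * η 0 + ζ 1 * η 1)) * Complex.I_sq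

theorem norm_sq_eq_sum_derivSym (ζ η : Plane) :
    ((Real.pi * ‖ζ‖ ^ 2 : ℝ) : ℂ) =
      -((4 * Real.pi : ℝ) : ℂ)⁻¹ * (∑ j, derivSym [j] ζ * derivSym [j] (ζ + η) -
        ∑ j, derivSym [j] ζ * derivSym [j] η) := by
  have : ((4 * Real.pi : ℝ) : ℂ) ≠ 0 := by exact_mod_cast (by positivity : 4 * Real.pi ≠ 0)
  rw [← mul_right_inj' this, neg_mul, mul_neg, mul_inv_cancel_left₀ this]
  simp only [derivSym_cons, derivSym_nil, EuclideanSpace.real_norm_sq_eq, Fin.sum_univ_two,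
    PiLp.add_apply]
  push_cast
  linear_combination (4 * (Real.pi : ℂ) ^ 2 * ((ζ 0 : ℂ) * (ζ 0 + η 0) + ζ 1 * (ζ 1 + η 1) -
    ζ 0 * η 0 - ζ 1 * η 1)) * Complex.I_sq

/-- The truncation of the commutator form. -/
noncomputable def wronskTerm (σ ν δ R : ℝ) (U : Fin 2 → Plane → ℂ) (φ h : Plane → ℂ)
    (z : Plane × Plane) : ℂ :=
  (((Real.pi * ‖z.1 + z.2‖ ^ 2) ^ (-(σ / 2)) *
    (Real.exp (-(δ * (Real.pi * ‖z.1‖ ^ 2))) *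
        besselW ν (Real.pi * ‖z.1 + z.2‖ ^ 2) (Real.pi * ‖z.2‖ ^ 2) δ -
      Real.exp (-(R * (Real.pi * ‖z.1‖ ^ 2))) *
        besselW ν (Real.pi * ‖z.1 + z.2‖ ^ 2) (Real.pi * ‖z.2‖ ^ 2) R) : ℝ) : ℂ) *
    (∑ i, U i z.1 * derivSym [i] z.2) * φ z.2 * 𝓕⁻ h (z.1 + z.2)

/-- With A = Σ ∂_j(ζ)∂_j(ζ+η) and B = Σ ∂_j(ζ)∂_j(η), up to one constant X-Y is A+B and Z is A-B,
which explains the two sign vectors. The A-terms already have a derivative on each factor; in the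
B-terms the divergence condition moves U·η to U·(ζ+η). -/
theorem wronskTerm_eq_sum {σ ν δ R : ℝ} (hν : 0 < ν) (hδ : 0 < δ) (hR : δ ≤ R)
    (U : Fin 2 → Plane → ℂ) (φ h : Plane → ℂ) {z : Plane × Plane} (hz2 : z.2 ≠ 0)
    (hz3 : z.1 + z.2 ≠ 0) (hdiv : ∑ i, derivSym [i] z.1 * U i z.1 = 0) :
    wronskTerm σ ν δ R U φ h z = -((4 * Real.pi : ℝ) : ℂ)⁻¹ * ∑ c : Fin 3, ∑ i, ∑ j,
      ((![1, 1, -1] c : ℂ) * triTerm 0 0 (σ / 2) (-ν) (![ν, ν + 1, ν] c) (![ν, ν, ν + 1] c)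
        [j] [i] [j] (U i) φ h δ R z +
      (![1, -1, 1] c : ℂ) * triTerm 0 0 (σ / 2) (-ν) (![ν, ν + 1, ν] c) (![ν, ν, ν + 1] c)
        [j] [j] [i] (U i) φ h δ R z) := by
  have p2 := norm_pos_iff.2 hz2
  have p3 := norm_pos_iff.2 hz3
  have hI := integral_besselE_wronskian (Z := Real.pi * ‖z.1‖ ^ 2) hν
    (by positivity : 0 < Real.pi * ‖z.1 + z.2‖ ^ 2) (by positivity : 0 < Real.pi * ‖z.2‖ ^ 2) hδ hR
  unfold wronskTerm
  rw [← hI]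
  unfold triTerm
  simp only [neg_zero, Real.rpow_zero, Complex.ofReal_add, Complex.ofReal_sub, Complex.ofReal_mul,
    Complex.ofReal_one, Fin.sum_univ_three, Matrix.cons_val_zero, Matrix.cons_val_one,
    Matrix.cons_val, one_mul]
  simp only [← Complex.ofReal_mul]
  rw [norm_sq_sub_eq_sum_derivSym, norm_sq_eq_sum_derivSym z.1 z.2]
  simp only [derivSym_singleton_add, Fin.sum_univ_two] at hdiv ⊢
  set ρ := -((4 * Real.pi : ℝ) : ℂ)⁻¹
  generalize derivSym [0] z.1 = a0 at *
  generalize derivSym [1] z.1 = a1 at *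
  generalize derivSym [0] z.2 = b0 at *
  generalize derivSym [1] z.2 = b1 at *
  set I0 := ∫ τ in Set.Ioc δ R, τ ^ (-ν) * besselE ν ν (Real.pi * ‖z.1 + z.2‖ ^ 2)
    (Real.pi * ‖z.2‖ ^ 2) (Real.pi * ‖z.1‖ ^ 2) τ
  set I1 := ∫ τ in Set.Ioc δ R, τ ^ (-ν) * besselE (ν + 1) ν (Real.pi * ‖z.1 + z.2‖ ^ 2)
    (Real.pi * ‖z.2‖ ^ 2) (Real.pi * ‖z.1‖ ^ 2) τ
  set I2 := ∫ τ in Set.Ioc δ R, τ ^ (-ν) * besselE ν (ν + 1) (Real.pi * ‖z.1 + z.2‖ ^ 2)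
    (Real.pi * ‖z.2‖ ^ 2) (Real.pi * ‖z.1‖ ^ 2) τ
  set P := (Real.pi * ‖z.1 + z.2‖ ^ 2) ^ (-(σ / 2))
  push_cast
  linear_combination (-ρ * P * (I0 - I1 + I2) * (a0 * b0 + a1 * b1) * φ z.2 *
    𝓕⁻ h (z.1 + z.2)) * hdiv

/-- The singularity |ζ+η|^{-σ} is integrated away through U·η = U·(ζ+η), which holds for
divergence-free `U` and supplies a factor |ζ+η|. The rest follows from the uniform bound for W. -/
theorem exists_norm_wronskTerm_le {σ ν : ℝ} (hσ : 0 ≤ σ) (hσ1 : σ < 1) (hν : 0 < ν)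
    (hν1 : ν < 1) {h : Plane → ℂ} (hh : Integrable h) :
    ∃ C : ℝ, ∀ (U : Fin 2 → Plane → ℂ) (φ : Plane → ℂ), ∀ δ R, 0 < δ → 0 < R →
      ∀ z : Plane × Plane, z.1 ≠ 0 ∧ z.2 ≠ 0 ∧ z.1 + z.2 ≠ 0 →
      ∑ i, derivSym [i] z.1 * U i z.1 = 0 →
      ‖wronskTerm σ ν δ R U φ h z‖ ≤
        C * ∑ i, ‖((((1 + ‖z.1‖) ^ (1 + 2 * ν) : ℝ) : ℂ) * U i z.1) *
          ((((1 + ‖z.2‖) ^ (1 + 2 * ν) : ℝ) : ℂ) * φ z.2)‖ := by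
  obtain ⟨-, K, hK⟩ := bddMeas_fourierInv hh
  have hν' : 0 < 1 - ν := by linarith
  set G : ℝ := Real.Gamma ν * Real.Gamma (1 - ν) with hG
  have hG0 : 0 ≤ G := mul_nonneg (Real.Gamma_pos_of_pos hν).le (Real.Gamma_pos_of_pos hν').le
  refine ⟨2 * G * (2 * Real.pi ^ ν) * (2 * Real.pi) * K, fun U φ δ R hδ hR z hz hdiv => ?_⟩
  obtain ⟨h1, h2, h3⟩ := hz
  have p1 := norm_pos_iff.2 h1
  have p2 := norm_pos_iff.2 h2
  have p3 := norm_pos_iff.2 h3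
  have hX : 0 < Real.pi * ‖z.1 + z.2‖ ^ 2 := by positivity
  have hY : 0 < Real.pi * ‖z.2‖ ^ 2 := by positivity
  have hZ : 0 < Real.pi * ‖z.1‖ ^ 2 := by positivity
  have hw : ∀ τ, 0 < τ → |Real.exp (-(τ * (Real.pi * ‖z.1‖ ^ 2))) *
      besselW ν (Real.pi * ‖z.1 + z.2‖ ^ 2) (Real.pi * ‖z.2‖ ^ 2) τ| ≤
      G * (2 * Real.pi ^ ν * ((1 + ‖z.1‖) ^ (2 * ν) * (1 + ‖z.2‖) ^ (2 * ν))) := by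
    intro τ hτ
    rw [abs_mul, abs_of_pos (Real.exp_pos _)]
    have e1 : Real.exp (-(τ * (Real.pi * ‖z.1‖ ^ 2))) ≤ 1 := by
      rw [Real.exp_le_one_iff]; nlinarith
    have e2 := abs_besselW_le hν hν1 hX hY hτ
    have e3 : (Real.pi * ‖z.1 + z.2‖ ^ 2) ^ ν + (Real.pi * ‖z.2‖ ^ 2) ^ ν ≤
        2 * Real.pi ^ ν * ((1 + ‖z.1‖) ^ (2 * ν) * (1 + ‖z.2‖) ^ (2 * ν)) := by
      rw [pi_mul_norm_sq_rpow, pi_mul_norm_sq_rpow]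
      have f1 := (rpow_norm_le_one_add_rpow (a := 2 * ν) (by linarith) le_rfl (z.1 + z.2)).trans
        (one_add_norm_add_rpow_le (by linarith) z.1 z.2)
      have f2 : ‖z.2‖ ^ (2 * ν) ≤ (1 + ‖z.1‖) ^ (2 * ν) * (1 + ‖z.2‖) ^ (2 * ν) := by
        refine (rpow_norm_le_one_add_rpow (by linarith) le_rfl z.2).trans ?_
        refine le_mul_of_one_le_left (by positivity) ?_
        exact Real.one_le_rpow (by linarith) (by linarith)
      calc _ ≤ Real.pi ^ ν * ((1 + ‖z.1‖) ^ (2 * ν) * (1 + ‖z.2‖) ^ (2 * ν)) +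
            Real.pi ^ ν * ((1 + ‖z.1‖) ^ (2 * ν) * (1 + ‖z.2‖) ^ (2 * ν)) := by gcongr
        _ = _ := by ring
    calc _ ≤ 1 * |besselW ν (Real.pi * ‖z.1 + z.2‖ ^ 2) (Real.pi * ‖z.2‖ ^ 2) τ| := by gcongr
      _ ≤ _ := by rw [one_mul]; exact e2.trans (by gcongr)
  have hdiv2 : ∑ i, U i z.1 * derivSym [i] z.2 = ∑ i, U i z.1 * derivSym [i] (z.1 + z.2) := by
    simp only [derivSym_singleton_add, mul_add, Finset.sum_add_distrib]
    rw [Finset.sum_congr rfl fun i _ => mul_comm (U i z.1) (derivSym [i] z.1), hdiv, zero_add]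
  have hS : ‖∑ i, U i z.1 * derivSym [i] (z.1 + z.2)‖ ≤
      2 * Real.pi * ‖z.1 + z.2‖ * ∑ i, ‖U i z.1‖ := by
    refine (norm_sum_le _ _).trans ?_
    rw [Finset.mul_sum]
    refine Finset.sum_le_sum fun i _ => ?_
    rw [norm_mul, mul_comm]
    gcongr
    exact norm_derivSym_singleton_le i _
  have k3 : (Real.pi * ‖z.1 + z.2‖ ^ 2) ^ (-(σ / 2)) * ‖z.1 + z.2‖ ≤
      (1 + ‖z.1‖) * (1 + ‖z.2‖) := by
    refine (rpow_neg_mul_norm_le (c := σ / 2) (by linarith) (by linarith) h3).trans ?_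
    refine (one_add_norm_add_rpow_le (by linarith) z.1 z.2).trans ?_
    have : ∀ w : Plane, (1 + ‖w‖) ^ (1 - 2 * (σ / 2)) ≤ 1 + ‖w‖ := fun w => by
      conv_rhs => rw [← Real.rpow_one (1 + ‖w‖)]
      exact Real.rpow_le_rpow_of_exponent_le (by linarith [norm_nonneg w]) (by linarith)
    exact mul_le_mul (this _) (this _) (by positivity) (by positivity)
  unfold wronskTerm
  rw [hdiv2, norm_mul, norm_mul, norm_mul, Complex.norm_real, norm_mul, Real.norm_eq_abs,
    Real.norm_eq_abs, abs_of_nonneg (by positivity : 0 ≤ (Real.pi * ‖z.1 + z.2‖ ^ 2) ^ (-(σ / 2)))]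
  have hsub := (abs_sub _ _).trans (add_le_add (hw δ hδ) (hw R hR))
  have hexp : ∀ w : Plane, (1 + ‖w‖) ^ (1 + 2 * ν) = (1 + ‖w‖) * (1 + ‖w‖) ^ (2 * ν) := fun w => by
    rw [Real.rpow_add (by positivity), Real.rpow_one]
  calc _ ≤ (Real.pi * ‖z.1 + z.2‖ ^ 2) ^ (-(σ / 2)) *
        (G * (2 * Real.pi ^ ν * ((1 + ‖z.1‖) ^ (2 * ν) * (1 + ‖z.2‖) ^ (2 * ν))) +
          G * (2 * Real.pi ^ ν * ((1 + ‖z.1‖) ^ (2 * ν) * (1 + ‖z.2‖) ^ (2 * ν)))) *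
        (2 * Real.pi * ‖z.1 + z.2‖ * ∑ i, ‖U i z.1‖) * ‖φ z.2‖ * K := by
        gcongr
        exact hK _
    _ = (2 * G * (2 * Real.pi ^ ν) * (2 * Real.pi) * K) *
        (((Real.pi * ‖z.1 + z.2‖ ^ 2) ^ (-(σ / 2)) * ‖z.1 + z.2‖) *
          ((1 + ‖z.1‖) ^ (2 * ν) * (1 + ‖z.2‖) ^ (2 * ν)) * ((∑ i, ‖U i z.1‖) * ‖φ z.2‖)) := by ring
    _ ≤ (2 * G * (2 * Real.pi ^ ν) * (2 * Real.pi) * K) *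
        (((1 + ‖z.1‖) * (1 + ‖z.2‖)) *
          ((1 + ‖z.1‖) ^ (2 * ν) * (1 + ‖z.2‖) ^ (2 * ν)) * ((∑ i, ‖U i z.1‖) * ‖φ z.2‖)) := by
        gcongr
    _ = _ := by
        congr 1
        rw [Finset.sum_mul, Finset.mul_sum]
        refine Finset.sum_congr rfl fun i _ => ?_
        simp only [norm_mul, Complex.norm_real]
        rw [Real.norm_of_nonneg (by positivity : 0 ≤ (1 + ‖z.1‖) ^ (1 + 2 * ν)),
          Real.norm_of_nonneg (by positivity : 0 ≤ (1 + ‖z.2‖) ^ (1 + 2 * ν)), hexp, hexp]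
        ring

/-- The lower endpoint tends to Γ(ν)Γ(1-ν)(X^ν-Y^ν); at the upper one W stays bounded while e^{-τZ}
tends to 0. -/
theorem tendsto_wronskTerm {σ ν : ℝ} (hν : 0 < ν) (hν1 : ν < 1) (U : Fin 2 → Plane → ℂ)
    (φ h : Plane → ℂ) {z : Plane × Plane} (hz : z.1 ≠ 0 ∧ z.2 ≠ 0 ∧ z.1 + z.2 ≠ 0) :
    Filter.Tendsto (fun N : ℕ => wronskTerm σ ν ((N : ℝ) + 1)⁻¹ (N + 1) U φ h z) Filter.atTop
      (nhds (((Real.pi ^ (ν - σ / 2) * (Real.Gamma ν * Real.Gamma (1 - ν)) : ℝ) : ℂ) *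
        (((‖z.1 + z.2‖ ^ (-σ) * (‖z.1 + z.2‖ ^ (2 * ν) - ‖z.2‖ ^ (2 * ν)) : ℝ) : ℂ) *
          (∑ i, U i z.1 * derivSym [i] z.2) * φ z.2 * 𝓕⁻ h (z.1 + z.2)))) := by
  obtain ⟨h1, h2, h3⟩ := hz
  have p1 := norm_pos_iff.2 h1
  have p2 := norm_pos_iff.2 h2
  have p3 := norm_pos_iff.2 h3
  have hX : 0 < Real.pi * ‖z.1 + z.2‖ ^ 2 := by positivity
  have hY : 0 < Real.pi * ‖z.2‖ ^ 2 := by positivity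
  have hZ : 0 < Real.pi * ‖z.1‖ ^ 2 := by positivity
  have t1 := (tendsto_besselW_zero hν hν1 hX hY).comp tendsto_natCast_add_one_inv
  have t2 : Filter.Tendsto (fun N : ℕ => Real.exp (-(((N : ℝ) + 1)⁻¹ * (Real.pi * ‖z.1‖ ^ 2))))
      Filter.atTop (nhds 1) := by
    have h0 : Filter.Tendsto (fun N : ℕ => ((N : ℝ) + 1)⁻¹) Filter.atTop (nhds 0) :=
      tendsto_natCast_add_one_inv.mono_right nhdsWithin_le_nhds
    have := (Real.continuous_exp.tendsto _).comp (h0.mul_const (Real.pi * ‖z.1‖ ^ 2)).neg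
    simpa [Function.comp_def] using this
  have t3 : Filter.Tendsto (fun N : ℕ => Real.exp (-(((N : ℝ) + 1) * (Real.pi * ‖z.1‖ ^ 2))) *
      besselW ν (Real.pi * ‖z.1 + z.2‖ ^ 2) (Real.pi * ‖z.2‖ ^ 2) ((N : ℝ) + 1))
      Filter.atTop (nhds 0) := by
    have h0 : Filter.Tendsto (fun N : ℕ => Real.exp (-(((N : ℝ) + 1) * (Real.pi * ‖z.1‖ ^ 2))))
        Filter.atTop (nhds 0) :=
      Real.tendsto_exp_neg_atTop_nhds_zero.comp (tendsto_natCast_add_one.atTop_mul_const hZ)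
    refine h0.zero_mul_isBoundedUnder_le ?_
    exact Filter.isBoundedUnder_of ⟨Real.Gamma ν * Real.Gamma (1 - ν) *
      ((Real.pi * ‖z.1 + z.2‖ ^ 2) ^ ν + (Real.pi * ‖z.2‖ ^ 2) ^ ν),
      fun N => abs_besselW_le hν hν1 hX hY (by positivity)⟩
  have t4 := ((t2.mul t1).sub t3).const_mul ((Real.pi * ‖z.1 + z.2‖ ^ 2) ^ (-(σ / 2)))
  have e : (Real.pi * ‖z.1 + z.2‖ ^ 2) ^ (-(σ / 2)) * (1 * (Real.Gamma ν * Real.Gamma (1 - ν) *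
      ((Real.pi * ‖z.1 + z.2‖ ^ 2) ^ ν - (Real.pi * ‖z.2‖ ^ 2) ^ ν)) - 0) =
      Real.pi ^ (ν - σ / 2) * (Real.Gamma ν * Real.Gamma (1 - ν)) *
      (‖z.1 + z.2‖ ^ (-σ) * (‖z.1 + z.2‖ ^ (2 * ν) - ‖z.2‖ ^ (2 * ν))) := by
    rw [pi_mul_norm_sq_rpow, pi_mul_norm_sq_rpow, pi_mul_norm_sq_rpow, sub_eq_add_neg ν,
      Real.rpow_add Real.pi_pos, show 2 * -(σ / 2) = -σ by ring]
    ring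
  rw [e] at t4
  have t5 := (((Complex.continuous_ofReal.tendsto _).comp t4).mul_const
    (∑ i, U i z.1 * derivSym [i] z.2)).mul_const (φ z.2) |>.mul_const (𝓕⁻ h (z.1 + z.2))
  have e2 : ((Real.pi ^ (ν - σ / 2) * (Real.Gamma ν * Real.Gamma (1 - ν)) : ℝ) : ℂ) *
        (((‖z.1 + z.2‖ ^ (-σ) * (‖z.1 + z.2‖ ^ (2 * ν) - ‖z.2‖ ^ (2 * ν)) : ℝ) : ℂ) *
          (∑ i, U i z.1 * derivSym [i] z.2) * φ z.2 * 𝓕⁻ h (z.1 + z.2)) =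
      ((Real.pi ^ (ν - σ / 2) * (Real.Gamma ν * Real.Gamma (1 - ν)) *
        (‖z.1 + z.2‖ ^ (-σ) * (‖z.1 + z.2‖ ^ (2 * ν) - ‖z.2‖ ^ (2 * ν))) : ℝ) : ℂ) *
          (∑ i, U i z.1 * derivSym [i] z.2) * φ z.2 * 𝓕⁻ h (z.1 + z.2) := by
    rw [Complex.ofReal_mul (Real.pi ^ (ν - σ / 2) * _)]
    ring
  rw [e2]
  exact t5

/-- The trilinear form of the commutator is controlled by the basic estimates. -/
theorem exists_commutator_form_le {σ ν a b : ℝ} {q : ℝ≥0∞} {r s : ℝ} (hσ : 0 ≤ σ) (hσ1 : σ < 1)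
    (hν : 0 < ν) (hν1 : ν < 1)
    (hcore : ∀ c : Fin 3, ∀ j m n : Fin 2,
      CoreBound ν σ (![ν, ν + 1, ν] c) (![ν, ν, ν + 1] c) a b q r s j m n) :
    ∃ C : ℝ≥0, ∀ (U : Fin 2 → Plane → ℂ) (φ h : Plane → ℂ),
      (∀ i, Integrable fun ζ => (((1 + ‖ζ‖) ^ (1 + 2 * ν) : ℝ) : ℂ) * U i ζ) →
      Integrable (fun ζ => (((1 + ‖ζ‖) ^ (1 + 2 * ν) : ℝ) : ℂ) * φ ζ) →
      Integrable (fun η => ((‖η‖ ^ b : ℝ) : ℂ) * φ η) → Integrable h → BddMeas h →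
      (∀ᵐ ζ, ∑ i, derivSym [i] ζ * U i ζ = 0) →
      ‖∫ z : Plane × Plane,
        ((‖z.1 + z.2‖ ^ (-σ) * (‖z.1 + z.2‖ ^ (2 * ν) - ‖z.2‖ ^ (2 * ν)) : ℝ) : ℂ) *
          (∑ i, U i z.1 * derivSym [i] z.2) * φ z.2 * 𝓕⁻ h (z.1 + z.2)‖ₑ ≤
        C * ((∑ i, eLpNorm (𝓕⁻ fun ζ => ((‖ζ‖ ^ a : ℝ) : ℂ) * U i ζ) q volume) *
          eLpNorm (𝓕⁻ fun η => ((‖η‖ ^ b : ℝ) : ℂ) * φ η) (ENNReal.ofReal r) volume *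
          eLpNorm h (ENNReal.ofReal s) volume) := by
  choose C hC using hcore
  set C₀ : ℝ≥0 := ∑ c, ∑ j, ∑ m, ∑ n, C c j m n with hC₀
  have hCle : ∀ c j m n, C c j m n ≤ C₀ := fun c j m n =>
    (Finset.single_le_sum (f := fun n => C c j m n) (fun _ _ => zero_le) (Finset.mem_univ n)).trans
    ((Finset.single_le_sum (f := fun m => ∑ n, C c j m n) (fun _ _ => zero_le)
      (Finset.mem_univ m)).trans
    ((Finset.single_le_sum (f := fun j => ∑ m, ∑ n, C c j m n) (fun _ _ => zero_le)
      (Finset.mem_univ j)).trans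
    (Finset.single_le_sum (f := fun c => ∑ j, ∑ m, ∑ n, C c j m n) (fun _ _ => zero_le)
      (Finset.mem_univ c))))
  set ρ : ℂ := -((4 * Real.pi : ℝ) : ℂ)⁻¹ with hρ
  set κ : ℝ := Real.pi ^ (ν - σ / 2) * (Real.Gamma ν * Real.Gamma (1 - ν)) with hκ
  have hκ0 : 0 < κ := mul_pos (Real.rpow_pos_of_pos Real.pi_pos _)
    (mul_pos (Real.Gamma_pos_of_pos hν) (Real.Gamma_pos_of_pos (by linarith)))
  set S : ℝ≥0 := ∑ c : Fin 3, ∑ _i : Fin 2, ∑ _j : Fin 2,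
    (‖(![1, 1, -1] c : ℂ)‖₊ + ‖(![1, -1, 1] c : ℂ)‖₊) with hS
  refine ⟨κ.toNNReal⁻¹ * (‖ρ‖₊ * (S * C₀)), fun U φ h hU hφ hφb hh hhb hdiv => ?_⟩
  set Q : ℝ≥0∞ := (∑ i, eLpNorm (𝓕⁻ fun ζ => ((‖ζ‖ ^ a : ℝ) : ℂ) * U i ζ) q volume) *
          eLpNorm (𝓕⁻ fun η => ((‖η‖ ^ b : ℝ) : ℂ) * φ η) (ENNReal.ofReal r) volume *
          eLpNorm h (ENNReal.ofReal s) volume with hQ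
  choose e he hIB using fun c i j m n => hC c j m n (U i) φ h (hU i) hφ hφb hh hhb
  have hIB' : ∀ c i j m n, ∀ N : ℕ, IntBd (triTerm 0 0 (σ / 2) (-ν) (![ν, ν + 1, ν] c) (![ν, ν, ν + 1] c)
      [j] [m] [n] (U i) φ h ((N : ℝ) + 1)⁻¹ (N + 1)) (C₀ * Q + e c i j m n N) := by
    intro c i j m n N
    refine (hIB c i j m n N).mono (add_le_add_left ?_ _)
    refine mul_le_mul' (by exact_mod_cast hCle c j m n) ?_
    refine mul_le_mul_left (mul_le_mul_left ?_ _) _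
    exact Finset.single_le_sum
      (f := fun i => eLpNorm (𝓕⁻ fun ζ => ((‖ζ‖ ^ a : ℝ) : ℂ) * U i ζ) q volume)
      (fun _ _ => zero_le) (Finset.mem_univ i)
  have hdiv' : ∀ᵐ z : Plane × Plane, ∑ i, derivSym [i] z.1 * U i z.1 = 0 :=
    Measure.quasiMeasurePreserving_fst.ae hdiv
  have hR : ∀ N : ℕ, ((N : ℝ) + 1)⁻¹ ≤ N + 1 := fun N => by
    have h1 : (1 : ℝ) ≤ N + 1 := by linarith [Nat.cast_nonneg (α := ℝ) N]
    exact (inv_le_one_of_one_le₀ h1).trans h1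
  have hW : ∀ N : ℕ, IntBd (wronskTerm σ ν ((N : ℝ) + 1)⁻¹ (N + 1) U φ h) (‖ρ‖ₑ *
      ∑ c : Fin 3, ∑ i : Fin 2, ∑ j : Fin 2,
        (‖(![1, 1, -1] c : ℂ)‖ₑ * (C₀ * Q + e c i j i j N) +
          ‖(![1, -1, 1] c : ℂ)‖ₑ * (C₀ * Q + e c i j j i N))) := by
    intro N
    have h1 := (IntBd.sum fun c : Fin 3 => IntBd.sum fun i : Fin 2 => IntBd.sum fun j : Fin 2 =>
      ((hIB' c i j i j N).const_mul (![1, 1, -1] c : ℂ)).add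
        ((hIB' c i j j i N).const_mul (![1, -1, 1] c : ℂ))).const_mul ρ
    refine h1.congr ?_
    filter_upwards [ae_prod_ne_zero, hdiv'] with z ⟨hz1, hz2, hz3⟩ hd
    rw [wronskTerm_eq_sum hν (by positivity) (hR N) U φ h hz2 hz3 hd]
  obtain ⟨D, hD⟩ := exists_norm_wronskTerm_le hσ hσ1 hν hν1 hh
  have hdom : Integrable fun z : Plane × Plane =>
      D * ∑ i, ‖((((1 + ‖z.1‖) ^ (1 + 2 * ν) : ℝ) : ℂ) * U i z.1) *
          ((((1 + ‖z.2‖) ^ (1 + 2 * ν) : ℝ) : ℂ) * φ z.2)‖ :=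
    (integrable_finsetSum _ fun i _ => ((hU i).mul_prod hφ).norm).const_mul D
  -- The integrals converge to κ times the commutator form and the errors in the core bounds vanish,
  -- so the inequality survives the limit.
  have hlim := tendsto_integral_of_dominated_convergence _ (fun N => (hW N).1.1) hdom
    (fun N => by
      filter_upwards [ae_prod_ne_zero, hdiv'] with z hz hd
      exact hD U φ _ _ (by positivity) (by positivity) z hz hd)
    (by
      filter_upwards [ae_prod_ne_zero] with z hz
      exact tendsto_wronskTerm hν hν1 U φ h hz)
  rw [integral_const_mul] at hlim
  have hB : Filter.Tendsto (fun N => ‖ρ‖ₑ * ∑ c : Fin 3, ∑ i : Fin 2, ∑ j : Fin 2,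
        (‖(![1, 1, -1] c : ℂ)‖ₑ * (C₀ * Q + e c i j i j N) +
          ‖(![1, -1, 1] c : ℂ)‖ₑ * (C₀ * Q + e c i j j i N))) Filter.atTop (nhds (‖ρ‖ₑ *
        ∑ c : Fin 3, ∑ i : Fin 2, ∑ j : Fin 2, (‖(![1, 1, -1] c : ℂ)‖ₑ * (C₀ * Q + 0) +
          ‖(![1, -1, 1] c : ℂ)‖ₑ * (C₀ * Q + 0)))) := by
    refine ENNReal.Tendsto.const_mul ?_ (Or.inr enorm_ne_top)
    refine tendsto_finsetSum _ fun c _ => tendsto_finsetSum _ fun i _ =>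
      tendsto_finsetSum _ fun j _ => ?_
    exact (ENNReal.Tendsto.const_mul (tendsto_const_nhds.add (he c i j i j))
      (Or.inr enorm_ne_top)).add (ENNReal.Tendsto.const_mul (tendsto_const_nhds.add (he c i j j i))
      (Or.inr enorm_ne_top))
  have hfin := le_of_tendsto_of_tendsto' hlim.enorm hB fun N => (hW N).2
  rw [enorm_mul, ← ofReal_norm (κ : ℂ), Complex.norm_real, Real.norm_of_nonneg hκ0.le] at hfin
  have hκN : (κ.toNNReal : ℝ≥0∞) = ENNReal.ofReal κ := rfl
  have hκN0 : κ.toNNReal ≠ 0 := by simpa using hκ0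
  rw [ENNReal.coe_mul, ENNReal.coe_inv hκN0, hκN, mul_assoc, mul_comm (ENNReal.ofReal κ)⁻¹,
    ← div_eq_mul_inv, ENNReal.le_div_iff_mul_le (by simp [hκ0]) (by simp),
    mul_comm _ (ENNReal.ofReal κ)]
  refine hfin.trans (le_of_eq ?_)
  simp only [add_zero, ← add_mul, ← Finset.sum_mul]
  rw [ENNReal.coe_mul, ENNReal.coe_mul, hS, mul_assoc, mul_assoc]
  simp only [ENNReal.coe_finsetSum, ENNReal.coe_add, enorm_eq_nnnorm]

/-! ### Bilinear expressions in frequency variables -/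

/-- The push-forward of the density `J` under `(ζ, η) ↦ ζ + η`. -/
noncomputable def freqPush (J : Plane × Plane → ℂ) (ξ : Plane) : ℂ := ∫ ζ, J (ζ, ξ - ζ)

theorem measurePreserving_freq :
    MeasurePreserving (fun z : Plane × Plane => (z.2, z.1 - z.2)) volume volume :=
  measurePreserving_prod_sub_swap (volume : Measure Plane) (volume : Measure Plane)

theorem integrable_freqPush {J : Plane × Plane → ℂ} (hJ : Integrable J) :
    Integrable (freqPush J) :=
  (measurePreserving_freq.integrable_comp_of_integrable hJ).integral_prod_left

theorem integral_freqPush {J : Plane × Plane → ℂ} (hJ : Integrable J) :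
    ∫ ξ, freqPush J ξ = ∫ z, J z := by
  have h1 : Integrable (fun z : Plane × Plane => J (z.2, z.1 - z.2)) (volume.prod volume) :=
    measurePreserving_freq.integrable_comp_of_integrable hJ
  have h2 := integral_prod _ h1
  have h3 := integral_map (μ := volume) (φ := fun z : Plane × Plane => (z.2, z.1 - z.2))
    measurePreserving_freq.measurable.aemeasurable (f := J)
    (by rw [measurePreserving_freq.map_eq]; exact hJ.1)
  rw [measurePreserving_freq.map_eq] at h3
  rw [h3]
  exact h2.symm

/-- Multipliers of the product act on the output frequency z.1 + z.2; this is how `Lam` acts on an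
advection term. -/
theorem freqPush_mul (J : Plane × Plane → ℂ) (m : Plane → ℂ) (ξ : Plane) :
    freqPush (fun z => m (z.1 + z.2) * J z) ξ = m ξ * freqPush J ξ := by
  unfold freqPush
  simp only [add_sub_cancel]
  exact integral_const_mul _ _

theorem integrable_char_mul {J : Plane × Plane → ℂ} (hJ : Integrable J) (x : Plane) :
    Integrable fun z : Plane × Plane =>
      ((Real.fourierChar (inner ℝ (z.1 + z.2) x) : Circle) : ℂ) * J z := by
  have hc : Continuous fun ξ : Plane => ((Real.fourierChar (inner ℝ ξ x) : Circle) : ℂ) :=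
    continuous_subtype_val.comp (Real.continuous_fourierChar.comp (by fun_prop))
  refine hJ.bdd_mul (c := 1) ?_ (Filter.Eventually.of_forall fun z => (Circle.norm_coe _).le)
  exact (hc.comp (continuous_fst.add continuous_snd)).aestronglyMeasurable

theorem fourierInv_freqPush {J : Plane × Plane → ℂ} (hJ : Integrable J) (x : Plane) :
    𝓕⁻ (freqPush J) x =
      ∫ z : Plane × Plane, ((Real.fourierChar (inner ℝ (z.1 + z.2) x) : Circle) : ℂ) * J z := by
  rw [← integral_freqPush (integrable_char_mul hJ x), Real.fourierInv_eq]
  refine integral_congr_ae (Filter.Eventually.of_forall fun ξ => ?_)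
  beta_reduce
  rw [freqPush_mul J fun ξ => ((Real.fourierChar (inner ℝ ξ x) : Circle) : ℂ), Circle.smul_def,
    smul_eq_mul]

theorem fourierInv_freqPush_sub {J J' : Plane × Plane → ℂ} (hJ : Integrable J)
    (hJ' : Integrable J') (x : Plane) :
    𝓕⁻ (freqPush fun z => J z - J' z) x = 𝓕⁻ (freqPush J) x - 𝓕⁻ (freqPush J') x := by
  have hs : Integrable fun z => J z - J' z := hJ.sub hJ'
  rw [fourierInv_freqPush hJ, fourierInv_freqPush hJ', fourierInv_freqPush hs, ← integral_sub (integrable_char_mul hJ x) (integrable_char_mul hJ' x)]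
  simp only [mul_sub]

theorem fourierInv_freqPush_sum {ι : Type*} [Fintype ι] {J : ι → Plane × Plane → ℂ}
    (hJ : ∀ i, Integrable (J i)) (x : Plane) :
    𝓕⁻ (freqPush fun z => ∑ i, J i z) x = ∑ i, 𝓕⁻ (freqPush (J i)) x := by
  rw [fourierInv_freqPush (integrable_finsetSum _ fun i _ => hJ i)]
  simp only [fourierInv_freqPush (hJ _), Finset.mul_sum]
  exact integral_finsetSum _ fun i _ => integrable_char_mul (hJ i) x

theorem fourierInv_freqPush_mul {g₁ g₂ : Plane → ℂ} (hg₁ : Integrable g₁) (hg₂ : Integrable g₂)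
    (x : Plane) : 𝓕⁻ (freqPush fun z => g₁ z.1 * g₂ z.2) x = 𝓕⁻ g₁ x * 𝓕⁻ g₂ x := by
  rw [fourierInv_freqPush (hg₁.mul_prod hg₂), Real.fourierInv_eq, Real.fourierInv_eq,
    ← integral_prod_mul]
  refine integral_congr_ae (Filter.Eventually.of_forall fun z => ?_)
  simp only [Circle.smul_def, smul_eq_mul]
  rw [inner_add_left, AddChar.map_add_eq_mul, Circle.coe_mul]
  ring

theorem integral_fourierInv_freqPush_mul {J : Plane × Plane → ℂ} (hJ : Integrable J)
    {h : Plane → ℂ} (hh : Integrable h) :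
    ∫ x, 𝓕⁻ (freqPush J) x * h x = ∫ z : Plane × Plane, 𝓕⁻ h (z.1 + z.2) * J z := by
  have hi : Integrable fun z : Plane × Plane => 𝓕⁻ h (z.1 + z.2) * J z := by
    obtain ⟨-, K, hK⟩ := bddMeas_fourierInv hh
    exact hJ.bdd_mul (c := K) ((continuous_fourierInv hh).comp
      (continuous_fst.add continuous_snd)).aestronglyMeasurable
      (Filter.Eventually.of_forall fun z => hK _)
  rw [integral_fourierInv_mul (integrable_freqPush hJ) hh, ← integral_freqPush hi]
  refine integral_congr_ae (Filter.Eventually.of_forall fun ξ => ?_)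
  beta_reduce
  rw [freqPush_mul, mul_comm]

theorem fourierInv_congr_ae {E : Type*} [NormedAddCommGroup E] [NormedSpace ℂ E] {g₁ g₂ : Plane → E}
    (h : g₁ =ᵐ[volume] g₂) : 𝓕⁻ g₁ = 𝓕⁻ g₂ := by
  funext x
  rw [Real.fourierInv_eq, Real.fourierInv_eq]
  refine integral_congr_ae ?_
  filter_upwards [h] with ξ hξ
  rw [hξ]

/-! ### Components and derivatives -/

theorem fourierInv_apply_component {g : Plane → EuclideanSpace ℂ (Fin 2)} (hg : Integrable g)
    (x : Plane) (i : Fin 2) : 𝓕⁻ g x i = 𝓕⁻ (fun ξ => g ξ i) x := by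
  rw [Real.fourierInv_eq, Real.fourierInv_eq]
  have h : Integrable fun ξ => Real.fourierChar (inner ℝ ξ x) • g ξ := by
    simpa using (Real.fourierIntegral_convergent_iff (μ := volume) (f := g) (-x)).2 hg
  have := (EuclideanSpace.proj (𝕜 := ℂ) i).integral_comp_comm h
  simpa [Circle.smul_def] using this.symm

theorem integrable_component {g : Plane → EuclideanSpace ℂ (Fin 2)} (hg : Integrable g)
    (i : Fin 2) : Integrable fun ξ => g ξ i :=
  (EuclideanSpace.proj (𝕜 := ℂ) i).integrable_comp hg

theorem fderiv_fourierInv {E : Type*} [NormedAddCommGroup E] [NormedSpace ℂ E] [CompleteSpace E]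
    {g : Plane → E} (hg : Integrable g)
    (hg1 : Integrable fun ξ : Plane => ‖ξ‖ * ‖g ξ‖) (x : Plane) (i : Fin 2) :
    fderiv ℝ (𝓕⁻ g) x (planeBasis i) = 𝓕⁻ (fun ξ => derivSym [i] ξ • g ξ) x := by
  have h1 := Real.hasFDerivAt_fourier hg hg1 (-x)
  have h2 : HasFDerivAt (𝓕⁻ g) ((𝓕 (VectorFourier.fourierSMulRight (innerSL ℝ) g) (-x)).comp
      (-ContinuousLinearMap.id ℝ Plane)) x := by
    have h3 : 𝓕⁻ g = fun y => 𝓕 g (-y) := funext fun y => Real.fourierInv_eq_fourier_neg g y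
    rw [h3]
    exact h1.comp x (hasFDerivAt_id x).neg
  rw [h2.fderiv]
  have hintg : Integrable fun v => Real.fourierChar (-(inner ℝ v (-x))) •
      VectorFourier.fourierSMulRight (innerSL ℝ) g v := by
    refine (Real.fourierIntegral_convergent_iff (-x)).2 ?_
    refine (hg1.const_mul (2 * Real.pi)).mono' hg.1.fourierSMulRight
      (Filter.Eventually.of_forall fun v => ?_)
    rw [VectorFourier.norm_fourierSMulRight, innerSL_apply_norm, mul_assoc]
  rw [ContinuousLinearMap.comp_apply, ContinuousLinearMap.neg_apply, ContinuousLinearMap.id_apply,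
    map_neg, Real.fourier_eq, Real.fourierInv_eq, ContinuousLinearMap.integral_apply hintg,
    ← integral_neg]
  refine integral_congr_ae (Filter.Eventually.of_forall fun ξ => ?_)
  simp only [inner_neg_right, neg_neg]
  have e1 : inner ℝ ξ (planeBasis i) = ξ i := by
    rw [planeBasis, EuclideanSpace.inner_single_right]; simp
  have e2 : (Real.fourierChar (inner ℝ ξ x) •
      VectorFourier.fourierSMulRight (innerSL ℝ) g ξ) (planeBasis i) =
      Real.fourierChar (inner ℝ ξ x) •
      (VectorFourier.fourierSMulRight (innerSL ℝ) g ξ (planeBasis i)) := rfl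
  rw [e2, VectorFourier.fourierSMulRight_apply, innerSL_apply_apply, e1, derivSym_cons, derivSym_nil,
    mul_one, ← smul_neg, neg_smul, neg_neg, ← Complex.coe_smul, smul_smul]

/-! ### The commutator in frequency variables -/

theorem lamSymbol_eq (s : ℝ) (ξ : Plane) :
    lamSymbol s ξ = (((2 * Real.pi) ^ s : ℝ) : ℂ) * ((‖ξ‖ ^ s : ℝ) : ℂ) := by
  rw [lamSymbol, Real.mul_rpow (by positivity) (norm_nonneg _), Complex.ofReal_mul]

theorem measurable_lamSymbol (s : ℝ) : Measurable (lamSymbol s) := by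
  unfold lamSymbol
  fun_prop

theorem norm_lamSymbol (s : ℝ) (ξ : Plane) :
    ‖lamSymbol s ξ‖ = (2 * Real.pi) ^ s * ‖ξ‖ ^ s := by
  rw [lamSymbol_eq, norm_mul, Complex.norm_real, Complex.norm_real,
    Real.norm_of_nonneg (by positivity), Real.norm_of_nonneg (by positivity)]

theorem integrable_of_norm_le_sum {J : Plane × Plane → ℂ} (hJ : AEStronglyMeasurable J volume)
    {G : Fin 2 → Plane → ℂ} {g : Plane → ℂ} (hG : ∀ i, Integrable (G i)) (hg : Integrable g) {C : ℝ}
    (hle : ∀ᵐ z : Plane × Plane, ‖J z‖ ≤ C * ∑ i, ‖G i z.1 * g z.2‖) : Integrable J :=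
  ((integrable_finsetSum _ fun i _ => ((hG i).mul_prod hg).norm).const_mul C).mono' hJ hle

/-- The density in frequency variables of `(U · ∇)φ`. -/
noncomputable def advectDensity (gU : Plane → EuclideanSpace ℂ (Fin 2)) (gφ : Plane → ℂ)
    (z : Plane × Plane) : ℂ := ∑ i, gU z.1 i * (derivSym [i] z.2 * gφ z.2)

theorem isFourierDataOf_advect {U : Plane → EuclideanSpace ℂ (Fin 2)} {φ : Plane → ℂ}
    {gU : Plane → EuclideanSpace ℂ (Fin 2)} {gφ : Plane → ℂ} (hU : IsFourierDataOf gU U)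
    (hφ : IsFourierDataOf gφ φ) (hφ1 : Integrable fun ξ => ((‖ξ‖ : ℝ) : ℂ) * gφ ξ) :
    Integrable (advectDensity gU gφ) ∧
      IsFourierDataOf (freqPush (advectDensity gU gφ)) (advect U φ) := by
  have hD : ∀ i, Integrable fun ξ => derivSym [i] ξ * gφ ξ := fun i => by
    refine (hφ1.norm.const_mul (2 * Real.pi)).mono'
      ((continuous_derivSym [i]).aestronglyMeasurable.mul hφ.1.1)
      (Filter.Eventually.of_forall fun ξ => ?_)
    rw [norm_mul, norm_mul, Complex.norm_real, norm_norm, ← mul_assoc]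
    gcongr
    exact norm_derivSym_singleton_le i ξ
  have hJ : ∀ i, Integrable fun z : Plane × Plane => gU z.1 i * (derivSym [i] z.2 * gφ z.2) :=
    fun i => (integrable_component hU.1 i).mul_prod (hD i)
  have hJs : Integrable (advectDensity gU gφ) := integrable_finsetSum _ fun i _ => hJ i
  refine ⟨hJs, integrable_freqPush hJs, ?_⟩
  funext x
  unfold advectDensity advect
  rw [fourierInv_freqPush_sum hJ]
  refine Finset.sum_congr rfl fun i _ => ?_
  rw [fourierInv_freqPush_mul (integrable_component hU.1 i) (hD i), ← hU.2, ← hφ.2,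
    fourierInv_apply_component hU.1, fderiv_fourierInv hφ.1]
  · simp only [smul_eq_mul]
  · simpa using hφ1.norm

theorem norm_advectDensity_le (gU : Plane → EuclideanSpace ℂ (Fin 2)) (gφ : Plane → ℂ)
    (z : Plane × Plane) :
    ‖advectDensity gU gφ z‖ ≤ 2 * Real.pi * ‖z.2‖ * ∑ i, ‖gU z.1 i‖ * ‖gφ z.2‖ := by
  unfold advectDensity
  refine (norm_sum_le _ _).trans ?_
  rw [Finset.mul_sum]
  refine Finset.sum_le_sum fun i _ => ?_
  rw [norm_mul, norm_mul]
  calc _ ≤ ‖gU z.1 i‖ * ((2 * Real.pi * ‖z.2‖) * ‖gφ z.2‖) := by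
        gcongr; exact norm_derivSym_singleton_le i _
    _ = _ := by ring

/-- Divergence-freeness trades the derivative on φ for one on the product; the factor |ζ+η| makes
negative powers of the output frequency harmless. -/
theorem norm_advectDensity_le_of_div {gU : Plane → EuclideanSpace ℂ (Fin 2)} (gφ : Plane → ℂ)
    {z : Plane × Plane} (hdiv : ∑ i, derivSym [i] z.1 * gU z.1 i = 0) :
    ‖advectDensity gU gφ z‖ ≤ 2 * Real.pi * ‖z.1 + z.2‖ * ∑ i, ‖gU z.1 i‖ * ‖gφ z.2‖ := by
  have : advectDensity gU gφ z = ∑ i, gU z.1 i * (derivSym [i] (z.1 + z.2) * gφ z.2) := by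
    unfold advectDensity
    simp only [derivSym_singleton_add, add_mul, mul_add, Finset.sum_add_distrib]
    rw [show ∑ i, gU z.1 i * (derivSym [i] z.1 * gφ z.2) =
      (∑ i, derivSym [i] z.1 * gU z.1 i) * gφ z.2 by
        rw [Finset.sum_mul]; exact Finset.sum_congr rfl fun i _ => by ring, hdiv, zero_mul, zero_add]
  rw [this]
  refine (norm_sum_le _ _).trans ?_
  rw [Finset.mul_sum]
  refine Finset.sum_le_sum fun i _ => ?_
  rw [norm_mul, norm_mul]
  calc _ ≤ ‖gU z.1 i‖ * ((2 * Real.pi * ‖z.1 + z.2‖) * ‖gφ z.2‖) := by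
        gcongr; exact norm_derivSym_singleton_le i _
    _ = _ := by ring

theorem sum_norm_weight_mul (s : ℝ) (gU : Plane → EuclideanSpace ℂ (Fin 2)) (gφ : Plane → ℂ)
    (z : Plane × Plane) :
    ∑ i, ‖((((1 + ‖z.1‖) ^ (1 + s) : ℝ) : ℂ) * gU z.1 i) *
        ((((1 + ‖z.2‖) ^ (1 + s) : ℝ) : ℂ) * gφ z.2)‖ =
      ((1 + ‖z.1‖) * (1 + ‖z.2‖)) * ((1 + ‖z.1‖) ^ s * (1 + ‖z.2‖) ^ s) *
        ∑ i, ‖gU z.1 i‖ * ‖gφ z.2‖ := by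
  rw [Finset.mul_sum]
  refine Finset.sum_congr rfl fun i _ => ?_
  simp only [norm_mul, Complex.norm_real]
  rw [Real.norm_of_nonneg (by positivity : 0 ≤ (1 + ‖z.1‖) ^ (1 + s)),
    Real.norm_of_nonneg (by positivity : 0 ≤ (1 + ‖z.2‖) ^ (1 + s)),
    Real.rpow_add (by positivity), Real.rpow_add (by positivity), Real.rpow_one, Real.rpow_one]
  ring

theorem rpow_norm_mul_norm_le {σ : ℝ} (hσ : 0 ≤ σ) (hσ1 : σ < 1) (ζ η : Plane) :
    ‖ζ + η‖ ^ (-σ) * ‖ζ + η‖ ≤ (1 + ‖ζ‖) * (1 + ‖η‖) := by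
  have h1 : (1 : ℝ) ≤ 1 + ‖ζ + η‖ := by linarith [norm_nonneg (ζ + η)]
  have h2 : ‖ζ + η‖ ^ (-σ) * ‖ζ + η‖ ≤ 1 + ‖ζ + η‖ := by
    rcases eq_or_ne (ζ + η) 0 with h | h
    · simp [h]
    · have h0 := norm_pos_iff.2 h
      nth_rw 2 [← Real.rpow_one ‖ζ + η‖]
      rw [← Real.rpow_add h0]
      have := rpow_norm_le_one_add_rpow (a := -σ + 1) (s := 1) (by linarith) (by linarith) (ζ + η)
      rwa [Real.rpow_one] at this
  have := one_add_norm_add_rpow_le zero_le_one ζ η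
  simp only [Real.rpow_one] at this
  exact h2.trans this

theorem isFourierDataOf_fhat {E : Type*} [NormedAddCommGroup E] [NormedSpace ℂ E] {f : Plane → E}
    (h : HasIntegrableFourier f) : IsFourierDataOf (fhat f) f := by
  rw [fhat, dif_pos h]
  exact h.choose_spec

theorem IsFourierDataOf.lam_eq {E : Type*} [NormedAddCommGroup E] [NormedSpace ℂ E]
    [CompleteSpace E] {g f : Plane → E} (h : IsFourierDataOf g f) (s : ℝ) :
    Lam s f = 𝓕⁻ fun ξ => lamSymbol s ξ • g ξ := by
  refine fourierInv_congr_ae ?_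
  filter_upwards [h.fhat_ae_eq] with ξ hξ
  rw [hξ]

theorem IsFourierDataOf.lamDefined {E : Type*} [NormedAddCommGroup E] [NormedSpace ℂ E]
    [CompleteSpace E] {g f : Plane → E} (h : IsFourierDataOf g f) {s : ℝ}
    (hs : Integrable fun ξ => lamSymbol s ξ • g ξ) : LamDefined s f := by
  refine ⟨⟨g, h⟩, hs.congr ?_⟩
  filter_upwards [h.fhat_ae_eq] with ξ hξ
  rw [hξ]

/-- The commutator is well defined, and its pairing with test functions is a trilinear form in
frequency variables. -/
theorem lamCommutator_spec {s₁ s₂ : ℝ} (hs₁ : 0 ≤ s₁) (hs₁1 : s₁ < 1) (hs₂ : 0 ≤ s₂)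
    {U : Plane → EuclideanSpace ℂ (Fin 2)} {φ : Plane → ℂ}
    {gU : Plane → EuclideanSpace ℂ (Fin 2)} {gφ : Plane → ℂ} (hU : IsFourierDataOf gU U)
    (hφ : IsFourierDataOf gφ φ)
    (hUr : ∀ i, Integrable fun ζ => (((1 + ‖ζ‖) ^ (1 + s₂) : ℝ) : ℂ) * gU ζ i)
    (hφr : Integrable fun ζ => (((1 + ‖ζ‖) ^ (1 + s₂) : ℝ) : ℂ) * gφ ζ)
    (hdiv : ∀ᵐ ζ, ∑ i, derivSym [i] ζ * gU ζ i = 0) :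
    LamDefined s₂ (advect U φ) ∧ LamDefined (-s₁) (lamCommutator s₂ U φ) ∧
    BddMeas (Lam (-s₁) (lamCommutator s₂ U φ)) ∧
    ∀ h : Plane → ℂ, Integrable h →
      ∫ x, Lam (-s₁) (lamCommutator s₂ U φ) x * h x = (((2 * Real.pi) ^ (s₂ - s₁) : ℝ) : ℂ) *
        ∫ z : Plane × Plane,
          ((‖z.1 + z.2‖ ^ (-s₁) * (‖z.1 + z.2‖ ^ s₂ - ‖z.2‖ ^ s₂) : ℝ) : ℂ) *
          (∑ i, gU z.1 i * derivSym [i] z.2) * gφ z.2 * 𝓕⁻ h (z.1 + z.2) := by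
  have hφ1 : Integrable fun ξ => ((‖ξ‖ : ℝ) : ℂ) * gφ ξ := by
    simpa using integrable_rpow_norm_mul zero_le_one (by linarith : 1 ≤ 1 + s₂) hφr
  obtain ⟨hJ, hA⟩ := isFourierDataOf_advect hU hφ hφ1
  set J := advectDensity gU gφ with hJdef
  have hm : Measurable fun z : Plane × Plane => lamSymbol s₂ (z.1 + z.2) :=
    (measurable_lamSymbol s₂).comp (by fun_prop)
  have hm2 : Measurable fun z : Plane × Plane => lamSymbol s₂ z.2 :=
    (measurable_lamSymbol s₂).comp (by fun_prop)
  have hm1 : Measurable fun z : Plane × Plane => lamSymbol (-s₁) (z.1 + z.2) :=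
    (measurable_lamSymbol (-s₁)).comp (by fun_prop)
  have b1 : ∀ ζ η : Plane, ‖lamSymbol s₂ (ζ + η)‖ ≤
      (2 * Real.pi) ^ s₂ * ((1 + ‖ζ‖) ^ s₂ * (1 + ‖η‖) ^ s₂) := by
    intro ζ η
    rw [norm_lamSymbol]
    gcongr
    exact (rpow_norm_le_one_add_rpow hs₂ le_rfl _).trans (one_add_norm_add_rpow_le hs₂ ζ η)
  have b2 : ∀ ζ η : Plane, ‖lamSymbol s₂ η‖ ≤
      (2 * Real.pi) ^ s₂ * ((1 + ‖ζ‖) ^ s₂ * (1 + ‖η‖) ^ s₂) := by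
    intro ζ η
    rw [norm_lamSymbol]
    gcongr
    refine (rpow_norm_le_one_add_rpow hs₂ le_rfl _).trans ?_
    refine le_mul_of_one_le_left (by positivity) ?_
    exact Real.one_le_rpow (by linarith [norm_nonneg ζ]) hs₂
  have hle1 : ∀ z : Plane × Plane, ∀ w : ℂ,
      ‖w‖ ≤ (2 * Real.pi) ^ s₂ * ((1 + ‖z.1‖) ^ s₂ * (1 + ‖z.2‖) ^ s₂) → ‖w * J z‖ ≤
      (2 * Real.pi) ^ s₂ * (2 * Real.pi) * ∑ i, ‖((((1 + ‖z.1‖) ^ (1 + s₂) : ℝ) : ℂ) * gU z.1 i) *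
        ((((1 + ‖z.2‖) ^ (1 + s₂) : ℝ) : ℂ) * gφ z.2)‖ := by
    intro z w hw
    rw [sum_norm_weight_mul, norm_mul]
    have h2 : ‖z.2‖ ≤ (1 + ‖z.1‖) * (1 + ‖z.2‖) := by
      nlinarith [norm_nonneg z.1, norm_nonneg z.2, mul_nonneg (norm_nonneg z.1) (norm_nonneg z.2)]
    calc _ ≤ ((2 * Real.pi) ^ s₂ * ((1 + ‖z.1‖) ^ s₂ * (1 + ‖z.2‖) ^ s₂)) *
          (2 * Real.pi * ((1 + ‖z.1‖) * (1 + ‖z.2‖)) * ∑ i, ‖gU z.1 i‖ * ‖gφ z.2‖) := by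
          refine mul_le_mul hw ((norm_advectDensity_le gU gφ z).trans ?_) (norm_nonneg _)
            (by positivity)
          gcongr
      _ = _ := by ring
  have hJ1 : Integrable fun z : Plane × Plane => lamSymbol s₂ (z.1 + z.2) * J z :=
    integrable_of_norm_le_sum (hm.aestronglyMeasurable.mul hJ.1) hUr hφr
      (Filter.Eventually.of_forall fun z => hle1 z _ (b1 z.1 z.2))
  have hJ2 : Integrable fun z : Plane × Plane => lamSymbol s₂ z.2 * J z :=
    integrable_of_norm_le_sum (hm2.aestronglyMeasurable.mul hJ.1) hUr hφr
      (Filter.Eventually.of_forall fun z => hle1 z _ (b2 z.1 z.2))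
  have e1 : (fun ξ => lamSymbol s₂ ξ • freqPush J ξ) =
      freqPush fun z => lamSymbol s₂ (z.1 + z.2) * J z := by
    funext ξ; rw [freqPush_mul, smul_eq_mul]
  have hlamA : LamDefined s₂ (advect U φ) := hA.lamDefined (by
    rw [e1]; exact integrable_freqPush hJ1)
  have hlamφ : IsFourierDataOf (fun ξ => lamSymbol s₂ ξ • gφ ξ) (Lam s₂ φ) := by
    refine ⟨?_, (hφ.lam_eq s₂).symm⟩
    refine integrable_mul_of_norm_le_rpow (C := (2 * Real.pi) ^ s₂) hφr
      (measurable_lamSymbol s₂).aestronglyMeasurable fun ζ => ?_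
    rw [norm_lamSymbol]
    gcongr
    exact rpow_norm_le_one_add_rpow hs₂ (by linarith) ζ
  obtain ⟨-, hA'⟩ := isFourierDataOf_advect hU hlamφ (by
    simp only [smul_eq_mul, ← mul_assoc]
    refine integrable_mul_of_norm_le_rpow (C := (2 * Real.pi) ^ s₂) hφr
      ((Complex.measurable_ofReal.comp measurable_norm).mul
        (measurable_lamSymbol s₂)).aestronglyMeasurable fun ζ => ?_
    rw [norm_mul, norm_lamSymbol, Complex.norm_real, norm_norm, Real.rpow_add (by positivity),
      Real.rpow_one, mul_left_comm]
    gcongr <;> linarith)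
  have e2 : advectDensity gU (fun ξ => lamSymbol s₂ ξ • gφ ξ) = fun z => lamSymbol s₂ z.2 * J z := by
    funext z
    simp only [hJdef, advectDensity, Finset.mul_sum, smul_eq_mul]
    exact Finset.sum_congr rfl fun i _ => by ring
  rw [e2] at hA'
  set Jc : Plane × Plane → ℂ := fun z => lamSymbol s₂ (z.1 + z.2) * J z - lamSymbol s₂ z.2 * J z
    with hJc
  have hJci : Integrable Jc := hJ1.sub hJ2
  have hcomm : IsFourierDataOf (freqPush Jc) (lamCommutator s₂ U φ) := by
    refine ⟨integrable_freqPush hJci, ?_⟩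
    funext x
    rw [hJc, fourierInv_freqPush_sub hJ1 hJ2, hA'.2, ← e1, ← hA.lam_eq]
    rfl
  -- Here the divergence condition is essential: |ζ+η|^{-s₁}|ζ+η| is bounded by the weights because
  -- s₁ < 1.
  have hJJ : Integrable fun z : Plane × Plane => lamSymbol (-s₁) (z.1 + z.2) * Jc z := by
    refine integrable_of_norm_le_sum (hm1.aestronglyMeasurable.mul hJci.1) hUr hφr
      (C := 2 * (2 * Real.pi) ^ s₂ * (2 * Real.pi) ^ (-s₁) * (2 * Real.pi)) ?_
    filter_upwards [Measure.quasiMeasurePreserving_fst.ae hdiv] with z hz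
    rw [sum_norm_weight_mul, norm_mul, norm_lamSymbol, hJc]
    beta_reduce
    rw [← sub_mul, norm_mul]
    have h1 := (norm_sub_le _ _).trans (add_le_add (b1 z.1 z.2) (b2 z.1 z.2))
    have h2 := norm_advectDensity_le_of_div gφ hz
    have h3 := rpow_norm_mul_norm_le hs₁ hs₁1 z.1 z.2
    calc _ ≤ (2 * Real.pi) ^ (-s₁) * ‖z.1 + z.2‖ ^ (-s₁) *
          (((2 * Real.pi) ^ s₂ * ((1 + ‖z.1‖) ^ s₂ * (1 + ‖z.2‖) ^ s₂) +
            (2 * Real.pi) ^ s₂ * ((1 + ‖z.1‖) ^ s₂ * (1 + ‖z.2‖) ^ s₂)) *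
          (2 * Real.pi * ‖z.1 + z.2‖ * ∑ i, ‖gU z.1 i‖ * ‖gφ z.2‖)) := by gcongr
      _ = 2 * (2 * Real.pi) ^ s₂ * (2 * Real.pi) ^ (-s₁) * (2 * Real.pi) *
          ((‖z.1 + z.2‖ ^ (-s₁) * ‖z.1 + z.2‖) * ((1 + ‖z.1‖) ^ s₂ * (1 + ‖z.2‖) ^ s₂) *
            ∑ i, ‖gU z.1 i‖ * ‖gφ z.2‖) := by ring
      _ ≤ _ := by gcongr
  have e3 : (fun ξ => lamSymbol (-s₁) ξ • freqPush Jc ξ) =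
      freqPush fun z => lamSymbol (-s₁) (z.1 + z.2) * Jc z := by
    funext ξ; rw [freqPush_mul, smul_eq_mul]
  have e4 : Lam (-s₁) (lamCommutator s₂ U φ) =
      𝓕⁻ (freqPush fun z => lamSymbol (-s₁) (z.1 + z.2) * Jc z) := by
    rw [hcomm.lam_eq, e3]
  refine ⟨hlamA, hcomm.lamDefined (by rw [e3]; exact integrable_freqPush hJJ), ?_, fun h hh => ?_⟩
  · rw [e4]; exact bddMeas_fourierInv (integrable_freqPush hJJ)
  · rw [e4, integral_fourierInv_freqPush_mul hJJ hh, ← integral_const_mul]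
    refine integral_congr_ae (Filter.Eventually.of_forall fun z => ?_)
    have e5 : J z = (∑ i, gU z.1 i * derivSym [i] z.2) * gφ z.2 := by
      simp only [hJdef, advectDensity, Finset.sum_mul, mul_assoc]
    simp only [hJc, lamSymbol_eq]
    rw [e5, sub_eq_add_neg s₂, Real.rpow_add (by positivity)]
    push_cast
    ring

/-! ### The commutator estimates -/

theorem FourierRegular.integrable_component {m : ℝ} {V : Plane → EuclideanSpace ℂ (Fin 2)}
    (hV : FourierRegular m V) (i : Fin 2) :
    Integrable fun ζ => (((1 + ‖ζ‖) ^ m : ℝ) : ℂ) * fhat V ζ i :=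
  _root_.integrable_component hV.2 i

theorem FourierRegular.integrable_scalar {m : ℝ} {φ : Plane → ℂ} (hφ : FourierRegular m φ) :
    Integrable fun ζ => (((1 + ‖ζ‖) ^ m : ℝ) : ℂ) * fhat φ ζ := hφ.2

/-- A divergence-free field satisfies `ζ · V̂(ζ) = 0`. -/
theorem sum_derivSym_mul_fhat_eq_zero {m : ℝ} (hm : 1 ≤ m) {V : Plane → EuclideanSpace ℂ (Fin 2)}
    (hV : FourierRegular m V) (hdiv : ∀ x, planeDiv V x = 0) :
    ∀ᵐ ζ, ∑ i, derivSym [i] ζ * fhat V ζ i = 0 := by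
  have hd := isFourierDataOf_fhat hV.1
  have hD : ∀ i j, Integrable fun ζ => derivSym [i] ζ * fhat V ζ j := fun i j =>
    integrable_derivSym_mul hm i (hV.integrable_component j)
  have hn : Integrable fun ξ : Plane => ‖ξ‖ * ‖fhat V ξ‖ := by
    refine hV.2.norm.mono' (measurable_norm.aestronglyMeasurable.mul hd.1.1.norm)
      (Filter.Eventually.of_forall fun ξ => ?_)
    rw [norm_mul, norm_norm, norm_norm, norm_smul, Complex.norm_real,
      Real.norm_of_nonneg (by positivity)]
    gcongr
    simpa using rpow_norm_le_one_add_rpow zero_le_one hm ξ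
  have hDv : ∀ i, Integrable fun ξ => derivSym [i] ξ • fhat V ξ := fun i => by
    refine (hn.const_mul (2 * Real.pi)).mono'
      ((continuous_derivSym [i]).aestronglyMeasurable.smul hd.1.1)
      (Filter.Eventually.of_forall fun ξ => ?_)
    rw [norm_smul, ← mul_assoc]
    gcongr
    exact norm_derivSym_singleton_le i ξ
  refine ae_eq_zero_of_fourierInv_eq_zero (integrable_finsetSum _ fun i _ => hD i i) ?_
  funext x
  have h := hdiv x
  unfold planeDiv at h
  rw [Pi.zero_apply, ← h]
  have e : ∀ i, fderiv ℝ V x (planeBasis i) i = 𝓕⁻ (fun ζ => derivSym [i] ζ * fhat V ζ i) x := by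
    intro i
    conv_lhs => rw [← hd.2]
    rw [fderiv_fourierInv hd.1 hn, fourierInv_apply_component (hDv i)]
    rfl
  simp only [e, Real.fourierInv_eq, Finset.smul_sum]
  refine integral_finsetSum _ fun i _ => ?_
  simpa using (Real.fourierIntegral_convergent_iff (μ := volume) (-x)).2 (hD i i)

/-- The bound for the trilinear form of the commutator. -/
def FormBound (s₁ s₂ a b : ℝ) (q : ℝ≥0∞) (r s : ℝ) : Prop :=
  ∃ C : ℝ≥0, ∀ (U : Fin 2 → Plane → ℂ) (φ h : Plane → ℂ),
    (∀ i, Integrable fun ζ => (((1 + ‖ζ‖) ^ (1 + s₂) : ℝ) : ℂ) * U i ζ) →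
    Integrable (fun ζ => (((1 + ‖ζ‖) ^ (1 + s₂) : ℝ) : ℂ) * φ ζ) →
    Integrable (fun η => ((‖η‖ ^ b : ℝ) : ℂ) * φ η) → Integrable h → BddMeas h →
    (∀ᵐ ζ, ∑ i, derivSym [i] ζ * U i ζ = 0) →
    ‖∫ z : Plane × Plane,
      ((‖z.1 + z.2‖ ^ (-s₁) * (‖z.1 + z.2‖ ^ s₂ - ‖z.2‖ ^ s₂) : ℝ) : ℂ) *
        (∑ i, U i z.1 * derivSym [i] z.2) * φ z.2 * 𝓕⁻ h (z.1 + z.2)‖ₑ ≤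
      C * ((∑ i, eLpNorm (𝓕⁻ fun ζ => ((‖ζ‖ ^ a : ℝ) : ℂ) * U i ζ) q volume) *
        eLpNorm (𝓕⁻ fun η => ((‖η‖ ^ b : ℝ) : ℂ) * φ η) (ENNReal.ofReal r) volume *
        eLpNorm h (ENNReal.ofReal s) volume)

/-- Only the indices s₂/2 and s₂/2+1 occur in the Wronskian identity, and both are at least s₂/2. -/
theorem formBound_of_coreBound {s₁ s₂ a b : ℝ} {q : ℝ≥0∞} {r s : ℝ} (hs₁ : 0 ≤ s₁) (hs₁1 : s₁ < 1)
    (hs₂ : 0 < s₂) (hs₂2 : s₂ < 2)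
    (h : ∀ μ μ' : ℝ, s₂ / 2 ≤ μ → s₂ / 2 ≤ μ' → ∀ j m n : Fin 2,
      CoreBound (s₂ / 2) s₁ μ μ' a b q r s j m n) : FormBound s₁ s₂ a b q r s := by
  have := exists_commutator_form_le (a := a) (b := b) (q := q) (r := r) (s := s) hs₁ hs₁1
    (by linarith : 0 < s₂ / 2) (by linarith) (fun c j m n => by
      refine h _ _ ?_ ?_ j m n <;> fin_cases c <;> simp)
  simp only [mul_div_cancel₀ s₂ (two_ne_zero' ℝ)] at this
  exact this

/-- For s₂ = 0 both powers equal 1, also at the origin since 0⁰ = 1, and the form vanishes. The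
Bessel argument needs ν > 0. -/
theorem formBound_zero (s₁ a b : ℝ) (q : ℝ≥0∞) (r s : ℝ) : FormBound s₁ 0 a b q r s :=
  ⟨0, fun U φ h _ _ _ _ _ _ => by simp⟩

/-- The `L^p` bound for the commutator in terms of Fourier data. -/
theorem FormBound.exists_eLpNorm_le {s₁ s₂ a b : ℝ} {q : ℝ≥0∞} {r p p' : ℝ} (hs₁ : 0 ≤ s₁)
    (hs₁1 : s₁ < 1) (hs₂ : 0 ≤ s₂) (hpp : p.HolderConjugate p')
    (hF : FormBound s₁ s₂ a b q r p') :
    ∃ C : ℝ≥0, ∀ (U gU : Plane → EuclideanSpace ℂ (Fin 2)) (φ gφ : Plane → ℂ),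
      IsFourierDataOf gU U → IsFourierDataOf gφ φ →
      (∀ i, Integrable fun ζ => (((1 + ‖ζ‖) ^ (1 + s₂) : ℝ) : ℂ) * gU ζ i) →
      Integrable (fun ζ => (((1 + ‖ζ‖) ^ (1 + s₂) : ℝ) : ℂ) * gφ ζ) →
      Integrable (fun η => ((‖η‖ ^ b : ℝ) : ℂ) * gφ η) →
      (∀ᵐ ζ, ∑ i, derivSym [i] ζ * gU ζ i = 0) →
      LamDefined s₂ (advect U φ) ∧ LamDefined (-s₁) (lamCommutator s₂ U φ) ∧
      eLpNorm (Lam (-s₁) (lamCommutator s₂ U φ)) (ENNReal.ofReal p) volume ≤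
        C * ((∑ i, eLpNorm (𝓕⁻ fun ζ => ((‖ζ‖ ^ a : ℝ) : ℂ) * gU ζ i) q volume) *
          eLpNorm (𝓕⁻ fun η => ((‖η‖ ^ b : ℝ) : ℂ) * gφ η) (ENNReal.ofReal r) volume) := by
  obtain ⟨C, hC⟩ := hF
  refine ⟨‖(((2 * Real.pi) ^ (s₂ - s₁) : ℝ) : ℂ)‖₊ * C,
    fun U gU φ gφ hU hφ hUr hφr hφb hdiv => ?_⟩
  obtain ⟨h1, h2, h3, h4⟩ := lamCommutator_spec hs₁ hs₁1 hs₂ hU hφ hUr hφr hdiv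
  refine ⟨h1, h2, eLpNorm_le_of_forall_integral_mul_le hpp h3 fun h hh hhb => ?_⟩
  rw [h4 h hh, enorm_mul, enorm_eq_nnnorm, ENNReal.coe_mul]
  refine (mul_le_mul_right (hC (fun i ζ => gU ζ i) gφ h hUr hφr hφb hh hhb hdiv) _).trans
    (le_of_eq ?_)
  ring

theorem eLpNorm_fourierInv_component_le {a : ℝ} {g : Plane → EuclideanSpace ℂ (Fin 2)}
    (hg : Integrable fun ζ => lamSymbol a ζ • g ζ) (q : ℝ≥0∞) (i : Fin 2) :
    eLpNorm (𝓕⁻ fun ζ => ((‖ζ‖ ^ a : ℝ) : ℂ) * g ζ i) q volume ≤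
      ‖(((2 * Real.pi) ^ a : ℝ) : ℂ)⁻¹‖ₑ * eLpNorm (𝓕⁻ fun ζ => lamSymbol a ζ • g ζ) q volume := by
  have hc : (((2 * Real.pi) ^ a : ℝ) : ℂ) ≠ 0 := by
    exact_mod_cast (Real.rpow_pos_of_pos (by positivity) a).ne'
  have e : (𝓕⁻ fun ζ => ((‖ζ‖ ^ a : ℝ) : ℂ) * g ζ i) = fun x => (((2 * Real.pi) ^ a : ℝ) : ℂ)⁻¹ *
      𝓕⁻ (fun ζ => lamSymbol a ζ • g ζ) x i := by
    funext x
    -- The constant (2π)^a is the ratio of `lamSymbol a` to |ζ|^a.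
    rw [fourierInv_apply_component hg, ← fourierInv_const_mul]
    refine congrFun (congrArg _ (funext fun ζ => ?_)) x
    rw [PiLp.smul_apply, smul_eq_mul, lamSymbol_eq]
    field_simp
  rw [e]
  refine (eLpNorm_const_smul_le (c := (((2 * Real.pi) ^ a : ℝ) : ℂ)⁻¹)
    (f := fun x => 𝓕⁻ (fun ζ => lamSymbol a ζ • g ζ) x i)).trans ?_
  refine mul_le_mul_right (eLpNorm_mono fun x => ?_) _
  exact PiLp.norm_apply_le _ i

theorem eLpNorm_fourierInv_scalar_le (b : ℝ) (g : Plane → ℂ) (r : ℝ≥0∞) :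
    eLpNorm (𝓕⁻ fun ζ => ((‖ζ‖ ^ b : ℝ) : ℂ) * g ζ) r volume ≤
      ‖(((2 * Real.pi) ^ b : ℝ) : ℂ)⁻¹‖ₑ * eLpNorm (𝓕⁻ fun ζ => lamSymbol b ζ • g ζ) r volume := by
  have hc : (((2 * Real.pi) ^ b : ℝ) : ℂ) ≠ 0 := by
    exact_mod_cast (Real.rpow_pos_of_pos (by positivity) b).ne'
  have e : (𝓕⁻ fun ζ => ((‖ζ‖ ^ b : ℝ) : ℂ) * g ζ) = fun x => (((2 * Real.pi) ^ b : ℝ) : ℂ)⁻¹ *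
      𝓕⁻ (fun ζ => lamSymbol b ζ • g ζ) x := by
    funext x
    rw [← fourierInv_const_mul]
    refine congrFun (congrArg _ (funext fun ζ => ?_)) x
    rw [smul_eq_mul, lamSymbol_eq]
    field_simp
  rw [e]
  exact eLpNorm_const_smul_le (c := (((2 * Real.pi) ^ b : ℝ) : ℂ)⁻¹)
    (f := 𝓕⁻ (fun ζ => lamSymbol b ζ • g ζ))

/-- Put b = s₂-s₁+1-a. The four cases are the interior of the interval, its right end a = 1, its
left end (where b = 1), and the degenerate interval s₂-s₁ = 1 with a = b = 1. -/
theorem formBound_of_mem_Icc {s₁ s₂ q r s a : ℝ} (hs₁ : 0 ≤ s₁) (hs₁1 : s₁ < 1)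
    (h0 : 0 ≤ s₂ - s₁) (h1 : s₂ - s₁ ≤ 1) (hq : 1 < q) (hr : 1 < r) (hs : 1 < s)
    (hqrs : q⁻¹ + r⁻¹ + s⁻¹ = 1) (ha : a ∈ Set.Icc (s₂ - s₁) 1) :
    FormBound s₁ s₂ a (s₂ - s₁ + 1 - a) (ENNReal.ofReal q) r s := by
  rcases eq_or_lt_of_le (by linarith : 0 ≤ s₂) with rfl | hs₂
  · exact formBound_zero _ _ _ _ _ _
  obtain ⟨ha0, ha1⟩ := ha
  have hq0 : 0 < q := by linarith
  have hqE : (ENNReal.ofReal q)⁻¹ + ENNReal.ofReal r⁻¹ + ENNReal.ofReal s⁻¹ = 1 := by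
    rw [← ENNReal.ofReal_inv_of_pos hq0, ← ENNReal.ofReal_add (by positivity) (by positivity),
      ← ENNReal.ofReal_add (by positivity) (by positivity), hqrs, ENNReal.ofReal_one]
  have hqE1 : 1 < ENNReal.ofReal q := by simpa using hq
  refine formBound_of_coreBound hs₁ hs₁1 hs₂ (by linarith) fun μ μ' hμ hμ' j m n => ?_
  rcases eq_or_lt_of_le ha1 with rfl | ha1
  · rcases eq_or_lt_of_le h1 with h1 | h1
    · rw [h1, add_sub_cancel_right]
      exact coreBound_one_one hs₁ hs₁1 hμ hμ' (by linarith) hq hr hs hqrs j m n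
    · exact coreBound_one_lt hs₁ hs₁1 (by linarith) (by linarith) (by linarith) (by linarith)
        (by linarith) (by linarith) hq hr hs hqE j m n
  · rcases eq_or_lt_of_le ha0 with rfl | ha0
    · rw [add_sub_cancel_left]
      exact coreBound_lt_one hs₁ hs₁1 (by linarith) (by linarith) (by linarith) (by linarith)
        (by linarith) (by linarith) hq hr hs hqrs j m n
    · exact coreBound_of_lt_lt hs₁ hs₁1 (by linarith) (by linarith) (by linarith) (by linarith)
        (by linarith) (by linarith) (by linarith) (by linarith) hqE1 hr hs hqE j m n

theorem exists_lamCommutator_le {s₁ s₂ p q r a : ℝ} (hs₁ : 0 ≤ s₁) (hs₁1 : s₁ < 1)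
    (h0 : 0 ≤ s₂ - s₁) (h1 : s₂ - s₁ ≤ 1) (hp : 1 < p) (hq : 2 < q) (hr : 1 < r)
    (hpqr : 1 / p = 1 / q + 1 / r) (ha : a ∈ Set.Icc (s₂ - s₁) 1) :
    ∃ C : ℝ≥0, ∀ (V : Plane → EuclideanSpace ℂ (Fin 2)) (φ : Plane → ℂ),
      FourierRegular (1 + s₂) V → FourierRegular (1 + s₂) φ →
      (∀ x, planeDiv V x = 0) →
      LamDefined s₂ (advect V φ) ∧
      LamDefined (-s₁) (lamCommutator s₂ V φ) ∧
      eLpNorm (Lam (-s₁) (lamCommutator s₂ V φ)) (ENNReal.ofReal p) volume ≤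
        C * eLpNorm (Lam a V) (ENNReal.ofReal q) volume *
          eLpNorm (Lam (s₂ - s₁ + 1 - a) φ) (ENNReal.ofReal r) volume := by
  have hpp : p.HolderConjugate p.conjExponent := Real.HolderConjugate.conjExponent hp
  have hpi := hpp.inv_add_inv_eq_one
  simp only [one_div] at hpqr
  obtain ⟨C, hC⟩ := (formBound_of_mem_Icc (q := q) (r := r) hs₁ hs₁1 h0 h1 (by linarith) hr
    hpp.symm.lt (by rw [← hpqr, hpi]) ha).exists_eLpNorm_le hs₁ hs₁1 (by linarith) hpp
  set b := s₂ - s₁ + 1 - a with hb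
  set c₁ := ‖(((2 * Real.pi) ^ a : ℝ) : ℂ)⁻¹‖₊ with hc₁
  set c₂ := ‖(((2 * Real.pi) ^ b : ℝ) : ℂ)⁻¹‖₊ with hc₂
  refine ⟨C * (2 * c₁ * c₂), fun V φ hV hφ hdiv => ?_⟩
  have hm : 1 ≤ 1 + s₂ := by linarith
  have hφr := hφ.integrable_scalar
  have hVd := isFourierDataOf_fhat hV.1
  have hφd := isFourierDataOf_fhat hφ.1
  obtain ⟨k1, k2, k3⟩ := hC V (fhat V) φ (fhat φ) hVd hφd hV.integrable_component hφr
    (integrable_rpow_norm_mul (by linarith [ha.2]) (by linarith [ha.1]) hφr)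
    (sum_derivSym_mul_fhat_eq_zero hm hV hdiv)
  refine ⟨k1, k2, k3.trans ?_⟩
  have hVa : Integrable fun ζ => lamSymbol a ζ • fhat V ζ := by
    refine (hV.2.norm.const_mul ((2 * Real.pi) ^ a)).mono'
      ((measurable_lamSymbol a).aestronglyMeasurable.smul hVd.1.1)
      (Filter.Eventually.of_forall fun ζ => ?_)
    rw [norm_smul, norm_smul, norm_lamSymbol, Complex.norm_real,
      Real.norm_of_nonneg (by positivity), ← mul_assoc]
    gcongr
    exact rpow_norm_le_one_add_rpow (by linarith [ha.1]) (by linarith [ha.2]) ζ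
  have n1 := fun i => eLpNorm_fourierInv_component_le hVa (ENNReal.ofReal q) i
  have n2 := eLpNorm_fourierInv_scalar_le b (fhat φ) (ENNReal.ofReal r)
  rw [← hVd.lam_eq] at n1
  rw [← hφd.lam_eq] at n2
  rw [enorm_eq_nnnorm] at n1 n2
  calc _ ≤ (C : ℝ≥0∞) * ((∑ _i : Fin 2, (c₁ : ℝ≥0∞) * eLpNorm (Lam a V) (ENNReal.ofReal q) volume) *
        (c₂ * eLpNorm (Lam b φ) (ENNReal.ofReal r) volume)) := by
        gcongr with i
        exact n1 i
    _ = _ := by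
        rw [Finset.sum_const, Finset.card_univ, Fintype.card_fin, nsmul_eq_mul]
        push_cast
        ring

/-- With a = s₃ and b = s₂-s₁+1-s₃ the hypotheses give a < 1 and -1 < b < 1, the last being s₂ <
s₁+s₃. Then no Riesz transform is needed, and the maximal function acts on the first factor, so L^∞
is allowed there. -/
theorem formBound_two {s₁ s₂ s₃ : ℝ} (hs₁ : 0 < s₁) (hs₂ : 0 < s₂) (hs₃ : 0 < s₃) (hs₁1 : s₁ < 1)
    (hs₃1 : s₃ < 1) (h : s₂ < s₁ + s₃) : FormBound s₁ s₂ s₃ (s₂ - s₁ + 1 - s₃) ⊤ 2 2 := by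
  refine formBound_of_coreBound hs₁.le hs₁1 hs₂ (by linarith) fun μ μ' hμ hμ' j m n => ?_
  refine coreBound_of_lt_lt hs₁.le hs₁1 (by linarith) (by linarith) hs₃.le hs₃1 (by linarith)
    (by linarith) (by linarith) (by linarith) (by simp) one_lt_two one_lt_two ?_ j m n
  rw [ENNReal.inv_top, zero_add, ← ENNReal.ofReal_add (by norm_num) (by norm_num),
    ← ENNReal.ofReal_one]
  norm_num

theorem exists_lamCommutator_two_le {s₁ s₂ s₃ : ℝ} (hs₁ : 0 < s₁) (hs₂ : 0 < s₂) (hs₃ : 0 < s₃)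
    (hs₁1 : s₁ < 1) (hs₃1 : s₃ < 1) (h : s₂ < s₁ + s₃) :
    ∃ C : ℝ≥0, ∀ (V : Plane → EuclideanSpace ℂ (Fin 2)) (φ : Plane → ℂ),
      FourierRegular (1 + s₂) V → FourierRegular (1 + s₂) φ →
      LamDefined (-s₃) V → LamDefined (s₂ - s₁ + 1 - s₃) φ →
      (∀ x, planeDiv V x = 0) →
      LamDefined s₂ (advect (Lam (-s₃) V) φ) ∧
      LamDefined (-s₁) (lamCommutator s₂ (Lam (-s₃) V) φ) ∧
      eLpNorm (Lam (-s₁) (lamCommutator s₂ (Lam (-s₃) V) φ)) 2 volume ≤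
        C * eLpNorm V ⊤ volume *
          eLpNorm (Lam (s₂ - s₁ + 1 - s₃) φ) 2 volume := by
  have hpp : (2 : ℝ).HolderConjugate 2 := Real.HolderConjugate.two_two
  have h2 : ENNReal.ofReal 2 = 2 := by simp
  obtain ⟨C, hC⟩ := (formBound_two hs₁ hs₂ hs₃ hs₁1 hs₃1 h).exists_eLpNorm_le hs₁.le hs₁1 hs₂.le hpp
  rw [h2] at hC
  set b := s₂ - s₁ + 1 - s₃ with hb
  set c₁ := ‖(((2 * Real.pi) ^ (-s₃) : ℝ) : ℂ)‖₊ with hc₁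
  set c₂ := ‖(((2 * Real.pi) ^ b : ℝ) : ℂ)⁻¹‖₊ with hc₂
  refine ⟨C * (2 * c₁ * c₂), fun V φ hV hφ hV3 hφb hdiv => ?_⟩
  have hφr := hφ.integrable_scalar
  have hVd := isFourierDataOf_fhat hV.1
  have hφd := isFourierDataOf_fhat hφ.1
  have hUd : IsFourierDataOf (fun ξ => lamSymbol (-s₃) ξ • fhat V ξ) (Lam (-s₃) V) := ⟨hV3.2, rfl⟩
  have hUr : ∀ i, Integrable fun ζ => (((1 + ‖ζ‖) ^ (1 + s₂) : ℝ) : ℂ) *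
      (lamSymbol (-s₃) ζ • fhat V ζ) i := by
    intro i
    have hUi := integrable_component hV3.2 i
    -- For |ζ| ≤ 1 the weight is bounded and integrability of |ζ|^{-s₃} V̂ suffices; for |ζ| ≥ 1 the
    -- symbol (2π|ζ|)^{-s₃} is at most 1 and the regularity of `V` applies.
    refine ((hUi.norm.const_mul (2 ^ (1 + s₂))).add (hV.integrable_component i).norm).mono' ?_ ?_
    · refine AEStronglyMeasurable.mul (Measurable.aestronglyMeasurable ?_) hUi.1
      fun_prop
    · refine Filter.Eventually.of_forall fun ζ => ?_
      rw [Pi.add_apply, norm_mul, Complex.norm_real, Real.norm_of_nonneg (by positivity)]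
      rcases le_total ‖ζ‖ 1 with hζ | hζ
      · refine le_add_of_le_of_nonneg ?_ (norm_nonneg _)
        gcongr
        linarith
      · refine le_add_of_nonneg_of_le (by positivity) ?_
        rw [norm_mul, Complex.norm_real, Real.norm_of_nonneg (by positivity), PiLp.smul_apply,
          norm_smul]
        gcongr
        refine mul_le_of_le_one_left (norm_nonneg _) ?_
        rw [lamSymbol, Complex.norm_real, Real.norm_of_nonneg (by positivity)]
        refine Real.rpow_le_one_of_one_le_of_nonpos ?_ (by linarith)
        nlinarith [Real.pi_gt_three]
  have hUdiv : ∀ᵐ ζ, ∑ i, derivSym [i] ζ * (lamSymbol (-s₃) ζ • fhat V ζ) i = 0 := by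
    filter_upwards [sum_derivSym_mul_fhat_eq_zero (by linarith) hV hdiv] with ζ hζ
    simp only [PiLp.smul_apply, smul_eq_mul, mul_left_comm _ (lamSymbol (-s₃) ζ)]
    rw [← Finset.mul_sum, hζ, mul_zero]
  have hcb : (((2 * Real.pi) ^ b : ℝ) : ℂ) ≠ 0 := by
    exact_mod_cast (Real.rpow_pos_of_pos (by positivity) b).ne'
  have hφb' : Integrable fun η => ((‖η‖ ^ b : ℝ) : ℂ) * fhat φ η := by
    refine (hφb.2.const_mul (((2 * Real.pi) ^ b : ℝ) : ℂ)⁻¹).congr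
      (Filter.Eventually.of_forall fun η => ?_)
    beta_reduce
    rw [smul_eq_mul, lamSymbol_eq]
    field_simp
  obtain ⟨k1, k2, k3⟩ := hC _ _ φ (fhat φ) hUd hφd hUr hφr hφb' hUdiv
  refine ⟨k1, k2, k3.trans ?_⟩
  have hne : ∀ᵐ ζ : Plane, ζ ≠ 0 := by simp [ae_iff]
  -- The choice a = s₃ undoes Λ^{-s₃} up to a constant, so the first norm is the sup norm of a
  -- component of `V` itself.
  have n1 : ∀ i, eLpNorm (𝓕⁻ fun ζ => ((‖ζ‖ ^ s₃ : ℝ) : ℂ) * (lamSymbol (-s₃) ζ • fhat V ζ) i) ⊤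
      volume ≤ c₁ * eLpNorm V ⊤ volume := by
    intro i
    have e1 : (fun ζ => ((‖ζ‖ ^ s₃ : ℝ) : ℂ) * (lamSymbol (-s₃) ζ • fhat V ζ) i) =ᵐ[volume]
        fun ζ => (((2 * Real.pi) ^ (-s₃) : ℝ) : ℂ) * fhat V ζ i := by
      filter_upwards [hne] with ζ hζ
      have h0 : ‖ζ‖ ^ s₃ ≠ 0 := (Real.rpow_pos_of_pos (norm_pos_iff.2 hζ) _).ne'
      have h0' : ((‖ζ‖ ^ s₃ : ℝ) : ℂ) ≠ 0 := by exact_mod_cast h0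
      rw [PiLp.smul_apply, smul_eq_mul, lamSymbol_eq, Real.rpow_neg (norm_nonneg ζ),
        Complex.ofReal_inv]
      field_simp
    have e2 : (𝓕⁻ fun ζ => (((2 * Real.pi) ^ (-s₃) : ℝ) : ℂ) * fhat V ζ i) = fun x =>
        (((2 * Real.pi) ^ (-s₃) : ℝ) : ℂ) * V x i := by
      funext x
      rw [fourierInv_const_mul, ← fourierInv_apply_component hVd.1, hVd.2]
    rw [fourierInv_congr_ae e1, e2]
    refine (eLpNorm_const_smul_le (c := (((2 * Real.pi) ^ (-s₃) : ℝ) : ℂ))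
      (f := fun x => V x i)).trans ?_
    rw [enorm_eq_nnnorm]
    exact mul_le_mul_right (eLpNorm_mono fun x => PiLp.norm_apply_le _ i) _
  have n2 := eLpNorm_fourierInv_scalar_le b (fhat φ) 2
  rw [← hφd.lam_eq, enorm_eq_nnnorm] at n2
  calc _ ≤ (C : ℝ≥0∞) * ((∑ _i : Fin 2, (c₁ : ℝ≥0∞) * eLpNorm V ⊤ volume) *
        (c₂ * eLpNorm (Lam b φ) 2 volume)) := by
        gcongr with i
        exact n1 i
    _ = _ := by
        rw [Finset.sum_const, Finset.card_univ, Fintype.card_fin, nsmul_eq_mul]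
        push_cast
        ring

theorem mainTheorem5 :
    (∀ s₁ s₂ p q r a : ℝ, 0 ≤ s₁ → s₁ < 1 → 0 ≤ s₂ - s₁ → s₂ - s₁ ≤ 1 →
      1 < p → 2 < q → 1 < r → 1 / p = 1 / q + 1 / r → a ∈ Set.Icc (s₂ - s₁) 1 →
      ∃ C : ℝ≥0, ∀ (V : Plane → EuclideanSpace ℂ (Fin 2)) (φ : Plane → ℂ),
        FourierRegular (1 + s₂) V → FourierRegular (1 + s₂) φ →
        (∀ x, planeDiv V x = 0) →
        LamDefined s₂ (advect V φ) ∧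
        LamDefined (-s₁) (lamCommutator s₂ V φ) ∧
        eLpNorm (Lam (-s₁) (lamCommutator s₂ V φ)) (ENNReal.ofReal p) volume ≤
          C * eLpNorm (Lam a V) (ENNReal.ofReal q) volume *
            eLpNorm (Lam (s₂ - s₁ + 1 - a) φ) (ENNReal.ofReal r) volume) ∧
    (∀ s₁ s₂ s₃ : ℝ, 0 < s₁ → 0 < s₂ → 0 < s₃ → s₁ < 1 → s₃ < 1 → s₂ < s₁ + s₃ →
      ∃ C : ℝ≥0, ∀ (V : Plane → EuclideanSpace ℂ (Fin 2)) (φ : Plane → ℂ),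
        FourierRegular (1 + s₂) V → FourierRegular (1 + s₂) φ →
        LamDefined (-s₃) V → LamDefined (s₂ - s₁ + 1 - s₃) φ →
        (∀ x, planeDiv V x = 0) →
        LamDefined s₂ (advect (Lam (-s₃) V) φ) ∧
        LamDefined (-s₁) (lamCommutator s₂ (Lam (-s₃) V) φ) ∧
        eLpNorm (Lam (-s₁) (lamCommutator s₂ (Lam (-s₃) V) φ)) 2 volume ≤
          C * eLpNorm V ⊤ volume *
            eLpNorm (Lam (s₂ - s₁ + 1 - s₃) φ) 2 volume) :=
  ⟨fun _ _ _ _ _ _ hs₁ hs₁1 h0 h1 hp hq hr hpqr ha =>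
    exists_lamCommutator_le hs₁ hs₁1 h0 h1 hp hq hr hpqr ha,
   fun _ _ _ hs₁ hs₂ hs₃ hs₁1 hs₃1 h => exists_lamCommutator_two_le hs₁ hs₂ hs₃ hs₁1 hs₃1 h⟩
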